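/- Let $g,n\ge 0$ be integers with $2g-2+n>0$. **Curves.** A *sharp monoid* is a commutative, cancellative, saturated monoid whose only unit is $0$. A stable tropical curve of genus $g$ with $n$ marked legs metrized by a sharp monoid $P$ is a finite connected graph with vertex weights $h(v)\in\mathbb Z_{\ge 0}$ and legs $l_1,\dots,l_n$, of genus $b_1+\sum_v h(v)=g$ and with $2h(v)-2+\mathrm{val}(v)>0$ for every vertex $v$, together with a nonzero length $d(e)\in P$ for every edge $e$. Let $\mathcal M_{g,n}$ be the category fibred in groupoids over $\mathbf{ShpMon}^{\mathrm{op}}$ of these curves; the pullback of a curve along $P\to Q$ contracts the edges whose length goes to $0$ (adding the genus of a contracted subgraph to the weight of the resulting vertex) and takes the images of the other lengths. The forgetful morphism $\pi_{g,n+1}:\mathcal M_{g,n+1}\to\mathcal M_{g,n}$ deletes the leg $l_{n+1}$ and, if its vertex $v$ becomes unstable, removes $v$: if $v$ had two edges, these are joined to one edge whose length is the sum of the two lengths; if $v$ had an edge and a leg $l_i$, this edge becomes the leg $l_i$. **Topological stacks.** Let $\mathbf{PC}$ be the category of strictly convex polyhedral cones $\sigma$ spanning finite-dimensional real vector spaces,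 with linear maps of cones. Restrict $\mathcal M_{g,n}$ to $\mathbf{PC}$ along $\sigma\mapsto\sigma^\vee$ (dual cone), extend it to topological spaces by $$\widetilde{\mathcal M}_{g,n}(X)=\varinjlim_{\sigma\in\mathbf{PC},\ X\to|\sigma|}\mathcal M_{g,n}(\sigma),$$ and let $|\mathcal M_{g,n}|$ be the associated stack on $\mathbf{Top}$ for the topology of open coverings. There is an induced morphism $|\pi_{g,n+1}|:|\mathcal M_{g,n+1}|\to|\mathcal M_{g,n}|$. For a category $F$ fibred in groupoids over $\mathbf{Top}$ let the *underlying topological space* $|F|$ be the set of isomorphism classes of objects over one-point spaces, with the finest topology for which the map $X\to|F|$ induced by any object of $F$ over any space $X$ is continuous. **Statement.** Let $\Gamma$ be a stable tropical curve of genus $g$ with $n$ marked legs and positive real edge lengths, let $[\Gamma]:*\to|\mathcal M_{g,n}|$ be the corresponding point (given over the cone $\mathbb R_{\ge0}$ by the curve with the lengths $t\mapsto t\,d(e)$, and by the point $1$ of this cone), and let $F=*\times_{|\mathcal M_{g,n}|}|\mathcal M_{g,n+1}|$ be its preimage under $|\pi_{g,n+1}|$, i.e. the $2$-categorical fibre product.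 Then: 1. $F$ is a subsheaf of the sheaf of continuous maps to its underlying topological space $|F|$: for objects $z$, $z'$ of $F$ over $X$, $X'$ and a continuous map $f:X\to X'$, there is at most one morphism $z\to z'$ over $f$, and there is one if and only if $f$ is compatible with the maps $X\to|F|$ and $X'\to|F|$ induced by $z$ and $z'$. In particular the objects of $F$ have no nontrivial automorphisms. 2. $|F|$ is homeomorphic to $\Gamma$ itself, i.e. to the space obtained from the vertices of $\Gamma$, a closed interval of length $d(e)$ for every edge $e$ and a half-line $[0,\infty)$ for every leg by gluing the ends of the intervals and the origins of the half-lines to the vertices to which they are attached (and not only to the quotient $\Gamma/\mathrm{Aut}(\Gamma)$). -/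

import Mathlib

open CategoryTheory

/-- A finite graph with vertex weights and `n` marked legs.  `V` is the set of vertices, `F` the
set of flags, `root f` the vertex from which the flag `f` emanates, and `inv` the involution on
flags.  The legs are the fixed points of `inv`, the edges are the two-element orbits
`{f, inv f}`. -/
structure MarkedGraph (n : ℕ) where
  V : Type
  F : Type
  [fintypeV : Fintype V]
  [fintypeF : Fintype F]
  root : F → V
  inv : F → F
  inv_inv : ∀ f, inv (inv f) = f
  weight : V → ℕ
  /-- the marking, a bijection from `{1, …, n}` (here `Fin n`) to the set of legs -/
  leg : Fin n → F
  leg_injective : Function.Injective leg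
  isLeg_iff : ∀ f, inv f = f ↔ f ∈ Set.range leg

attribute [instance] MarkedGraph.fintypeV MarkedGraph.fintypeF

namespace MarkedGraph

variable {n : ℕ}

/-- The number of flags emanating from a vertex. -/
noncomputable def val (G : MarkedGraph n) (v : G.V) : ℕ := {f | G.root f = v}.ncard

/-- `w` can be reached from `v` by crossing edges all of whose flags lie in `T`. -/
def Reach (G : MarkedGraph n) (T : Set G.F) : G.V → G.V → Prop :=
  Relation.ReflTransGen fun v w => ∃ f ∈ T, G.root f = v ∧ G.root (G.inv f) = w

/-- First Betti number `#E - #V + 1` of a connected graph with vertex set `S` whose edges consist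
of the flags in `T`; every edge consists of exactly two flags, so there are `#T / 2` edges. -/
noncomputable def betti (G : MarkedGraph n) (S : Set G.V) (T : Set G.F) : ℚ :=
  (T.ncard : ℚ) / 2 - S.ncard + 1

/-- The subgraph with vertex set `S` whose edges consist of the flags in `T` is (nonempty and)
connected of genus `k`, where the genus is the first Betti number plus the sum of the vertex
weights. -/
structure IsConnectedOfGenus (G : MarkedGraph n) (S : Set G.V) (T : Set G.F) (k : ℕ) : Prop where
  nonempty : S.Nonempty
  reach : ∀ v ∈ S, ∀ w ∈ S, G.Reach T v w
  genus : G.betti S T + ∑ᶠ v ∈ S, (G.weight v : ℚ) = k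

/-- A morphism `π : G → H` of weighted marked graphs, sending vertices to vertices and each flag
of `G` to a flag or to a vertex of `H`, compatibly with root map, involution and markings, such
that every flag `f` of `H` has exactly one preimage (here called `lift f`), and such that the
preimage of every vertex `w` of `H` is connected with genus the weight of `w`.  The flags outside
the range of `lift` are the contracted ones: `π` sends such a flag to the common image of the end
vertices of its edge.  So `π` is the same thing as the pair `(onV, lift)`. -/
@[ext]
structure Contraction (G H : MarkedGraph n) where
  onV : G.V → H.V
  lift : H.F → G.F
  lift_injective : Function.Injective lift
  onV_root : ∀ f, onV (G.root (lift f)) = H.root f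
  inv_lift : ∀ f, G.inv (lift f) = lift (H.inv f)
  onV_contracted : ∀ f, f ∉ Set.range lift → onV (G.root (G.inv f)) = onV (G.root f)
  lift_leg : ∀ i, lift (H.leg i) = G.leg i
  fiber : ∀ w, G.IsConnectedOfGenus {v | onV v = w}
    {f | f ∉ Set.range lift ∧ onV (G.root f) = w} (H.weight w)

open Classical in
/-- Indicator of a proposition. -/
noncomputable def ind (p : Prop) : ℚ := if p then 1 else 0

theorem ind_true {p : Prop} (h : p) : ind p = 1 := if_pos h

theorem ind_false {p : Prop} (h : ¬ p) : ind p = 0 := if_neg h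

theorem ind_and (p q : Prop) : ind (p ∧ q) = ind p * ind q := by
  by_cases hp : p <;> by_cases hq : q <;> simp [ind, hp, hq]

theorem ind_congr {p q : Prop} (h : p ↔ q) : ind p = ind q := by rw [propext h]

theorem sum_ind_fiber {α β : Type} [Fintype α] [Fintype β] (φ : α → β) (P : β → Prop)
    (x : α → ℚ) :
    ∑ a, ind (P (φ a)) * x a = ∑ b, ind (P b) * ∑ a, ind (φ a = b) * x a := by
  simp_rw [Finset.mul_sum]
  rw [Finset.sum_comm]
  refine Finset.sum_congr rfl fun a _ => ?_
  rw [Finset.sum_eq_single (φ a)]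
  · rw [ind_true (p := φ a = φ a) rfl, one_mul]
  · intro b _ hb
    rw [ind_false (p := φ a = b) (fun h => hb h.symm)]; ring
  · simp

theorem sum_ind_injective {α β : Type} [Fintype α] [Fintype β] (φ : α → β)
    (hφ : Function.Injective φ) (x : β → ℚ) :
    ∑ a, x (φ a) = ∑ b, ind (b ∈ Set.range φ) * x b := by
  classical
  rw [← Finset.sum_image (s := Finset.univ) (g := φ) (f := x) (fun a _ b _ h => hφ h)]
  rw [← Finset.sum_subset (Finset.subset_univ (Finset.univ.image φ))
    (f := fun b => ind (b ∈ Set.range φ) * x b)]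
  · refine Finset.sum_congr rfl fun b hb => ?_
    rw [ind_true (by simpa using hb), one_mul]
  · intro b _ hb
    rw [ind_false (by simpa using hb), zero_mul]

theorem ncard_eq_sum {α : Type} [Fintype α] (S : Set α) :
    (S.ncard : ℚ) = ∑ a, ind (a ∈ S) := by
  classical
  simp only [ind]
  rw [Finset.sum_boole, Set.ncard_eq_toFinset_card']
  congr 2; ext; simp

theorem genus_eq_iff (G : MarkedGraph n) (S : Set G.V) (T : Set G.F) (k : ℚ) :
    G.betti S T + ∑ᶠ v ∈ S, (G.weight v : ℚ) = k ↔
      (∑ f, ind (f ∈ T)) / 2 + (∑ v, ind (v ∈ S) * ((G.weight v : ℚ) - 1)) = k - 1 := by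
  have h1 : ∑ᶠ v ∈ S, (G.weight v : ℚ) = ∑ v, ind (v ∈ S) * (G.weight v : ℚ) := by
    classical
    rw [finsum_eq_sum_of_fintype]
    refine Finset.sum_congr rfl fun v _ => ?_
    rw [finsum_eq_if]
    by_cases h : v ∈ S <;> simp [ind, h]
  have h2 : (∑ v, ind (v ∈ S) * ((G.weight v : ℚ) - 1))
      = (∑ v, ind (v ∈ S) * (G.weight v : ℚ)) - ∑ v, ind (v ∈ S) := by
    rw [← Finset.sum_sub_distrib]
    exact Finset.sum_congr rfl fun v _ => by ring
  rw [h1, h2, betti, ncard_eq_sum, ncard_eq_sum]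
  constructor <;> intro h <;> linarith

theorem Reach.mono {G : MarkedGraph n} {T T' : Set G.F} (h : T ⊆ T') {v w : G.V}
    (hr : G.Reach T v w) : G.Reach T' v w :=
  Relation.ReflTransGen.mono (fun _ _ hs => by
    obtain ⟨f, hf, h1, h2⟩ := hs
    exact ⟨f, h hf, h1, h2⟩) _ _ hr

theorem Reach.step {G : MarkedGraph n} {T : Set G.F} {f : G.F} (hf : f ∈ T) :
    G.Reach T (G.root f) (G.root (G.inv f)) :=
  Relation.ReflTransGen.single ⟨f, hf, rfl, rfl⟩

namespace Contraction

def refl (G : MarkedGraph n) : Contraction G G where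
  onV := id
  lift := id
  lift_injective := Function.injective_id
  onV_root _ := rfl
  inv_lift _ := rfl
  onV_contracted f hf := absurd ⟨f, rfl⟩ hf
  lift_leg _ := rfl
  fiber w := by
    refine ⟨⟨w, rfl⟩, ?_, ?_⟩
    · rintro v rfl w rfl; exact Relation.ReflTransGen.refl
    · have : {f | f ∉ Set.range (id : G.F → G.F) ∧ id (G.root f) = w} = ∅ := by ext; simp
      rw [this]
      have h2 : {v | id v = w} = {w} := by ext; simp
      rw [h2]
      simp [betti]

variable {G H K : MarkedGraph n}

def trans (a : Contraction G H) (b : Contraction H K) : Contraction G K where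
  onV := b.onV ∘ a.onV
  lift := a.lift ∘ b.lift
  lift_injective := a.lift_injective.comp b.lift_injective
  onV_root f := by simp [a.onV_root, b.onV_root]
  inv_lift f := by simp [a.inv_lift, b.inv_lift]
  onV_contracted f hf := by
    by_cases h : f ∈ Set.range a.lift
    · obtain ⟨e, rfl⟩ := h
      have he : e ∉ Set.range b.lift := by
        rintro ⟨k, rfl⟩; exact hf ⟨k, rfl⟩
      simp [a.inv_lift, a.onV_root, b.onV_contracted e he]
    · simp [a.onV_contracted f h]
  lift_leg i := by simp [a.lift_leg, b.lift_leg]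
  fiber w := by
    have hT : ∀ u, b.onV u = w → {f | f ∉ Set.range a.lift ∧ a.onV (G.root f) = u} ⊆
        {f | f ∉ Set.range (a.lift ∘ b.lift) ∧ (b.onV ∘ a.onV) (G.root f) = w} := by
      rintro u hu f ⟨hf, hfu⟩
      refine ⟨?_, by simp [hfu, hu]⟩
      rintro ⟨k, rfl⟩; exact hf ⟨_, rfl⟩
    refine ⟨?_, ?_, ?_⟩
    · obtain ⟨u, hu⟩ := (b.fiber w).nonempty
      obtain ⟨v, hv⟩ := (a.fiber u).nonempty
      exact ⟨v, by simp_all⟩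
    · intro v hv v' hv'
      have key : ∀ u', H.Reach {f | f ∉ Set.range b.lift ∧ b.onV (H.root f) = w} (a.onV v) u' →
          b.onV u' = w ∧ ∀ x, a.onV x = u' →
            G.Reach {f | f ∉ Set.range (a.lift ∘ b.lift) ∧ (b.onV ∘ a.onV) (G.root f) = w} v x := by
        intro u' hu'
        induction hu' with
        | refl => exact ⟨hv, fun x hx => ((a.fiber _).reach v rfl x hx).mono (hT _ hv)⟩
        | tail h1 h2 ih =>
          obtain ⟨e, ⟨he1, he2⟩, rfl, rfl⟩ := h2
          have hw : b.onV (H.root (H.inv e)) = w := by rw [b.onV_contracted e he1, he2]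
          refine ⟨hw, fun x hx => ?_⟩
          have r1 := ih.2 (G.root (a.lift e)) (a.onV_root e)
          have r2 : G.Reach {f | f ∉ Set.range (a.lift ∘ b.lift) ∧
              (b.onV ∘ a.onV) (G.root f) = w} (G.root (a.lift e)) (G.root (G.inv (a.lift e))) := by
            refine Reach.step ⟨?_, by simp [a.onV_root, he2]⟩
            rintro ⟨k, hk⟩; exact he1 ⟨k, a.lift_injective hk⟩
          have r3 := ((a.fiber _).reach (G.root (G.inv (a.lift e)))
            (by simp [a.inv_lift, a.onV_root]) x hx).mono (hT _ hw)
          exact (r1.trans r2).trans r3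
      exact (key _ ((b.fiber w).reach _ hv _ hv')).2 v' rfl
    · have hb := (genus_eq_iff _ _ _ _).1 (b.fiber w).genus
      have ha := fun u => (genus_eq_iff _ _ _ _).1 (a.fiber u).genus
      rw [genus_eq_iff, ← hb]
      have hV : ∑ v, ind (v ∈ {v | (b.onV ∘ a.onV) v = w}) * ((G.weight v : ℚ) - 1)
          = ∑ u, ind (b.onV u = w) * ∑ v, ind (a.onV v = u) * ((G.weight v : ℚ) - 1) :=
        sum_ind_fiber a.onV (fun u => b.onV u = w) _
      have hF : ∑ f, ind (f ∈ {f | f ∉ Set.range (a.lift ∘ b.lift) ∧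
              (b.onV ∘ a.onV) (G.root f) = w})
          = (∑ u, ind (b.onV u = w) * ∑ f, ind (f ∉ Set.range a.lift ∧ a.onV (G.root f) = u))
            + ∑ e, ind (e ∉ Set.range b.lift ∧ b.onV (H.root e) = w) := by
        have e1 : ∑ u, ind (b.onV u = w) * ∑ f, ind (f ∉ Set.range a.lift ∧
              a.onV (G.root f) = u)
            = ∑ f, ind (b.onV (a.onV (G.root f)) = w) * ind (f ∉ Set.range a.lift) := by
          rw [sum_ind_fiber (fun f => a.onV (G.root f)) (fun u => b.onV u = w)]
          refine Finset.sum_congr rfl fun u _ => ?_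
          congr 1
          exact Finset.sum_congr rfl fun f _ => by rw [ind_and, mul_comm]
        have e2 : ∑ e, ind (e ∉ Set.range b.lift ∧ b.onV (H.root e) = w)
            = ∑ f, ind (f ∈ Set.range a.lift) * ind (f ∉ Set.range (a.lift ∘ b.lift) ∧
                b.onV (a.onV (G.root f)) = w) := by
          rw [← sum_ind_injective a.lift a.lift_injective
            (fun f => ind (f ∉ Set.range (a.lift ∘ b.lift) ∧ b.onV (a.onV (G.root f)) = w))]
          refine Finset.sum_congr rfl fun e _ => ind_congr ?_
          rw [a.onV_root]
          refine and_congr_left fun _ => not_congr ⟨?_, ?_⟩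
          · rintro ⟨k, rfl⟩; exact ⟨k, rfl⟩
          · rintro ⟨k, hk⟩; exact ⟨k, a.lift_injective hk⟩
        rw [e1, e2, ← Finset.sum_add_distrib]
        refine Finset.sum_congr rfl fun f _ => ?_
        by_cases hf : f ∈ Set.range a.lift
        · rw [ind_true hf, ind_false (not_not.2 hf)]
          simp
        · have hf' : f ∉ Set.range (a.lift ∘ b.lift) := by
            rintro ⟨k, rfl⟩; exact hf ⟨_, rfl⟩
          rw [ind_false hf, ind_true hf, zero_mul, add_zero, mul_one]
          exact ind_congr ⟨fun h => h.2, fun h => ⟨hf', h⟩⟩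
      have hsum : (∑ u, ind (b.onV u = w) *
              ∑ f, ind (f ∉ Set.range a.lift ∧ a.onV (G.root f) = u)) / 2
          + (∑ u, ind (b.onV u = w) * ∑ v, ind (a.onV v = u) * ((G.weight v : ℚ) - 1))
          = ∑ u, ind (b.onV u = w) * ((H.weight u : ℚ) - 1) := by
        rw [Finset.sum_div, ← Finset.sum_add_distrib]
        refine Finset.sum_congr rfl fun u _ => ?_
        rw [← ha u]
        simp only [Set.mem_ofPred_eq]
        ring
      rw [hV, hF]
      simp only [Set.mem_ofPred_eq]
      rw [← hsum]
      ring

end Contraction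

end MarkedGraph

namespace MarkedGraph

/-! ### Deleting the last leg and stabilizing -/

section Stabilization

variable {n : ℕ} (G : MarkedGraph (n + 1))

/-- The leg to be deleted. -/
def lastLeg : G.F := G.leg (Fin.last n)

/-- The vertex from which the leg to be deleted emanates. -/
def lastRoot : G.V := G.root G.lastLeg

/-- After deletion of the last leg the vertex from which it emanated violates
`2 h(v) - 2 + val(v) > 0`. -/
def Unstab : Prop := 2 * G.weight G.lastRoot + (G.val G.lastRoot - 1) ≤ 2

/-- The flags that survive: the last leg is removed, and so are all flags at its vertex if that
vertex becomes unstable. -/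
def Kept (f : G.F) : Prop := f ≠ G.lastLeg ∧ (G.Unstab → G.root f ≠ G.lastRoot)

/-- For a flag `f` at the vertex that becomes unstable: the flag there which is neither the last
leg nor `f`. -/
noncomputable def other (f : G.F) : G.F :=
  haveI : Nonempty G.F := ⟨f⟩
  Classical.epsilon fun f' => G.root f' = G.lastRoot ∧ f' ≠ G.lastLeg ∧ f' ≠ f

open Classical in
/-- A surviving flag stays where it is, while a flag at the vertex that becomes unstable is
replaced by the flag at the far end of the other edge at that vertex. -/
noncomputable def jump (f : G.F) : G.F := if G.Kept f then f else G.inv (G.other f)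

/-- `f₁` and `f₂` are the two flags other than the last leg at the vertex that becomes unstable;
`f₁` belongs to an edge that is not a loop, and `f₂` is a leg or belongs to an edge that is not a
loop. -/
structure Thin (f₁ f₂ : G.F) : Prop where
  unstab : G.Unstab
  weight_eq : G.weight G.lastRoot = 0
  ne₁₂ : f₁ ≠ f₂
  ne₁ : f₁ ≠ G.lastLeg
  ne₂ : f₂ ≠ G.lastLeg
  root₁ : G.root f₁ = G.lastRoot
  root₂ : G.root f₂ = G.lastRoot
  only : ∀ f, G.root f = G.lastRoot → f = G.lastLeg ∨ f = f₁ ∨ f = f₂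
  out₁ : G.root (G.inv f₁) ≠ G.lastRoot
  out₂ : G.inv f₂ = f₂ ∨ G.root (G.inv f₂) ≠ G.lastRoot

/-- If the vertex of the last leg becomes unstable, it is connected to the rest of the graph
either via two edges or via one edge, in which case it carries one further leg. -/
def Stabilizable : Prop := G.Unstab → ∃ f₁ f₂, G.Thin f₁ f₂

variable {G}

theorem inv_lastLeg : G.inv G.lastLeg = G.lastLeg := (G.isLeg_iff _).2 ⟨_, rfl⟩

theorem inv_injective : Function.Injective G.inv := fun a b h => by
  rw [← G.inv_inv a, h, G.inv_inv]

theorem inv_ne_lastLeg {f : G.F} (h : f ≠ G.lastLeg) : G.inv f ≠ G.lastLeg := fun e => by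
  apply h; rw [← G.inv_inv f, e, inv_lastLeg]

theorem kept_of_not_unstab (h : ¬ G.Unstab) {f : G.F} (hf : f ≠ G.lastLeg) : G.Kept f :=
  ⟨hf, fun h' => absurd h' h⟩

theorem jump_of_kept {f : G.F} (h : G.Kept f) : G.jump f = f := if_pos h

theorem jump_of_not_kept {f : G.F} (h : ¬ G.Kept f) : G.jump f = G.inv (G.other f) := if_neg h

namespace Thin

variable {f₁ f₂ : G.F}

theorem other₁ (t : G.Thin f₁ f₂) : G.other f₁ = f₂ := by
  have : Nonempty G.F := ⟨f₁⟩
  have := Classical.epsilon_spec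
    (p := fun f' => G.root f' = G.lastRoot ∧ f' ≠ G.lastLeg ∧ f' ≠ f₁) ⟨f₂, t.root₂, t.ne₂, t.ne₁₂.symm⟩
  rcases t.only _ this.1 with h | h | h
  · exact absurd h this.2.1
  · exact absurd h this.2.2
  · exact h

theorem other₂ (t : G.Thin f₁ f₂) : G.other f₂ = f₁ := by
  have : Nonempty G.F := ⟨f₁⟩
  have := Classical.epsilon_spec
    (p := fun f' => G.root f' = G.lastRoot ∧ f' ≠ G.lastLeg ∧ f' ≠ f₂) ⟨f₁, t.root₁, t.ne₁, t.ne₁₂⟩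
  rcases t.only _ this.1 with h | h | h
  · exact absurd h this.2.1
  · exact h
  · exact absurd h this.2.2

theorem kept_iff (t : G.Thin f₁ f₂) {f : G.F} : G.Kept f ↔ G.root f ≠ G.lastRoot :=
  ⟨fun h => h.2 t.unstab, fun h => ⟨fun e => h (by rw [e]; rfl), fun _ => h⟩⟩

theorem not_kept₁ (t : G.Thin f₁ f₂) : ¬ G.Kept f₁ := fun h => t.kept_iff.1 h t.root₁

theorem not_kept₂ (t : G.Thin f₁ f₂) : ¬ G.Kept f₂ := fun h => t.kept_iff.1 h t.root₂

theorem kept_inv₁ (t : G.Thin f₁ f₂) : G.Kept (G.inv f₁) := t.kept_iff.2 t.out₁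

theorem jump₁ (t : G.Thin f₁ f₂) : G.jump f₁ = G.inv f₂ := by rw [jump_of_not_kept t.not_kept₁, t.other₁]

theorem jump₂ (t : G.Thin f₁ f₂) : G.jump f₂ = G.inv f₁ := by rw [jump_of_not_kept t.not_kept₂, t.other₂]

theorem cases (t : G.Thin f₁ f₂) (f : G.F) : G.Kept f ∨ f = G.lastLeg ∨ f = f₁ ∨ f = f₂ := by
  by_cases h : G.root f = G.lastRoot
  · exact Or.inr (t.only f h)
  · exact Or.inl (t.kept_iff.2 h)

end Thin

open Classical in
variable (G) in
/-- The graph obtained by deleting the last leg, and, if the vertex `v` from which it emanates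
becomes unstable, deleting `v` and all flags at `v` and connecting the remaining two flags to an
edge (if `v` had two edges) or turning the remaining flag into a leg with the marking of the
second leg at `v` (if `v` had an edge and a second leg). -/
noncomputable def stabilize (hG : G.Stabilizable) : MarkedGraph n where
  V := {w : G.V // G.Unstab → w ≠ G.lastRoot}
  F := {f : G.F // G.Kept f}
  root f := ⟨G.root f.1, f.2.2⟩
  inv f := if h : G.Kept (G.jump (G.inv f.1)) then ⟨_, h⟩ else f
  inv_inv := by
    rintro ⟨f, hf⟩
    by_cases hu : G.Unstab
    · obtain ⟨f₁, f₂, t⟩ := hG hu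
      have h1 := G.inv_inv
      have h2 := t.jump₁
      have h3 := t.jump₂
      have h4 := t.not_kept₁
      have h5 := t.not_kept₂
      have h6 := t.kept_inv₁
      have h7 := t.out₂
      have h8 : ∀ f, G.Kept f → G.jump f = f := fun f => jump_of_kept
      have h9 := t.cases (G.inv f)
      have h10 := inv_ne_lastLeg hf.1
      have h11 : ∀ f, G.Kept f ↔ G.root f ≠ G.lastRoot := fun f => t.kept_iff
      grind
    · have h8 : ∀ f, G.Kept f → G.jump f = f := fun f => jump_of_kept
      have h9 := kept_of_not_unstab hu (inv_ne_lastLeg hf.1)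
      have h1 := G.inv_inv
      grind
  weight w := G.weight w.1
  leg i := ⟨G.jump (G.leg i.castSucc), by
    have hne : G.leg i.castSucc ≠ G.lastLeg := fun h => by
      have := G.leg_injective h
      exact absurd this (Fin.castSucc_lt_last i).ne
    have hfix : G.inv (G.leg i.castSucc) = G.leg i.castSucc := (G.isLeg_iff _).2 ⟨_, rfl⟩
    by_cases hu : G.Unstab
    · obtain ⟨f₁, f₂, t⟩ := hG hu
      rcases t.cases (G.leg i.castSucc) with h | h | h | h
      · rwa [jump_of_kept h]
      · exact absurd h hne
      · exact absurd t.root₁ (by have := t.out₁; rw [← h, hfix] at this; rwa [← h])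
      · rw [h, t.jump₂]; exact t.kept_inv₁
    · have h := kept_of_not_unstab hu hne
      rwa [jump_of_kept h]⟩
  leg_injective := by
    intro i j hij
    have hij : G.jump (G.leg i.castSucc) = G.jump (G.leg j.castSucc) := congrArg Subtype.val hij
    have hne : ∀ i : Fin n, G.leg i.castSucc ≠ G.lastLeg := fun i h => by
      have := G.leg_injective h
      exact absurd this (Fin.castSucc_lt_last i).ne
    have hfix : ∀ i : Fin n, G.inv (G.leg i.castSucc) = G.leg i.castSucc :=
      fun i => (G.isLeg_iff _).2 ⟨_, rfl⟩
    suffices G.leg i.castSucc = G.leg j.castSucc from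
      Fin.castSucc_injective _ (G.leg_injective this)
    by_cases hu : G.Unstab
    · obtain ⟨f₁, f₂, t⟩ := hG hu
      have h1 := G.inv_inv
      have h2 := t.jump₁
      have h3 := t.jump₂
      have h4 := t.root₁
      have h5 := t.root₂
      have h6 := t.out₁
      have h8 : ∀ f, G.Kept f → G.jump f = f := fun f => jump_of_kept
      have h9 := t.cases (G.leg i.castSucc)
      have h10 := t.cases (G.leg j.castSucc)
      have h11 := hne i
      have h12 := hne j
      have h13 := hfix i
      have h14 := hfix j
      grind
    · rwa [jump_of_kept (kept_of_not_unstab hu (hne i)),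
        jump_of_kept (kept_of_not_unstab hu (hne j))] at hij
  isLeg_iff := by
    have hleg : ∀ f, f ≠ G.lastLeg → (G.inv f = f ↔ ∃ i : Fin n, G.leg i.castSucc = f) := by
      intro f hf
      rw [G.isLeg_iff]
      constructor
      · rintro ⟨i, rfl⟩
        induction i using Fin.lastCases with
        | last => exact absurd rfl hf
        | cast i => exact ⟨i, rfl⟩
      · rintro ⟨i, rfl⟩; exact ⟨_, rfl⟩
    have hne : ∀ i : Fin n, G.leg i.castSucc ≠ G.lastLeg := fun i h => by
      have := G.leg_injective h
      exact absurd this (Fin.castSucc_lt_last i).ne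
    rintro ⟨f, hf⟩
    by_cases hu : G.Unstab
    · obtain ⟨f₁, f₂, t⟩ := hG hu
      have h1 := G.inv_inv
      have h2 := t.jump₁
      have h3 := t.jump₂
      have h4 := t.root₁
      have h5 := t.root₂
      have h6 := t.out₁
      have h7 := t.out₂
      have h8 : ∀ f, G.Kept f → G.jump f = f := fun f => jump_of_kept
      have h9 := t.cases (G.inv f)
      have h10 := inv_ne_lastLeg hf.1
      have h11 : ∀ f, G.Kept f ↔ G.root f ≠ G.lastRoot := fun f => t.kept_iff
      have h12 := hleg f hf.1
      have h13 := hleg f₂ t.ne₂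
      have h14 := t.ne₁₂
      constructor
      · intro h
        rcases h9 with h | h | h | h
        · have : G.inv f = f := by grind
          obtain ⟨i, hi⟩ := h12.1 this
          exact ⟨i, by grind⟩
        · exact absurd h h10
        · have : G.inv f₂ = f₂ := by grind
          obtain ⟨i, hi⟩ := h13.1 this
          exact ⟨i, by grind⟩
        · grind
      · rintro ⟨i, hi⟩
        have h15 := t.cases (G.leg i.castSucc)
        have h16 := hne i
        have h17 : G.inv (G.leg i.castSucc) = G.leg i.castSucc := (G.isLeg_iff _).2 ⟨_, rfl⟩
        grind
    · have h8 : ∀ f, G.Kept f → G.jump f = f := fun f => jump_of_kept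
      have h9 := kept_of_not_unstab hu (inv_ne_lastLeg hf.1)
      have h10 := hleg f hf.1
      have h11 := fun i => kept_of_not_unstab hu (hne i)
      constructor
      · intro h
        have : G.inv f = f := by grind
        obtain ⟨i, hi⟩ := h10.1 this
        exact ⟨i, by grind⟩
      · rintro ⟨i, hi⟩
        have : G.inv f = f := h10.2 ⟨i, by grind⟩
        grind

end Stabilization

end MarkedGraph

namespace MarkedGraph

section StabilizeConnected

variable {n : ℕ} {G : MarkedGraph (n + 1)}

theorem sum_ind_split {α : Type} [Fintype α] (P Q : α → Prop) (a b : α) (hab : a ≠ b)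
    (h : ∀ f, P f ↔ Q f ∨ f = a ∨ f = b) (ha : ¬ Q a) (hb : ¬ Q b) :
    ∑ f, ind (P f) = ∑ f, ind (Q f) + 2 := by
  classical
  have : ∀ f, ind (P f) = ind (Q f) + ((if f = a then 1 else 0) + (if f = b then 1 else 0)) := by
    intro f
    by_cases h1 : f = a
    · subst h1; rw [ind_true ((h f).2 (by simp)), ind_false ha]; simp [hab]
    · by_cases h2 : f = b
      · subst h2; rw [ind_true ((h f).2 (by simp)), ind_false hb]; simp [h1]
      · rw [ind_congr (h f)]; simp [h1, h2]
  simp_rw [this, Finset.sum_add_distrib]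
  simp
  norm_num

theorem IsConnectedOfGenus.stabilize {hG : G.Stabilizable} {S : Set G.V} {T : Set G.F} {k : ℕ}
    (h : G.IsConnectedOfGenus S T k) (hinv : ∀ f ∈ T, G.inv f ∈ T) (hS : ∀ f ∈ T, G.root f ∈ S)
    (hleg : ∀ f ∈ T, G.inv f ≠ f)
    (hne : ∀ f₁ f₂, G.Thin f₁ f₂ → G.lastRoot ∈ S → f₁ ∈ T ∨ f₂ ∈ T) :
    (G.stabilize hG).IsConnectedOfGenus {w | w.1 ∈ S}
      {f | f.1 ∈ T ∧ (G.Kept (G.inv f.1) ∨ G.other (G.inv f.1) ∈ T)} k := by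
  have hl : G.lastLeg ∉ T := fun h => hleg _ h inv_lastLeg
  have hTl : ∀ f ∈ T, f ≠ G.lastLeg := fun f hf e => hl (e ▸ hf)
  have hsumV : ∑ w : (G.stabilize hG).V, ind (w ∈ {w : (G.stabilize hG).V | w.1 ∈ S}) *
        (((G.stabilize hG).weight w : ℚ) - 1)
      = ∑ v, ind (G.Unstab → v ≠ G.lastRoot) * (ind (v ∈ S) * ((G.weight v : ℚ) - 1)) := by
    have := sum_ind_injective (α := (G.stabilize hG).V) (fun w => w.1) (fun a b h => Subtype.ext h)
      (fun v => ind (v ∈ S) * ((G.weight v : ℚ) - 1))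
    refine Eq.trans this (Finset.sum_congr rfl fun v _ => ?_)
    congr 1
    exact ind_congr ⟨fun ⟨w, hw⟩ => hw ▸ w.2, fun hv => ⟨⟨v, hv⟩, rfl⟩⟩
  have hsumF : ∑ f : (G.stabilize hG).F, ind (f ∈ {f : (G.stabilize hG).F |
        f.1 ∈ T ∧ (G.Kept (G.inv f.1) ∨ G.other (G.inv f.1) ∈ T)})
      = ∑ f, ind (G.Kept f ∧ f ∈ T ∧ (G.Kept (G.inv f) ∨ G.other (G.inv f) ∈ T)) := by
    have := sum_ind_injective (α := (G.stabilize hG).F) (fun w => w.1) (fun a b h => Subtype.ext h)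
      (fun f => ind (f ∈ T ∧ (G.Kept (G.inv f) ∨ G.other (G.inv f) ∈ T)))
    refine Eq.trans this (Finset.sum_congr rfl fun f _ => ?_)
    rw [ind_and (G.Kept f)]
    congr 1
    exact ind_congr ⟨fun ⟨w, hw⟩ => hw ▸ w.2, fun hv => ⟨⟨f, hv⟩, rfl⟩⟩
  have hg := (genus_eq_iff _ _ _ _).1 h.genus
  by_cases hu : G.Unstab
  · obtain ⟨f₁, f₂, t⟩ := hG hu
    have h1 := G.inv_inv
    have o1 := t.other₁
    have o2 := t.other₂
    have j1 := t.jump₁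
    have j2 := t.jump₂
    have n1 := t.not_kept₁
    have n2 := t.not_kept₂
    have k1 := t.kept_inv₁
    have out1 := t.out₁
    have out2 := t.out₂
    have r1 := t.root₁
    have r2 := t.root₂
    have n12 := t.ne₁₂
    have hk : ∀ f, G.Kept f ↔ G.root f ≠ G.lastRoot := fun f => t.kept_iff
    have hc : ∀ f ∈ T, G.Kept f ∨ f = f₁ ∨ f = f₂ := fun f hf => by
      rcases t.cases f with h | h | h | h
      · exact Or.inl h
      · exact absurd h (hTl f hf)
      · exact Or.inr (Or.inl h)
      · exact Or.inr (Or.inr h)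
    have hjk : ∀ f, G.Kept f → G.jump f = f := fun f => jump_of_kept
    refine ⟨?_, ?_, ?_⟩
    · obtain ⟨v, hv⟩ := h.nonempty
      by_cases hv0 : v = G.lastRoot
      · rcases hne f₁ f₂ t (hv0 ▸ hv) with hf | hf
        · exact ⟨⟨G.root (G.inv f₁), fun _ => out1⟩, hS _ (hinv _ hf)⟩
        · refine ⟨⟨G.root (G.inv f₂), fun _ => ?_⟩, hS _ (hinv _ hf)⟩
          exact out2.resolve_left (hleg _ hf)
      · exact ⟨⟨v, fun _ => hv0⟩, hv⟩
    · rintro ⟨v, hv⟩ hvS ⟨w, hw⟩ hwS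
      have hstep : ∀ (f : G.F) (hf : G.Kept f) (b : G.V) (hb : G.Unstab → b ≠ G.lastRoot),
          f ∈ T → (G.Kept (G.inv f) ∨ G.other (G.inv f) ∈ T) → G.Kept (G.jump (G.inv f)) →
          G.root (G.jump (G.inv f)) = b →
          (G.stabilize hG).Reach {f | f.1 ∈ T ∧ (G.Kept (G.inv f.1) ∨ G.other (G.inv f.1) ∈ T)}
            ⟨G.root f, hf.2⟩ ⟨b, hb⟩ := by
        rintro f hf b hb hfT hfT' hfk rfl
        refine Relation.ReflTransGen.single ⟨⟨f, hf⟩, ⟨hfT, hfT'⟩, rfl, ?_⟩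
        simp only [MarkedGraph.stabilize, hfk, dif_pos]
      have key : ∀ u, G.Reach T v u →
          (∀ hu : G.Unstab → u ≠ G.lastRoot, (G.stabilize hG).Reach
            {f | f.1 ∈ T ∧ (G.Kept (G.inv f.1) ∨ G.other (G.inv f.1) ∈ T)} ⟨v, hv⟩ ⟨u, hu⟩) ∧
          (u = G.lastRoot → ∀ f, f ∈ T → G.root f = G.lastRoot →
            ∀ hf : G.Unstab → G.root (G.inv f) ≠ G.lastRoot, (G.stabilize hG).Reach
            {f | f.1 ∈ T ∧ (G.Kept (G.inv f.1) ∨ G.other (G.inv f.1) ∈ T)}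
            ⟨v, hv⟩ ⟨G.root (G.inv f), hf⟩) := by
        intro u hr
        induction hr with
        | refl => exact ⟨fun _ => Relation.ReflTransGen.refl, fun e => absurd e (hv hu)⟩
        | tail _ hs ih =>
          obtain ⟨f, hf, rfl, rfl⟩ := hs
          have hfi := hinv f hf
          by_cases a : G.root f = G.lastRoot <;> by_cases b : G.root (G.inv f) = G.lastRoot
          · exfalso
            have := hleg f hf
            rcases hc f hf with h | h | h
            · exact (hk f).1 h a
            · rw [h] at b; exact out1 b
            · rw [h] at b this; exact out2.elim this (fun h => h b)
          · exact ⟨fun hu => ih.2 a f hf a hu, fun e => absurd e b⟩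
          · refine ⟨fun hu' => absurd b (hu' hu), fun _ e he hre hre' => ?_⟩
            have hfk : G.Kept f := (hk f).2 a
            have hek : G.Kept (G.inv e) := (hk _).2 (hre' hu)
            have hre'' : e = f₁ ∨ e = f₂ := (hc e he).resolve_left (fun h => (hk e).1 h hre)
            have hrf : G.inv f = f₁ ∨ G.inv f = f₂ :=
              (hc _ hfi).resolve_left (fun h => (hk _).1 h b)
            have ih1 := ih.1 (fun _ => a)
            by_cases hef : e = G.inv f
            · subst hef
              have : (⟨G.root (G.inv (G.inv f)), hre'⟩ : (G.stabilize hG).V)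
                = ⟨G.root f, fun _ => a⟩ := Subtype.ext (congrArg G.root (h1 f))
              rw [this]; exact ih1
            · have hoe : G.other (G.inv f) = e := by grind
              have hje : G.jump (G.inv f) = G.inv e := by grind
              exact ih1.trans (hstep f hfk _ hre' hf (Or.inr (hoe ▸ he)) (hje ▸ hek) (by rw [hje]))
          · refine ⟨fun hu' => ?_, fun e => absurd e b⟩
            have hfk : G.Kept f := (hk f).2 a
            have hfk' : G.Kept (G.inv f) := (hk _).2 b
            exact (ih.1 (fun _ => a)).trans (hstep f hfk _ hu' hf (Or.inl hfk')
              (by rwa [hjk _ hfk']) (by rw [hjk _ hfk']))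
      exact (key w (h.reach v hvS w hwS)).1 hw
    · rw [genus_eq_iff, hsumV, hsumF, ← hg]
      have hV : ∑ v, ind (v ∈ S) * ((G.weight v : ℚ) - 1) =
          ∑ v, ind (G.Unstab → v ≠ G.lastRoot) * (ind (v ∈ S) * ((G.weight v : ℚ) - 1))
            - ind (G.lastRoot ∈ S) := by
        rw [eq_sub_iff_add_eq]
        classical
        have : ind (G.lastRoot ∈ S) = ∑ v, if v = G.lastRoot then ind (v ∈ S) else 0 := by simp
        rw [this, ← Finset.sum_add_distrib]
        refine Finset.sum_congr rfl fun v _ => ?_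
        by_cases hv : v = G.lastRoot
        · subst hv
          rw [if_pos rfl, ind_false (p := G.Unstab → G.lastRoot ≠ G.lastRoot) (fun h => h hu rfl), t.weight_eq]
          simp
        · rw [if_neg hv, ind_true (p := G.Unstab → v ≠ G.lastRoot) (fun _ => hv)]
          simp
      rw [hV]
      have hTk : ∀ f, f ∈ T → G.inv f ∈ T := hinv
      have hTi : ∀ f, G.inv f ∈ T → f ∈ T := fun f hf => by simpa [h1] using hinv _ hf
      by_cases hvS : G.lastRoot ∈ S
      · rw [ind_true hvS]
        have : ∑ f, ind (f ∈ T) = ∑ f, ind (G.Kept f ∧ f ∈ T ∧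
            (G.Kept (G.inv f) ∨ G.other (G.inv f) ∈ T)) + 2 := by
          have hi : ∀ f, f ∈ T → G.Kept (G.inv f) ∨ G.inv f = f₁ ∨ G.inv f = f₂ :=
            fun f hf => hc _ (hinv f hf)
          by_cases hf1 : f₁ ∈ T <;> by_cases hf2 : f₂ ∈ T
          · refine sum_ind_split _ _ f₁ f₂ n12 ?_ (fun h => n1 h.1) (fun h => n2 h.1)
            intro f
            have := hc f
            have := hi f
            grind
          · have hne1 := hleg _ hf1
            have := hinv _ hf1
            refine sum_ind_split _ _ f₁ (G.inv f₁) hne1.symm ?_ (fun h => n1 h.1) ?_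
            · intro f
              have := hc f
              have := hi f
              grind
            · grind
          · have hne1 := hleg _ hf2
            have := hinv _ hf2
            refine sum_ind_split _ _ f₂ (G.inv f₂) hne1.symm ?_ (fun h => n2 h.1) ?_
            · intro f
              have := hc f
              have := hi f
              grind
            · grind
          · exact absurd (hne f₁ f₂ t hvS) (by simp [hf1, hf2])
        rw [this]; ring
      · rw [ind_false hvS]
        have : ∑ f, ind (f ∈ T) = ∑ f, ind (G.Kept f ∧ f ∈ T ∧
            (G.Kept (G.inv f) ∨ G.other (G.inv f) ∈ T)) := by
          refine Finset.sum_congr rfl fun f _ => ind_congr ⟨fun hf => ?_, fun h => h.2.1⟩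
          have a : ∀ f ∈ T, G.Kept f := fun f hf => (hk f).2 fun e => hvS (e ▸ hS f hf)
          exact ⟨a f hf, hf, Or.inl (a _ (hinv f hf))⟩
        rw [this]; ring
  · have hk : ∀ f ∈ T, G.Kept f := fun f hf => kept_of_not_unstab hu (hTl f hf)
    refine ⟨?_, ?_, ?_⟩
    · obtain ⟨v, hv⟩ := h.nonempty
      exact ⟨⟨v, fun h => absurd h hu⟩, hv⟩
    · rintro ⟨v, hv⟩ hvS ⟨w, hw⟩ hwS
      have key : ∀ u, G.Reach T v u → (G.stabilize hG).Reach
            {f | f.1 ∈ T ∧ (G.Kept (G.inv f.1) ∨ G.other (G.inv f.1) ∈ T)} ⟨v, hv⟩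
            ⟨u, fun h => absurd h hu⟩ := by
        intro u hr
        induction hr with
        | refl => exact Relation.ReflTransGen.refl
        | tail _ hs ih =>
          obtain ⟨f, hf, rfl, rfl⟩ := hs
          have hfi := hk _ (hinv f hf)
          refine ih.tail ⟨⟨f, hk f hf⟩, ⟨hf, Or.inl hfi⟩, rfl, ?_⟩
          have : G.Kept (G.jump (G.inv f)) := by rwa [jump_of_kept hfi]
          simp only [MarkedGraph.stabilize, this, dif_pos]
          simp only [jump_of_kept hfi]
      exact key w (h.reach v hvS w hwS)
    · rw [genus_eq_iff, hsumV, hsumF, ← hg]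
      congr 1
      · congr 1
        refine Finset.sum_congr rfl fun f _ => ind_congr ⟨fun h => h.2.1, fun hf => ?_⟩
        exact ⟨hk f hf, hf, Or.inl (hk _ (hinv f hf))⟩
      · refine Finset.sum_congr rfl fun v _ => ?_
        rw [ind_true (p := G.Unstab → v ≠ G.lastRoot) (fun h => absurd h hu), one_mul]

theorem val_eq_sum {n : ℕ} (G : MarkedGraph n) (v : G.V) :
    (G.val v : ℚ) = ∑ f, ind (G.root f = v) := ncard_eq_sum _

/-- The vertex condition `2 h(v) - 2 + val(v) > 0`. -/
def IsStable {n : ℕ} (G : MarkedGraph n) : Prop := ∀ v, 2 < 2 * G.weight v + G.val v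

theorem one_le_val_lastRoot : 1 ≤ G.val G.lastRoot :=
  (Set.ncard_pos (Set.toFinite _)).2 ⟨G.lastLeg, rfl⟩

theorem stabilizable_of_connected {g : ℕ} (hgn : 2 < 2 * g + n)
    (hc : G.IsConnectedOfGenus Set.univ {f | G.inv f ≠ f} g) (hs : G.IsStable) :
    G.Stabilizable := by
  intro hu
  have hv := one_le_val_lastRoot (G := G)
  have hs0 := hs G.lastRoot
  have h3 : 2 * G.weight G.lastRoot + G.val G.lastRoot = 3 := by
    unfold Unstab at hu; omega
  have hex : ∃ f₁, G.root f₁ = G.lastRoot ∧ G.root (G.inv f₁) ≠ G.lastRoot := by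
    by_contra hcon
    push Not at hcon
    have hall : ∀ v, v = G.lastRoot := by
      intro v
      have hr := hc.reach G.lastRoot trivial v trivial
      induction hr with
      | refl => rfl
      | tail _ hs ih =>
        obtain ⟨f, _, h1, rfl⟩ := hs
        exact hcon f (h1.trans ih)
    have hg := (genus_eq_iff _ _ _ _).1 hc.genus
    have hV : ∑ v, ind (v ∈ (Set.univ : Set G.V)) * ((G.weight v : ℚ) - 1)
        = (G.weight G.lastRoot : ℚ) - 1 := by
      rw [Finset.sum_eq_single G.lastRoot (fun v _ h => absurd (hall v) h) (by simp)]
      rw [ind_true (Set.mem_univ _), one_mul]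
    have hval := G.val_eq_sum G.lastRoot
    have hval2 : ∑ f, ind (G.root f = G.lastRoot)
        = ∑ f, ind (f ∈ {f | G.inv f ≠ f}) + ∑ f, ind (f ∈ Set.range G.leg) := by
      rw [← Finset.sum_add_distrib]
      refine Finset.sum_congr rfl fun f _ => ?_
      rw [ind_true (hall _)]
      by_cases h : G.inv f = f
      · rw [ind_true ((G.isLeg_iff f).1 h), ind_false (by simpa using h), zero_add]
      · rw [ind_false (fun h' => h ((G.isLeg_iff f).2 h')), ind_true (by simpa using h), add_zero]
    have hleg : ∑ f, ind (f ∈ Set.range G.leg) = (n : ℚ) + 1 := by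
      have := sum_ind_injective G.leg G.leg_injective (fun _ => 1)
      simpa using this.symm
    rw [hV] at hg
    rw [hval2, hleg] at hval
    have h3' : 2 * (G.weight G.lastRoot : ℚ) + G.val G.lastRoot = 3 := by exact_mod_cast h3
    have : (2 * g + n : ℚ) = 2 := by linarith
    have : 2 * g + n = 2 := by exact_mod_cast this
    omega
  obtain ⟨f₁, hr1, ho1⟩ := hex
  have hne1 : f₁ ≠ G.lastLeg := by
    rintro rfl; rw [inv_lastLeg] at ho1; exact ho1 hr1
  have h2 : 2 ≤ G.val G.lastRoot := by
    have : ({G.lastLeg, f₁} : Set G.F).ncard ≤ G.val G.lastRoot := by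
      apply Set.ncard_le_ncard _ (Set.toFinite _)
      rintro f (rfl | rfl)
      · rfl
      · exact hr1
    rwa [Set.ncard_pair hne1.symm] at this
  have hw : G.weight G.lastRoot = 0 := by omega
  have hval : G.val G.lastRoot = 3 := by omega
  obtain ⟨x, y, z, hxy, hxz, hyz, hset⟩ := Set.ncard_eq_three.1 hval
  have hmem : ∀ f, G.root f = G.lastRoot ↔ f = x ∨ f = y ∨ f = z := fun f => by
    have : f ∈ {f | G.root f = G.lastRoot} ↔ f ∈ ({x, y, z} : Set G.F) := by rw [hset]
    simpa using this
  have hl : G.root G.lastLeg = G.lastRoot := rfl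
  have hex2 : ∃ f₂, G.root f₂ = G.lastRoot ∧ f₁ ≠ f₂ ∧ f₂ ≠ G.lastLeg ∧
      ∀ f, G.root f = G.lastRoot → f = G.lastLeg ∨ f = f₁ ∨ f = f₂ := by
    have a1 := (hmem _).1 hl
    have a2 := (hmem _).1 hr1
    have hx := (hmem x).2 (by simp)
    have hy := (hmem y).2 (by simp)
    have hz := (hmem z).2 (by simp)
    have hm := fun f => (hmem f).1
    rcases a1 with a1 | a1 | a1 <;> rcases a2 with a2 | a2 | a2
    · exact absurd (a2.trans a1.symm) hne1
    · exact ⟨z, hz, by grind, by grind, by grind⟩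
    · exact ⟨y, hy, by grind, by grind, by grind⟩
    · exact ⟨z, hz, by grind, by grind, by grind⟩
    · exact absurd (a2.trans a1.symm) hne1
    · exact ⟨x, hx, by grind, by grind, by grind⟩
    · exact ⟨y, hy, by grind, by grind, by grind⟩
    · exact ⟨x, hx, by grind, by grind, by grind⟩
    · exact absurd (a2.trans a1.symm) hne1
  obtain ⟨f₂, hr2, h12, hne2, honly⟩ := hex2
  refine ⟨f₁, f₂, hu, hw, h12, hne1, hne2, hr1, hr2, honly, ho1, ?_⟩
  by_contra hcon
  push Not at hcon
  rcases honly _ hcon.2 with h | h | h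
  · exact inv_ne_lastLeg hne2 h
  · apply ho1; rw [← h, G.inv_inv]; exact hr2
  · exact hcon.1 h

theorem IsStable.stabilize {hG : G.Stabilizable} (hs : G.IsStable) :
    (G.stabilize hG).IsStable := by
  rintro ⟨w, hw⟩
  have hval : (G.stabilize hG).val ⟨w, hw⟩ = {f | G.Kept f ∧ G.root f = w}.ncard := by
    refine Eq.trans (Set.ncard_image_of_injective _ (f := fun f : (G.stabilize hG).F => f.1)
      (fun a b h => Subtype.ext h)).symm ?_
    congr 1
    ext f
    constructor
    · rintro ⟨e, he, rfl⟩
      exact ⟨e.2, congrArg Subtype.val he⟩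
    · rintro ⟨h1, h2⟩
      exact ⟨⟨f, h1⟩, Subtype.ext h2, rfl⟩
  rw [hval]
  change 2 < 2 * G.weight w + _
  by_cases h : w = G.lastRoot
  · subst h
    have hu : ¬ G.Unstab := fun h => hw h rfl
    have : {f | G.Kept f ∧ G.root f = G.lastRoot} = {f | G.root f = G.lastRoot} \ {G.lastLeg} := by
      ext f
      constructor
      · rintro ⟨h1, h2⟩; exact ⟨h2, h1.1⟩
      · rintro ⟨h1, h2⟩; exact ⟨kept_of_not_unstab hu h2, h1⟩
    rw [this, Set.ncard_sdiff_singleton_of_mem (by rfl)]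
    unfold Unstab at hu
    exact not_le.1 hu
  · have : {f | G.Kept f ∧ G.root f = w} = {f | G.root f = w} := by
      ext f
      constructor
      · rintro ⟨h1, h2⟩; exact h2
      · rintro rfl; exact ⟨⟨fun e => h (by rw [e]; rfl), fun _ => h⟩, rfl⟩
    rw [this]
    exact hs w

theorem IsConnectedOfGenus.stabilize_univ {hG : G.Stabilizable} {g : ℕ}
    (h : G.IsConnectedOfGenus Set.univ {f | G.inv f ≠ f} g) :
    (G.stabilize hG).IsConnectedOfGenus Set.univ {f | (G.stabilize hG).inv f ≠ f} g := by
  have := h.stabilize (hG := hG) (fun f hf => by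
      simp only [Set.mem_ofPred_eq, G.inv_inv] at hf ⊢; exact fun e => hf e.symm)
    (fun _ _ => trivial) (fun f hf => hf)
    (fun f₁ f₂ t _ => Or.inl (fun e => t.out₁ (by rw [e, t.root₁])))
  suffices hF : {f | (G.stabilize hG).inv f ≠ f} = {f : (G.stabilize hG).F | f.1 ∈ {f | G.inv f ≠ f} ∧
      (G.Kept (G.inv f.1) ∨ G.other (G.inv f.1) ∈ {f | G.inv f ≠ f})} by
    rw [hF]; exact this
  ext ⟨f, hf⟩
  have hinv : (G.stabilize hG).inv ⟨f, hf⟩ ≠ ⟨f, hf⟩ ↔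
      G.Kept (G.jump (G.inv f)) ∧ G.jump (G.inv f) ≠ f := by
    by_cases hk : G.Kept (G.jump (G.inv f))
    · simp [MarkedGraph.stabilize, hk]
    · simp [MarkedGraph.stabilize, hk]
  have hjk : ∀ f, G.Kept f → G.jump f = f := fun f => jump_of_kept
  refine Iff.trans hinv ?_
  simp only [Set.mem_ofPred_eq]
  by_cases hu : G.Unstab
  · obtain ⟨f₁, f₂, t⟩ := hG hu
    have h1 := G.inv_inv
    have o1 := t.other₁
    have o2 := t.other₂
    have j1 := t.jump₁
    have j2 := t.jump₂
    have n1 := t.not_kept₁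
    have n2 := t.not_kept₂
    have k1 := t.kept_inv₁
    have out1 := t.out₁
    have out2 := t.out₂
    have n12 := t.ne₁₂
    have hk : ∀ f, G.Kept f ↔ G.root f ≠ G.lastRoot := fun f => t.kept_iff
    have r1 := t.root₁
    have r2 := t.root₂
    rcases t.cases (G.inv f) with h | h | h | h
    · grind
    · exact absurd h (inv_ne_lastLeg hf.1)
    · grind
    · grind
  · have := kept_of_not_unstab hu (inv_ne_lastLeg hf.1)
    grind

end StabilizeConnected

end MarkedGraph

namespace MarkedGraph

namespace Contraction

variable {n : ℕ}

section Val

variable {A B : MarkedGraph n} (c : Contraction A B)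

theorem mem_range_of_inv_eq {f : A.F} (h : A.inv f = f) : f ∈ Set.range c.lift := by
  obtain ⟨i, rfl⟩ := (A.isLeg_iff f).1 h
  exact ⟨_, c.lift_leg i⟩

theorem inv_mem_range {f : A.F} : A.inv f ∈ Set.range c.lift ↔ f ∈ Set.range c.lift := by
  constructor
  · rintro ⟨e, he⟩; exact ⟨B.inv e, by rw [← c.inv_lift, he, A.inv_inv]⟩
  · rintro ⟨e, rfl⟩; exact ⟨B.inv e, (c.inv_lift e).symm⟩

theorem val_sum (w : B.V) :
    ∑ v, ind (c.onV v = w) * (2 * (A.weight v : ℚ) - 2 + A.val v)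
      = 2 * (B.weight w : ℚ) - 2 + B.val w := by
  have hg := (genus_eq_iff _ _ _ _).1 (c.fiber w).genus
  have hv : ∑ v, ind (c.onV v = w) * (A.val v : ℚ) = ∑ f, ind (c.onV (A.root f) = w) := by
    have := sum_ind_fiber A.root (fun v => c.onV v = w) (fun _ => (1 : ℚ))
    simp only [mul_one] at this
    rw [this]
    exact Finset.sum_congr rfl fun v _ => by rw [val_eq_sum]
  have hl := sum_ind_injective c.lift c.lift_injective (fun f => ind (c.onV (A.root f) = w))
  simp only [c.onV_root] at hl
  have hs : ∑ f, ind (c.onV (A.root f) = w)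
      = ∑ f, ind (f ∈ {f | f ∉ Set.range c.lift ∧ c.onV (A.root f) = w})
        + ∑ f, ind (f ∈ Set.range c.lift) * ind (c.onV (A.root f) = w) := by
    rw [← Finset.sum_add_distrib]
    refine Finset.sum_congr rfl fun f _ => ?_
    rw [Set.mem_ofPred_eq, ind_and, ← add_mul]
    by_cases hf : f ∈ Set.range c.lift
    · rw [ind_true hf, ind_false (not_not.2 hf)]; ring
    · rw [ind_false hf, ind_true hf]; ring
  rw [← hl, ← val_eq_sum, ← hv] at hs
  simp only [Set.mem_ofPred_eq] at hs hg
  have : ∑ v, ind (c.onV v = w) * (2 * (A.weight v : ℚ) - 2 + A.val v)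
      = 2 * ∑ v, ind (c.onV v = w) * ((A.weight v : ℚ) - 1)
        + ∑ v, ind (c.onV v = w) * (A.val v : ℚ) := by
    rw [Finset.mul_sum, ← Finset.sum_add_distrib]
    exact Finset.sum_congr rfl fun v _ => by ring
  rw [this]
  linarith

end Val

variable {A B : MarkedGraph (n + 1)} (c : Contraction A B)

theorem lift_lastLeg : c.lift B.lastLeg = A.lastLeg := c.lift_leg _

theorem onV_lastRoot : c.onV A.lastRoot = B.lastRoot := by
  rw [lastRoot, ← c.lift_lastLeg, c.onV_root]; rfl

theorem lift_ne_lastLeg {f : B.F} (h : f ≠ B.lastLeg) : c.lift f ≠ A.lastLeg := fun e =>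
  h (c.lift_injective (e.trans c.lift_lastLeg.symm))

theorem fiber_of_unstab (hA : A.IsStable) (hu : B.Unstab) {v : A.V}
    (hv : c.onV v = B.lastRoot) : v = A.lastRoot := by
  classical
  by_contra hne
  have h1 := c.val_sum B.lastRoot
  have hb := one_le_val_lastRoot (G := B)
  have h2 : 2 * (B.weight B.lastRoot : ℚ) - 2 + B.val B.lastRoot ≤ 1 := by
    have : 2 * B.weight B.lastRoot + B.val B.lastRoot ≤ 3 := by unfold Unstab at hu; omega
    have : (2 * B.weight B.lastRoot + B.val B.lastRoot : ℚ) ≤ 3 := by exact_mod_cast this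
    linarith
  have hp : ∀ v, (1 : ℚ) ≤ 2 * (A.weight v : ℚ) - 2 + A.val v := fun v => by
    have := hA v
    have : (3 : ℚ) ≤ 2 * A.weight v + A.val v := by exact_mod_cast this
    linarith
  have h3 : ∑ x ∈ {v, A.lastRoot}, ind (c.onV x = B.lastRoot) *
      (2 * (A.weight x : ℚ) - 2 + A.val x) ≤
      ∑ v, ind (c.onV v = B.lastRoot) * (2 * (A.weight v : ℚ) - 2 + A.val v) := by
    refine Finset.sum_le_sum_of_subset_of_nonneg (Finset.subset_univ _) fun x _ _ => ?_
    refine mul_nonneg ?_ (by linarith [hp x])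
    by_cases h : c.onV x = B.lastRoot
    · rw [ind_true h]; norm_num
    · rw [ind_false h]
  rw [Finset.sum_pair hne, ind_true hv, ind_true c.onV_lastRoot] at h3
  linarith [hp v, hp A.lastRoot]

theorem unstab_of_unstab (hA : A.IsStable) (hSB : B.Stabilizable) (hu : B.Unstab) :
    A.Unstab ∧ ∀ f, A.root f = A.lastRoot → f ∈ Set.range c.lift := by
  have hfib : ∀ v, c.onV v = B.lastRoot ↔ v = A.lastRoot :=
    fun v => ⟨c.fiber_of_unstab hA hu, fun h => h ▸ c.onV_lastRoot⟩
  have h1 := c.val_sum B.lastRoot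
  have hb := one_le_val_lastRoot (G := B)
  have ha := one_le_val_lastRoot (G := A)
  have hs : ∀ x : A.V → ℚ, ∑ v, ind (c.onV v = B.lastRoot) * x v = x A.lastRoot := by
    intro x
    rw [Finset.sum_eq_single A.lastRoot]
    · rw [ind_true c.onV_lastRoot, one_mul]
    · intro v _ hv; rw [ind_false (fun h => hv ((hfib v).1 h)), zero_mul]
    · simp
  rw [hs] at h1
  have h2 : 2 * A.weight A.lastRoot + A.val A.lastRoot
      = 2 * B.weight B.lastRoot + B.val B.lastRoot := by
    have : (2 * A.weight A.lastRoot + A.val A.lastRoot : ℚ)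
      = 2 * B.weight B.lastRoot + B.val B.lastRoot := by linarith
    exact_mod_cast this
  have hB : B.weight B.lastRoot = 0 := by
    obtain ⟨f₁, f₂, t⟩ := hSB hu
    exact t.weight_eq
  have hg := (genus_eq_iff _ _ _ _).1 (c.fiber B.lastRoot).genus
  rw [← ncard_eq_sum] at hg
  simp only [Set.mem_ofPred_eq, hs, hB] at hg
  refine ⟨by unfold Unstab at hu ⊢; omega, fun f hf => ?_⟩
  by_contra hfr
  have hpos : (0 : ℚ) < ({f | f ∉ Set.range c.lift ∧ c.onV (A.root f) = B.lastRoot}.ncard : ℚ) := by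
    have : f ∈ {f | f ∉ Set.range c.lift ∧ c.onV (A.root f) = B.lastRoot} :=
      ⟨hfr, hf ▸ c.onV_lastRoot⟩
    exact_mod_cast (Set.ncard_pos (Set.toFinite _)).2 ⟨f, this⟩
  have hw : (0 : ℚ) ≤ A.weight A.lastRoot := by positivity
  push_cast at hg
  linarith

theorem not_mem_range_of_not_unstab (hu : ¬ B.Unstab) {f₁ f₂ : A.F} (t : A.Thin f₁ f₂) :
    f₁ ∉ Set.range c.lift ∨ f₂ ∉ Set.range c.lift := by
  by_contra hcon
  push Not at hcon
  apply hu
  have hfl : ∀ f, A.root f = A.lastRoot → f ∈ Set.range c.lift := by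
    intro f hf
    rcases t.only f hf with rfl | rfl | rfl
    · exact ⟨_, c.lift_lastLeg⟩
    · exact hcon.1
    · exact hcon.2
  have hfib : ∀ v, c.onV v = B.lastRoot ↔ v = A.lastRoot := by
    refine fun v => ⟨fun h => ?_, fun h => h ▸ c.onV_lastRoot⟩
    have hr := (c.fiber B.lastRoot).reach _ c.onV_lastRoot v h
    clear h
    induction hr with
    | refl => rfl
    | tail _ hs ih =>
      obtain ⟨f, ⟨hf, _⟩, h1, rfl⟩ := hs
      exact absurd (hfl f (h1.trans ih)) hf
  have h1 := c.val_sum B.lastRoot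
  have hs : ∀ x : A.V → ℚ, ∑ v, ind (c.onV v = B.lastRoot) * x v = x A.lastRoot := by
    intro x
    rw [Finset.sum_eq_single A.lastRoot]
    · rw [ind_true c.onV_lastRoot, one_mul]
    · intro v _ hv; rw [ind_false (fun h => hv ((hfib v).1 h)), zero_mul]
    · simp
  rw [hs] at h1
  have ha := one_le_val_lastRoot (G := A)
  have h2 : 2 * A.weight A.lastRoot + A.val A.lastRoot
      = 2 * B.weight B.lastRoot + B.val B.lastRoot := by
    have : (2 * A.weight A.lastRoot + A.val A.lastRoot : ℚ)
      = 2 * B.weight B.lastRoot + B.val B.lastRoot := by linarith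
    exact_mod_cast this
  have := t.unstab
  have hb := one_le_val_lastRoot (G := B)
  unfold Unstab at this ⊢
  omega

/-- What a contraction does with the flags at the vertex of the last leg. -/
structure Facts (A B : MarkedGraph (n + 1)) (c : Contraction A B) : Prop where
  inv_invA : ∀ f, A.inv (A.inv f) = f
  inv_invB : ∀ f, B.inv (B.inv f) = f
  inv_lift : ∀ f, A.inv (c.lift f) = c.lift (B.inv f)
  inj : ∀ e e', c.lift e = c.lift e' → e = e'
  last : c.lift B.lastLeg = A.lastLeg ∧ A.inv A.lastLeg = A.lastLeg ∧ B.inv B.lastLeg = B.lastLeg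
  jumpA : ∀ f, A.Kept f → A.jump f = f
  jumpB : ∀ f, B.Kept f → B.jump f = f
  ne_lastA : ∀ f, A.Kept f → f ≠ A.lastLeg
  ne_lastB : ∀ f, B.Kept f → f ≠ B.lastLeg
  cases :
    -- nothing becomes unstable
    ((∀ f, A.Kept f ↔ f ≠ A.lastLeg) ∧ (∀ f, B.Kept f ↔ f ≠ B.lastLeg)) ∨
    -- in both graphs the vertex becomes unstable
    (∃ f₁ f₂ e₁ e₂, c.lift e₁ = f₁ ∧ c.lift e₂ = f₂ ∧
      (∀ f, A.Kept f ↔ f ≠ A.lastLeg ∧ f ≠ f₁ ∧ f ≠ f₂) ∧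
      (∀ f, B.Kept f ↔ f ≠ B.lastLeg ∧ f ≠ e₁ ∧ f ≠ e₂) ∧
      A.other f₁ = f₂ ∧ A.other f₂ = f₁ ∧ B.other e₁ = e₂ ∧ B.other e₂ = e₁ ∧
      A.jump f₁ = A.inv f₂ ∧ A.jump f₂ = A.inv f₁ ∧
      B.jump e₁ = B.inv e₂ ∧ B.jump e₂ = B.inv e₁ ∧
      A.Kept (A.inv f₁) ∧ (A.inv f₂ = f₂ ∨ A.Kept (A.inv f₂)) ∧
      f₁ ≠ f₂ ∧ e₁ ≠ e₂ ∧ f₁ ≠ A.lastLeg ∧ f₂ ≠ A.lastLeg ∧ A.root f₁ = A.root f₂) ∨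
    -- only in the first graph the vertex becomes unstable
    (∃ f₁ f₂, (¬ (∃ e, c.lift e = f₁) ∨ ¬ (∃ e, c.lift e = f₂)) ∧
      (∀ f, A.Kept f ↔ f ≠ A.lastLeg ∧ f ≠ f₁ ∧ f ≠ f₂) ∧
      (∀ f, B.Kept f ↔ f ≠ B.lastLeg) ∧
      A.other f₁ = f₂ ∧ A.other f₂ = f₁ ∧
      A.jump f₁ = A.inv f₂ ∧ A.jump f₂ = A.inv f₁ ∧
      A.Kept (A.inv f₁) ∧ (A.inv f₂ = f₂ ∧ (∃ e, c.lift e = f₂) ∨ A.Kept (A.inv f₂)) ∧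
      f₁ ≠ f₂ ∧ f₁ ≠ A.lastLeg ∧ f₂ ≠ A.lastLeg ∧ A.root f₁ = A.root f₂)

theorem _root_.MarkedGraph.Thin.kept_iff' {f₁ f₂ : A.F} (t : A.Thin f₁ f₂) (f : A.F) :
    A.Kept f ↔ f ≠ A.lastLeg ∧ f ≠ f₁ ∧ f ≠ f₂ := by
  rw [t.kept_iff]
  constructor
  · refine fun h => ⟨?_, ?_, ?_⟩
    · rintro rfl; exact h rfl
    · rintro rfl; exact h t.root₁
    · rintro rfl; exact h t.root₂
  · rintro ⟨h1, h2, h3⟩ h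
    rcases t.only f h with h | h | h
    · exact h1 h
    · exact h2 h
    · exact h3 h

theorem facts (hA : A.IsStable) (hSA : A.Stabilizable) (hSB : B.Stabilizable) : Facts A B c := by
  refine ⟨A.inv_inv, B.inv_inv, c.inv_lift, fun _ _ h => c.lift_injective h,
    ⟨c.lift_lastLeg, inv_lastLeg, inv_lastLeg⟩,
    fun _ => jump_of_kept, fun _ => jump_of_kept, fun _ h => h.1, fun _ h => h.1, ?_⟩
  by_cases huA : A.Unstab
  · obtain ⟨f₁, f₂, t⟩ := hSA huA
    have kA := t.kept_iff'
    have out2 : A.inv f₂ = f₂ ∨ A.Kept (A.inv f₂) := by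
      rw [t.kept_iff]; exact t.out₂
    by_cases huB : B.Unstab
    · obtain ⟨e₁, e₂, s⟩ := hSB huB
      have kB := s.kept_iff'
      have hroot : ∀ e, A.root (c.lift e) = A.lastRoot ↔ B.root e = B.lastRoot := by
        intro e
        rw [← c.onV_root e]
        exact ⟨fun h => h ▸ c.onV_lastRoot, c.fiber_of_unstab hA huB⟩
      have r1 := (hroot e₁).2 s.root₁
      have r2 := (hroot e₂).2 s.root₂
      have o1 := t.only _ r1
      have o2 := t.only _ r2
      have l1 := c.lift_ne_lastLeg s.ne₁
      have l2 := c.lift_ne_lastLeg s.ne₂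
      have l3 : c.lift e₁ ≠ c.lift e₂ := fun h => s.ne₁₂ (c.lift_injective h)
      refine Or.inr (Or.inl ?_)
      rcases o1.resolve_left l1 with h1 | h1
      · have h2 : c.lift e₂ = f₂ := by grind
        exact ⟨f₁, f₂, e₁, e₂, h1, h2, kA, kB, t.other₁, t.other₂, s.other₁, s.other₂,
          t.jump₁, t.jump₂, s.jump₁, s.jump₂, t.kept_inv₁, out2, t.ne₁₂, s.ne₁₂, t.ne₁, t.ne₂,
          t.root₁.trans t.root₂.symm⟩
      · have h2 : c.lift e₂ = f₁ := by grind
        exact ⟨f₁, f₂, e₂, e₁, h2, h1, kA, fun f => (kB f).trans (by tauto), t.other₁, t.other₂,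
          s.other₂, s.other₁, t.jump₁, t.jump₂, s.jump₂, s.jump₁, t.kept_inv₁, out2, t.ne₁₂,
          s.ne₁₂.symm, t.ne₁, t.ne₂, t.root₁.trans t.root₂.symm⟩
    · refine Or.inr (Or.inr ⟨f₁, f₂, c.not_mem_range_of_not_unstab huB t, kA,
        fun f => ⟨fun h => h.1, kept_of_not_unstab huB⟩, t.other₁, t.other₂, t.jump₁, t.jump₂,
        t.kept_inv₁, ?_, t.ne₁₂, t.ne₁, t.ne₂, t.root₁.trans t.root₂.symm⟩)
      exact out2.imp (fun h => ⟨h, c.mem_range_of_inv_eq h⟩) id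
  · have huB : ¬ B.Unstab := fun h => huA (c.unstab_of_unstab hA hSB h).1
    exact Or.inl ⟨fun f => ⟨fun h => h.1, kept_of_not_unstab huA⟩,
      fun f => ⟨fun h => h.1, kept_of_not_unstab huB⟩⟩

variable {c}

theorem Facts.kept_jump_lift (F : Facts A B c) {f : B.F} (hf : B.Kept f) :
    A.Kept (A.jump (c.lift f)) := by
  obtain ⟨h1, h2, h3, h4, h5, h6, h7, h8, h9, h10 | ⟨f₁, f₂, e₁, e₂, h10⟩ | ⟨f₁, f₂, h10⟩⟩ := F
  · grind
  · grind
  · grind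

theorem Facts.jump_lift_jump (F : Facts A B c) {f : B.F} (hf : f ≠ B.lastLeg)
    (hf' : B.Kept (B.jump f)) : A.jump (c.lift (B.jump f)) = A.jump (c.lift f) := by
  obtain ⟨h1, h2, h3, h4, h5, h6, h7, h8, h9, h10 | ⟨f₁, f₂, e₁, e₂, h10⟩ | ⟨f₁, f₂, h10⟩⟩ := F
  · grind
  · grind
  · grind

theorem Facts.jump_lift_injective (F : Facts A B c) {f f' : B.F} (hf : B.Kept f)
    (hf' : B.Kept f') (h : A.jump (c.lift f) = A.jump (c.lift f')) : f = f' := by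
  obtain ⟨h1, h2, h3, h4, h5, h6, h7, h8, h9, h10 | ⟨f₁, f₂, e₁, e₂, h10⟩ | ⟨f₁, f₂, h10⟩⟩ := F
  · grind
  · grind
  · grind

theorem Facts.inv_jump_lift (F : Facts A B c) {f : B.F} (hf : B.Kept f) :
    (A.Kept (A.jump (A.inv (A.jump (c.lift f)))) ∧ B.Kept (B.jump (B.inv f)) ∧
      A.jump (A.inv (A.jump (c.lift f))) = A.jump (c.lift (B.jump (B.inv f)))) ∨
    (A.Kept (A.jump (A.inv (A.jump (c.lift f)))) ∧ ¬ B.Kept (B.jump (B.inv f)) ∧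
      A.jump (A.inv (A.jump (c.lift f))) = A.jump (c.lift f)) ∨
    (¬ A.Kept (A.jump (A.inv (A.jump (c.lift f)))) ∧ B.Kept (B.jump (B.inv f)) ∧
      A.jump (c.lift f) = A.jump (c.lift (B.jump (B.inv f)))) ∨
    (¬ A.Kept (A.jump (A.inv (A.jump (c.lift f)))) ∧ ¬ B.Kept (B.jump (B.inv f))) := by
  obtain ⟨h1, h2, h3, h4, h5, h6, h7, h8, h9, h10 | ⟨f₁, f₂, e₁, e₂, h10⟩ | ⟨f₁, f₂, h10⟩⟩ := F
  · grind
  · have a : A.Kept (c.lift f) := by grind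
    rw [h6 _ a, h3]
    have b : B.inv f ≠ B.lastLeg := by grind
    by_cases hi₁ : B.inv f = e₁
    · have a1 : c.lift (B.inv e₂) = A.inv f₂ := by grind
      grind
    · by_cases hi₂ : B.inv f = e₂
      · grind
      · grind
  · have b : B.inv f ≠ B.lastLeg := by grind
    by_cases hi₁ : c.lift f = f₁
    · grind
    · by_cases hi₂ : c.lift f = f₂
      · grind
      · grind

theorem Facts.range_iff (F : Facts A B c) {f : A.F} (hf : A.Kept f) :
    (∃ e, B.Kept e ∧ A.jump (c.lift e) = f) ↔ ((∃ e, c.lift e = f) ∨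
      (¬ A.Kept (A.inv f) ∧ ∃ e, c.lift e = A.other (A.inv f))) := by
  obtain ⟨h1, h2, h3, h4, h5, h6, h7, h8, h9, h10 | ⟨f₁, f₂, e₁, e₂, h10⟩ | ⟨f₁, f₂, h10⟩⟩ := F
  · grind
  · have hk : ∀ e, B.Kept e ↔ A.Kept (c.lift e) := by grind
    have hr : ¬ A.Kept (A.inv f) → ∃ e, c.lift e = f := by
      intro h
      have : A.inv f = f₁ ∨ A.inv f = f₂ := by grind
      rcases this with h' | h'
      · exact ⟨B.inv e₁, by grind⟩
      · exact ⟨B.inv e₂, by grind⟩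
    constructor
    · rintro ⟨e, he, rfl⟩
      exact Or.inl ⟨e, (h6 _ ((hk e).1 he)).symm⟩
    · intro h
      obtain ⟨e, rfl⟩ := h.elim id fun h => hr h.1
      exact ⟨e, (hk e).2 hf, h6 _ hf⟩
  · constructor
    · rintro ⟨e, he, rfl⟩
      by_cases hi₁ : c.lift e = f₁
      · exact Or.inr (by grind)
      · by_cases hi₂ : c.lift e = f₂
        · exact Or.inr (by grind)
        · exact Or.inl ⟨e, by grind⟩
    · rintro (⟨e, rfl⟩ | ⟨h, e, he⟩)
      · exact ⟨e, by grind, h6 _ hf⟩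
      · exact ⟨e, by grind, by grind⟩

end Contraction

end MarkedGraph

namespace MarkedGraph

theorem stabilize_inv_of_kept {n : ℕ} {G : MarkedGraph (n + 1)} {hG : G.Stabilizable}
    (f : (G.stabilize hG).F) (h : G.Kept (G.jump (G.inv f.1))) :
    ((G.stabilize hG).inv f).1 = G.jump (G.inv f.1) :=
  congrArg Subtype.val (dif_pos h : (G.stabilize hG).inv f = ⟨_, h⟩)

theorem stabilize_inv_of_not_kept {n : ℕ} {G : MarkedGraph (n + 1)} {hG : G.Stabilizable}
    (f : (G.stabilize hG).F) (h : ¬ G.Kept (G.jump (G.inv f.1))) :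
    (G.stabilize hG).inv f = f := dif_neg h

namespace Contraction

variable {n : ℕ} {A B : MarkedGraph (n + 1)} (c : Contraction A B)

variable {c} in
theorem Facts.other_mem (F : Facts A B c) {f : A.F} (h : ¬ A.Kept (A.inv f)) (hf : A.Kept f)
    (hr : ¬ ∃ e, c.lift e = f) (ho : ¬ ∃ e, c.lift e = A.other (A.inv f)) :
    A.Kept (A.jump (A.inv f)) ∧ A.jump (A.inv f) = A.inv (A.other (A.inv f)) ∧
      A.root (A.other (A.inv f)) = A.root (A.inv f) := by
  obtain ⟨h1, h2, h3, h4, h5, h6, h7, h8, h9, h10 | ⟨f₁, f₂, e₁, e₂, h10⟩ | ⟨f₁, f₂, h10⟩⟩ := F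
  · grind
  · grind
  · grind

variable {c} in
theorem Facts.root_other (F : Facts A B c) {f : A.F} (h : ¬ A.Kept (A.inv f)) (hf : A.Kept f) :
    A.root (A.other (A.inv f)) = A.root (A.inv f) := by
  obtain ⟨h1, h2, h3, h4, h5, h6, h7, h8, h9, h10 | ⟨f₁, f₂, e₁, e₂, h10⟩ | ⟨f₁, f₂, h10⟩⟩ := F
  · grind
  · grind
  · grind

variable {c} in
theorem Facts.lift_cases (F : Facts A B c) {f : B.F} (hf : B.Kept f) :
    A.jump (c.lift f) = c.lift f ∨ (A.jump (c.lift f) = A.inv (A.other (c.lift f)) ∧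
      (¬ ∃ e, c.lift e = A.other (c.lift f)) ∧
      A.root (A.other (c.lift f)) = A.root (c.lift f)) := by
  obtain ⟨h1, h2, h3, h4, h5, h6, h7, h8, h9, h10 | ⟨f₁, f₂, e₁, e₂, h10⟩ | ⟨f₁, f₂, h10⟩⟩ := F
  · grind
  · grind
  · grind

/-- The contraction induced on the stabilizations. -/
noncomputable def stabilize (hA : A.IsStable) (hSA : A.Stabilizable) (hSB : B.Stabilizable) :
    Contraction (A.stabilize hSA) (B.stabilize hSB) where
  onV v := ⟨c.onV v.1, fun hu h => v.2 (c.unstab_of_unstab hA hSB hu).1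
    (c.fiber_of_unstab hA hu h)⟩
  lift f := ⟨A.jump (c.lift f.1), (c.facts hA hSA hSB).kept_jump_lift f.2⟩
  lift_injective f f' h := Subtype.ext
    ((c.facts hA hSA hSB).jump_lift_injective f.2 f'.2 (congrArg Subtype.val h))
  onV_root f := by
    refine Subtype.ext ?_
    change c.onV (A.root (A.jump (c.lift f.1))) = B.root f.1
    rcases (c.facts hA hSA hSB).lift_cases f.2 with h | ⟨h, h', h''⟩
    · rw [h, c.onV_root]
    · rw [h, c.onV_contracted _ h', h'', c.onV_root]
  inv_lift f := by
    refine Subtype.ext ?_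
    let f' : (A.stabilize hSA).F :=
      ⟨A.jump (c.lift f.1), (c.facts hA hSA hSB).kept_jump_lift f.2⟩
    change ((A.stabilize hSA).inv f').1 = A.jump (c.lift ((B.stabilize hSB).inv f).1)
    rcases (c.facts hA hSA hSB).inv_jump_lift f.2 with h | h | h | h
    · rw [stabilize_inv_of_kept f' h.1, stabilize_inv_of_kept f h.2.1]; exact h.2.2
    · rw [stabilize_inv_of_kept f' h.1, stabilize_inv_of_not_kept f h.2.1]; exact h.2.2
    · rw [stabilize_inv_of_not_kept f' h.1, stabilize_inv_of_kept f h.2.1]; exact h.2.2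
    · rw [stabilize_inv_of_not_kept f' h.1, stabilize_inv_of_not_kept f h.2]
  onV_contracted f hf := by
    refine Subtype.ext ?_
    change c.onV (A.root ((A.stabilize hSA).inv f).1) = c.onV (A.root f.1)
    have hr : ¬ ((∃ e, c.lift e = f.1) ∨
        (¬ A.Kept (A.inv f.1) ∧ ∃ e, c.lift e = A.other (A.inv f.1))) := by
      rw [← (c.facts hA hSA hSB).range_iff f.2]
      rintro ⟨e, he, he'⟩
      exact hf ⟨⟨e, he⟩, Subtype.ext he'⟩
    push Not at hr
    have hr1 : f.1 ∉ Set.range c.lift := fun ⟨e, he⟩ => hr.1 e he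
    by_cases hk : A.Kept (A.inv f.1)
    · rw [stabilize_inv_of_kept _ (by rwa [jump_of_kept hk]), jump_of_kept hk,
        c.onV_contracted _ hr1]
    · have ho : A.other (A.inv f.1) ∉ Set.range c.lift := fun ⟨e, he⟩ => hr.2 hk e he
      obtain ⟨a1, a2, a3⟩ := (c.facts hA hSA hSB).other_mem hk f.2 hr1 ho
      rw [stabilize_inv_of_kept _ a1, a2, c.onV_contracted _ ho, a3, c.onV_contracted _ hr1]
  lift_leg i := Subtype.ext (by
    have hne : B.leg i.castSucc ≠ B.lastLeg := fun h => by
      have := B.leg_injective h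
      exact absurd this (Fin.castSucc_lt_last i).ne
    have := (c.facts hA hSA hSB).jump_lift_jump hne ((B.stabilize hSB).leg i).2
    rw [c.lift_leg] at this
    exact this)
  fiber w := by
    have h := (c.fiber w.1).stabilize (hG := hSA) ?_ ?_ ?_ ?_
    · have hV : {v : (A.stabilize hSA).V | v.1 ∈ {v | c.onV v = w.1}} =
          {v | (⟨c.onV v.1, fun hu h => v.2 (c.unstab_of_unstab hA hSB hu).1
            (c.fiber_of_unstab hA hu h)⟩ : (B.stabilize hSB).V) = w} := by
        ext v
        exact ⟨fun h => Subtype.ext h, fun h => congrArg Subtype.val h⟩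
      have hF : {f : (A.stabilize hSA).F |
            f.1 ∈ {f | f ∉ Set.range c.lift ∧ c.onV (A.root f) = w.1} ∧
            (A.Kept (A.inv f.1) ∨
              A.other (A.inv f.1) ∈ {f | f ∉ Set.range c.lift ∧ c.onV (A.root f) = w.1})} =
          {f | f ∉ Set.range (fun f : (B.stabilize hSB).F =>
              (⟨A.jump (c.lift f.1), (c.facts hA hSA hSB).kept_jump_lift f.2⟩ :
                (A.stabilize hSA).F)) ∧
            (⟨c.onV (A.root f.1), fun hu h => f.2.2 (c.unstab_of_unstab hA hSB hu).1
              (c.fiber_of_unstab hA hu h)⟩ : (B.stabilize hSB).V) = w} := by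
        ext f
        have hr := (c.facts hA hSA hSB).range_iff f.2
        have hr' : f ∈ Set.range (fun f : (B.stabilize hSB).F =>
              (⟨A.jump (c.lift f.1), (c.facts hA hSA hSB).kept_jump_lift f.2⟩ :
                (A.stabilize hSA).F)) ↔ (∃ e, B.Kept e ∧ A.jump (c.lift e) = f.1) :=
          ⟨fun ⟨e, he⟩ => ⟨e.1, e.2, congrArg Subtype.val he⟩,
            fun ⟨e, he, he'⟩ => ⟨⟨e, he⟩, Subtype.ext he'⟩⟩
        have hw : (⟨c.onV (A.root f.1), fun hu h => f.2.2 (c.unstab_of_unstab hA hSB hu).1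
              (c.fiber_of_unstab hA hu h)⟩ : (B.stabilize hSB).V) = w ↔
              c.onV (A.root f.1) = w.1 :=
          ⟨fun h => congrArg Subtype.val h, fun h => Subtype.ext h⟩
        have hro := fun h => (c.facts hA hSA hSB).root_other (f := f.1) h f.2
        have hco := c.onV_contracted f.1
        refine Iff.trans ?_ (and_congr (not_congr hr') hw).symm
        rw [hr]
        constructor
        · rintro ⟨⟨h1, h2⟩, h3⟩
          refine ⟨?_, h2⟩
          rintro (h | ⟨h, h'⟩)
          · exact h1 h
          · exact h3.elim h fun h3 => h3.1 h'
        · rintro ⟨h1, h2⟩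
          push Not at h1
          have h1' : f.1 ∉ Set.range c.lift := fun ⟨e, he⟩ => h1.1 e he
          refine ⟨⟨h1', h2⟩, ?_⟩
          by_cases hk : A.Kept (A.inv f.1)
          · exact Or.inl hk
          · refine Or.inr ⟨fun ⟨e, he⟩ => h1.2 hk e he, ?_⟩
            rw [hro hk, hco h1', h2]
      rw [hV, hF] at h
      exact h
    · rintro f ⟨h1, h2⟩
      exact ⟨fun h => h1 (c.inv_mem_range.1 h), (c.onV_contracted f h1).trans h2⟩
    · exact fun f h => h.2
    · exact fun f h h' => h.1 (c.mem_range_of_inv_eq h')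
    · intro f₁ f₂ t hw
      have hw : c.onV A.lastRoot = w.1 := hw
      rw [c.onV_lastRoot] at hw
      have hu : ¬ B.Unstab := fun hu => w.2 hu hw.symm
      refine (c.not_mem_range_of_not_unstab hu t).imp (fun h => ⟨h, ?_⟩) (fun h => ⟨h, ?_⟩)
      · rw [t.root₁, c.onV_lastRoot]; exact hw
      · rw [t.root₂, c.onV_lastRoot]; exact hw

@[ext]
theorem ext_lift {A B : MarkedGraph n} {c d : Contraction A B} (hV : ∀ v, c.onV v = d.onV v)
    (hF : ∀ f, c.lift f = d.lift f) : c = d :=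
  Contraction.ext (funext hV) (funext hF)

theorem stabilize_refl (hA : A.IsStable) (hSA : A.Stabilizable) :
    (refl A).stabilize hA hSA hSA = refl _ :=
  ext_lift (fun _ => rfl) fun f => Subtype.ext (jump_of_kept f.2)

theorem stabilize_trans {C : MarkedGraph (n + 1)} (d : Contraction B C) (hA : A.IsStable)
    (hB : B.IsStable)
    (hSA : A.Stabilizable) (hSB : B.Stabilizable) (hSC : C.Stabilizable) :
    (c.trans d).stabilize hA hSA hSC =
      (c.stabilize hA hSA hSB).trans (d.stabilize hB hSB hSC) :=
  ext_lift (fun _ => rfl) fun f => Subtype.ext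
    ((c.facts hA hSA hSB).jump_lift_jump (d.lift_ne_lastLeg f.2.1)
      ((d.facts hB hSB hSC).kept_jump_lift f.2)).symm

end Contraction

end MarkedGraph

/-! ### Sharp monoids, tropical curves metrized by monoids -/

/-- A sharp (integral and saturated) commutative monoid.  Being cancellative, it embeds into its
groupification `P^gp`; it is saturated if every `x = a - b` of `P^gp` such that `k • x` lies in
`P` for some `k ≥ 1` lies in `P`; it is sharp if `0` is its only unit. -/
structure ShpMon where
  carrier : Type
  [addCommMonoid : AddCommMonoid carrier]
  cancel : ∀ a b c : carrier, a + b = a + c → b = c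
  saturated : ∀ (k : ℕ), 0 < k → ∀ a b c : carrier, k • a = k • b + c → ∃ d, a = b + d
  sharp : ∀ a b : carrier, a + b = 0 → a = 0

namespace ShpMon

instance : CoeSort ShpMon Type := ⟨carrier⟩

instance (P : ShpMon) : AddCommMonoid P := P.addCommMonoid

instance : Category ShpMon where
  Hom P Q := P →+ Q
  id P := AddMonoidHom.id P
  comp f g := g.comp f

/-- The monoid of nonnegative real numbers. -/
noncomputable def nnreal : ShpMon where
  carrier := NNReal
  cancel _ _ _ h := add_left_cancel h
  saturated k hk a b c h := by
    refine exists_add_of_le ?_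
    have : k • b ≤ k • a := h ▸ le_self_add
    rw [nsmul_eq_mul, nsmul_eq_mul] at this
    exact le_of_mul_le_mul_left this (by exact_mod_cast hk)
  sharp a b h := (add_eq_zero.1 h).1

end ShpMon

/-- A stable tropical curve of genus `g` with `n` marked legs, metrized by the monoid `P`: every
edge has a nonzero length in `P`.  The length is encoded as a function on flags which has the same
value on the two flags of an edge and which is zero on the legs. -/
structure StableCurve (g n : ℕ) (P : ShpMon) extends MarkedGraph n where
  connected : toMarkedGraph.IsConnectedOfGenus Set.univ {f | inv f ≠ f} g
  stable : toMarkedGraph.IsStable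
  len : F → P
  len_inv : ∀ f, len (inv f) = len f
  len_eq_zero_iff : ∀ f, len f = 0 ↔ inv f = f

/-- A morphism from the curve `A` over `P` to the curve `B` over `Q` along `h : P → Q`: a
contraction of graphs such that the edges that are not contracted have the lengths prescribed by
`h`, and such that an edge is contracted if and only if `h` takes its length to zero (the edges of
`B` have nonzero lengths, so that an edge whose length goes to zero has to be contracted). -/
structure CurveContraction {g n : ℕ} {P Q : ShpMon} (h : P →+ Q) (A : StableCurve g n P)
    (B : StableCurve g n Q) where
  graph : MarkedGraph.Contraction A.toMarkedGraph B.toMarkedGraph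
  len_lift : ∀ f, h (A.len (graph.lift f)) = B.len f
  len_contracted : ∀ f, f ∉ Set.range graph.lift → h (A.len f) = 0

namespace CurveContraction

variable {g n : ℕ} {P Q R : ShpMon} {h : P →+ Q} {k : Q →+ R} {A : StableCurve g n P}
  {B : StableCurve g n Q} {C : StableCurve g n R}

def refl (A : StableCurve g n P) : CurveContraction (AddMonoidHom.id P) A A where
  graph := .refl _
  len_lift _ := rfl
  len_contracted f hf := absurd ⟨f, rfl⟩ hf

def trans (a : CurveContraction h A B) (b : CurveContraction k B C) :
    CurveContraction (k.comp h) A C where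
  graph := a.graph.trans b.graph
  len_lift f := by
    change k (h (A.len (a.graph.lift (b.graph.lift f)))) = _
    rw [a.len_lift, b.len_lift]
  len_contracted f hf := by
    change k (h (A.len f)) = 0
    by_cases hr : f ∈ Set.range a.graph.lift
    · obtain ⟨e, rfl⟩ := hr
      rw [a.len_lift]
      exact b.len_contracted e fun ⟨e', he⟩ => hf ⟨e', congrArg _ he⟩
    · rw [a.len_contracted f hr, map_zero]

end CurveContraction

/-! ### The forgetful morphism on curves -/

namespace StableCurve

variable {g n : ℕ} {P : ShpMon}

theorem stabilizable (hgn : 2 < 2 * g + n) (A : StableCurve g (n + 1) P) :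
    A.toMarkedGraph.Stabilizable :=
  MarkedGraph.stabilizable_of_connected hgn A.connected A.stable

open Classical in
/-- The lengths after stabilization: an edge that results from connecting two flags gets the sum of
the lengths of the two old edges, all other edges keep their lengths. -/
noncomputable def stabLen (A : StableCurve g (n + 1) P) (f : A.F) : P :=
  if A.Kept (A.inv f) then A.len f
  else if A.Kept (A.jump (A.inv f)) then A.len f + A.len (A.other (A.inv f))
  else 0

theorem stabLen_of_kept {A : StableCurve g (n + 1) P} {f : A.F} (h : A.Kept (A.inv f)) :
    A.stabLen f = A.len f := if_pos h

theorem stabLen_of_kept_jump {A : StableCurve g (n + 1) P} {f : A.F} (h : ¬ A.Kept (A.inv f))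
    (h' : A.Kept (A.jump (A.inv f))) :
    A.stabLen f = A.len f + A.len (A.other (A.inv f)) := by
  rw [stabLen, if_neg h, if_pos h']

theorem stabLen_of_not_kept {A : StableCurve g (n + 1) P} {f : A.F} (h : ¬ A.Kept (A.inv f))
    (h' : ¬ A.Kept (A.jump (A.inv f))) : A.stabLen f = 0 := by
  rw [stabLen, if_neg h, if_neg h']

theorem stabLen_jump_inv {A : StableCurve g (n + 1) P} (hS : A.Stabilizable) {f : A.F}
    (hf : A.Kept f) (h : A.Kept (A.jump (A.inv f))) :
    A.stabLen (A.jump (A.inv f)) = A.stabLen f := by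
  have F := (MarkedGraph.Contraction.refl A.toMarkedGraph).facts A.stable hS hS
  have hl := A.len_inv
  obtain ⟨h1, h2, h3, h4, h5, h6, h7, h8, h9, h10⟩ := F
  by_cases hk : A.Kept (A.inv f)
  · have h' : A.Kept (A.inv (A.inv f)) := by rwa [h1]
    rw [h6 _ hk, stabLen_of_kept hk, stabLen_of_kept h', hl]
  · obtain ⟨f', hf', ho, ho', hj⟩ : ∃ f', A.other (A.inv f) = f' ∧ A.other f' = A.inv f ∧
        A.jump (A.inv f) = A.inv f' ∧ A.jump f' = f ∧ ¬ A.Kept f' := by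
      rcases h10 with h10 | ⟨f₁, f₂, e₁, e₂, h10⟩ | ⟨f₁, f₂, h10⟩
      · grind
      · grind
      · grind
    rw [stabLen_of_kept_jump hk h, ho', stabLen_of_kept_jump (by rw [h1]; exact hj.2)
      (by rw [h1, hj.1]; exact hf), h1, ho, hf', hl, hl, add_comm]

theorem stabLen_eq_zero_iff {A : StableCurve g (n + 1) P} (hS : A.Stabilizable) {f : A.F}
    (hf : A.Kept f) : A.stabLen f = 0 ↔ (A.Kept (A.jump (A.inv f)) → A.jump (A.inv f) = f) := by
  have F := (MarkedGraph.Contraction.refl A.toMarkedGraph).facts A.stable hS hS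
  obtain ⟨h1, h2, h3, h4, h5, h6, h7, h8, h9, h10⟩ := F
  by_cases hk : A.Kept (A.inv f)
  · rw [stabLen_of_kept hk, A.len_eq_zero_iff, h6 _ hk]
    exact ⟨fun h _ => h, fun h => h hk⟩
  · by_cases hk' : A.Kept (A.jump (A.inv f))
    · rw [stabLen_of_kept_jump hk hk']
      have hne : A.inv f ≠ f := fun h => hk (by rwa [h])
      have hne2 : A.jump (A.inv f) ≠ f := by
        rcases h10 with h10 | ⟨f₁, f₂, e₁, e₂, h10⟩ | ⟨f₁, f₂, h10⟩
        · grind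
        · grind
        · grind
      exact ⟨fun h => absurd ((A.len_eq_zero_iff f).1 (P.sharp _ _ h)) hne,
        fun h => absurd (h hk') hne2⟩
    · rw [stabLen_of_not_kept hk hk']
      exact ⟨fun _ h => absurd h hk', fun _ => rfl⟩

/-- Deleting the last leg of a curve and stabilizing. -/
noncomputable def stabilize (hgn : 2 < 2 * g + n) (A : StableCurve g (n + 1) P) :
    StableCurve g n P where
  toMarkedGraph := A.toMarkedGraph.stabilize (A.stabilizable hgn)
  connected := A.connected.stabilize_univ
  stable := A.stable.stabilize
  len f := A.stabLen f.1
  len_inv f := by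
    by_cases h : A.Kept (A.jump (A.inv f.1))
    · rw [MarkedGraph.stabilize_inv_of_kept f h]
      exact stabLen_jump_inv (A.stabilizable hgn) f.2 h
    · rw [MarkedGraph.stabilize_inv_of_not_kept f h]
  len_eq_zero_iff f := by
    rw [stabLen_eq_zero_iff (A.stabilizable hgn) f.2]
    by_cases h : A.Kept (A.jump (A.inv f.1))
    · exact ⟨fun hh => Subtype.ext ((MarkedGraph.stabilize_inv_of_kept f h).trans (hh h)),
        fun hh _ => (MarkedGraph.stabilize_inv_of_kept f h).symm.trans (congrArg Subtype.val hh)⟩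
    · exact ⟨fun _ => MarkedGraph.stabilize_inv_of_not_kept f h, fun _ h' => absurd h' h⟩

end StableCurve

namespace CurveContraction

variable {g n : ℕ} {P Q R : ShpMon} {h : P →+ Q} {k : Q →+ R} {A : StableCurve g (n + 1) P}
  {B : StableCurve g (n + 1) Q} {C : StableCurve g (n + 1) R}

theorem stabLen_lift (a : CurveContraction h A B) (hSA : A.Stabilizable) (hSB : B.Stabilizable)
    {f : B.F} (hf : B.Kept f) :
    h (A.stabLen (A.jump (a.graph.lift f))) = B.stabLen f := by
  have F := a.graph.facts A.stable hSA hSB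
  have hl := a.len_lift
  have hc : ∀ f, (¬ ∃ e, a.graph.lift e = f) → h (A.len f) = 0 := a.len_contracted
  obtain ⟨h1, h2, h3, h4, h5, h6, h7, h8, h9, h10 | ⟨f₁, f₂, e₁, e₂, h10⟩ | ⟨f₁, f₂, h10⟩⟩ := F
  · have b := h6 (a.graph.lift f) (by grind)
    rw [b, StableCurve.stabLen_of_kept (by grind), StableCurve.stabLen_of_kept (by grind), hl]
  · have b := h6 (a.graph.lift f) (by grind)
    have hk : ∀ e, B.Kept e ↔ A.Kept (a.graph.lift e) := by grind
    rw [b]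
    by_cases c : B.Kept (B.inv f)
    · rw [StableCurve.stabLen_of_kept (by rw [h3]; exact (hk _).1 c),
        StableCurve.stabLen_of_kept c, hl]
    · have ho : a.graph.lift (B.other (B.inv f)) = A.other (a.graph.lift (B.inv f)) := by
        have : B.inv f = e₁ ∨ B.inv f = e₂ := by grind
        grind
      have cA : ¬ A.Kept (A.inv (a.graph.lift f)) := by rw [h3]; exact fun h => c ((hk _).2 h)
      have hj : B.Kept (B.jump (B.inv f)) ↔ A.Kept (A.jump (A.inv (a.graph.lift f))) := by
        rw [h3, hk]
        have : B.inv f = e₁ ∨ B.inv f = e₂ := by grind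
        grind
      by_cases d : B.Kept (B.jump (B.inv f))
      · rw [StableCurve.stabLen_of_kept_jump c d, StableCurve.stabLen_of_kept_jump cA (hj.1 d),
          map_add, hl, h3, ← ho, hl]
      · rw [StableCurve.stabLen_of_not_kept c d,
          StableCurve.stabLen_of_not_kept cA (fun h => d (hj.2 h)), map_zero]
  · rw [StableCurve.stabLen_of_kept (f := f) (by grind)]
    by_cases c : A.Kept (a.graph.lift f)
    · rw [h6 _ c]
      by_cases d : A.Kept (A.inv (a.graph.lift f))
      · rw [StableCurve.stabLen_of_kept d, hl]
      · have e1 : A.Kept (A.jump (A.inv (a.graph.lift f))) := by grind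
        have e2 : ¬ ∃ e, a.graph.lift e = A.other (A.inv (a.graph.lift f)) := by grind
        rw [StableCurve.stabLen_of_kept_jump d e1, map_add, hc _ e2, hl, add_zero]
    · obtain ⟨f', e1, e2, e3, e4, e5, e6⟩ : ∃ f', A.jump (a.graph.lift f) = A.inv f' ∧
          (¬ ∃ e, a.graph.lift e = f') ∧ ¬ A.Kept f' ∧ A.other f' = a.graph.lift f ∧
          A.jump f' = A.inv (a.graph.lift f) ∧
          (A.Kept (A.inv (a.graph.lift f)) ∨ A.inv (a.graph.lift f) = a.graph.lift f) := by
        have : a.graph.lift f = f₁ ∨ a.graph.lift f = f₂ := by grind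
        rcases this with h' | h'
        · exact ⟨f₂, by grind, by grind, by grind, by grind, by grind, by grind⟩
        · exact ⟨f₁, by grind, by grind, by grind, by grind, by grind, by grind⟩
      rw [e1]
      by_cases d : A.Kept (A.inv (a.graph.lift f))
      · rw [StableCurve.stabLen_of_kept_jump (by rw [h1]; exact e3) (by rw [h1, e5]; exact d), h1,
          e4, map_add, A.len_inv, hc _ e2, hl, zero_add]
      · have e7 := e6.resolve_left d
        rw [StableCurve.stabLen_of_not_kept (by rw [h1]; exact e3) (by rw [h1, e5]; exact d),
          map_zero, ← hl, (A.len_eq_zero_iff _).2 e7, map_zero]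

theorem stabLen_contracted (a : CurveContraction h A B) (hSA : A.Stabilizable)
    (hSB : B.Stabilizable) {f : A.F} (hf : A.Kept f)
    (hr : ¬ ∃ e, B.Kept e ∧ A.jump (a.graph.lift e) = f) : h (A.stabLen f) = 0 := by
  have F := a.graph.facts A.stable hSA hSB
  rw [F.range_iff hf] at hr
  push Not at hr
  have hr1 : f ∉ Set.range a.graph.lift := fun ⟨e, he⟩ => hr.1 e he
  by_cases hk : A.Kept (A.inv f)
  · rw [StableCurve.stabLen_of_kept hk, a.len_contracted f hr1]
  · have ho : A.other (A.inv f) ∉ Set.range a.graph.lift := fun ⟨e, he⟩ => hr.2 hk e he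
    by_cases hk' : A.Kept (A.jump (A.inv f))
    · rw [StableCurve.stabLen_of_kept_jump hk hk', map_add, a.len_contracted f hr1,
        a.len_contracted _ ho, add_zero]
    · rw [StableCurve.stabLen_of_not_kept hk hk', map_zero]

/-- The morphism induced on the stabilizations. -/
noncomputable def stabilize (hgn : 2 < 2 * g + n) (a : CurveContraction h A B) :
    CurveContraction h (A.stabilize hgn) (B.stabilize hgn) where
  graph := a.graph.stabilize A.stable (A.stabilizable hgn) (B.stabilizable hgn)
  len_lift f := a.stabLen_lift (A.stabilizable hgn) (B.stabilizable hgn) f.2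
  len_contracted f hf := a.stabLen_contracted (A.stabilizable hgn) (B.stabilizable hgn) f.2
    fun ⟨e, he, he'⟩ => hf ⟨⟨e, he⟩, Subtype.ext he'⟩

end CurveContraction

/-! ### The fibred categories of tropical curves -/

/-- An object over `X : D` is a stable tropical curve of genus `g` with `n` marked legs, metrized
by the monoid that the functor `S` attaches to `X`.  For `D = ShpMonᵒᵖ` and `S` the identity this
is the moduli problem of tropical curves over sharp monoids. -/
structure Curves {D : Type 1} [Category.{0} D] (S : D ⥤ ShpMonᵒᵖ) (g n : ℕ) where
  base : D
  curve : StableCurve g n (S.obj base).unop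

namespace Curves

variable {D : Type 1} [Category.{0} D] {S : D ⥤ ShpMonᵒᵖ} {g n : ℕ}

/-- A morphism of curves over a morphism `f` of base objects: the curve on the target specializes
to the curve on the source, along the map of monoids belonging to `f`. -/
structure Hom (X Y : Curves S g n) where
  base : X.base ⟶ Y.base
  curve : CurveContraction (S.map base).unop Y.curve X.curve

theorem Hom.ext' {X Y : Curves S g n} {a b : Hom X Y} (h : a.base = b.base)
    (h' : a.curve.graph = b.curve.graph) : a = b := by
  obtain ⟨a, ⟨a', _, _⟩⟩ := a
  obtain ⟨b, ⟨b', _, _⟩⟩ := b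
  obtain rfl : a = b := h
  obtain rfl : a' = b' := h'
  rfl

/-- Transport of a morphism of curves along an equality of maps of monoids. -/
def _root_.CurveContraction.congr {P Q : ShpMon} {h k : P →+ Q} (e : h = k) {A : StableCurve g n P}
    {B : StableCurve g n Q} (a : CurveContraction h A B) : CurveContraction k A B where
  graph := a.graph
  len_lift f := e ▸ a.len_lift f
  len_contracted f hf := e ▸ a.len_contracted f hf

instance : Category (Curves S g n) where
  Hom := Hom
  id X := ⟨𝟙 _, (CurveContraction.refl X.curve).congr (by rw [S.map_id]; rfl)⟩
  comp a b := ⟨a.base ≫ b.base, (b.curve.trans a.curve).congr (by rw [S.map_comp]; rfl)⟩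
  id_comp a := Hom.ext' (Category.id_comp _) rfl
  comp_id a := Hom.ext' (Category.comp_id _) rfl
  assoc a b c := Hom.ext' (Category.assoc _ _ _) rfl

variable (S g n) in
/-- The projection to the category of base objects. -/
def proj : Curves S g n ⥤ D where
  obj X := X.base
  map a := a.base

/-- The forgetful morphism, which deletes the last leg and stabilizes. -/
noncomputable def forget (S : D ⥤ ShpMonᵒᵖ) (hgn : 2 < 2 * g + n) :
    Curves S g (n + 1) ⥤ Curves S g n where
  obj X := ⟨X.base, X.curve.stabilize hgn⟩
  map a := ⟨a.base, a.curve.stabilize hgn⟩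
  map_id X := Hom.ext' rfl (MarkedGraph.Contraction.stabilize_refl X.curve.stable _)
  map_comp {_ Y Z} _ _ := Hom.ext' rfl (MarkedGraph.Contraction.stabilize_trans _ _
    Z.curve.stable Y.curve.stable _ _ _)

end Curves

/-! ### Polyhedral cones -/

/-- A polyhedral cone: a strictly convex intersection `cone` of finitely many closed half spaces in
a finite-dimensional real vector space `V` which is spanned by `cone`.  The norm on `V` serves only
to fix the usual topology of `V`; the morphisms below ignore it. -/
structure PC where
  V : Type
  [normedAddCommGroup : NormedAddCommGroup V]
  [normedSpace : NormedSpace ℝ V]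
  [finiteDimensional : FiniteDimensional ℝ V]
  cone : Set V
  polyhedral : ∃ s : Set (Module.Dual ℝ V), s.Finite ∧ cone = {v | ∀ ℓ ∈ s, 0 ≤ ℓ v}
  salient : ∀ v ∈ cone, -v ∈ cone → v = 0
  span_eq_top : Submodule.span ℝ cone = ⊤

attribute [instance] PC.normedAddCommGroup PC.normedSpace PC.finiteDimensional

namespace PC

/-- Morphisms of polyhedral cones are linear maps taking one cone into the other. -/
instance : Category PC where
  Hom σ τ := {f : σ.V →ₗ[ℝ] τ.V // ∀ v ∈ σ.cone, f v ∈ τ.cone}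
  id σ := ⟨LinearMap.id, fun _ h => h⟩
  comp f g := ⟨g.1.comp f.1, fun v h => g.2 _ (f.2 v h)⟩

/-- The dual cone, as a submonoid of the dual vector space. -/
def dualCone (σ : PC) : AddSubmonoid (Module.Dual ℝ σ.V) where
  carrier := {ℓ | ∀ v ∈ σ.cone, 0 ≤ ℓ v}
  zero_mem' _ _ := le_rfl
  add_mem' ha hb v hv := add_nonneg (ha v hv) (hb v hv)

/-- The dual cone is a sharp monoid. -/
def dualMon (σ : PC) : ShpMon where
  carrier := σ.dualCone
  cancel _ _ _ h := add_left_cancel h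
  saturated k hk a b c h := by
    have hk' : (0 : ℝ) < k := by exact_mod_cast hk
    refine ⟨⟨(k : ℝ)⁻¹ • c.1, fun v hv => ?_⟩, Subtype.ext ?_⟩
    · exact mul_nonneg (inv_nonneg.2 hk'.le) (c.2 v hv)
    · have h1 : k • a.1 = k • b.1 + c.1 := congrArg Subtype.val h
      change a.1 = b.1 + (k : ℝ)⁻¹ • c.1
      rw [← Nat.cast_smul_eq_nsmul ℝ, ← Nat.cast_smul_eq_nsmul ℝ] at h1
      rw [eq_sub_of_add_eq' h1.symm, smul_sub, smul_smul, smul_smul, inv_mul_cancel₀ hk'.ne']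
      simp
  sharp a b h := by
    have h1 : a.1 + b.1 = 0 := congrArg Subtype.val h
    have h2 : ∀ v ∈ σ.cone, a.1 v = 0 := fun v hv => by
      have h3 : a.1 v + b.1 v = 0 := by rw [← LinearMap.add_apply, h1]; rfl
      linarith [a.2 v hv, b.2 v hv]
    refine Subtype.ext (LinearMap.ext_on σ.span_eq_top fun v hv => ?_)
    exact h2 v hv

/-- The functor taking a polyhedral cone to its dual monoid. -/
def dual : PC ⥤ ShpMonᵒᵖ where
  obj σ := Opposite.op σ.dualMon
  map {σ τ} f := Quiver.Hom.op (show τ.dualMon →+ σ.dualMon from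
    { toFun := fun ℓ => ⟨ℓ.1.comp f.1, fun v hv => ℓ.2 _ (f.2 v hv)⟩
      map_zero' := rfl
      map_add' := fun _ _ => rfl })

/-- The functor taking a polyhedral cone to its underlying topological space. -/
def space : PC ⥤ TopCat.{0} where
  obj σ := TopCat.of σ.cone
  map f := TopCat.ofHom ⟨fun v => ⟨f.1 v.1, f.2 _ v.2⟩,
    (f.1.continuous_of_finiteDimensional.comp continuous_subtype_val).subtype_mk _⟩

/-- The cone of nonnegative real numbers. -/
noncomputable def ray : PC where
  V := ℝ
  cone := Set.Ici 0
  polyhedral := ⟨{LinearMap.id}, Set.finite_singleton _, by ext; simp⟩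
  salient v h h' := le_antisymm (by simpa using h') h
  span_eq_top := by
    refine Submodule.eq_top_iff'.2 fun x => ?_
    have : (1 : ℝ) ∈ Submodule.span ℝ (Set.Ici (0 : ℝ)) := Submodule.subset_span (Set.mem_Ici.2 zero_le_one)
    simpa using Submodule.smul_mem _ x this

/-- The point `1` of the cone of nonnegative real numbers. -/
noncomputable def rayOne : ray.cone := ⟨(1 : ℝ), zero_le_one (α := ℝ)⟩

/-- The constant map with value `1` to the cone of nonnegative real numbers. -/
noncomputable def constOne (T : TopCat.{0}) : T ⟶ space.obj ray :=
  TopCat.ofHom (ContinuousMap.const T rayOne)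

/-- A nonnegative real number `r`, regarded as the linear function `t ↦ t * r` in the dual of the
cone of nonnegative real numbers. -/
noncomputable def nnrealToDual : ShpMon.nnreal →+ ray.dualMon where
  toFun r := ⟨LinearMap.toSpanSingleton ℝ ℝ (NNReal.toReal r), fun _ hv =>
    mul_nonneg hv (NNReal.coe_nonneg r)⟩
  map_zero' := Subtype.ext (LinearMap.ext fun x : ℝ => mul_zero x)
  map_add' a b := Subtype.ext (LinearMap.ext fun x : ℝ => mul_add x a.1 b.1)

theorem nnrealToDual_eq_zero {r : ShpMon.nnreal} (h : nnrealToDual r = 0) : r = 0 := by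
  have h1 : (nnrealToDual r).1 (1 : ℝ) = 0 := by rw [h]; rfl
  exact NNReal.eq ((one_mul _).symm.trans h1)

end PC

/-- Replacing the lengths of a curve by their images under a map of monoids that takes no nonzero
element to zero. -/
def StableCurve.mapLen {g n : ℕ} {P Q : ShpMon} (A : StableCurve g n P) (h : P →+ Q)
    (hh : ∀ p, h p = 0 → p = 0) : StableCurve g n Q where
  toMarkedGraph := A.toMarkedGraph
  connected := A.connected
  stable := A.stable
  len f := h (A.len f)
  len_inv f := congrArg h (A.len_inv f)
  len_eq_zero_iff f := ⟨fun e => (A.len_eq_zero_iff f).1 (hh _ e),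
    fun e => by rw [(A.len_eq_zero_iff f).2 e, map_zero]⟩

/-! ### Categories over topological spaces, extension and stackification -/

/-- A category over the category of topological spaces. -/
structure CatOver where
  E : Type 1
  [category : Category.{1} E]
  p : E ⥤ TopCat.{0}

attribute [instance] CatOver.category

namespace CatOver

/-- A functor over the category of topological spaces. -/
structure Hom (A B : CatOver) where
  F : A.E ⥤ B.E
  w : F ⋙ B.p ≅ A.p

/-- A section of `A` over the category of all topological spaces, that is, a morphism to `A` from
the (stack represented by the) one-point space. -/
structure Point (A : CatOver) where
  F : TopCat.{0} ⥤ A.E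
  w : F ⋙ A.p ≅ 𝟭 TopCat.{0}

theorem lift_comp_lift {C C' D : Type*} [Category* C] [Category* C'] [Category* D]
    (W : MorphismProperty C) (W' : MorphismProperty C') (G : C ⥤ C') (P : C ⥤ D) (P' : C' ⥤ D)
    (h : G ⋙ P' = P) (hG : W.IsInvertedBy (G ⋙ W'.Q)) (hP : W.IsInvertedBy P)
    (hP' : W'.IsInvertedBy P') :
    Localization.Construction.lift (G ⋙ W'.Q) hG ⋙ Localization.Construction.lift P' hP' =
      Localization.Construction.lift P hP := by
  refine Localization.Construction.uniq _ _ ?_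
  rw [← Functor.assoc, Localization.Construction.fac, Functor.assoc,
    Localization.Construction.fac, Localization.Construction.fac, h]

section Extension

variable {C C' : Type 1} [Category.{0} C] [Category.{0} C'] (p : C ⥤ PC) (p' : C' ⥤ PC)

/-- For a category `C` over polyhedral cones: triples consisting of a topological space `X`, an
object `c` of `C` over a cone `σ`, and a continuous map from `X` to the space of `σ`. -/
abbrev Triples := Comma (𝟭 TopCat.{0}) (p ⋙ PC.space)

/-- The morphisms of triples over isomorphisms of topological spaces. -/
def triplesIso : MorphismProperty (Triples p) := fun _ _ f => IsIso f.left

/-- The extension to topological spaces of a moduli problem `C` on polyhedral cones.  Inverting the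
morphisms of triples over isomorphisms forms, over each topological space `X`, the (filtered)
colimit of the groupoids `C(σ)` over all cones `σ` with a continuous map from `X` to the space
of `σ`. -/
noncomputable def extension : CatOver where
  E := (triplesIso p).Localization
  p := Localization.Construction.lift (Comma.fst _ _) fun _ _ _ h => h

variable {p p'}

/-- A functor over polyhedral cones induces a functor on triples. -/
def triplesMap (F : C ⥤ C') (w : F ⋙ p' ≅ p) : Triples p ⥤ Triples p' where
  obj Z := ⟨Z.left, F.obj Z.right, Z.hom ≫ PC.space.map (w.inv.app Z.right)⟩
  map {Z Z'} f := ⟨f.left, F.map f.right, by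
    have h1 := f.w
    have h2 := w.inv.naturality f.right
    simp only [Functor.id_map, Functor.comp_map] at h1 h2 ⊢
    rw [← Category.assoc, h1, Category.assoc, Category.assoc, ← PC.space.map_comp,
      ← PC.space.map_comp, h2]⟩

/-- The extension of a functor to topological spaces. -/
noncomputable def extensionMap (F : C ⥤ C') (w : F ⋙ p' ≅ p) :
    Hom (extension p) (extension p') where
  F := Localization.Construction.lift (triplesMap F w ⋙ (triplesIso p').Q)
    fun _ _ f h => (triplesIso p').Q_inverts _ (show IsIso ((triplesMap F w).map f).left from h)
  w := eqToIso (lift_comp_lift _ _ _ _ _ rfl _ _ _)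

end Extension

section Plus

variable (A B : CatOver)

/-- A descent datum of `A` on a covering sieve `R` of a topological space `X`. -/
structure Descent where
  X : TopCat.{0}
  R : Sieve X
  covering : R ∈ TopCat.grothendieckTopology X
  obj : ∀ {T : TopCat.{0}} (i : T ⟶ X), R i → A.E
  baseIso : ∀ {T : TopCat.{0}} (i : T ⟶ X) (hi : R i), A.p.obj (obj i hi) ≅ T
  map : ∀ {T T' : TopCat.{0}} (u : T ⟶ T') (i : T ⟶ X) (i' : T' ⟶ X) (hi : R i) (hi' : R i'),
    u ≫ i' = i → (obj i hi ⟶ obj i' hi')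
  map_over : ∀ {T T' : TopCat.{0}} (u : T ⟶ T') (i : T ⟶ X) (i' : T' ⟶ X) (hi : R i)
    (hi' : R i') (w : u ≫ i' = i),
    A.p.map (map u i i' hi hi' w) ≫ (baseIso i' hi').hom = (baseIso i hi).hom ≫ u
  map_id : ∀ {T : TopCat.{0}} (i : T ⟶ X) (hi : R i) (w : 𝟙 T ≫ i = i),
    map (𝟙 T) i i hi hi w = 𝟙 _
  map_comp : ∀ {T T' T'' : TopCat.{0}} (u : T ⟶ T') (u' : T' ⟶ T'') (i : T ⟶ X) (i' : T' ⟶ X)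
    (i'' : T'' ⟶ X) (hi : R i) (hi' : R i') (hi'' : R i'') (w : u ≫ i' = i) (w' : u' ≫ i'' = i')
    (w'' : (u ≫ u') ≫ i'' = i),
    map (u ≫ u') i i'' hi hi'' w'' = map u i i' hi hi' w ≫ map u' i' i'' hi' hi'' w'

variable {A B}

/-- A morphism of descent data over a continuous map `f : X → Y`, where the covering sieve of `X`
refines the pullback of the covering sieve of `Y`: for `i : T → X` in the first sieve and
`j = f ∘ i` a morphism over the identity of `T` between the corresponding objects, natural
in `T`. -/
@[ext]
structure Descent.Hom (D D' : A.Descent) where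
  f : D.X ⟶ D'.X
  le : ∀ {T : TopCat.{0}} (i : T ⟶ D.X), D.R i → D'.R (i ≫ f)
  app : ∀ {T : TopCat.{0}} (i : T ⟶ D.X) (j : T ⟶ D'.X) (hi : D.R i) (hj : D'.R j),
    i ≫ f = j → (D.obj i hi ⟶ D'.obj j hj)
  app_over : ∀ {T : TopCat.{0}} (i : T ⟶ D.X) (j : T ⟶ D'.X) (hi : D.R i) (hj : D'.R j)
    (w : i ≫ f = j), A.p.map (app i j hi hj w) ≫ (D'.baseIso j hj).hom = (D.baseIso i hi).hom
  naturality : ∀ {T T' : TopCat.{0}} (u : T ⟶ T') (i : T ⟶ D.X) (i' : T' ⟶ D.X) (j : T ⟶ D'.X)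
    (j' : T' ⟶ D'.X) (hi : D.R i) (hi' : D.R i') (hj : D'.R j) (hj' : D'.R j')
    (w : i ≫ f = j) (w' : i' ≫ f = j') (v : u ≫ i' = i) (v' : u ≫ j' = j),
    D.map u i i' hi hi' v ≫ app i' j' hi' hj' w' = app i j hi hj w ≫ D'.map u j j' hj hj' v'

theorem Descent.Hom.app_comp {D D' D'' : A.Descent} (a : Descent.Hom D D') (b : Descent.Hom D' D'')
    {T : TopCat.{0}} (i : T ⟶ D.X) (j j' : T ⟶ D'.X) (k : T ⟶ D''.X) (hi : D.R i) (hj : D'.R j)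
    (hj' : D'.R j') (hk : D''.R k) (w : i ≫ a.f = j) (w' : i ≫ a.f = j') (v : j ≫ b.f = k)
    (v' : j' ≫ b.f = k) :
    a.app i j hi hj w ≫ b.app j k hj hk v = a.app i j' hi hj' w' ≫ b.app j' k hj' hk v' := by
  subst w
  subst w'
  rfl

theorem Descent.Hom.ext' {D D' : A.Descent} {a b : Descent.Hom D D'} (h : a.f = b.f)
    (h' : ∀ {T : TopCat.{0}} (i : T ⟶ D.X) (j : T ⟶ D'.X) (hi : D.R i) (hj : D'.R j)
      (w : i ≫ a.f = j) (w' : i ≫ b.f = j), a.app i j hi hj w = b.app i j hi hj w') : a = b := by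
  obtain ⟨f, _, app, _, _⟩ := a
  obtain ⟨f', _, app', _, _⟩ := b
  obtain rfl : f = f' := h
  obtain rfl : @app = @app' := by
    funext T i j hi hj w
    exact h' i j hi hj w w
  rfl

instance : Category A.Descent where
  Hom := Descent.Hom
  id D :=
    { f := 𝟙 _
      le := fun i hi => by rwa [Category.comp_id]
      app := fun {T} i j hi hj w => D.map (𝟙 T) i j hi hj (by
        rw [Category.id_comp, ← w, Category.comp_id])
      app_over := fun i j hi hj w => by rw [D.map_over, Category.comp_id]
      naturality := fun u i i' j j' hi hi' hj hj' w w' v v' => by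
        rw [← D.map_comp u (𝟙 _) i i' j' hi hi' hj' _ _ (by simp_all),
          ← D.map_comp (𝟙 _) u i j j' hi hj hj' _ _ (by simp_all)]
        congr 1 }
  comp {D D' D''} a b :=
    { f := a.f ≫ b.f
      le := fun i hi => by rw [← Category.assoc]; exact b.le _ (a.le i hi)
      app := fun i k hi hk w => a.app i (i ≫ a.f) hi (a.le i hi) rfl ≫
        b.app (i ≫ a.f) k (a.le i hi) hk (by rw [Category.assoc, w])
      app_over := fun i k hi hk w => by
        rw [A.p.map_comp, Category.assoc, b.app_over, a.app_over]
      naturality := fun u i i' j j' hi hi' hj hj' w w' v v' => by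
        have h : u ≫ i' ≫ a.f = i ≫ a.f := by rw [← Category.assoc, v]
        have h1 := a.naturality u i i' (i ≫ a.f) (i' ≫ a.f) hi hi' (a.le i hi) (a.le i' hi') rfl rfl
          v h
        have h2 := b.naturality u (i ≫ a.f) (i' ≫ a.f) j j' (a.le i hi) (a.le i' hi') hj hj'
          (by rw [Category.assoc, w]) (by rw [Category.assoc, w']) h v'
        exact (Category.assoc _ _ _).symm.trans ((congrArg (· ≫ _) h1).trans
          ((Category.assoc _ _ _).trans ((congrArg (_ ≫ ·) h2).trans
            (Category.assoc _ _ _).symm))) }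
  id_comp {D D'} a := Descent.Hom.ext' (Category.id_comp _) fun {T} i j hi hj w w' => by
    change D.map (𝟙 T) i (i ≫ 𝟙 _) hi _ _ ≫ a.app (i ≫ 𝟙 _) j _ hj _ = a.app i j hi hj w'
    rw [a.naturality (𝟙 T) i (i ≫ 𝟙 _) j j hi _ hj hj w' _ _ (Category.id_comp _), D'.map_id,
      Category.comp_id]
  comp_id {D D'} a := Descent.Hom.ext' (Category.comp_id _) fun {T} i j hi hj w w' => by
    subst w'
    change a.app i (i ≫ a.f) hi _ _ ≫ D'.map (𝟙 T) (i ≫ a.f) (i ≫ a.f) _ hj _ = _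
    rw [D'.map_id, Category.comp_id]
  assoc {D D' D'' D'''} a b c := Descent.Hom.ext' (Category.assoc _ _ _) fun i j hi hj w w' => by
    change (a.app i (i ≫ a.f) hi _ _ ≫ b.app (i ≫ a.f) (i ≫ a.f ≫ b.f) _ _ _) ≫
        c.app (i ≫ a.f ≫ b.f) j _ hj _ =
      a.app i (i ≫ a.f) hi _ _ ≫ b.app (i ≫ a.f) ((i ≫ a.f) ≫ b.f) _ _ _ ≫
        c.app ((i ≫ a.f) ≫ b.f) j _ hj _
    rw [Category.assoc]
    congr 1

/-- The morphisms of descent data over isomorphisms of topological spaces. -/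
def descentIso (A : CatOver) : MorphismProperty A.Descent := fun _ _ f => IsIso f.f

/-- The space on which a descent datum lives. -/
def descentBase (A : CatOver) : A.Descent ⥤ TopCat.{0} where
  obj D := D.X
  map a := a.f

/-- The plus construction.  Inverting the morphisms of descent data over isomorphisms of
topological spaces forms, over each topological space `X`, the filtered colimit over the covering
sieves of `X` of the groupoids of descent data. -/
noncomputable def plus (A : CatOver) : CatOver where
  E := (descentIso A).Localization
  p := Localization.Construction.lift (descentBase A) fun _ _ _ h => h

/-- The effect of a functor over topological spaces on descent data. -/
def descentMap (F : Hom A B) : A.Descent ⥤ B.Descent where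
  obj D :=
    { X := D.X
      R := D.R
      covering := D.covering
      obj := fun i hi => F.F.obj (D.obj i hi)
      baseIso := fun i hi => F.w.app (D.obj i hi) ≪≫ D.baseIso i hi
      map := fun u i i' hi hi' w => F.F.map (D.map u i i' hi hi' w)
      map_over := fun u i i' hi hi' w => by
        have h := F.w.hom.naturality (D.map u i i' hi hi' w)
        simp only [Functor.comp_map] at h
        simp only [Iso.trans_hom, Iso.app_hom, Category.assoc]
        rw [← Category.assoc, h, Category.assoc, D.map_over]
      map_id := fun i hi w => by rw [D.map_id i hi w, F.F.map_id]
      map_comp := fun u u' i i' i'' hi hi' hi'' w w' w'' => by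
        rw [D.map_comp u u' i i' i'' hi hi' hi'' w w' w'', F.F.map_comp] }
  map {D D'} (a : Descent.Hom D D') :=
    { f := a.f
      le := a.le
      app := fun i j hi hj w => F.F.map (a.app i j hi hj w)
      app_over := fun i j hi hj w => by
        have h := F.w.hom.naturality (a.app i j hi hj w)
        simp only [Functor.comp_map] at h
        simp only [Iso.trans_hom, Iso.app_hom]
        rw [← Category.assoc, h, Category.assoc, a.app_over]
      naturality := fun u i i' j j' hi hi' hj hj' w w' v v' => by
        rw [← F.F.map_comp, a.naturality u i i' j j' hi hi' hj hj' w w' v v', F.F.map_comp] }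
  map_id D := Descent.Hom.ext' rfl fun i j hi hj w w' => rfl
  map_comp a b := Descent.Hom.ext' rfl fun i j hi hj w w' => F.F.map_comp _ _

/-- The effect of a functor over topological spaces on plus constructions. -/
noncomputable def plusMap (F : Hom A B) : Hom A.plus B.plus where
  F := Localization.Construction.lift (descentMap F ⋙ (descentIso B).Q)
    fun _ _ f h => (descentIso B).Q_inverts _ (show IsIso ((descentMap F).map f).f from h)
  w := eqToIso (lift_comp_lift _ _ _ _ _ rfl _ _ _)

/-- The descent data attached to a morphism from the one-point space: over every topological space
take the constant family. -/
def descentPoint (s : A.Point) : TopCat.{0} ⥤ A.Descent where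
  obj X :=
    { X := X
      R := ⊤
      covering := (TopCat.grothendieckTopology).top_mem X
      obj := fun {T} _ _ => s.F.obj T
      baseIso := fun {T} _ _ => s.w.app T
      map := fun u _ _ _ _ _ => s.F.map u
      map_over := fun u _ _ _ _ _ => s.w.hom.naturality u
      map_id := fun _ _ _ => s.F.map_id _
      map_comp := fun u u' _ _ _ _ _ _ _ _ _ => s.F.map_comp u u' }
  map {X Y} f :=
    { f := f
      le := fun _ _ => trivial
      app := fun {T} _ _ _ _ _ => 𝟙 (s.F.obj T)
      app_over := fun _ _ _ _ _ => by rw [A.p.map_id, Category.id_comp]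
      naturality := fun u _ _ _ _ _ _ _ _ _ _ _ _ => by
        rw [Category.comp_id, Category.id_comp] }
  map_id X := Descent.Hom.ext' rfl fun _ _ _ _ _ _ => (s.F.map_id _).symm
  map_comp _ _ := Descent.Hom.ext' rfl fun _ _ _ _ _ _ => (Category.comp_id _).symm

/-- A morphism from the one-point space to `A` gives one to the plus construction of `A`. -/
noncomputable def plusPoint (s : A.Point) : A.plus.Point where
  F := descentPoint s ⋙ (descentIso A).Q
  w := eqToIso (congrArg (descentPoint s ⋙ ·)
    (Localization.Construction.fac (descentBase A) (fun _ _ _ h => h)))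

end Plus

/-- The stackification for the topology of open coverings.  As for sheaves of groupoids in general,
the plus construction has to be applied three times. -/
noncomputable def stackify (A : CatOver) : CatOver := A.plus.plus.plus

noncomputable def stackifyMap {A B : CatOver} (F : Hom A B) : Hom A.stackify B.stackify :=
  plusMap (plusMap (plusMap F))

noncomputable def stackifyPoint {A : CatOver} (s : A.Point) : A.stackify.Point :=
  plusPoint (plusPoint (plusPoint s))

/-! ### Preimages of points, underlying topological spaces -/

section Preimage

variable {A B : CatOver} (F : CatOver.Hom A B) (s : B.Point)

/-- The preimage of the point `s` of `B` under `F : A → B`, that is, the fibre product (in the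
`2`-categorical sense) of `A` with the one-point space over `B`.  Its objects over a space `X` are
the objects `a` of `A` over `X` with an isomorphism, over the identity of `X`, from the image of `a`
in `B` to the constant family over `X` given by `s`. -/
structure Preimage where
  obj : A.E
  iso : F.F.obj obj ≅ s.F.obj (A.p.obj obj)
  iso_over : B.p.map iso.hom ≫ s.w.hom.app (A.p.obj obj) = F.w.hom.app obj

namespace Preimage

variable {F s}

@[ext]
structure Hom (Z Z' : Preimage F s) where
  hom : Z.obj ⟶ Z'.obj
  comm : F.F.map hom ≫ Z'.iso.hom = Z.iso.hom ≫ s.F.map (A.p.map hom)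

instance : Category (Preimage F s) where
  Hom := Hom
  id Z := ⟨𝟙 _, by simp⟩
  comp a b := ⟨a.hom ≫ b.hom, by
    rw [F.F.map_comp, Category.assoc, b.comm, ← Category.assoc, a.comm, A.p.map_comp, s.F.map_comp,
      Category.assoc]⟩
  id_comp a := Hom.ext (Category.id_comp _)
  comp_id a := Hom.ext (Category.comp_id _)
  assoc a b c := Hom.ext (Category.assoc _ _ _)

end Preimage

/-- The preimage of a point as a category over topological spaces. -/
def preimage : CatOver where
  E := Preimage F s
  p :=
    { obj := fun Z => A.p.obj Z.obj
      map := fun a => A.p.map a.hom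
      map_id := fun _ => A.p.map_id _
      map_comp := fun _ _ => A.p.map_comp _ _ }

end Preimage

section UnderlyingSpace

variable (A : CatOver)

/-- The objects over one-point spaces. -/
def PointObj : Type 1 := {z : A.E // Nonempty (Unique (A.p.obj z))}

/-- The point set of `A`: the isomorphism classes of objects over one-point spaces. -/
def UnderlyingSpace : Type 1 :=
  Quot fun z z' : A.PointObj => Nonempty (z.1 ≅ z'.1)

variable {A}

/-- For an object `z` of `A` over `X`, the map `c` takes every point `x` of `X` to the isomorphism
class of the restriction of `z` to the subspace `{x}`. -/
def IsPointMap (z : A.E) (c : A.p.obj z → A.UnderlyingSpace) : Prop :=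
  ∀ x, ∃ (w : A.PointObj) (m : w.1 ⟶ z), Quot.mk _ w = c x ∧ ∀ y, A.p.map m y = x

/-- The underlying topological space carries the finest topology for which the map `X → |A|` given
by any object of `A` over any topological space `X` is continuous. -/
instance : TopologicalSpace A.UnderlyingSpace :=
  ⨆ (z : A.E) (c : A.p.obj z → A.UnderlyingSpace) (_ : IsPointMap z c),
    TopologicalSpace.coinduced c inferInstance

variable (A) in
/-- Morphisms in `A` over a continuous map `h : X → Y` between objects `z` over `X` and `z'` over `Y`
are unique, and they exist if and only if the corresponding maps from `X` and `Y` to the underlying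
space of `A` are compatible with `h`.  For a stack in groupoids this says that `A` is a subsheaf of
the sheaf of continuous maps to the underlying space of `A`. -/
def IsSubsheafOfUnderlyingSpace : Prop :=
  ∀ (z z' : A.E) (h : A.p.obj z ⟶ A.p.obj z') (c : A.p.obj z → A.UnderlyingSpace)
    (c' : A.p.obj z' → A.UnderlyingSpace), IsPointMap z c → IsPointMap z' c' →
    (∀ x, c' (h x) = c x) → ∃! m : z ⟶ z', A.p.map m = h

end UnderlyingSpace

end CatOver

/-! ### The moduli stack of tropical curves -/

/-- The moduli stack of tropical curves over polyhedral cones. -/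
abbrev TropicalCurves (g n : ℕ) : Type 1 := Curves PC.dual g n

/-- The topological stack underlying the moduli stack of tropical curves. -/
noncomputable def topologicalMg (g n : ℕ) : CatOver :=
  (CatOver.extension (Curves.proj PC.dual g n)).stackify

/-- The forgetful morphism of topological stacks. -/
noncomputable def topologicalForget {g n : ℕ} (hgn : 2 < 2 * g + n) :
    CatOver.Hom (topologicalMg g (n + 1)) (topologicalMg g n) :=
  CatOver.stackifyMap (CatOver.extensionMap (Curves.forget PC.dual hgn) (Iso.refl _))

namespace StableCurve

variable {g n : ℕ}

/-- A tropical curve with real lengths, as an object over the cone of nonnegative real numbers. -/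
noncomputable def overRay (Γ : StableCurve g n ShpMon.nnreal) : TropicalCurves g n where
  base := PC.ray
  curve := Γ.mapLen PC.nnrealToDual fun _ => PC.nnrealToDual_eq_zero

/-- For every topological space `T` the object given by `Γ` and the constant map with value `1` from
`T` to the cone of nonnegative real numbers. -/
noncomputable def triples (Γ : StableCurve g n ShpMon.nnreal) :
    TopCat.{0} ⥤ CatOver.Triples (Curves.proj PC.dual g n) where
  obj T := ⟨T, Γ.overRay, PC.constOne T⟩
  map f := ⟨f, 𝟙 _, rfl⟩

/-- The point of the topological moduli stack corresponding to a tropical curve. -/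
noncomputable def point (Γ : StableCurve g n ShpMon.nnreal) : (topologicalMg g n).Point :=
  CatOver.stackifyPoint
    { F := Γ.triples ⋙ (CatOver.triplesIso _).Q
      w := eqToIso (congrArg (Γ.triples ⋙ ·)
        (Localization.Construction.fac (Comma.fst _ _) (fun _ _ _ h => h))) }

/-- The length of a flag as a real number. -/
noncomputable def realLen (Γ : StableCurve g n ShpMon.nnreal) (f : Γ.F) : ℝ :=
  NNReal.toReal (Γ.len f)

/-- The disjoint union of the vertices and, for every flag `f`, of the interval `[0, len f]` if `f`
belongs to an edge and of the half-line `[0, ∞)` if `f` is a leg. -/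
abbrev Pieces (Γ : StableCurve g n ShpMon.nnreal) : Type :=
  (Σ _ : Γ.V, PUnit) ⊕ (Σ f : Γ.F, {t : ℝ // 0 ≤ t ∧ (Γ.inv f ≠ f → t ≤ Γ.realLen f)})

/-- The beginning of the piece of a flag is the vertex from which the flag emanates, and the
intervals of the two flags of an edge are the same interval with the two orientations. -/
inductive Glue (Γ : StableCurve g n ShpMon.nnreal) : Γ.Pieces → Γ.Pieces → Prop
  | root (f : Γ.F) (h : 0 ≤ (0 : ℝ) ∧ (Γ.inv f ≠ f → 0 ≤ Γ.realLen f)) :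
      Glue Γ (Sum.inr ⟨f, ⟨0, h⟩⟩) (Sum.inl ⟨Γ.root f, PUnit.unit⟩)
  | flip (f : Γ.F) (hf : Γ.inv f ≠ f) (t : ℝ) (h : 0 ≤ t ∧ (Γ.inv f ≠ f → t ≤ Γ.realLen f))
      (h' : 0 ≤ Γ.realLen f - t ∧
        (Γ.inv (Γ.inv f) ≠ Γ.inv f → Γ.realLen f - t ≤ Γ.realLen (Γ.inv f))) :
      Glue Γ (Sum.inr ⟨f, ⟨t, h⟩⟩) (Sum.inr ⟨Γ.inv f, ⟨Γ.realLen f - t, h'⟩⟩)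

/-- The tropical curve `Γ` as a topological space. -/
def Realization (Γ : StableCurve g n ShpMon.nnreal) : Type := Quot Γ.Glue

instance (Γ : StableCurve g n ShpMon.nnreal) : TopologicalSpace Γ.Realization :=
  inferInstanceAs (TopologicalSpace (Quot Γ.Glue))

end StableCurve

namespace CatOver

/-! ### Cartesian morphisms and localizations with right fractions. -/

/-- Every morphism is cartesian. -/
def Cart (A : CatOver) : Prop :=
  ∀ ⦃a b c : A.E⦄ (f : b ⟶ c) (g : a ⟶ c) (k : A.p.obj a ⟶ A.p.obj b),
    k ≫ A.p.map f = A.p.map g → ∃! l : a ⟶ b, A.p.map l = k ∧ l ≫ f = g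

namespace Cart

variable {A : CatOver} (hA : A.Cart)

include hA

theorem ext {a b c : A.E} (f : b ⟶ c) {l l' : a ⟶ b} (h : A.p.map l = A.p.map l')
    (h' : l ≫ f = l' ≫ f) : l = l' :=
  (hA f (l' ≫ f) (A.p.map l') (by rw [A.p.map_comp])).unique ⟨h, h'⟩ ⟨rfl, rfl⟩

theorem exists_lift {a b c : A.E} (f : b ⟶ c) (g : a ⟶ c) (k : A.p.obj a ⟶ A.p.obj b)
    (h : k ≫ A.p.map f = A.p.map g) : ∃ l : a ⟶ b, A.p.map l = k ∧ l ≫ f = g :=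
  (hA f g k h).exists

theorem isIso {b c : A.E} (f : b ⟶ c) (hf : IsIso (A.p.map f)) : IsIso f := by
  obtain ⟨l, h1, h2⟩ := hA.exists_lift f (𝟙 c) (inv (A.p.map f)) (by simp)
  refine ⟨l, hA.ext f ?_ ?_, h2⟩
  · simp [h1]
  · simp [h2]

end Cart

/-- A functor to topological spaces all of whose morphisms become cartesian after refinement by
morphisms over isomorphisms. -/
structure Refinable {D : Type*} [Category* D] (b : D ⥤ TopCat.{0}) : Prop where
  exists_lift : ∀ {x y z : D} (f : y ⟶ z) (g : x ⟶ z) (k : b.obj x ⟶ b.obj y),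
    k ≫ b.map f = b.map g → ∃ (x' : D) (t : x' ⟶ x) (l : x' ⟶ y), IsIso (b.map t) ∧
      b.map l = b.map t ≫ k ∧ l ≫ f = t ≫ g
  ext : ∀ {x y z : D} (f : y ⟶ z) (l l' : x ⟶ y), b.map l = b.map l' → l ≫ f = l' ≫ f →
    ∃ (x' : D) (t : x' ⟶ x), IsIso (b.map t) ∧ t ≫ l = t ≫ l'

/-- The objects and morphisms of `A` come from `D` after refinement. -/
structure Presentation (A : CatOver) {D : Type*} [Category* D] (L : D ⥤ A.E) : Prop where
  surj : ∀ a : A.E, ∃ d, Nonempty (L.obj d ≅ a)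
  full : ∀ {d d' : D} (m : L.obj d ⟶ L.obj d'), ∃ (d₁ : D) (u : d₁ ⟶ d) (f : d₁ ⟶ d'),
    IsIso (L.map u) ∧ L.map u ≫ m = L.map f
  faithful : ∀ {d d' : D} (f g : d ⟶ d'), L.map f = L.map g →
    ∃ (d₁ : D) (t : d₁ ⟶ d), IsIso (L.map t) ∧ t ≫ f = t ≫ g

/-- The morphisms of `D` over isomorphisms. -/
def overIso {D : Type*} [Category* D] (b : D ⥤ TopCat.{0}) : MorphismProperty D :=
  fun _ _ f => IsIso (b.map f)

theorem overIso_isMultiplicative {D : Type*} [Category* D] (b : D ⥤ TopCat.{0}) :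
    (overIso b).IsMultiplicative where
  id_mem x := by
    unfold overIso; rw [b.map_id]; infer_instance
  comp_mem f g hf hg := by
    unfold overIso at *; rw [b.map_comp]; infer_instance

/-- The Ore condition is the lifting condition for the base map of the numerator divided by that of
the denominator. The cancellation condition is the uniqueness condition, since a denominator has an
invertible, hence cancellable, base map. -/
theorem Refinable.hasRightCalculusOfFractions {D : Type*} [Category* D] {b : D ⥤ TopCat.{0}}
    (h : Refinable b) : (overIso b).HasRightCalculusOfFractions :=
  { overIso_isMultiplicative b with
    exists_rightFraction := fun X Y φ => by
      have := φ.hs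
      unfold overIso at this
      obtain ⟨x', t, l, ht, hl, hc⟩ := h.exists_lift φ.s φ.f (b.map φ.f ≫ inv (b.map φ.s))
        (by simp)
      exact ⟨⟨t, ht, l⟩, hc.symm⟩
    ext := fun X Y Y' f₁ f₂ s hs hc => by
      unfold overIso at hs
      obtain ⟨x', t, ht, h'⟩ := h.ext s f₁ f₂ (by
        rw [← cancel_mono (b.map s), ← b.map_comp, hc, b.map_comp]) hc
      exact ⟨x', t, ht, h'⟩ }

/-- These are the standard consequences of right fractions, in the form used below: the refinement
always occurs at the source. -/
theorem Refinable.presentation {A : CatOver} {D : Type*} [Category* D] (L : D ⥤ A.E)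
    (h : Refinable (L ⋙ A.p)) [L.IsLocalization (overIso (L ⋙ A.p))] : Presentation A L := by
  have := h.hasRightCalculusOfFractions
  have hW : ∀ {x y : D} (f : x ⟶ y), overIso (L ⋙ A.p) f → IsIso (L.map f) := fun f hf =>
    Localization.inverts L (overIso (L ⋙ A.p)) f hf
  refine ⟨fun a => ?_, fun {d d'} m => ?_, fun {d d'} f g hfg => ?_⟩
  · have := Localization.essSurj L (overIso (L ⋙ A.p))
    exact ⟨L.objPreimage a, ⟨L.objObjPreimageIso a⟩⟩
  · obtain ⟨φ, rfl⟩ := Localization.exists_rightFraction L (overIso (L ⋙ A.p)) m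
    exact ⟨_, φ.s, φ.f, hW _ φ.hs, φ.map_s_comp_map _ _⟩
  · obtain ⟨x, t, ht, hc⟩ := (MorphismProperty.map_eq_iff_precomp L (overIso (L ⋙ A.p)) f g).1 hfg
    exact ⟨x, t, hW _ ht, hc⟩

/-- Morphisms of the localization are fractions. The numerators can be lifted in `D` after a
refinement, and the refinements and denominators become invertible under `L`, so that the lift can
be transported back. -/
theorem Refinable.cart {A : CatOver} {D : Type*} [Category* D] (L : D ⥤ A.E)
    (h : Refinable (L ⋙ A.p)) [L.IsLocalization (overIso (L ⋙ A.p))] : A.Cart := by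
  have P := h.presentation L
  have hW : ∀ {x y : D} (f : x ⟶ y), IsIso (A.p.map (L.map f)) → IsIso (L.map f) := fun f hf =>
    Localization.inverts L (overIso (L ⋙ A.p)) f hf
  have key : ∀ {a b c : D} (f : L.obj b ⟶ L.obj c) (g : L.obj a ⟶ L.obj c)
      (k : A.p.obj (L.obj a) ⟶ A.p.obj (L.obj b)), k ≫ A.p.map f = A.p.map g →
      ∃ l : L.obj a ⟶ L.obj b, A.p.map l = k ∧ l ≫ f = g := by
    intro a b c f g k hk
    obtain ⟨b', s, f', hs, hf'⟩ := P.full f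
    obtain ⟨a', s', g', hs', hg'⟩ := P.full g
    have ef : A.p.map (L.map s) ≫ A.p.map f = A.p.map (L.map f') := by
      rw [← A.p.map_comp, hf']
    have eg : A.p.map (L.map s') ≫ A.p.map g = A.p.map (L.map g') := by
      rw [← A.p.map_comp, hg']
    obtain ⟨x, t, l, ht, hl, hc⟩ := h.exists_lift f' g'
      (A.p.map (L.map s') ≫ k ≫ inv (A.p.map (L.map s))) (by
        change _ ≫ A.p.map (L.map f') = A.p.map (L.map g')
        rw [← ef, ← eg, ← hk]; simp)
    have := hW t ht
    change A.p.map (L.map l) = A.p.map (L.map t) ≫ _ at hl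
    refine ⟨inv (L.map s') ≫ inv (L.map t) ≫ L.map l ≫ L.map s, ?_, ?_⟩
    · simp [hl]
    · simp only [Category.assoc]
      rw [IsIso.inv_comp_eq, IsIso.inv_comp_eq, hf', hg', ← L.map_comp, ← L.map_comp, hc]
  have keyU : ∀ {a b c : D} (f : L.obj b ⟶ L.obj c) (l l' : L.obj a ⟶ L.obj b),
      A.p.map l = A.p.map l' → l ≫ f = l' ≫ f → l = l' := by
    intro a b c f l l' hl hc
    obtain ⟨b', s, f', hs, hf'⟩ := P.full f
    -- move to the source of the denominator
    suffices ∀ m m' : L.obj a ⟶ L.obj b', A.p.map m = A.p.map m' →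
        m ≫ L.map f' = m' ≫ L.map f' → m = m' by
      have := this (l ≫ inv (L.map s)) (l' ≫ inv (L.map s)) (by simp [hl])
        (by rw [← hf']; simpa using hc)
      exact (cancel_mono _).1 this
    intro m m' hm hm'
    -- Writing `m` as a fraction and then `m'`, restricted along the denominator of `m`, gives both
    -- a common denominator.
    obtain ⟨a₁, u, k, hu, hk⟩ := P.full m
    obtain ⟨a₂, u', k', hu', hk'⟩ := P.full (L.map u ≫ m')
    have hcomm : L.map ((u' ≫ k) ≫ f') = L.map (k' ≫ f') := by
      rw [L.map_comp, L.map_comp, L.map_comp, ← hk, ← hk']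
      simp [hm']
    obtain ⟨a₃, t, ht, hh⟩ := P.faithful _ _ hcomm
    obtain ⟨a₄, t', ht', hh'⟩ := h.ext f' (t ≫ u' ≫ k) (t ≫ k') (by
      change A.p.map (L.map _) = A.p.map (L.map _)
      rw [L.map_comp, L.map_comp, L.map_comp, ← hk, ← hk']
      simp [hm]) (by simpa using hh)
    have := hW t' ht'
    have e : L.map t' ≫ L.map t ≫ L.map u' ≫ L.map u ≫ m =
        L.map t' ≫ L.map t ≫ L.map u' ≫ L.map u ≫ m' := by
      rw [hk, hk', ← L.map_comp, ← L.map_comp, ← L.map_comp, hh', L.map_comp, L.map_comp]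
    simpa [cancel_epi] using e
  intro a b c f g k hk
  obtain ⟨a₀, ⟨ea⟩⟩ := P.surj a
  obtain ⟨b₀, ⟨eb⟩⟩ := P.surj b
  obtain ⟨c₀, ⟨ec⟩⟩ := P.surj c
  obtain ⟨l, h1, h2⟩ := key (eb.hom ≫ f ≫ ec.inv) (ea.hom ≫ g ≫ ec.inv)
    (A.p.map ea.hom ≫ k ≫ A.p.map eb.inv) (by
      simp only [A.p.map_comp, Category.assoc, ← hk]
      rw [← A.p.map_comp_assoc eb.inv eb.hom]; simp)
  refine ⟨ea.inv ≫ l ≫ eb.hom, ⟨?_, ?_⟩, ?_⟩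
  · simp only [A.p.map_comp, h1, Category.assoc]
    rw [← A.p.map_comp_assoc, ← A.p.map_comp]; simp
  · have := congrArg (fun x => ea.inv ≫ x ≫ ec.hom) h2
    simpa using this
  · rintro l' ⟨h1', h2'⟩
    have : ea.hom ≫ l' ≫ eb.inv = l := by
      refine keyU (eb.hom ≫ f ≫ ec.inv) _ _ ?_ ?_
      · rw [h1]; simp [h1']
      · rw [h2]; simp [reassoc_of% h2']
    rw [← this]; simp

end CatOver

namespace CatOver

/-! ### Preimages of points -/

/-- The lift in `A` is automatically compatible with the identifications with `s`: the two sides of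
the required equation lie over the same map and agree after composition with a morphism in the image
of `s`, which is cartesian in `B`. -/
theorem Preimage.cart {A B : CatOver} {F : CatOver.Hom A B} {s : B.Point} (hA : A.Cart)
    (hB : B.Cart) : (preimage F s).Cart := by
  have hF : ∀ {x y : A.E} (m : x ⟶ y), B.p.map (F.F.map m) =
      F.w.hom.app x ≫ A.p.map m ≫ F.w.inv.app y := fun {x y} m => by
    rw [← Category.assoc]
    exact (Iso.eq_comp_inv (F.w.app y)).2 (F.w.hom.naturality m)
  have hs : ∀ {X Y : TopCat.{0}} (m : X ⟶ Y), B.p.map (s.F.map m) =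
      s.w.hom.app X ≫ m ≫ s.w.inv.app Y := fun {X Y} m => by
    rw [← Category.assoc]
    exact (Iso.eq_comp_inv (s.w.app Y)).2 (s.w.hom.naturality m)
  have hi : ∀ z : Preimage F s, B.p.map z.iso.hom =
      F.w.hom.app z.obj ≫ s.w.inv.app (A.p.obj z.obj) := fun z =>
    (Iso.eq_comp_inv (s.w.app _)).2 z.iso_over
  have main : ∀ (a b : Preimage F s) (l : a.obj ⟶ b.obj), B.p.map (F.F.map l ≫ b.iso.hom) =
      B.p.map (a.iso.hom ≫ s.F.map (A.p.map l)) := by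
    intro a b l
    rw [B.p.map_comp, B.p.map_comp, hF, hs, hi, hi]
    simp only [Category.assoc]
    congr 1
    rw [← Category.assoc (F.w.inv.app _), Iso.inv_hom_id_app, ← Category.assoc (s.w.inv.app _),
      Iso.inv_hom_id_app]
    exact congrArg _ (Category.id_comp _) |>.trans (Category.id_comp _).symm
  intro a b c f g k hk
  obtain ⟨l, ⟨h1, h2⟩, hu⟩ := hA f.hom g.hom k hk
  refine ⟨⟨l, ?_⟩, ⟨h1, Preimage.Hom.ext h2⟩, fun l' hl' =>
    Preimage.Hom.ext (hu l'.hom ⟨hl'.1, congrArg Preimage.Hom.hom hl'.2⟩)⟩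
  refine hB.ext (s.F.map (A.p.map f.hom)) ?_ ?_
  · exact main a b l
  · have e1 := f.comm
    have e2 := g.comm
    simp only [Category.assoc]
    rw [← e1, ← F.F.map_comp_assoc, h2, e2, ← s.F.map_comp, h1]
    congr 2
    exact hk.symm

/-! ### Objects and morphisms of the preimage, represented before localization. -/

section Strict

variable {A B : CatOver} {F : CatOver.Hom A B} {s : B.Point}
  {D : Type*} [Category* D] {D' : Type*} [Category* D'] {L : D ⥤ A.E} {L' : D' ⥤ B.E}
  {FD : D ⥤ D'} {sD : TopCat.{0} ⥤ D'} (α : L ⋙ F.F ≅ FD ⋙ L') (β : sD ⋙ L' ≅ s.F)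

/-- The morphism in `B` that a morphism `μ` of the presenting category gives. -/
def strictHom (d : D) (μ : FD.obj d ⟶ sD.obj (A.p.obj (L.obj d))) :
    F.F.obj (L.obj d) ⟶ s.F.obj (A.p.obj (L.obj d)) :=
  α.hom.app d ≫ L'.map μ ≫ β.hom.app _

/-- `μ` lies over the identity. -/
def StrictOver (d : D) (μ : FD.obj d ⟶ sD.obj (A.p.obj (L.obj d))) : Prop :=
  B.p.map (strictHom α β d μ) ≫ s.w.hom.app (A.p.obj (L.obj d)) = F.w.hom.app (L.obj d)

variable {α β}

theorem strictHom_naturality {d d' : D} {μ : FD.obj d ⟶ sD.obj (A.p.obj (L.obj d))}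
    {μ' : FD.obj d' ⟶ sD.obj (A.p.obj (L.obj d'))} (f : d ⟶ d')
    (h : FD.map f ≫ μ' = μ ≫ sD.map (A.p.map (L.map f))) :
    F.F.map (L.map f) ≫ strictHom α β d' μ' =
      strictHom α β d μ ≫ s.F.map (A.p.map (L.map f)) := by
  have h1 := α.hom.naturality f
  have h2 := β.hom.naturality (A.p.map (L.map f))
  simp only [Functor.comp_map] at h1 h2
  unfold strictHom
  rw [← Category.assoc, h1]
  simp only [Category.assoc]
  rw [← h2, ← L'.map_comp_assoc, ← L'.map_comp_assoc, h]

theorem StrictOver.isIso (hB : B.Cart) {d : D} {μ : FD.obj d ⟶ sD.obj (A.p.obj (L.obj d))}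
    (h : StrictOver α β d μ) : IsIso (strictHom α β d μ) := by
  refine hB.isIso _ ?_
  have : B.p.map (strictHom α β d μ) = F.w.hom.app (L.obj d) ≫ inv (s.w.hom.app _) := by
    rw [← h]; simp
  rw [this]; infer_instance

/-- The object of the preimage given by a morphism of the presenting category. -/
noncomputable def ofStrict (hB : B.Cart) (d : D) (μ : FD.obj d ⟶ sD.obj (A.p.obj (L.obj d)))
    (h : StrictOver α β d μ) : Preimage F s where
  obj := L.obj d
  iso := haveI := h.isIso hB; asIso (strictHom α β d μ)
  iso_over := h

/-- A compatible morphism of the presenting category gives a morphism in the preimage. -/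
noncomputable def ofStrictMap (hB : B.Cart) {d d' : D} {μ : FD.obj d ⟶ sD.obj (A.p.obj (L.obj d))}
    {μ' : FD.obj d' ⟶ sD.obj (A.p.obj (L.obj d'))} (h : StrictOver α β d μ)
    (h' : StrictOver α β d' μ') (f : d ⟶ d')
    (hf : FD.map f ≫ μ' = μ ≫ sD.map (A.p.map (L.map f))) :
    ofStrict hB d μ h ⟶ ofStrict hB d' μ' h' :=
  ⟨L.map f, strictHom_naturality f hf⟩

/-- Strictness survives refinement, because refinements have invertible base maps that can be
cancelled. -/
theorem StrictOver.of_map {d d' : D} {μ : FD.obj d ⟶ sD.obj (A.p.obj (L.obj d))}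
    {μ' : FD.obj d' ⟶ sD.obj (A.p.obj (L.obj d'))} (f : d ⟶ d')
    (hf : FD.map f ≫ μ' = μ ≫ sD.map (A.p.map (L.map f))) (h' : StrictOver α β d' μ')
    (hi : IsIso (A.p.map (L.map f))) : StrictOver α β d μ := by
  have h1 := strictHom_naturality (α := α) (β := β) f hf
  have h2 := s.w.hom.naturality (A.p.map (L.map f))
  have h3 := F.w.hom.naturality (L.map f)
  simp only [Functor.comp_map, Functor.id_map] at h2 h3
  unfold StrictOver at *
  rw [← cancel_mono (A.p.map (L.map f)), Category.assoc]
  change _ ≫ s.w.hom.app (A.p.obj (L.obj d)) ≫ A.p.map (L.map f) = _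
  rw [← h2, ← B.p.map_comp_assoc, ← h1, B.p.map_comp, Category.assoc, h', h3]

/-- The data needed to describe the preimage in terms of the presenting categories. -/
structure StrictData (α : L ⋙ F.F ≅ FD ⋙ L') (β : sD ⋙ L' ≅ s.F) : Prop where
  cartA : A.Cart
  cartB : B.Cart
  presA : Presentation A L
  presB : Presentation B L'
  refine_map : ∀ (d : D) (e : D') (t : e ⟶ FD.obj d), IsIso (L'.map t) →
    ∃ (d' : D) (u : d' ⟶ d) (v : FD.obj d' ⟶ e), IsIso (L.map u) ∧ v ≫ t = FD.map u

namespace StrictData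

variable (S : StrictData α β)

include S

/-- The identification of an object with `s` is a morphism of the localization `B.E`, hence comes
from `D'` after a refinement in `D'`. By `refine_map` this refinement is dominated by one that comes
from `D`, so that the object itself can be refined accordingly. -/
theorem exists_strict (Z : Preimage F s) : ∃ (d : D)
    (μ : FD.obj d ⟶ sD.obj (A.p.obj (L.obj d))) (_ : StrictOver α β d μ)
    (e : L.obj d ⟶ Z.obj), IsIso e ∧
      F.F.map e ≫ Z.iso.hom = strictHom α β d μ ≫ s.F.map (A.p.map e) := by
  obtain ⟨a, i, hi⟩ := Z
  obtain ⟨d, ⟨ε⟩⟩ := S.presA.surj a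
  obtain ⟨e, u, ν, hu, hν⟩ := S.presB.full
    (α.inv.app d ≫ F.F.map ε.hom ≫ i.hom ≫ s.F.map (A.p.map ε.inv) ≫ β.inv.app (A.p.obj (L.obj d)))
  obtain ⟨d', u', v, hu', hv⟩ := S.refine_map d e u hu
  -- The target of `ν` belongs to the base of `d`; the inverse of the base map of `u'` moves it to
  -- the base of `d'`.
  let μ : FD.obj d' ⟶ sD.obj (A.p.obj (L.obj d')) :=
    v ≫ ν ≫ sD.map (inv (A.p.map (L.map u')))
  have key : strictHom α β d' μ = F.F.map (L.map u') ≫ F.F.map ε.hom ≫ i.hom ≫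
      s.F.map (A.p.map ε.inv) ≫ s.F.map (inv (A.p.map (L.map u'))) := by
    have h1 := α.hom.naturality u'
    have h2 := β.hom.naturality (inv (A.p.map (L.map u')))
    simp only [Functor.comp_map] at h1 h2
    simp only [strictHom, μ, L'.map_comp, Category.assoc]
    rw [h2, ← reassoc_of% hν, ← L'.map_comp_assoc, hv, ← reassoc_of% h1]
    simp
  have hcomm : F.F.map (L.map u' ≫ ε.hom) ≫ i.hom =
      strictHom α β d' μ ≫ s.F.map (A.p.map (L.map u' ≫ ε.hom)) := by
    rw [key]
    simp only [F.F.map_comp, Category.assoc]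
    rw [← s.F.map_comp, ← s.F.map_comp]
    have : A.p.map ε.inv ≫ inv (A.p.map (L.map u')) ≫ A.p.map (L.map u' ≫ ε.hom) = 𝟙 _ := by
      rw [A.p.map_comp, IsIso.inv_hom_id_assoc, ← A.p.map_comp, ε.inv_hom_id, A.p.map_id]
    rw [this, s.F.map_id, Category.comp_id]
  have hover : StrictOver α β d' μ := by
    have h2 := s.w.hom.naturality (A.p.map (L.map u' ≫ ε.hom))
    have h3 := F.w.hom.naturality (L.map u' ≫ ε.hom)
    simp only [Functor.comp_map, Functor.id_map] at h2 h3
    unfold StrictOver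
    rw [← cancel_mono (A.p.map (L.map u' ≫ ε.hom)), Category.assoc]
    change _ ≫ s.w.hom.app (A.p.obj (L.obj d')) ≫ A.p.map _ = _
    rw [← h2, ← B.p.map_comp_assoc, ← hcomm, B.p.map_comp, Category.assoc, hi, h3]
  exact ⟨d', μ, hover, L.map u' ≫ ε.hom, inferInstance, hcomm⟩

/-- A morphism between strict objects is a fraction of morphisms of `D`, but its compatibility with
`μ₁` and `μ₂` is known only after applying `L'`. One further refinement, provided by `faithful` and
brought back to `D` by `refine_map`, makes it hold in `D'`. -/
theorem exists_roof {d₁ d₂ : D} {μ₁ : FD.obj d₁ ⟶ sD.obj (A.p.obj (L.obj d₁))}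
    {μ₂ : FD.obj d₂ ⟶ sD.obj (A.p.obj (L.obj d₂))} (h₁ : StrictOver α β d₁ μ₁)
    (m : L.obj d₁ ⟶ L.obj d₂)
    (hc : F.F.map m ≫ strictHom α β d₂ μ₂ = strictHom α β d₁ μ₁ ≫ s.F.map (A.p.map m)) :
    ∃ (d₃ : D) (μ₃ : FD.obj d₃ ⟶ sD.obj (A.p.obj (L.obj d₃))) (_ : StrictOver α β d₃ μ₃)
      (u : d₃ ⟶ d₁) (f : d₃ ⟶ d₂), IsIso (L.map u) ∧ L.map u ≫ m = L.map f ∧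
      FD.map u ≫ μ₁ = μ₃ ≫ sD.map (A.p.map (L.map u)) ∧
      FD.map f ≫ μ₂ = μ₃ ≫ sD.map (A.p.map (L.map f)) := by
  obtain ⟨d, u, f, hu, hf⟩ := S.presA.full m
  have e : L'.map (FD.map f ≫ μ₂) =
      L'.map (FD.map u ≫ μ₁ ≫ sD.map (inv (A.p.map (L.map u))) ≫ sD.map (A.p.map (L.map f))) := by
    have h1 := α.hom.naturality f
    have h1' := α.hom.naturality u
    have h2 := β.hom.naturality (A.p.map m)
    simp only [Functor.comp_map] at h1 h1' h2
    have e1 : inv (A.p.map (L.map u)) ≫ A.p.map (L.map f) = A.p.map m := by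
      rw [← hf, A.p.map_comp]; simp
    rw [← sD.map_comp, e1, ← cancel_epi (α.hom.app d), ← cancel_mono (β.hom.app _)]
    simp only [L'.map_comp, Category.assoc]
    rw [h2, ← reassoc_of% h1, ← reassoc_of% h1', ← hf, F.F.map_comp, Category.assoc]
    congr 1
    simpa [strictHom] using hc
  obtain ⟨e₀, t, ht, hh⟩ := S.presB.faithful _ _ e
  obtain ⟨d₃, w, v, hw, hv⟩ := S.refine_map d e₀ t ht
  have hh' : FD.map w ≫ FD.map f ≫ μ₂ = FD.map w ≫
      FD.map u ≫ μ₁ ≫ sD.map (inv (A.p.map (L.map u))) ≫ sD.map (A.p.map (L.map f)) := by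
    rw [← hv, Category.assoc, hh, Category.assoc]
  have hwi : IsIso (L.map (w ≫ u)) := by rw [L.map_comp]; infer_instance
  have hwu : FD.map (w ≫ u) ≫ μ₁ = (FD.map (w ≫ u) ≫ μ₁ ≫ sD.map (inv (A.p.map (L.map (w ≫ u)))))
      ≫ sD.map (A.p.map (L.map (w ≫ u))) := by
    simp only [Category.assoc]
    rw [← sD.map_comp, IsIso.inv_hom_id, sD.map_id, Category.comp_id]
  refine ⟨d₃, _, ?_, w ≫ u, w ≫ f, hwi,
    by rw [L.map_comp, L.map_comp, Category.assoc, hf], hwu, ?_⟩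
  · exact StrictOver.of_map (w ≫ u) hwu h₁ inferInstance
  · have e2 : inv (A.p.map (L.map (w ≫ u))) ≫ A.p.map (L.map (w ≫ f)) =
        inv (A.p.map (L.map u)) ≫ A.p.map (L.map f) := by
      rw [IsIso.inv_comp_eq]
      simp
    simp only [FD.map_comp, Category.assoc, hh']
    rw [← sD.map_comp, ← sD.map_comp, e2]

/-- Functorial continuous maps on the objects given by the presenting category extend to the whole
preimage. -/
theorem exists_map {R : Type*} [TopologicalSpace R]
    (φ : ∀ (d : D) (μ : FD.obj d ⟶ sD.obj (A.p.obj (L.obj d))), StrictOver α β d μ →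
      C(A.p.obj (L.obj d), R))
    (hφ : ∀ {d d' : D} {μ : FD.obj d ⟶ sD.obj (A.p.obj (L.obj d))}
      {μ' : FD.obj d' ⟶ sD.obj (A.p.obj (L.obj d'))} (h : StrictOver α β d μ)
      (h' : StrictOver α β d' μ') (f : d ⟶ d'),
      FD.map f ≫ μ' = μ ≫ sD.map (A.p.map (L.map f)) →
      ∀ x, φ d' μ' h' (A.p.map (L.map f) x) = φ d μ h x) :
    ∃ Φ : ∀ Z : Preimage F s, C(A.p.obj Z.obj, R),
      (∀ {Z Z' : Preimage F s} (m : Z ⟶ Z') (x), Φ Z' (A.p.map m.hom x) = Φ Z x) ∧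
      ∀ (d : D) (μ : FD.obj d ⟶ sD.obj (A.p.obj (L.obj d))) (h : StrictOver α β d μ) (x),
        Φ (ofStrict S.cartB d μ h) x = φ d μ h x := by
  choose d μ h e he hec using S.exists_strict
  -- Both legs of a roof are compatible morphisms of `D`, and the base map of the denominator is
  -- bijective, so invariance extends from `D` to all morphisms between strict objects.
  have hmap : ∀ {d₁ d₂ : D} {μ₁ : FD.obj d₁ ⟶ sD.obj (A.p.obj (L.obj d₁))}
      {μ₂ : FD.obj d₂ ⟶ sD.obj (A.p.obj (L.obj d₂))} (h₁ : StrictOver α β d₁ μ₁)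
      (h₂ : StrictOver α β d₂ μ₂) (m : L.obj d₁ ⟶ L.obj d₂)
      (_ : F.F.map m ≫ strictHom α β d₂ μ₂ = strictHom α β d₁ μ₁ ≫ s.F.map (A.p.map m)) (x),
      φ d₂ μ₂ h₂ (A.p.map m x) = φ d₁ μ₁ h₁ x := by
    intro d₁ d₂ μ₁ μ₂ h₁ h₂ m hc x
    obtain ⟨d₃, μ₃, h₃, u, f, hu, hm, c1, c2⟩ := S.exists_roof h₁ m hc
    have hx : x = A.p.map (L.map u) (inv (A.p.map (L.map u)) x) := by
      rw [← TopCat.comp_app]; simp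
    generalize inv (A.p.map (L.map u)) x = y at hx
    subst hx
    rw [hφ h₃ h₁ u c1]
    have : A.p.map m (A.p.map (L.map u) y) = A.p.map (L.map f) y := by
      rw [← hm, A.p.map_comp]; rfl
    exact (congrArg _ this).trans (hφ h₃ h₂ f c2 y)
  have key : ∀ Z (x : A.p.obj Z.obj), A.p.map (e Z) (A.p.map (inv (e Z)) x) = x := by
    intro Z x
    rw [← TopCat.comp_app, ← A.p.map_comp]; simp
  refine ⟨fun Z => (φ _ _ (h Z)).comp (TopCat.Hom.hom (A.p.map (inv (e Z)))), ?_, ?_⟩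
  · intro Z Z' m x
    have hc : F.F.map (e Z ≫ m.hom ≫ inv (e Z')) ≫ strictHom α β (d Z') (μ Z') =
        strictHom α β (d Z) (μ Z) ≫ s.F.map (A.p.map (e Z ≫ m.hom ≫ inv (e Z'))) := by
      rw [← cancel_mono (s.F.map (A.p.map (e Z'))), Category.assoc, ← hec Z', ← F.F.map_comp_assoc]
      simp only [Category.assoc, IsIso.inv_hom_id, Category.comp_id]
      rw [← s.F.map_comp, ← A.p.map_comp]
      simp only [Category.assoc, IsIso.inv_hom_id, Category.comp_id]
      rw [F.F.map_comp, Category.assoc, m.comm, reassoc_of% (hec Z), A.p.map_comp, s.F.map_comp]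
    have := hmap (h Z) (h Z') _ hc (A.p.map (inv (e Z)) x)
    refine Eq.trans (congrArg (φ _ _ (h Z')) ?_) this
    change (A.p.map m.hom ≫ A.p.map (inv (e Z'))) x = (A.p.map (inv (e Z)) ≫ A.p.map _) x
    rw [← A.p.map_comp, ← A.p.map_comp]
    simp
  · intro d₀ μ₀ h₀ x
    have := hmap (h _) h₀ (e (ofStrict S.cartB d₀ μ₀ h₀)) (hec (ofStrict S.cartB d₀ μ₀ h₀))
      (A.p.map (inv (e _)) x)
    exact this.symm.trans (congrArg _ (key (ofStrict S.cartB d₀ μ₀ h₀) x))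

/-- Uniqueness of morphisms over a given map can be checked on the presenting category. -/
theorem hom_unique
    (hu : ∀ {d d' : D} {μ : FD.obj d ⟶ sD.obj (A.p.obj (L.obj d))}
      {μ' : FD.obj d' ⟶ sD.obj (A.p.obj (L.obj d'))}, StrictOver α β d μ →
      StrictOver α β d' μ' → ∀ f f' : d ⟶ d',
      FD.map f ≫ μ' = μ ≫ sD.map (A.p.map (L.map f)) →
      FD.map f' ≫ μ' = μ ≫ sD.map (A.p.map (L.map f')) →
      A.p.map (L.map f) = A.p.map (L.map f') →
      ∃ (d₀ : D) (t : d₀ ⟶ d), IsIso (L.map t) ∧ t ≫ f = t ≫ f')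
    {Z Z' : Preimage F s} (m m' : Z ⟶ Z') (hm : A.p.map m.hom = A.p.map m'.hom) : m = m' := by
  obtain ⟨d₁, μ₁, h₁, e₁, he₁, hec₁⟩ := S.exists_strict Z
  obtain ⟨d₂, μ₂, h₂, e₂, he₂, hec₂⟩ := S.exists_strict Z'
  have conj : ∀ m : Z ⟶ Z', F.F.map (e₁ ≫ m.hom ≫ inv e₂) ≫ strictHom α β d₂ μ₂ =
      strictHom α β d₁ μ₁ ≫ s.F.map (A.p.map (e₁ ≫ m.hom ≫ inv e₂)) := by
    intro m
    rw [← cancel_mono (s.F.map (A.p.map e₂)), Category.assoc, ← hec₂, ← F.F.map_comp_assoc]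
    simp only [Category.assoc, IsIso.inv_hom_id, Category.comp_id]
    rw [← s.F.map_comp, ← A.p.map_comp]
    simp only [Category.assoc, IsIso.inv_hom_id, Category.comp_id]
    rw [F.F.map_comp, Category.assoc, m.comm, reassoc_of% hec₁, A.p.map_comp, s.F.map_comp]
  have c := conj m
  have c' := conj m'
  have hn : A.p.map (e₁ ≫ m.hom ≫ inv e₂) = A.p.map (e₁ ≫ m'.hom ≫ inv e₂) := by
    simp only [Functor.map_comp, hm]
  refine Preimage.Hom.ext ?_
  suffices e₁ ≫ m.hom ≫ inv e₂ = e₁ ≫ m'.hom ≫ inv e₂ by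
    rwa [cancel_epi, cancel_mono] at this
  generalize e₁ ≫ m.hom ≫ inv e₂ = n at c hn
  generalize e₁ ≫ m'.hom ≫ inv e₂ = n' at c' hn
  -- Two roofs in succession write `n` and `n'` as fractions with the common denominator `u' ≫ u`.
  obtain ⟨d₃, μ₃, h₃, u, f, hu3, hf, c1, c2⟩ := S.exists_roof h₁ n c
  obtain ⟨d₄, μ₄, h₄, u', f', hu4, hf', c1', c2'⟩ := S.exists_roof h₃ (L.map u ≫ n') (by
    rw [F.F.map_comp, Category.assoc, c', reassoc_of% (strictHom_naturality u c1), A.p.map_comp,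
      s.F.map_comp])
  have hC2 : FD.map (u' ≫ f) ≫ μ₂ = μ₄ ≫ sD.map (A.p.map (L.map (u' ≫ f))) := by
    simp only [Functor.map_comp, Category.assoc]
    rw [c2, reassoc_of% c1']
  obtain ⟨d₀, t, ht, hh⟩ := hu h₄ h₂ (u' ≫ f) f' hC2 c2' (by
    rw [L.map_comp, ← hf, ← hf', A.p.map_comp, A.p.map_comp, A.p.map_comp, A.p.map_comp, hn])
  have : L.map t ≫ L.map u' ≫ L.map u ≫ n = L.map t ≫ L.map u' ≫ L.map u ≫ n' := by
    rw [hf, hf', ← L.map_comp, ← L.map_comp, hh, L.map_comp]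
  rwa [cancel_epi, cancel_epi, cancel_epi] at this

end StrictData

end Strict

end CatOver

/-! ### Descent data and the plus construction as a localization with right fractions. -/

namespace CatOver

theorem mem_grothendieckTopology_iff {X : TopCat.{0}} (R : Sieve X) :
    R ∈ TopCat.grothendieckTopology X ↔ ∀ x : X, ∃ (U : TopCat.{0}) (j : U ⟶ X),
      R j ∧ Topology.IsOpenEmbedding j ∧ x ∈ Set.range j := by
  rw [Precoverage.mem_toGrothendieck_iff_of_isStableUnderComposition]
  constructor
  · rintro ⟨S, ⟨hS, hS'⟩, hle⟩ x
    obtain ⟨U, j, hj, hx⟩ := (Presieve.mem_comap_jointlySurjectivePrecoverage_iff _).1 hS x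
    exact ⟨U, j, hle _ _ hj, hS' hj, hx⟩
  · intro h
    refine ⟨fun U j => R j ∧ Topology.IsOpenEmbedding j, ⟨?_, fun U j hj => hj.2⟩,
      fun U j hj => hj.1⟩
    refine (Presieve.mem_comap_jointlySurjectivePrecoverage_iff _).2 fun x => ?_
    obtain ⟨U, j, h1, h2, h3⟩ := h x
    exact ⟨U, j, ⟨h1, h2⟩, h3⟩

namespace Descent

variable {A : CatOver}

/-- Restriction of a descent datum to a smaller covering sieve. -/
abbrev restrict (D : A.Descent) (R : Sieve D.X) (hR : R ∈ TopCat.grothendieckTopology D.X)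
    (h : ∀ {T : TopCat.{0}} (i : T ⟶ D.X), R i → D.R i) : A.Descent where
  X := D.X
  R := R
  covering := hR
  obj i hi := D.obj i (h i hi)
  baseIso i hi := D.baseIso i (h i hi)
  map u i i' hi hi' := D.map u i i' (h i hi) (h i' hi')
  map_over u i i' hi hi' := D.map_over u i i' (h i hi) (h i' hi')
  map_id i hi := D.map_id i (h i hi)
  map_comp u u' i i' i'' hi hi' hi'' := D.map_comp u u' i i' i'' (h i hi) (h i' hi') (h i'' hi'')

def restrictHom (D : A.Descent) (R : Sieve D.X) (hR : R ∈ TopCat.grothendieckTopology D.X)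
    (h : ∀ {T : TopCat.{0}} (i : T ⟶ D.X), R i → D.R i) : D.restrict R hR h ⟶ D where
  f := 𝟙 D.X
  le i hi := (Category.comp_id (X := _) (Y := D.X) i).symm ▸ h i hi
  app {T} i j hi hj w := D.map (𝟙 T) i j (h i hi) hj
    ((Category.id_comp j).trans (w.symm.trans (Category.comp_id i)))
  app_over i j hi hj w := by
    refine (D.map_over _ _ _ _ _ _).trans (Category.comp_id _)
  naturality {T T'} u i i' j j' hi hi' hj hj' w w' v v' := by
    obtain rfl : i = j := (Category.comp_id i).symm.trans w
    obtain rfl : i' = j' := (Category.comp_id i').symm.trans w'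
    refine (D.map_comp u (𝟙 _) i i' i' _ _ hj' v _ (by rw [Category.comp_id, v'])).symm.trans
      (Eq.trans ?_ (D.map_comp (𝟙 _) u i i i' _ hj hj' _ _ (by rw [Category.id_comp, v'])))
    congr 1

/-- Pulling back a descent datum along a continuous map. -/
abbrev pull (D : A.Descent) {X : TopCat.{0}} (f : X ⟶ D.X) (R : Sieve X)
    (hR : R ∈ TopCat.grothendieckTopology X)
    (h : ∀ {T : TopCat.{0}} (i : T ⟶ X), R i → D.R (i ≫ f)) : A.Descent where
  X := X
  R := R
  covering := hR
  obj i hi := D.obj (i ≫ f) (h i hi)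
  baseIso i hi := D.baseIso (i ≫ f) (h i hi)
  map u i i' hi hi' w := D.map u (i ≫ f) (i' ≫ f) (h i hi) (h i' hi') (by rw [← w]; simp)
  map_over u i i' hi hi' _ := D.map_over u (i ≫ f) (i' ≫ f) (h i hi) (h i' hi') _
  map_id i hi _ := D.map_id (i ≫ f) (h i hi) _
  map_comp u u' i i' i'' hi hi' hi'' _ _ _ :=
    D.map_comp u u' (i ≫ f) (i' ≫ f) (i'' ≫ f) (h i hi) (h i' hi') (h i'' hi'') _ _ _

def pullHom (D : A.Descent) {X : TopCat.{0}} (f : X ⟶ D.X) (R : Sieve X)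
    (hR : R ∈ TopCat.grothendieckTopology X)
    (h : ∀ {T : TopCat.{0}} (i : T ⟶ X), R i → D.R (i ≫ f)) : D.pull f R hR h ⟶ D where
  f := f
  le := h
  app {T} i j hi hj w := D.map (𝟙 T) (i ≫ f) j (h i hi) hj ((Category.id_comp j).trans w.symm)
  app_over i j hi hj w := (D.map_over _ _ _ _ _ _).trans (Category.comp_id _)
  naturality {T T'} u i i' j j' hi hi' hj hj' w w' v v' := by
    have e : u ≫ j' = i ≫ f := v'.trans w.symm
    refine (D.map_comp u (𝟙 _) (i ≫ f) (i' ≫ f) j' _ _ hj' _ _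
      (by rw [Category.comp_id, e])).symm.trans (Eq.trans ?_
        (D.map_comp (𝟙 _) u (i ≫ f) j j' _ hj hj' _ _ (by rw [Category.id_comp, e])))
    congr 1

theorem Hom.congr_app {D D' : A.Descent} {a b : D ⟶ D'} (h : a = b) {T : TopCat.{0}}
    (i : T ⟶ D.X) (j : T ⟶ D'.X) (hi : D.R i) (hj : D'.R j) (w : i ≫ a.f = j)
    (w' : i ≫ b.f = j) : a.app i j hi hj w = b.app i j hi hj w' := by
  subst h; rfl

/-- The components lie over the isomorphism between the two copies of `T`, and cartesian morphisms
over isomorphisms are invertible. This is what allows division by components of morphisms of descent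
data. -/
theorem Hom.isIso_app (hA : A.Cart) {D D' : A.Descent} (a : D ⟶ D') {T : TopCat.{0}}
    (i : T ⟶ D.X) (j : T ⟶ D'.X) (hi : D.R i) (hj : D'.R j) (w : i ≫ a.f = j) :
    IsIso (a.app i j hi hj w) := by
  refine hA.isIso _ ?_
  have : A.p.map (a.app i j hi hj w) = (D.baseIso i hi).hom ≫ (D'.baseIso j hj).inv := by
    rw [← a.app_over i j hi hj w]; simp
  rw [this]; infer_instance

theorem comp_app {D D' D'' : A.Descent} (a : D ⟶ D') (b : D' ⟶ D'') {T : TopCat.{0}}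
    (i : T ⟶ D.X) (j : T ⟶ D'.X) (k : T ⟶ D''.X) (hi : D.R i) (hj : D'.R j) (hk : D''.R k)
    (w : i ≫ a.f = j) (w' : j ≫ b.f = k) (w'' : i ≫ (a ≫ b).f = k) :
    (a ≫ b).app i k hi hk w'' = a.app i j hi hj w ≫ b.app j k hj hk w' := by
  subst w
  rfl

theorem comp_f {D D' D'' : A.Descent} (a : D ⟶ D') (b : D' ⟶ D'') : (a ≫ b).f = a.f ≫ b.f := rfl

end Descent

/-- The lift is a component of `g` followed by the inverse of a component of `f`. This makes sense
for those `i` in the sieve of `x` whose composite with `k` lies in the sieve of `y`; hence the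
refinement to the intersection of these two covering sieves. Uniqueness needs no refinement, since
components of `f` can be cancelled. -/
theorem refinable_descent {A : CatOver} (hA : A.Cart) : Refinable (descentBase A) where
  exists_lift {x y z} f g k hk := by
    change k ≫ f.f = g.f at hk
    change x.X ⟶ y.X at k
    let R : Sieve x.X := x.R ⊓ y.R.pullback k
    have hR : R ∈ TopCat.grothendieckTopology x.X :=
      (TopCat.grothendieckTopology).intersection_covering x.covering
        ((TopCat.grothendieckTopology).pullback_stable k y.covering)
    have hf := fun {T : TopCat.{0}} (i : T ⟶ y.X) (j : T ⟶ z.X) hi hj w =>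
      Descent.Hom.isIso_app hA f i j hi hj w
    have hz : ∀ {T : TopCat.{0}} (i : T ⟶ x.X) (j : T ⟶ y.X), i ≫ k = j → i ≫ g.f = j ≫ f.f := by
      intro T i j w; rw [← hk, ← w]; exact (Category.assoc _ _ _).symm
    let l : x.restrict R hR (fun i hi => hi.1) ⟶ y :=
      { f := k
        le := fun i hi => hi.2
        app := fun {T} i j hi hj w =>
          g.app i (j ≫ f.f) hi.1 (Descent.Hom.le f j hj) (hz i j w) ≫
            (haveI := hf j (j ≫ f.f) hj (Descent.Hom.le f j hj) rfl; inv (f.app j (j ≫ f.f) hj (Descent.Hom.le f j hj) rfl))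
        app_over := fun {T} i j hi hj w => by
          have := hf j (j ≫ f.f) hj (Descent.Hom.le f j hj) rfl
          rw [← f.app_over j (j ≫ f.f) hj (Descent.Hom.le f j hj) rfl, ← Category.assoc,
            ← A.p.map_comp, Category.assoc, IsIso.inv_hom_id, Category.comp_id]
          exact g.app_over _ _ _ _ _
        naturality := fun {T T'} u i i' j j' hi hi' hj hj' w w' v v' => by
          have := hf j (j ≫ f.f) hj (Descent.Hom.le f j hj) rfl
          have := hf j' (j' ≫ f.f) hj' (Descent.Hom.le f j' hj') rfl
          have v'' : u ≫ j' ≫ f.f = j ≫ f.f := by rw [← v', Category.assoc]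
          have n1 := g.naturality u i i' (j ≫ f.f) (j' ≫ f.f) hi.1 hi'.1 (Descent.Hom.le f j hj) (Descent.Hom.le f j' hj')
            (hz i j w) (hz i' j' w') v v''
          have n2 := f.naturality u j j' (j ≫ f.f) (j' ≫ f.f) hj hj' (Descent.Hom.le f j hj) (Descent.Hom.le f j' hj')
            rfl rfl v' v''
          rw [← cancel_mono (f.app j' (j' ≫ f.f) hj' (Descent.Hom.le f j' hj') rfl)]
          simp only [Category.assoc, IsIso.inv_hom_id, Category.comp_id]
          rw [n2, IsIso.inv_hom_id_assoc]
          exact n1 }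
    refine ⟨_, x.restrictHom R hR (fun i hi => hi.1), l, ?_, ?_, ?_⟩
    · change IsIso (𝟙 _); infer_instance
    · exact (Category.id_comp _).symm
    · refine Descent.Hom.ext' (by rw [Descent.comp_f, Descent.comp_f]
                                  exact hk.trans (Category.id_comp _).symm) ?_
      intro T i m hi hm w w'
      have hi' : x.R i ∧ y.R (i ≫ k) := hi
      have e : i ≫ g.f = m := by rw [← w]; exact hz i (i ≫ k) rfl
      subst e
      have e2 : (i ≫ k) ≫ f.f = i ≫ g.f := (hz i (i ≫ k) rfl).symm
      rw [Descent.comp_app l f i (i ≫ k) (i ≫ g.f) hi hi'.2 hm rfl e2,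
        Descent.comp_app _ g i i (i ≫ g.f) hi hi'.1 hm (Category.comp_id _) rfl]
      have a1 : (x.restrictHom R hR (fun i hi => hi.1)).app i i hi hi'.1 (Category.comp_id _) = 𝟙 _ :=
        x.map_id i hi'.1 _
      rw [a1]
      change (g.app i _ _ _ _ ≫ inv _) ≫ _ = 𝟙 (x.obj i hi'.1) ≫ _
      rw [Category.id_comp]
      have := hf (i ≫ k) ((i ≫ k) ≫ f.f) hi'.2 (Descent.Hom.le f _ hi'.2) rfl
      -- The two maps to `z.X` are equal but not by definition, and the components depend on them;
      -- with both generalized, one can be substituted for the other.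
      have key : ∀ (m m' : T ⟶ z.X) (hm : z.R m) (hm' : z.R m') (e : m = m') (w1 w2 w3 w4)
          [IsIso (f.app (i ≫ k) m hi'.2 hm w1)],
          (g.app i m hi'.1 hm w3 ≫ inv (f.app (i ≫ k) m hi'.2 hm w1)) ≫
            f.app (i ≫ k) m' hi'.2 hm' w2 = g.app i m' hi'.1 hm' w4 := by
        intro m m' hm hm' e w1 w2 w3 w4 _
        subst e
        simp
      exact key _ _ _ _ e2 _ _ _ _
  ext {x y z} f l l' hl hc := by
    refine ⟨x, 𝟙 x, by rw [CategoryTheory.Functor.map_id]; infer_instance, ?_⟩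
    rw [Category.id_comp, Category.id_comp]
    refine Descent.Hom.ext' hl fun {T} i j hi hj w w' => ?_
    have := Descent.Hom.isIso_app hA f j (j ≫ f.f) hj (Descent.Hom.le f j hj) rfl
    rw [← cancel_mono (f.app j (j ≫ f.f) hj (Descent.Hom.le f j hj) rfl)]
    have w2 : i ≫ (l ≫ f).f = j ≫ f.f := by rw [Descent.comp_f, ← w, Category.assoc]
    have w3 : i ≫ (l' ≫ f).f = j ≫ f.f := by rw [Descent.comp_f, ← w', Category.assoc]
    rw [← Descent.comp_app l f i j _ hi hj (Descent.Hom.le f j hj) w rfl w2,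
      ← Descent.comp_app l' f i j _ hi hj (Descent.Hom.le f j hj) w' rfl w3]
    exact Descent.Hom.congr_app hc _ _ _ _ _ _

/-- The functor from descent data to the plus construction. -/
noncomputable def plusQ (A : CatOver) : A.Descent ⥤ A.plus.E :=
  (descentIso A).Q

instance plusQ_isLocalization (A : CatOver) : (plusQ A).IsLocalization
    (overIso (plusQ A ⋙ A.plus.p)) :=
  inferInstanceAs ((descentIso A).Q.IsLocalization (descentIso A))

theorem cart_plus {A : CatOver} (hA : A.Cart) : A.plus.Cart :=
  Refinable.cart (A := A.plus) (plusQ A) (refinable_descent hA)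

theorem presentation_plus {A : CatOver} (hA : A.Cart) :
    Presentation A.plus (plusQ A) :=
  Refinable.presentation (A := A.plus) (plusQ A) (refinable_descent hA)

noncomputable def plusComm {A B : CatOver} (F : CatOver.Hom A B) :
    plusQ A ⋙ (plusMap F).F ≅ descentMap F ⋙ plusQ B :=
  NatIso.ofComponents (fun D => Iso.refl ((plusQ B).obj ((descentMap F).obj D))) (fun _ =>
    (Category.comp_id _).trans (Category.id_comp _).symm)

theorem isIso_plusQ_map_iff {A : CatOver} {D D' : A.Descent} (f : D ⟶ D') :
    IsIso ((plusQ A).map f) ↔ IsIso f.f := by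
  constructor
  · intro h
    exact A.plus.p.map_isIso ((plusQ A).map f)
  · intro h
    exact Localization.inverts (plusQ A) (overIso (plusQ A ⋙ A.plus.p)) f h

theorem over_inv {B : CatOver} {a b : B.E} {X : TopCat.{0}} (f : a ⟶ b) (hf : IsIso f)
    {x : B.p.obj a ⟶ X} {y : B.p.obj b ⟶ X} (h : B.p.map f ≫ y = x) :
    B.p.map (@inv _ _ _ _ f hf) ≫ x = y := by
  rw [← h, ← B.p.map_comp_assoc]; simp

theorem comp_inv_eq_of_comp_eq {C : Type*} [Category* C] {a b c d : C} (f : a ⟶ b) (f' : c ⟶ d)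
    (k : a ⟶ c) (l : b ⟶ d) (hf : IsIso f) (hf' : IsIso f') (h : k ≫ f' = f ≫ l) :
    l ≫ @inv _ _ _ _ f' hf' = @inv _ _ _ _ f hf ≫ k := by
  rw [IsIso.comp_inv_eq, Category.assoc, h, IsIso.inv_hom_id_assoc]

/-- For `refine_map`, a refinement `t` of the image of a descent datum `d` is dominated by the image
of the pullback of `d` along the base map of `t`, taken on the sieve of `e`. The comparison `v`
consists of the inverses of the components of `t`. -/
theorem strictData_plus {A B : CatOver} {F : CatOver.Hom A B} {s : B.Point} (hA : A.Cart)
    (hB : B.Cart) : StrictData (F := plusMap F) (s := plusPoint s) (plusComm F)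
      (Iso.refl (descentPoint s ⋙ plusQ B)) where
  cartA := cart_plus hA
  cartB := cart_plus hB
  presA := presentation_plus hA
  presB := presentation_plus hB
  refine_map d e t ht := by
    rw [isIso_plusQ_map_iff] at ht
    have hle : ∀ {T : TopCat.{0}} (i : T ⟶ e.X), e.R i → d.R (i ≫ t.f) := fun i hi => Descent.Hom.le t i hi
    have hI := fun {T : TopCat.{0}} (i : T ⟶ e.X) (j : T ⟶ d.X) hi hj w =>
      Descent.Hom.isIso_app hB t i j hi hj w
    have hid : ∀ {T : TopCat.{0}} {i j : T ⟶ e.X}, i ≫ 𝟙 e.X = j → i = j := fun w =>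
      (Category.comp_id _).symm.trans w
    have hI' : ∀ {T : TopCat.{0}} (i j : T ⟶ e.X) (hi : e.R i) (hj : e.R j) (h : i = j),
        IsIso (t.app j (i ≫ t.f) hj (hle i hi) (congrArg (· ≫ t.f) h.symm)) :=
      fun i j hi hj h => hI _ _ _ _ _
    let v : (descentMap F).obj (d.pull t.f e.R e.covering hle) ⟶ e :=
      { f := 𝟙 e.X
        le := fun {T} i hi => (Category.comp_id (X := T) (Y := e.X) i).symm ▸ hi
        app := fun {T} i j hi hj w =>
          @inv _ _ _ _ _ (hI' i j hi hj (hid w))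
        app_over := fun {T} i j hi hj w => by
          obtain rfl := hid w
          exact over_inv _ (hI i (i ≫ t.f) hj (hle i hi) rfl)
            (t.app_over i (i ≫ t.f) hj (hle i hi) rfl)
        naturality := fun {T T'} u i i' j j' hi hi' hj hj' w w' v v' => by
          obtain rfl := hid w
          obtain rfl := hid w'
          have n := t.naturality u i i' (i ≫ t.f) (i' ≫ t.f) hj hj' (hle i hi) (hle i' hi') rfl rfl
            v ((Category.assoc u i' t.f).symm.trans (congrArg (· ≫ t.f) v))
          exact comp_inv_eq_of_comp_eq _ _ _ _ (hI i (i ≫ t.f) hj (hle i hi) rfl)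
            (hI i' (i' ≫ t.f) hj' (hle i' hi') rfl) n }
    refine ⟨_, d.pullHom t.f e.R e.covering hle, v, ?_, ?_⟩
    · exact (isIso_plusQ_map_iff _).2 ht
    · refine Descent.Hom.ext' (Category.id_comp _) fun {T} i m hi hm w w' => ?_
      have e1 : i ≫ t.f = m := w'
      subst e1
      rw [Descent.comp_app v t i i (i ≫ t.f) hi hi hm (Category.comp_id _) rfl]
      have := hI i (i ≫ t.f) hi (hle i hi) rfl
      change _ = F.F.map (d.map (𝟙 T) (i ≫ t.f) (i ≫ t.f) (hle i hi) (hle i hi) _)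
      rw [d.map_id, F.F.map_id]
      exact @IsIso.inv_hom_id _ _ _ _ _ this

end CatOver

/-! ### Pullback of objects, classifiers, and components of strict objects. -/

namespace CatOver

/-- Objects can be pulled back along continuous maps. -/
def Fibered (A : CatOver) : Prop :=
  ∀ (a : A.E) {T : TopCat.{0}} (t : T ⟶ A.p.obj a),
    ∃ (a' : A.E) (m : a' ⟶ a) (e : A.p.obj a' ≅ T), A.p.map m = e.hom ≫ t

/-- After pulling back in `A`, the identification with `s` is found by lifting the given one through
the cartesian morphism of `B` that `s` assigns to the base map. The lift lies over an isomorphism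
and is therefore invertible. -/
theorem Preimage.fibered {A B : CatOver} {F : CatOver.Hom A B} {s : B.Point} (hA : A.Fibered)
    (hB : B.Cart) : (preimage F s).Fibered := by
  intro Z T t
  obtain ⟨a', m, e, hm⟩ := hA Z.obj t
  have h1 := F.w.hom.naturality m
  have h2 := s.w.hom.naturality (A.p.map m)
  simp only [Functor.comp_map, Functor.id_map] at h1 h2
  have h0 : (F.w.hom.app a' ≫ s.w.inv.app (A.p.obj a')) ≫ B.p.map (s.F.map (A.p.map m)) =
      B.p.map (F.F.map m ≫ Z.iso.hom) := by
    rw [← cancel_mono (s.w.hom.app (A.p.obj Z.obj)), B.p.map_comp, Category.assoc, Category.assoc,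
      Category.assoc, Z.iso_over, h1]
    exact congrArg (F.w.hom.app a' ≫ ·) ((congrArg (_ ≫ ·) h2).trans
      (Iso.inv_hom_id_app_assoc s.w (A.p.obj a') (A.p.map m)))
  obtain ⟨l, hl, hl'⟩ := hB.exists_lift _ _ _ h0
  have : IsIso l := hB.isIso l (by rw [hl]; infer_instance)
  have h3 : B.p.map l ≫ s.w.hom.app (A.p.obj a') = F.w.hom.app a' := by
    rw [hl, Category.assoc, Iso.inv_hom_id_app]; exact Category.comp_id _
  exact ⟨⟨a', asIso l, h3⟩, ⟨m, hl'.symm⟩, e, hm⟩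

/-- A description of the preimage of a point, up to local existence of morphisms, as the space `R`,
which is covered by the spaces `K i`. -/
structure Classifier {A B : CatOver} (F : CatOver.Hom A B) (s : B.Point) {R : Type}
    [TopologicalSpace R] {I : Type} {K : I → TopCat.{0}} (κ : ∀ i, C(K i, R)) where
  cartA : A.Cart
  cartB : B.Cart
  fibA : A.Fibered
  map : ∀ Z : Preimage F s, C(A.p.obj Z.obj, R)
  map_hom : ∀ {Z Z' : Preimage F s} (m : Z ⟶ Z') (x), map Z' (A.p.map m.hom x) = map Z x
  unique : ∀ {Z Z' : Preimage F s} (m m' : Z ⟶ Z'), A.p.map m.hom = A.p.map m'.hom → m = m'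
  locally : ∀ {Z Z' : Preimage F s} (h : A.p.obj Z.obj ⟶ A.p.obj Z'.obj),
    (∀ x, map Z' (h x) = map Z x) → ∀ x, ∃ (W : Preimage F s) (m : W ⟶ Z) (m' : W ⟶ Z'),
      Topology.IsOpenEmbedding (A.p.map m.hom) ∧ x ∈ Set.range (A.p.map m.hom) ∧
      A.p.map m'.hom = A.p.map m.hom ≫ h
  sect : ∀ i, ∃ (Z : Preimage F s) (e : A.p.obj Z.obj ≅ K i), ∀ x, map Z x = κ i (e.hom x)

/-- Compatible maps lift to morphisms. -/
def Classifier.Full {A B : CatOver} {F : CatOver.Hom A B} {s : B.Point} {R : Type}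
    [TopologicalSpace R] {I : Type} {K : I → TopCat.{0}} {κ : ∀ i, C(K i, R)}
    (C : Classifier F s κ) : Prop :=
  ∀ {Z Z' : Preimage F s} (h : A.p.obj Z.obj ⟶ A.p.obj Z'.obj),
    (∀ x, C.map Z' (h x) = C.map Z x) → ∃ m : Z ⟶ Z', A.p.map m.hom = h

theorem fibered_plus {A : CatOver} (hA : A.Cart) : A.plus.Fibered := by
  intro a T t
  obtain ⟨D, ⟨ε⟩⟩ := (presentation_plus hA).surj a
  let f : T ⟶ D.X := t ≫ A.plus.p.map ε.inv
  let R : Sieve T := D.R.pullback f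
  have hR : R ∈ TopCat.grothendieckTopology T :=
    (TopCat.grothendieckTopology).pullback_stable f D.covering
  refine ⟨(plusQ A).obj (D.pull f R hR fun i hi => hi),
    (plusQ A).map (D.pullHom f R hR fun i hi => hi) ≫ ε.hom, Iso.refl _, ?_⟩
  rw [A.plus.p.map_comp]
  change (t ≫ A.plus.p.map ε.inv) ≫ A.plus.p.map ε.hom = 𝟙 T ≫ t
  rw [Category.assoc, ← A.plus.p.map_comp, ε.inv_hom_id, A.plus.p.map_id, Category.id_comp]
  exact Category.comp_id _

section Plus

variable {A B : CatOver} {F : CatOver.Hom A B} {s : B.Point}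

/-- All comparison isomorphisms involved come from equalities of functors whose values agree by
definition, so their components are identities and the condition reduces to the base map of `μ`. -/
theorem strictOver_plus_iff (D : A.Descent) (μ : (descentMap F).obj D ⟶ (descentPoint s).obj D.X) :
    StrictOver (F := plusMap F) (s := plusPoint s) (plusComm F)
      (Iso.refl (descentPoint s ⋙ plusQ B)) D μ ↔ μ.f = 𝟙 D.X := by
  have e1 : (plusPoint s).w.hom.app D.X = 𝟙 D.X :=
    (eqToHom_app (congrArg (descentPoint s ⋙ ·)
      (Localization.Construction.fac (descentBase B) (fun _ _ _ h => h))) D.X).trans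
      (eqToHom_refl D.X rfl)
  have e2 : (plusMap F).w.hom.app ((plusQ A).obj D) = 𝟙 D.X :=
    (eqToHom_app (lift_comp_lift (descentIso A) (descentIso B) (descentMap F) (descentBase A)
      (descentBase B) rfl _ _ _) ((plusQ A).obj D)).trans (eqToHom_refl D.X rfl)
  have e3 : B.plus.p.map (strictHom (F := plusMap F) (s := plusPoint s) (plusComm F)
      (Iso.refl (descentPoint s ⋙ plusQ B)) D μ) = μ.f := by
    have : strictHom (F := plusMap F) (s := plusPoint s) (plusComm F)
      (Iso.refl (descentPoint s ⋙ plusQ B)) D μ = (plusQ B).map μ :=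
      (Category.id_comp _).trans (Category.comp_id _)
    rw [this]; rfl
  unfold StrictOver
  constructor
  · intro h
    exact e3.symm.trans ((Category.comp_id _).symm.trans
      ((congrArg (_ ≫ ·) e1).symm.trans (h.trans e2)))
  · intro h
    exact (congrArg (_ ≫ ·) e1).trans ((Category.comp_id _).trans (e3.trans (h.trans e2.symm)))

theorem comp_f_eq {D : A.Descent} {μ : (descentMap F).obj D ⟶ (descentPoint s).obj D.X}
    (hμ : μ.f = 𝟙 D.X) {T : TopCat.{0}} (i : T ⟶ D.X) : i ≫ μ.f = i := by
  rw [hμ]; exact Category.comp_id _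

/-- The isomorphism of the image of a component with the constant family. -/
def pointApp {D : A.Descent} {μ : (descentMap F).obj D ⟶ (descentPoint s).obj D.X}
    (hμ : μ.f = 𝟙 D.X) {T : TopCat.{0}} (i : T ⟶ D.X) (hi : D.R i) :
    F.F.obj (D.obj i hi) ⟶ s.F.obj T :=
  μ.app i i hi trivial (comp_f_eq hμ i)

theorem isIso_pointApp (hB : B.Cart) {D : A.Descent}
    {μ : (descentMap F).obj D ⟶ (descentPoint s).obj D.X} (hμ : μ.f = 𝟙 D.X) {T : TopCat.{0}}
    (i : T ⟶ D.X) (hi : D.R i) : IsIso (pointApp hμ i hi) :=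
  Descent.Hom.isIso_app hB μ _ _ _ _ _

theorem pointApp_over {D : A.Descent} {μ : (descentMap F).obj D ⟶ (descentPoint s).obj D.X}
    (hμ : μ.f = 𝟙 D.X) {T : TopCat.{0}} (i : T ⟶ D.X) (hi : D.R i) :
    B.p.map (pointApp hμ i hi) ≫ s.w.hom.app T =
      F.w.hom.app (D.obj i hi) ≫ (D.baseIso i hi).hom :=
  μ.app_over i i hi trivial (comp_f_eq hμ i)

theorem pointApp_naturality {D : A.Descent}
    {μ : (descentMap F).obj D ⟶ (descentPoint s).obj D.X} (hμ : μ.f = 𝟙 D.X)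
    {T T' : TopCat.{0}} (u : T ⟶ T') (i : T ⟶ D.X) (hi : D.R i) (i' : T' ⟶ D.X) (hi' : D.R i')
    (w : u ≫ i' = i) :
    F.F.map (D.map u i i' hi hi' w) ≫ pointApp hμ i' hi' = pointApp hμ i hi ≫ s.F.map u :=
  μ.naturality u i i' i i' hi hi' trivial trivial (comp_f_eq hμ i) (comp_f_eq hμ i') w w

/-- Compatibility with the identifications, read off component by component; `map_comp_point_eq` is
the converse. -/
theorem map_app_pointApp {D D' : A.Descent}
    {μ : (descentMap F).obj D ⟶ (descentPoint s).obj D.X} (hμ : μ.f = 𝟙 D.X)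
    {μ' : (descentMap F).obj D' ⟶ (descentPoint s).obj D'.X} (hμ' : μ'.f = 𝟙 D'.X)
    (f : D ⟶ D') (hf : (descentMap F).map f ≫ μ' = μ ≫ (descentPoint s).map f.f)
    {T : TopCat.{0}} (i : T ⟶ D.X) (hi : D.R i) (j : T ⟶ D'.X) (hj : D'.R j) (w : i ≫ f.f = j) :
    F.F.map (f.app i j hi hj w) ≫ pointApp hμ' j hj = pointApp hμ i hi := by
  have e1 := Descent.comp_app ((descentMap F).map f) μ' i j j hi hj trivial w (comp_f_eq hμ' j)
    ((Category.assoc _ _ _).symm.trans ((congrArg (· ≫ μ'.f) w).trans (comp_f_eq hμ' j)))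
  have e2 := Descent.comp_app μ ((descentPoint s).map f.f) i i j hi trivial trivial
    (comp_f_eq hμ i) w
    ((Category.assoc _ _ _).symm.trans ((congrArg (· ≫ f.f) (comp_f_eq hμ i)).trans w))
  exact e1.symm.trans ((Descent.Hom.congr_app hf _ _ _ _ _ _).trans
    (e2.trans (Category.comp_id _)))

theorem map_comp_point_eq {D D' : A.Descent}
    {μ : (descentMap F).obj D ⟶ (descentPoint s).obj D.X} (hμ : μ.f = 𝟙 D.X)
    {μ' : (descentMap F).obj D' ⟶ (descentPoint s).obj D'.X} (hμ' : μ'.f = 𝟙 D'.X)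
    (f : D ⟶ D') (hf : ∀ {T : TopCat.{0}} (i : T ⟶ D.X) (hi : D.R i) (j : T ⟶ D'.X) (hj : D'.R j)
      (w : i ≫ f.f = j), F.F.map (f.app i j hi hj w) ≫ pointApp hμ' j hj = pointApp hμ i hi) :
    (descentMap F).map f ≫ μ' = μ ≫ (descentPoint s).map f.f := by
  refine Descent.Hom.ext' ?_ ?_
  · have e1 : ((descentMap F).map f ≫ μ').f = f.f := comp_f_eq hμ' f.f
    have e2 : (μ ≫ (descentPoint s).map f.f).f = f.f :=
      (congrArg (· ≫ f.f) hμ).trans (Category.id_comp f.f)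
    exact e1.trans e2.symm
  · intro T i j hi hj w w'
    have w0 : i ≫ f.f = j := (comp_f_eq hμ' (i ≫ f.f)).symm.trans ((Category.assoc _ _ _).trans w)
    subst w0
    have e1 := Descent.comp_app ((descentMap F).map f) μ' i (i ≫ f.f) (i ≫ f.f) hi
      (Descent.Hom.le f i hi) trivial rfl (comp_f_eq hμ' (i ≫ f.f)) w
    have e2 := Descent.comp_app μ ((descentPoint s).map f.f) i i (i ≫ f.f) hi trivial trivial
      (comp_f_eq hμ i) rfl w'
    exact e1.trans ((hf i hi _ (Descent.Hom.le f i hi) rfl).trans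
      ((Category.comp_id _).symm.trans e2.symm))

/-- The component of a strict object of the plus construction. -/
noncomputable def component (hB : B.Cart) {D : A.Descent}
    {μ : (descentMap F).obj D ⟶ (descentPoint s).obj D.X} (hμ : μ.f = 𝟙 D.X)
    {T : TopCat.{0}} (i : T ⟶ D.X) (hi : D.R i) : Preimage F s where
  obj := D.obj i hi
  iso := @asIso _ _ _ _ (pointApp hμ i hi) (isIso_pointApp hB hμ i hi) ≪≫
    s.F.mapIso (D.baseIso i hi).symm
  iso_over := by
    have h := pointApp_over hμ i hi
    have h2 := s.w.hom.naturality (D.baseIso i hi).inv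
    simp only [Functor.comp_map, Functor.id_map] at h2
    change B.p.map (pointApp hμ i hi ≫ s.F.map (D.baseIso i hi).inv) ≫ _ = _
    rw [B.p.map_comp, Category.assoc, h2, reassoc_of% h, Iso.hom_inv_id]
    exact Category.comp_id _

/-- The morphism between components given by a morphism of strict objects. -/
noncomputable def componentApp (hB : B.Cart) {D D' : A.Descent}
    {μ : (descentMap F).obj D ⟶ (descentPoint s).obj D.X} (hμ : μ.f = 𝟙 D.X)
    {μ' : (descentMap F).obj D' ⟶ (descentPoint s).obj D'.X} (hμ' : μ'.f = 𝟙 D'.X)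
    (f : D ⟶ D') (hf : (descentMap F).map f ≫ μ' = μ ≫ (descentPoint s).map f.f)
    {T : TopCat.{0}} (i : T ⟶ D.X) (hi : D.R i) (j : T ⟶ D'.X) (hj : D'.R j) (w : i ≫ f.f = j) :
    component hB hμ i hi ⟶ component hB hμ' j hj where
  hom := f.app i j hi hj w
  comm := by
    change F.F.map (f.app i j hi hj w) ≫ pointApp hμ' j hj ≫
      s.F.map (D'.baseIso j hj).inv = (pointApp hμ i hi ≫
      s.F.map (D.baseIso i hi).inv) ≫ s.F.map (A.p.map (f.app i j hi hj w))
    have h2 : (D'.baseIso j hj).inv = (D.baseIso i hi).inv ≫ A.p.map (f.app i j hi hj w) := by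
      rw [Iso.eq_inv_comp, Iso.comp_inv_eq, f.app_over]
    rw [← Category.assoc, map_app_pointApp hμ hμ' f hf, h2, s.F.map_comp, Category.assoc]

/-- The restriction morphisms between the components of a strict object. -/
noncomputable def componentMap (hB : B.Cart) {D : A.Descent}
    {μ : (descentMap F).obj D ⟶ (descentPoint s).obj D.X} (hμ : μ.f = 𝟙 D.X)
    {T T' : TopCat.{0}} (u : T ⟶ T') (i : T ⟶ D.X) (hi : D.R i) (i' : T' ⟶ D.X) (hi' : D.R i')
    (w : u ≫ i' = i) : component hB hμ i hi ⟶ component hB hμ i' hi' where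
  hom := D.map u i i' hi hi' w
  comm := by
    change F.F.map (D.map u i i' hi hi' w) ≫ pointApp hμ i' hi' ≫
      s.F.map (D.baseIso i' hi').inv = (pointApp hμ i hi ≫
      s.F.map (D.baseIso i hi).inv) ≫ s.F.map (A.p.map (D.map u i i' hi hi' w))
    have h2 : u ≫ (D.baseIso i' hi').inv =
        (D.baseIso i hi).inv ≫ A.p.map (D.map u i i' hi hi' w) := by
      rw [Iso.eq_inv_comp, ← Category.assoc, Iso.comp_inv_eq, D.map_over]
    rw [← Category.assoc, pointApp_naturality, Category.assoc, Category.assoc, ← s.F.map_comp,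
      ← s.F.map_comp, h2]

end Plus

end CatOver

namespace CatOver

variable {A B : CatOver} {F : CatOver.Hom A B} {s : B.Point}

theorem Preimage.p_hom_comp {Z Z' Z'' : Preimage F s} (m : Z ⟶ Z') (m' : Z' ⟶ Z'') :
    A.p.map (m ≫ m').hom = A.p.map m.hom ≫ A.p.map m'.hom :=
  A.p.map_comp _ _

theorem Preimage.p_hom_id (Z : Preimage F s) : A.p.map (𝟙 Z : Z ⟶ Z).hom = 𝟙 (A.p.obj Z.obj) :=
  A.p.map_id _

theorem Preimage.exists_lift (hA : A.Cart) (hB : B.Cart) {Z Z' Z'' : Preimage F s} (f : Z' ⟶ Z'')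
    (g : Z ⟶ Z'') (k : A.p.obj Z.obj ⟶ A.p.obj Z'.obj) (h : k ≫ A.p.map f.hom = A.p.map g.hom) :
    ∃ l : Z ⟶ Z', A.p.map l.hom = k ∧ l ≫ f = g :=
  (Preimage.cart (F := F) (s := s) hA hB).exists_lift f g k h

theorem conj_conj {C : Type*} [Category* C] {X Y X' Y' : C} {a : X ⟶ Y} {a' : Y ⟶ X}
    {b : X' ⟶ Y'} {b' : Y' ⟶ X'} (ha : a' ≫ a = 𝟙 Y) (hb : b' ≫ b = 𝟙 Y') (h : Y ⟶ Y') :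
    a' ≫ (a ≫ h ≫ b') ≫ b = h := by
  simp only [Category.assoc, hb, reassoc_of% ha, Category.comp_id]

namespace StrictData

variable {D : Type*} [Category* D] {D' : Type*} [Category* D']
    {L : D ⥤ A.E} {L' : D' ⥤ B.E} {FD : D ⥤ D'} {sD : TopCat.{0} ⥤ D'}
    {α : L ⋙ F.F ≅ FD ⋙ L'} {β : sD ⋙ L' ≅ s.F} (S : StrictData α β)

include S

theorem exists_ofStrict (Z : Preimage F s) :
    ∃ (d : D) (μ : FD.obj d ⟶ sD.obj (A.p.obj (L.obj d))) (h : StrictOver α β d μ),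
      Nonempty (ofStrict S.cartB d μ h ≅ Z) := by
  obtain ⟨d, μ, h, e, he, hc⟩ := S.exists_strict Z
  let m : ofStrict S.cartB d μ h ⟶ Z := ⟨e, hc⟩
  have : IsIso m := by
    refine (Preimage.cart S.cartA S.cartB).isIso (A := preimage F s) m ?_
    change IsIso (A.p.map e)
    infer_instance
  exact ⟨d, μ, h, ⟨asIso m⟩⟩

/-- Lifting of compatible maps can be checked on strict objects. -/
theorem full_of_strict {R : Type*} [TopologicalSpace R]
    {Φ : ∀ Z : Preimage F s, C(A.p.obj Z.obj, R)}
    (hΦ : ∀ {Z Z' : Preimage F s} (m : Z ⟶ Z') (x), Φ Z' (A.p.map m.hom x) = Φ Z x)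
    (full : ∀ {d d' : D} {μ : FD.obj d ⟶ sD.obj (A.p.obj (L.obj d))}
      {μ' : FD.obj d' ⟶ sD.obj (A.p.obj (L.obj d'))} (h : StrictOver α β d μ)
      (h' : StrictOver α β d' μ') (k : A.p.obj (L.obj d) ⟶ A.p.obj (L.obj d')),
      (∀ x, Φ (ofStrict S.cartB d' μ' h') (k x) = Φ (ofStrict S.cartB d μ h) x) →
      ∃ m : ofStrict S.cartB d μ h ⟶ ofStrict S.cartB d' μ' h', A.p.map m.hom = k)
    {Z Z' : Preimage F s} (h : A.p.obj Z.obj ⟶ A.p.obj Z'.obj)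
    (hh : ∀ x, Φ Z' (h x) = Φ Z x) : ∃ m : Z ⟶ Z', A.p.map m.hom = h := by
  obtain ⟨d, μ, hμ, ⟨e⟩⟩ := S.exists_ofStrict Z
  obtain ⟨d', μ', hμ', ⟨e'⟩⟩ := S.exists_ofStrict Z'
  obtain ⟨m, hm⟩ := full hμ hμ' (A.p.map e.hom.hom ≫ h ≫ A.p.map e'.inv.hom) (fun x => by
    exact Eq.trans (hΦ e'.inv (h (A.p.map e.hom.hom x))) ((hh _).trans (hΦ e.hom x)))
  refine ⟨e.inv ≫ m ≫ e'.hom, ?_⟩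
  have a1 : A.p.map e.inv.hom ≫ A.p.map e.hom.hom = 𝟙 _ := by
    rw [← Preimage.p_hom_comp, e.inv_hom_id, Preimage.p_hom_id]
  have a2 : A.p.map e'.inv.hom ≫ A.p.map e'.hom.hom = 𝟙 _ := by
    rw [← Preimage.p_hom_comp, e'.inv_hom_id, Preimage.p_hom_id]
  refine (Preimage.p_hom_comp _ _).trans ((congrArg (_ ≫ ·)
    ((Preimage.p_hom_comp m e'.hom).trans (congrArg (· ≫ _) hm))).trans ?_)
  exact conj_conj a1 a2 h

end StrictData

theorem comp_inv_hom_comp {C : Type*} [Category* C] {X Y Z W : C} (a : X ⟶ Y) (e : Z ≅ Y)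
    (b : Y ⟶ W) : (a ≫ e.inv) ≫ e.hom ≫ b = a ≫ b := by simp

/-! ### Gluing the classifying maps of the components of a descent datum. -/

section Plus

theorem Descent.p_map (D : A.Descent) {T T' : TopCat.{0}} (u : T ⟶ T') (i : T ⟶ D.X)
    (hi : D.R i) (i' : T' ⟶ D.X) (hi' : D.R i') (w : u ≫ i' = i) :
    A.p.map (D.map u i i' hi hi' w) = (D.baseIso i hi).hom ≫ u ≫ (D.baseIso i' hi').inv := by
  rw [← Category.assoc, Iso.eq_comp_inv, D.map_over]

theorem Descent.Hom.p_app {D D' : A.Descent} (f : D ⟶ D') {T : TopCat.{0}} (i : T ⟶ D.X)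
    (hi : D.R i) (j : T ⟶ D'.X) (hj : D'.R j) (w : i ≫ f.f = j) :
    A.p.map (f.app i j hi hj w) = (D.baseIso i hi).hom ≫ (D'.baseIso j hj).inv := by
  rw [Iso.eq_comp_inv, f.app_over]

/-- The morphism from the one-point space with a given value. -/
def pt {X : TopCat.{0}} (x : X) : TopCat.of PUnit.{1} ⟶ X :=
  TopCat.ofHom (ContinuousMap.const _ x)

theorem pt_comp {X Y : TopCat.{0}} (f : X ⟶ Y) (x : X) : pt x ≫ f = pt (f x) := rfl

/-- The inclusion of the point factors through an open member of the covering around it. Every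
descent datum therefore has a component at each point, which allows the glued map to be defined
pointwise. -/
theorem exists_const_mem (D : A.Descent) (x : D.X) : D.R (pt x) := by
  obtain ⟨U, j, hj, -, u, rfl⟩ := (mem_grothendieckTopology_iff D.R).1 D.covering x
  exact D.R.downward_closed hj (pt u)

variable {D : A.Descent} {μ : (descentMap F).obj D ⟶ (descentPoint s).obj D.X}

/-- The morphism in `A` underlying a morphism between components. -/
def componentHom {hB : B.Cart} {D' : A.Descent}
    {μ' : (descentMap F).obj D' ⟶ (descentPoint s).obj D'.X}
    {hμ : μ.f = 𝟙 D.X} {hμ' : μ'.f = 𝟙 D'.X} {T T' : TopCat.{0}} {i : T ⟶ D.X} {hi : D.R i}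
    {j : T' ⟶ D'.X} {hj : D'.R j} (m : component hB hμ i hi ⟶ component hB hμ' j hj) :
    D.obj i hi ⟶ D'.obj j hj := m.hom

/-- Morphisms between components can be restricted. -/
theorem exists_componentHom_restrict (hA : A.Cart) {hB : B.Cart} {D' : A.Descent}
    {μ' : (descentMap F).obj D' ⟶ (descentPoint s).obj D'.X}
    {hμ : μ.f = 𝟙 D.X} {hμ' : μ'.f = 𝟙 D'.X} {T T' : TopCat.{0}} {i : T ⟶ D.X} {hi : D.R i}
    {j : T ⟶ D'.X} {hj : D'.R j} (u : T' ⟶ T) (W : Preimage F s)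
    (m : W ⟶ component hB hμ i hi) (m' : W ⟶ component hB hμ' j hj) (e : A.p.obj W.obj ≅ T')
    (hm : A.p.map m.hom = e.hom ≫ u ≫ (D.baseIso i hi).inv)
    (hm' : A.p.map m'.hom = e.hom ≫ u ≫ (D'.baseIso j hj).inv) {i' : T' ⟶ D.X} (hi' : D.R i')
    {j' : T' ⟶ D'.X} (hj' : D'.R j') (w : u ≫ i = i') (w' : u ≫ j = j') :
    ∃ l : component hB hμ i' hi' ⟶ component hB hμ' j' hj',
      A.p.map (componentHom l) = (D.baseIso i' hi').hom ≫ (D'.baseIso j' hj').inv := by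
  have cart := Preimage.cart (F := F) (s := s) hA hB
  obtain ⟨l, hl, -⟩ := cart.exists_lift (A := preimage F s) m
    (componentMap hB hμ u i' hi' i hi w) ((D.baseIso i' hi').hom ≫ e.inv) (by
      refine Eq.trans ?_ (D.p_map u i' hi' i hi w).symm
      exact (congrArg (_ ≫ ·) hm).trans (comp_inv_hom_comp _ _ _))
  obtain ⟨l', hl', -⟩ := cart.exists_lift (A := preimage F s)
    (componentMap hB hμ' u j' hj' j hj w') (l ≫ m')
    ((D.baseIso i' hi').hom ≫ (D'.baseIso j' hj').inv) (by
      refine (congrArg (_ ≫ ·) (D'.p_map u j' hj' j hj w')).trans ?_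
      refine Eq.trans ?_ (((preimage F s).p.map_comp l m').trans
        ((congrArg (· ≫ _) hl).trans (congrArg (_ ≫ ·) hm'))).symm
      exact (comp_inv_hom_comp _ _ _).trans (comp_inv_hom_comp _ _ _).symm)
  exact ⟨l', hl'⟩

namespace Classifier

variable {R : Type} [TopologicalSpace R] {I : Type} {K : I → TopCat.{0}} {κ : ∀ i, C(K i, R)}
  (C : Classifier F s κ)

/-- The map of a strict object of the plus construction to the classifying space. -/
noncomputable def glued (hμ : μ.f = 𝟙 D.X) (x : D.X) : R :=
  C.map (component C.cartB hμ _ (exists_const_mem D x)) ((D.baseIso _ _).inv PUnit.unit)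

/-- The restriction morphism from the component at the point `i t` to the component at `i`
transports classifying maps, so the pointwise definition agrees with the classifying maps of all
components. -/
theorem map_component (hμ : μ.f = 𝟙 D.X) {T : TopCat.{0}} (i : T ⟶ D.X) (hi : D.R i) (t : T) :
    C.map (component C.cartB hμ i hi) ((D.baseIso i hi).inv t) = C.glued hμ (i t) := by
  have h := C.map_hom (componentMap C.cartB hμ (pt t) _ (exists_const_mem D (i t)) i hi rfl)
    ((D.baseIso _ (exists_const_mem D (i t))).inv PUnit.unit)
  refine Eq.trans (congrArg _ ?_) h
  have h2 : pt t ≫ (D.baseIso i hi).inv = (D.baseIso _ (exists_const_mem D (i t))).inv ≫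
      A.p.map (D.map (pt t) _ i _ hi (pt_comp i t)) :=
    Eq.trans (by simp) (congrArg (_ ≫ ·) (D.p_map (pt t) _ _ i hi (pt_comp i t)).symm)
  exact congrArg (fun f : TopCat.of PUnit.{1} ⟶ _ => f PUnit.unit) h2

theorem map_component' (hμ : μ.f = 𝟙 D.X) {T : TopCat.{0}} (i : T ⟶ D.X) (hi : D.R i)
    (y : A.p.obj (D.obj i hi)) :
    C.map (component C.cartB hμ i hi) y = C.glued hμ (i ((D.baseIso i hi).hom y)) := by
  rw [← C.map_component hμ i hi]
  congr 1
  exact (congrArg (fun f : A.p.obj (D.obj i hi) ⟶ _ => f y) (D.baseIso i hi).hom_inv_id).symm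

/-- Continuity is local, and on an open member of the sieve the glued map is the classifying map of
a component. -/
theorem continuous_glued (hμ : μ.f = 𝟙 D.X) : Continuous (C.glued hμ) := by
  refine continuous_iff_continuousAt.2 fun x => ?_
  obtain ⟨U, j, hj, ho, u, rfl⟩ := (mem_grothendieckTopology_iff D.R).1 D.covering x
  rw [← ho.continuousAt_iff]
  have : C.glued hμ ∘ j = C.map (component C.cartB hμ j hj) ∘ (D.baseIso j hj).inv :=
    funext fun t => (C.map_component hμ j hj t).symm
  rw [this]
  exact ((map_continuous _).comp (TopCat.Hom.hom (D.baseIso j hj).inv).continuous).continuousAt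

theorem glued_map {D' : A.Descent} {μ' : (descentMap F).obj D' ⟶ (descentPoint s).obj D'.X}
    (hμ : μ.f = 𝟙 D.X) (hμ' : μ'.f = 𝟙 D'.X) (f : D ⟶ D')
    (hf : (descentMap F).map f ≫ μ' = μ ≫ (descentPoint s).map f.f) (x : D.X) :
    C.glued hμ' (f.f x) = C.glued hμ x := by
  have h := C.map_hom (componentApp C.cartB hμ hμ' f hf _ (exists_const_mem D x) _
    (exists_const_mem D' (f.f x)) rfl) ((D.baseIso _ _).inv PUnit.unit)
  refine Eq.trans (congrArg (C.map (component C.cartB hμ' _ (exists_const_mem D' (f.f x)))) ?_) h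
  have h2 : (D'.baseIso _ (exists_const_mem D' (f.f x))).inv =
      (D.baseIso _ (exists_const_mem D x)).inv ≫ A.p.map (f.app _ _ _ _ (pt_comp f.f x)) :=
    Eq.trans (by simp) (congrArg (_ ≫ ·) (f.p_app _ _ _ _ (pt_comp f.f x)).symm)
  exact congrArg (fun f : TopCat.of PUnit.{1} ⟶ _ => f PUnit.unit) h2

-- Each component of a morphism of descent data is a morphism of the preimage before the plus
-- construction, where morphisms are determined by their base maps.
include C in
theorem app_unique {D' : A.Descent} {μ' : (descentMap F).obj D' ⟶ (descentPoint s).obj D'.X}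
    (hμ : μ.f = 𝟙 D.X) (hμ' : μ'.f = 𝟙 D'.X) (f f' : D ⟶ D')
    (hf : (descentMap F).map f ≫ μ' = μ ≫ (descentPoint s).map f.f)
    (hf' : (descentMap F).map f' ≫ μ' = μ ≫ (descentPoint s).map f'.f) (h : f.f = f'.f) :
    f = f' := by
  refine Descent.Hom.ext' h fun {T} i j hi hj w w' => ?_
  have e : A.p.map (f.app i j hi hj w) = A.p.map (f'.app i j hi hj w') := by
    rw [← cancel_mono (D'.baseIso j hj).hom, f.app_over, f'.app_over]
  exact congrArg Preimage.Hom.hom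
    (C.unique (componentApp C.cartB hμ hμ' f hf i hi j hj w)
      (componentApp C.cartB hμ hμ' f' hf' i hi j hj w') e)

/-- A compatible continuous map between the bases of strict objects lifts. -/
theorem exists_app {D' : A.Descent} {μ' : (descentMap F).obj D' ⟶ (descentPoint s).obj D'.X}
    (hμ : μ.f = 𝟙 D.X) (hμ' : μ'.f = 𝟙 D'.X) (h : D.X ⟶ D'.X)
    (hh : ∀ x, C.glued hμ' (h x) = C.glued hμ x) :
    ∃ (R : Sieve D.X) (hR : R ∈ TopCat.grothendieckTopology D.X)
      (hle : ∀ {T : TopCat.{0}} (i : T ⟶ D.X), R i → D.R i) (f : D.restrict R hR hle ⟶ D'),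
      f.f = h ∧ ∀ {T : TopCat.{0}} (i : T ⟶ D.X) (hi : R i) (j : T ⟶ D'.X) (hj : D'.R j)
        (w : i ≫ f.f = j), F.F.map (f.app i j hi hj w) ≫ pointApp hμ' j hj =
          pointApp hμ i (hle i hi) := by
  let P {T : TopCat.{0}} (i : T ⟶ D.X) (hi : D.R i) : Preimage F s := component C.cartB hμ i hi
  let P' {T : TopCat.{0}} (j : T ⟶ D'.X) (hj : D'.R j) : Preimage F s := component C.cartB hμ' j hj
  -- The sieve of those `i` over which the components are already related by a morphism over the
  -- identity of the source of `i`. Local existence of morphisms makes it a covering sieve.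
  let R : Sieve D.X :=
    { arrows := fun T i => ∃ (hi : D.R i) (hj : D'.R (i ≫ h)) (m : P i hi ⟶ P' (i ≫ h) hj),
        A.p.map (componentHom m) = (D.baseIso i hi).hom ≫ (D'.baseIso (i ≫ h) hj).inv
      downward_closed := by
        rintro T T' i ⟨hi, hj, m, hm⟩ u
        have hi' := D.R.downward_closed hi u
        have hj' : D'.R ((u ≫ i) ≫ h) := by
          rw [Category.assoc]; exact D'.R.downward_closed hj u
        refine ⟨hi', hj', exists_componentHom_restrict C.cartA u _
          (componentMap C.cartB hμ u (u ≫ i) hi' i hi rfl)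
          (componentMap C.cartB hμ u (u ≫ i) hi' i hi rfl ≫ m) (D.baseIso (u ≫ i) hi')
          (D.p_map u _ _ i hi rfl) ?_ hi' hj' rfl (Category.assoc _ _ _).symm⟩
        refine (A.p.map_comp _ (componentHom m)).trans ?_
        refine (congrArg₂ (· ≫ ·) ((D.p_map u _ _ i hi rfl).trans (Category.assoc _ _ _).symm)
          hm).trans ?_
        exact (comp_inv_hom_comp _ _ _).trans (Category.assoc _ _ _) }
  have hR : R ∈ TopCat.grothendieckTopology D.X := by
    refine (mem_grothendieckTopology_iff R).2 fun x => ?_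
    obtain ⟨T, i, ⟨hi, hj⟩, ho, t, rfl⟩ := (mem_grothendieckTopology_iff (D.R ⊓ D'.R.pullback h)).1
      ((TopCat.grothendieckTopology).intersection_covering D.covering
        ((TopCat.grothendieckTopology).pullback_stable h D'.covering)) x
    have hj : D'.R (i ≫ h) := hj
    -- The base of `W` is an open part of `T` around the given point, and its composite with `i` is
    -- the required member of the sieve.
    obtain ⟨W, m, m', hm, ⟨w, hw⟩, hm'⟩ := C.locally (Z := P i hi) (Z' := P' (i ≫ h) hj)
      ((D.baseIso i hi).hom ≫ (D'.baseIso (i ≫ h) hj).inv) (fun y => by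
        refine (C.map_component' hμ' (i ≫ h) hj _).trans
          (Eq.trans ?_ (C.map_component' hμ i hi y).symm)
        refine Eq.trans ?_ (hh _)
        congr 1
        exact congrArg (fun f : A.p.obj (D.obj i hi) ⟶ _ => h (i (f y)))
          (by rw [Category.assoc, Iso.inv_hom_id, Category.comp_id] :
            ((D.baseIso i hi).hom ≫ (D'.baseIso (i ≫ h) hj).inv) ≫ (D'.baseIso (i ≫ h) hj).hom =
              (D.baseIso i hi).hom)) ((D.baseIso i hi).inv t)
    let u : A.p.obj W.obj ⟶ T := A.p.map m.hom ≫ (D.baseIso i hi).hom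
    have hi' : D.R (u ≫ i) := D.R.downward_closed hi u
    have hj' : D'.R ((u ≫ i) ≫ h) := by rw [Category.assoc]; exact D'.R.downward_closed hj u
    refine ⟨A.p.obj W.obj, u ≫ i, ⟨hi', hj', ?_⟩, ?_, w, ?_⟩
    · refine exists_componentHom_restrict C.cartA u W m m' (Iso.refl _) ?_ ?_ hi' hj' rfl
        (Category.assoc _ _ _).symm
      · exact ((Category.id_comp _).trans (Iso.comp_inv_eq _ |>.2 rfl)).symm
      · exact hm'.trans ((Category.assoc _ _ _).symm.trans (Category.id_comp _).symm)
    · have hb : Topology.IsOpenEmbedding (D.baseIso i hi).hom :=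
        (TopCat.homeoOfIso (D.baseIso i hi)).isOpenEmbedding
      exact ho.comp (hb.comp hm)
    · change i ((D.baseIso i hi).hom (A.p.map m.hom w)) = i t
      rw [hw]
      congr 1
      exact congrArg (fun f : T ⟶ T => f t) (D.baseIso i hi).inv_hom_id
  have hle : ∀ {T : TopCat.{0}} (i : T ⟶ D.X), R i → D.R i := fun i hi => hi.1
  have ex : ∀ {T : TopCat.{0}} (i : T ⟶ D.X) (j : T ⟶ D'.X) (hi : R i) (hj : D'.R j),
      i ≫ h = j → ∃ m : P i hi.1 ⟶ P' j hj,
        A.p.map (componentHom m) = (D.baseIso i hi.1).hom ≫ (D'.baseIso j hj).inv := by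
    rintro T i j ⟨hi, hj', m, hm⟩ hj rfl
    exact ⟨m, hm⟩
  -- The choices need no coherence: both sides of the naturality square lie over the same map, so
  -- `unique` identifies them.
  choose m hm using @ex
  have hov : ∀ {T : TopCat.{0}} (i : T ⟶ D.X) (j : T ⟶ D'.X) (hi : R i) (hj : D'.R j)
      (w : i ≫ h = j), A.p.map (componentHom (m i j hi hj w)) ≫ (D'.baseIso j hj).hom =
        (D.baseIso i hi.1).hom := fun i j hi hj w => (Iso.eq_comp_inv _).1 (hm i j hi hj w)
  let app {T : TopCat.{0}} (i : T ⟶ D.X) (j : T ⟶ D'.X) (hi : R i) (hj : D'.R j)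
      (w : i ≫ h = j) : D.obj i hi.1 ⟶ D'.obj j hj := componentHom (m i j hi hj w)
  refine ⟨R, hR, hle,
    { f := h
      le := fun i hi => hi.2.1
      app := app
      app_over := hov
      naturality := fun {T T'} u i i' j j' hi hi' hj hj' w w' v v' => by
        refine congrArg Preimage.Hom.hom (C.unique
          (componentMap C.cartB hμ u i hi.1 i' hi'.1 v ≫ m i' j' hi' hj' w')
          (m i j hi hj w ≫ componentMap C.cartB hμ' u j hj j' hj' v') ?_)
        refine (A.p.map_comp (D.map u i i' hi.1 hi'.1 v)
          (componentHom (m i' j' hi' hj' w'))).trans (Eq.trans ?_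
          (A.p.map_comp (componentHom (m i j hi hj w)) (D'.map u j j' hj hj' v')).symm)
        rw [hm, hm, D.p_map, D'.p_map, comp_inv_hom_comp]
        exact (congrArg (· ≫ _) (Category.assoc _ _ _).symm).trans
          ((comp_inv_hom_comp _ _ _).trans (Category.assoc _ _ _)) }, rfl, fun i hi j hj w => ?_⟩
  have hc := (m i j hi hj w).comm
  change F.F.map (componentHom (m i j hi hj w)) ≫ pointApp hμ' j hj ≫
    s.F.map (D'.baseIso j hj).inv = (pointApp hμ i hi.1 ≫ s.F.map (D.baseIso i hi.1).inv) ≫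
      s.F.map (A.p.map (componentHom (m i j hi hj w))) at hc
  rw [hm, Category.assoc, ← s.F.map_comp, Iso.inv_hom_id_assoc] at hc
  rw [← cancel_mono (s.F.map (D'.baseIso j hj).inv), Category.assoc]
  exact hc

end Classifier

end Plus

end CatOver

/-! ### The plus construction of a classifier is a full classifier. -/

namespace CatOver

variable {A B : CatOver} {F : CatOver.Hom A B} {s : B.Point}

namespace Classifier

variable {R : Type} [TopologicalSpace R] {I : Type} {K : I → TopCat.{0}} {κ : ∀ i, C(K i, R)}

/-- The strict object of the plus construction given by an object of the preimage. -/
theorem exists_strict_of_object (C : Classifier F s κ) (Z : Preimage F s) {T : TopCat.{0}}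
    (e : A.p.obj Z.obj ≅ T) :
    ∃ (D : A.Descent) (b : D.X ≅ T) (μ : (descentMap F).obj D ⟶ (descentPoint s).obj D.X)
      (hμ : μ.f = 𝟙 D.X), ∀ x : D.X, C.glued hμ x = C.map Z (e.inv (b.hom x)) := by
  have fib : ∀ {U : TopCat.{0}} (t : U ⟶ T), ∃ (P : Preimage F s) (m : P ⟶ Z)
      (b : A.p.obj P.obj ≅ U), A.p.map m.hom = b.hom ≫ t ≫ e.inv := fun t =>
    Preimage.fibered (F := F) (s := s) C.fibA C.cartB Z (t ≫ e.inv)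
  -- The pullbacks of `Z` are chosen independently of each other. Their restriction maps are
  -- determined by base maps, and `unique` supplies functoriality, so that they form a descent datum
  -- on the maximal sieve.
  choose P m b hm using @fib
  have ex : ∀ {U U' : TopCat.{0}} (u : U ⟶ U') (t : U ⟶ T) (t' : U' ⟶ T), u ≫ t' = t →
      ∃ l : P t ⟶ P t', A.p.map l.hom = (b t).hom ≫ u ≫ (b t').inv := by
    intro U U' u t t' w
    obtain ⟨l, hl, -⟩ := Preimage.exists_lift C.cartA C.cartB (m t') (m t)
        ((b t).hom ≫ u ≫ (b t').inv) (by
      rw [hm, hm, ← w]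
      simp)
    exact ⟨l, hl⟩
  choose l hl using @ex
  let D : A.Descent :=
    { X := T
      R := ⊤
      covering := (TopCat.grothendieckTopology).top_mem T
      obj := fun t _ => (P t).obj
      baseIso := fun t _ => b t
      map := fun u t t' _ _ w => (l u t t' w).hom
      map_over := fun u t t' _ _ w => by
        refine (congrArg (· ≫ _) (hl u t t' w)).trans ?_
        exact (Iso.eq_comp_inv (b t')).1 (Category.assoc _ _ _).symm
      map_id := fun t _ w => by
        refine congrArg Preimage.Hom.hom (C.unique (l (𝟙 _) t t w) (𝟙 _) ?_)
        refine (hl (𝟙 _) t t w).trans (Eq.trans ?_ (A.p.map_id _).symm)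
        rw [Category.id_comp, Iso.hom_inv_id]
      map_comp := fun u u' t t' t'' _ _ _ w w' w'' => by
        refine congrArg Preimage.Hom.hom (C.unique (l (u ≫ u') t t'' w'')
          (l u t t' w ≫ l u' t' t'' w') ?_)
        refine (hl _ _ _ _).trans (Eq.trans ?_ ((Preimage.p_hom_comp (l u t t' w)
          (l u' t' t'' w')).trans (congrArg₂ (· ≫ ·) (hl _ _ _ _) (hl _ _ _ _))).symm)
        refine Eq.trans ?_ (congrArg (· ≫ _) (Category.assoc _ _ _))
        refine Eq.trans ?_ (comp_inv_hom_comp _ _ _).symm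
        simp only [Category.assoc] }
  have nat : ∀ {U U' : TopCat.{0}} (u : U ⟶ U') (t : U ⟶ T) (t' : U' ⟶ T) (w : u ≫ t' = t),
      F.F.map (l u t t' w).hom ≫ (P t').iso.hom ≫ s.F.map (b t').hom =
        ((P t).iso.hom ≫ s.F.map (b t).hom) ≫ s.F.map u := by
    intro U U' u t t' w
    rw [← Category.assoc, (l u t t' w).comm, Category.assoc, Category.assoc]
    refine congrArg (_ ≫ ·) ?_
    rw [← s.F.map_comp]
    refine Eq.trans (congrArg _ ?_) (s.F.map_comp _ _)
    refine (congrArg (· ≫ _) ((hl u t t' w).trans (Category.assoc _ _ _).symm)).trans ?_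
    exact (Iso.eq_comp_inv (b t')).1 rfl
  let μ : (descentMap F).obj D ⟶ (descentPoint s).obj D.X :=
    { f := 𝟙 T
      le := fun _ _ => trivial
      app := fun {U} t t' _ _ _ => (P t).iso.hom ≫ s.F.map (b t).hom
      app_over := fun {U} t t' _ _ _ => by
        have h2 := s.w.hom.naturality (b t).hom
        simp only [Functor.comp_map, Functor.id_map] at h2
        refine (congrArg (· ≫ _) (B.p.map_comp _ _)).trans ((Category.assoc _ _ _).trans ?_)
        refine (congrArg (_ ≫ ·) h2).trans ((Category.assoc _ _ _).symm.trans ?_)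
        exact congrArg (· ≫ (b t).hom) (P t).iso_over
      naturality := fun u t t' _ _ _ _ _ _ _ _ w _ => nat u t t' w }
  refine ⟨D, Iso.refl _, μ, rfl, fun x => ?_⟩
  -- The component has the same underlying object as the chosen pullback to the point; its
  -- identification with `s` differs only by a detour along `b (pt x)` and back, so the identity is
  -- a morphism.
  let n : component C.cartB (μ := μ) rfl (pt x) trivial ⟶ P (pt x) :=
    { hom := 𝟙 _
      comm := by
        refine (congrArg (· ≫ _) (F.F.map_id _)).trans ((Category.id_comp _).trans ?_)
        change _ = (((P (pt x)).iso.hom ≫ s.F.map (b (pt x)).hom) ≫ s.F.map (b (pt x)).inv) ≫ _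
        refine Eq.trans ?_ (congrArg (_ ≫ ·) ((congrArg s.F.map (A.p.map_id _)).trans
          (s.F.map_id _))).symm
        refine Eq.trans ?_ (Category.comp_id _).symm
        refine Eq.trans (Category.comp_id _).symm (Eq.trans (congrArg (_ ≫ ·) ?_)
          (Category.assoc _ _ _).symm)
        exact ((congrArg s.F.map (b (pt x)).hom_inv_id).symm.trans (s.F.map_comp _ _)).symm.trans
          (s.F.map_id _) |>.symm }
  have h1 := C.map_hom (n ≫ m (pt x)) ((b (pt x)).inv PUnit.unit)
  refine Eq.trans h1.symm (congrArg (C.map Z) ?_)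
  have h3 : (b (pt x)).inv ≫ A.p.map (n ≫ m (pt x)).hom = pt x ≫ e.inv := by
    refine (congrArg (_ ≫ ·) ((A.p.map_comp _ _).trans (congrArg₂ (· ≫ ·) (A.p.map_id _)
      (hm (pt x))))).trans ?_
    exact (congrArg (_ ≫ ·) (Category.id_comp _)).trans ((b (pt x)).inv_hom_id_assoc _)
  exact congrArg (fun f : TopCat.of PUnit.{1} ⟶ _ => f PUnit.unit) h3

end Classifier

/-- The object of the preimage under the plus construction given by a strict object. -/
noncomputable def strictPlus (hB : B.Cart) (D : A.Descent)
    (μ : (descentMap F).obj D ⟶ (descentPoint s).obj D.X) (hμ : μ.f = 𝟙 D.X) :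
    Preimage (plusMap F) (plusPoint s) :=
  ofStrict (F := plusMap F) (s := plusPoint s) (α := plusComm F)
    (β := Iso.refl (descentPoint s ⋙ plusQ B)) (cart_plus hB) D μ ((strictOver_plus_iff D μ).2 hμ)

/-- The continuous map underlying a morphism between strict objects. -/
noncomputable def strictPlusBase {hB : B.Cart} {D D' : A.Descent}
    {μ : (descentMap F).obj D ⟶ (descentPoint s).obj D.X}
    {μ' : (descentMap F).obj D' ⟶ (descentPoint s).obj D'.X} {hμ : μ.f = 𝟙 D.X}
    {hμ' : μ'.f = 𝟙 D'.X} (m : strictPlus hB D μ hμ ⟶ strictPlus hB D' μ' hμ') : D.X ⟶ D'.X :=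
  A.plus.p.map m.hom

/-- The morphism of strict objects given by a morphism of descent data. -/
noncomputable def strictPlusMap (hB : B.Cart) {D D' : A.Descent}
    {μ : (descentMap F).obj D ⟶ (descentPoint s).obj D.X}
    {μ' : (descentMap F).obj D' ⟶ (descentPoint s).obj D'.X} (hμ : μ.f = 𝟙 D.X)
    (hμ' : μ'.f = 𝟙 D'.X) (f : D ⟶ D')
    (hf : (descentMap F).map f ≫ μ' = μ ≫ (descentPoint s).map f.f) :
    strictPlus hB D μ hμ ⟶ strictPlus hB D' μ' hμ' :=
  ofStrictMap (cart_plus hB) _ _ f hf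

theorem strictPlusBase_comp {hB : B.Cart} {D D' D'' : A.Descent}
    {μ : (descentMap F).obj D ⟶ (descentPoint s).obj D.X}
    {μ' : (descentMap F).obj D' ⟶ (descentPoint s).obj D'.X}
    {μ'' : (descentMap F).obj D'' ⟶ (descentPoint s).obj D''.X} {hμ : μ.f = 𝟙 D.X}
    {hμ' : μ'.f = 𝟙 D'.X} {hμ'' : μ''.f = 𝟙 D''.X}
    (m : strictPlus hB D μ hμ ⟶ strictPlus hB D' μ' hμ')
    (m' : strictPlus hB D' μ' hμ' ⟶ strictPlus hB D'' μ'' hμ'') :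
    strictPlusBase (m ≫ m') = strictPlusBase m ≫ strictPlusBase m' :=
  A.plus.p.map_comp _ _

theorem strictPlus_exists_lift (hA : A.Cart) {hB : B.Cart} {D D' : A.Descent}
    {μ : (descentMap F).obj D ⟶ (descentPoint s).obj D.X}
    {μ' : (descentMap F).obj D' ⟶ (descentPoint s).obj D'.X} {hμ : μ.f = 𝟙 D.X}
    {hμ' : μ'.f = 𝟙 D'.X} (m : strictPlus hB D μ hμ ⟶ strictPlus hB D' μ' hμ')
    (k : D'.X ⟶ D.X) (hk : k ≫ strictPlusBase m = 𝟙 D'.X) :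
    ∃ l : strictPlus hB D' μ' hμ' ⟶ strictPlus hB D μ hμ, strictPlusBase l = k := by
  obtain ⟨l, hl, -⟩ := Preimage.exists_lift (cart_plus hA) (cart_plus hB) m
    (𝟙 (strictPlus hB D' μ' hμ')) k (hk.trans (Preimage.p_hom_id (strictPlus hB D' μ' hμ')).symm)
  exact ⟨l, hl⟩

namespace Classifier

variable {R : Type} [TopologicalSpace R] {I : Type} {K : I → TopCat.{0}} {κ : ∀ i, C(K i, R)}

/-- Compatible maps between strict objects of the plus construction lift. -/
theorem exists_strict_hom (C : Classifier F s κ) {D D' : A.Descent}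
    {μ : (descentMap F).obj D ⟶ (descentPoint s).obj D.X}
    {μ' : (descentMap F).obj D' ⟶ (descentPoint s).obj D'.X}
    (hμ : μ.f = 𝟙 D.X) (hμ' : μ'.f = 𝟙 D'.X) (k : D.X ⟶ D'.X)
    (hk : ∀ x : D.X, C.glued hμ' (k x) = C.glued hμ x) :
    ∃ m : strictPlus C.cartB D μ hμ ⟶ strictPlus C.cartB D' μ' hμ', strictPlusBase m = k := by
  obtain ⟨R₀, hR₀, hle, f, hf, hc⟩ := C.exists_app hμ hμ' k hk
  let r := D.restrictHom R₀ hR₀ hle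
  let μ₀ : (descentMap F).obj (D.restrict R₀ hR₀ hle) ⟶ (descentPoint s).obj D.X :=
    (descentMap F).map r ≫ μ
  have hμ₀ : μ₀.f = 𝟙 D.X := comp_f_eq hμ (𝟙 D.X)
  have hr : (descentMap F).map r ≫ μ = μ₀ ≫ (descentPoint s).map (𝟙 D.X) :=
    ((congrArg (μ₀ ≫ ·) ((descentPoint s).map_id D.X)).trans (Category.comp_id _)).symm
  have hpt : ∀ {T : TopCat.{0}} (i : T ⟶ D.X) (hi : R₀ i),
      pointApp hμ₀ i hi = pointApp hμ i (hle i hi) := by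
    intro T i hi
    have := map_app_pointApp hμ₀ hμ r hr i hi i (hle i hi) (Category.comp_id _)
    refine this.symm.trans ?_
    refine (congrArg (· ≫ _) ((congrArg F.F.map ?_).trans (F.F.map_id _))).trans
      (Category.id_comp _)
    exact D.map_id i _ _
  let φ := strictPlusMap C.cartB hμ₀ hμ' f (map_comp_point_eq hμ₀ hμ' f
      fun {T} i hi j hj w => (hc i hi j hj w).trans (hpt i hi).symm)
  -- Restriction to a smaller covering sieve lies over the identity, so after the plus construction
  -- it has a morphism back over the identity.
  obtain ⟨ρ, hρ⟩ := strictPlus_exists_lift C.cartA (strictPlusMap C.cartB hμ₀ hμ r hr) (𝟙 D.X)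
    (Category.id_comp _)
  exact ⟨ρ ≫ φ, (strictPlusBase_comp ρ φ).trans ((congrArg₂ (· ≫ ·) hρ hf).trans
    (Category.id_comp k))⟩

/-- The plus construction of a preimage is classified by the same space, and compatible maps now
lift globally. -/
theorem exists_plus (C : Classifier F s κ) :
    ∃ C' : Classifier (plusMap F) (plusPoint s) κ, C'.Full := by
  have S := strictData_plus (F := F) (s := s) C.cartA C.cartB
  obtain ⟨Φ, h1, h2⟩ := S.exists_map (R := R)
    (fun D μ h => ⟨C.glued ((strictOver_plus_iff D μ).1 h),
      C.continuous_glued ((strictOver_plus_iff D μ).1 h)⟩)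
    (fun {D D' μ μ'} h h' f hf x => C.glued_map ((strictOver_plus_iff D μ).1 h)
      ((strictOver_plus_iff D' μ').1 h') f hf x)
  have full := @StrictData.full_of_strict _ _ _ _ _ _ _ _ _ _ _ _ _ _ S R _ Φ h1
    (fun {D D' μ μ'} hμ hμ' k hk =>
      C.exists_strict_hom ((strictOver_plus_iff D μ).1 hμ)
        ((strictOver_plus_iff D' μ').1 hμ') k fun x =>
          (h2 D' μ' hμ' (k x)).symm.trans ((hk x).trans (h2 D μ hμ x)))
  refine ⟨
    { cartA := S.cartA
      cartB := S.cartB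
      fibA := fibered_plus C.cartA
      map := Φ
      map_hom := h1
      unique := fun {Z Z'} m m' hm => S.hom_unique
        (fun {D D' μ μ'} h h' f f' hf hf' hff => ⟨D, 𝟙 D,
          by rw [CategoryTheory.Functor.map_id]; infer_instance,
          by rw [C.app_unique ((strictOver_plus_iff D μ).1 h) ((strictOver_plus_iff D' μ').1 h')
            f f' hf hf' hff]⟩) m m' hm
      -- Lifts now exist globally, so no shrinking of `Z` is needed.
      locally := fun {Z Z'} h hh x => by
        obtain ⟨m, hm⟩ := full h hh
        refine ⟨Z, 𝟙 Z, m, ?_, ⟨x, ?_⟩, ?_⟩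
        · rw [Preimage.p_hom_id]; exact .id
        · rw [Preimage.p_hom_id]; rfl
        · rw [hm, Preimage.p_hom_id, Category.id_comp]
      sect := fun i => by
        obtain ⟨Z, e, hZ⟩ := C.sect i
        obtain ⟨D, b, μ, hμ, hg⟩ := C.exists_strict_of_object Z e
        refine ⟨strictPlus C.cartB D μ hμ, b, fun x => ?_⟩
        refine (h2 D μ ((strictOver_plus_iff D μ).2 hμ) x).trans
          ((hg x).trans ((hZ _).trans (congrArg (κ i) ?_)))
        exact congrArg (fun f : K i ⟶ K i => f (b.hom x)) e.inv_hom_id }, full⟩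

end Classifier

end CatOver

/-! ### From a full classifier to the underlying topological space. -/

namespace CatOver

variable {A B : CatOver} {F : CatOver.Hom A B} {s : B.Point}

namespace Classifier

variable {R : Type} [TopologicalSpace R] {I : Type} {K : I → TopCat.{0}} {κ : ∀ i, C(K i, R)}
  (C : Classifier F s κ)

/-- The value of the classifying map at an object over a point. -/
noncomputable def value (w : (preimage F s).PointObj) : R :=
  C.map w.1 w.2.some.default

theorem map_eq_value (w : (preimage F s).PointObj) (x : A.p.obj (Preimage.obj w.1)) :
    C.map w.1 x = C.value w :=
  congrArg (C.map w.1) (w.2.some.uniq x)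

theorem value_eq_of_iso {w w' : (preimage F s).PointObj} (e : w.1 ≅ w'.1) :
    C.value w = C.value w' := by
  rw [← C.map_eq_value w' (A.p.map (Preimage.Hom.hom e.hom) w.2.some.default)]
  exact (C.map_hom e.hom _).symm

/-- The map from the underlying space. -/
noncomputable def toSpace : (preimage F s).UnderlyingSpace → R :=
  Quot.lift C.value fun _ _ ⟨e⟩ => C.value_eq_of_iso e

/-- For two objects over one-point spaces with the same value, fullness gives morphisms in both
directions. Their composites have the identity as base map, hence are identities by uniqueness. -/
theorem toSpace_injective (hC : C.Full) : Function.Injective C.toSpace := by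
  rintro ⟨w⟩ ⟨w'⟩ h
  change C.value w = C.value w' at h
  have lift : ∀ v v' : (preimage F s).PointObj, C.value v = C.value v' →
      Nonempty (v.1 ⟶ v'.1) := by
    intro v v' h
    obtain ⟨m, -⟩ := hC (Z := v.1) (Z' := v'.1)
      (TopCat.ofHom (ContinuousMap.const _ v'.2.some.default)) (fun x => by
        rw [C.map_eq_value v, h]; rfl)
    exact ⟨m⟩
  have sub : ∀ (v : (preimage F s).PointObj) (m : v.1 ⟶ v.1), m = 𝟙 _ := by
    intro v m
    refine C.unique (Z := v.1) (Z' := v.1) m (𝟙 _) ?_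
    ext x
    exact (v.2.some.uniq _).trans (v.2.some.uniq _).symm
  obtain ⟨a⟩ := lift w w' h
  obtain ⟨b⟩ := lift w' w h.symm
  exact Quot.sound ⟨⟨a, b, sub w _, sub w' _⟩⟩

/-- Through `toSpace`, the maps `X → |F|` of the statement become the classifying maps. -/
theorem toSpace_comp_of_isPointMap {z : (preimage F s).E}
    {c : (preimage F s).p.obj z → (preimage F s).UnderlyingSpace} (hc : IsPointMap z c)
    (x : (preimage F s).p.obj z) : C.toSpace (c x) = C.map z x := by
  obtain ⟨w, m, hw, hm⟩ := hc x
  rw [← hw, ← hm w.2.some.default]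
  exact (C.map_hom (Z := w.1) (Z' := z) m _).symm

include C in
theorem exists_isPointMap (z : (preimage F s).E) :
    ∃ c : (preimage F s).p.obj z → (preimage F s).UnderlyingSpace, IsPointMap z c := by
  choose w m e hm using fun x : (preimage F s).p.obj z =>
    Preimage.fibered C.fibA C.cartB z (pt x)
  refine ⟨fun x => Quot.mk _ ⟨w x, ⟨(TopCat.homeoOfIso (e x)).toEquiv.unique⟩⟩, fun x =>
    ⟨_, m x, rfl, fun y => ?_⟩⟩
  rw [hm]; rfl

/-- Compatibility with the maps to the underlying space implies compatibility with the classifying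
maps, whereupon fullness gives existence and rigidity gives uniqueness. The topology of the
underlying space plays no role here. -/
theorem isSubsheaf (hC : C.Full) : (preimage F s).IsSubsheafOfUnderlyingSpace := by
  intro z z' h c c' hc hc' hh
  obtain ⟨m, hm⟩ := hC (Z := z) (Z' := z') h (fun x => by
    exact (C.toSpace_comp_of_isPointMap hc' (h x)).symm.trans ((congrArg C.toSpace (hh x)).trans
      (C.toSpace_comp_of_isPointMap hc x)))
  exact ⟨m, hm, fun m' hm' => C.unique (Z := z) (Z' := z') m' m
    ((show A.p.map (Preimage.Hom.hom m') = h from hm').trans hm.symm)⟩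

/-- By the definition of the topology, continuity can be tested after composition with each map from
a base, where `toSpace` becomes a continuous classifying map. -/
theorem continuous_toSpace : Continuous C.toSpace := by
  refine continuous_iSup_dom.2 fun z => continuous_iSup_dom.2 fun c => continuous_iSup_dom.2
    fun hc => continuous_coinduced_dom.2 ?_
  have : C.toSpace ∘ c = C.map z := funext fun x => C.toSpace_comp_of_isPointMap hc x
  rw [this]
  exact map_continuous _

theorem surjective_toSpace (hκ : ∀ r, ∃ i k, κ i k = r) : Function.Surjective C.toSpace := by
  intro r
  obtain ⟨i, k, rfl⟩ := hκ r
  obtain ⟨Z, e, hZ⟩ := C.sect i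
  obtain ⟨c, hc⟩ := C.exists_isPointMap Z
  refine ⟨c (e.inv k), (C.toSpace_comp_of_isPointMap hc _).trans ((hZ _).trans ?_)⟩
  exact congrArg (fun f : K i ⟶ K i => κ i (f k)) e.inv_hom_id

/-- The bijection is continuous, and it remains to see that it is open. Openness in `R` is tested on
the pieces `K i`; over each of them there is an object with classifying map `κ i`, and its map to
the underlying space is continuous by the definition of the topology. -/
theorem nonempty_homeomorph (hC : C.Full) (hκ : ∀ r, ∃ i k, κ i k = r)
    (ho : ∀ U : Set R, (∀ i, IsOpen (κ i ⁻¹' U)) → IsOpen U) :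
    Nonempty ((preimage F s).UnderlyingSpace ≃ₜ R) := by
  let E := Equiv.ofBijective C.toSpace ⟨C.toSpace_injective hC, C.surjective_toSpace hκ⟩
  refine ⟨E.toHomeomorph fun U => ⟨fun hU => ?_, fun hU => hU.preimage C.continuous_toSpace⟩⟩
  refine ho U fun i => ?_
  obtain ⟨Z, e, hZ⟩ := C.sect i
  obtain ⟨c, hc⟩ := C.exists_isPointMap Z
  have hcc : Continuous c := by
    refine continuous_iff_coinduced_le.2 ?_
    exact le_iSup_of_le Z (le_iSup_of_le c (le_iSup_of_le hc le_rfl))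
  have : κ i ⁻¹' U = e.inv ⁻¹' (c ⁻¹' (E ⁻¹' U)) := by
    ext k
    have h1 : κ i k = C.toSpace (c (e.inv k)) := by
      exact (congrArg (fun f : K i ⟶ K i => κ i (f k)) e.inv_hom_id).symm.trans
        ((hZ _).symm.trans (C.toSpace_comp_of_isPointMap hc (e.inv k)).symm)
    exact iff_of_eq (congrArg (· ∈ U) h1)
  rw [this]
  exact (hU.preimage hcc).preimage (TopCat.Hom.hom e.inv).continuous

end Classifier

end CatOver

/-! ### Contractions of graphs: images, factorization, contraction of a set of edges. -/

namespace MarkedGraph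

namespace Contraction

variable {n : ℕ} {A B C : MarkedGraph n}

theorem onV_surjective (c : Contraction A B) : Function.Surjective c.onV := fun w =>
  (c.fiber w).nonempty

/-- Contractions are epimorphic: `onV` is surjective, and `lift`, which goes the other way, is
injective. -/
theorem trans_left_cancel (c : Contraction A B) {d e : Contraction B C}
    (h : c.trans d = c.trans e) : d = e := by
  refine ext_lift (fun w => ?_) fun f => ?_
  · obtain ⟨v, rfl⟩ := c.onV_surjective w
    exact congrFun (congrArg onV h) v
  · exact c.lift_injective (congrFun (congrArg lift h) f)

/-- By `val_sum` the quantity `2 h - 2 + val` of a vertex of `B` is the sum over its nonempty fibre,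
and every summand is at least one. -/
theorem isStable (c : Contraction A B) (hA : A.IsStable) : B.IsStable := by
  intro w
  have h1 := c.val_sum w
  have hp : ∀ v, (1 : ℚ) ≤ 2 * (A.weight v : ℚ) - 2 + A.val v := fun v => by
    have := hA v
    have : (3 : ℚ) ≤ 2 * A.weight v + A.val v := by exact_mod_cast this
    linarith
  obtain ⟨v, hv⟩ := c.onV_surjective w
  have h2 : ind (c.onV v = w) * (2 * (A.weight v : ℚ) - 2 + A.val v) ≤
      ∑ v, ind (c.onV v = w) * (2 * (A.weight v : ℚ) - 2 + A.val v) := by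
    refine Finset.single_le_sum (f := fun v => ind (c.onV v = w) *
      (2 * (A.weight v : ℚ) - 2 + A.val v)) (fun x _ => ?_) (Finset.mem_univ v)
    refine mul_nonneg ?_ (by linarith [hp x])
    unfold ind; split_ifs <;> norm_num
  rw [ind_true hv] at h2
  have h3 : (2 : ℚ) < 2 * B.weight w + B.val w := by linarith [hp v]
  exact_mod_cast h3

/-- The image of a connected subgraph that contains all contracted edges at its vertices. -/
theorem image (c : Contraction A B) {S : Set B.V} {T : Set B.F} {k : ℕ}
    (h : A.IsConnectedOfGenus {v | c.onV v ∈ S}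
      {f | (f ∉ Set.range c.lift ∧ c.onV (A.root f) ∈ S) ∨ ∃ e ∈ T, c.lift e = f} k) :
    B.IsConnectedOfGenus S T k := by
  refine ⟨?_, ?_, ?_⟩
  · obtain ⟨v, hv⟩ := h.nonempty
    exact ⟨_, hv⟩
  · intro w hw w' hw'
    obtain ⟨v, rfl⟩ := c.onV_surjective w
    obtain ⟨v', rfl⟩ := c.onV_surjective w'
    have hr := h.reach v hw v' hw'
    clear hw'
    induction hr with
    | refl => exact Relation.ReflTransGen.refl
    | tail _ hs ih =>
      obtain ⟨f, ⟨hf, _⟩ | ⟨e, he, rfl⟩, rfl, rfl⟩ := hs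
      · rwa [c.onV_contracted f hf]
      · refine ih.tail ⟨e, he, (c.onV_root e).symm, ?_⟩
        rw [c.inv_lift, c.onV_root]
  · have hb := (genus_eq_iff _ _ _ _).1 h.genus
    have ha := fun u => (genus_eq_iff _ _ _ _).1 (c.fiber u).genus
    rw [genus_eq_iff, ← hb]
    have hV : ∑ v, ind (v ∈ {v | c.onV v ∈ S}) * ((A.weight v : ℚ) - 1)
        = ∑ u, ind (u ∈ S) * ∑ v, ind (c.onV v = u) * ((A.weight v : ℚ) - 1) :=
      sum_ind_fiber c.onV (fun u => u ∈ S) _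
    have e1 : ∑ u, ind (u ∈ S) * ∑ f, ind (f ∉ Set.range c.lift ∧ c.onV (A.root f) = u)
        = ∑ f, ind (c.onV (A.root f) ∈ S) * ind (f ∉ Set.range c.lift) := by
      rw [sum_ind_fiber (fun f => c.onV (A.root f)) (fun u => u ∈ S)]
      refine Finset.sum_congr rfl fun u _ => ?_
      congr 1
      exact Finset.sum_congr rfl fun f _ => by rw [ind_and, mul_comm]
    have e2 : ∑ e, ind (e ∈ T)
        = ∑ f, ind (f ∈ Set.range c.lift) * ind (∃ e ∈ T, c.lift e = f) := by
      rw [← sum_ind_injective c.lift c.lift_injective (fun f => ind (∃ e ∈ T, c.lift e = f))]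
      refine Finset.sum_congr rfl fun e _ => ind_congr ⟨fun he => ⟨e, he, rfl⟩, ?_⟩
      rintro ⟨e', he, h⟩
      exact c.lift_injective h ▸ he
    have hF : ∑ f, ind (f ∈ {f | (f ∉ Set.range c.lift ∧ c.onV (A.root f) ∈ S) ∨
          ∃ e ∈ T, c.lift e = f})
        = (∑ u, ind (u ∈ S) * ∑ f, ind (f ∉ Set.range c.lift ∧ c.onV (A.root f) = u))
          + ∑ e, ind (e ∈ T) := by
      rw [e1, e2, ← Finset.sum_add_distrib]
      refine Finset.sum_congr rfl fun f _ => ?_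
      by_cases hf : f ∈ Set.range c.lift
      · rw [ind_true hf, ind_false (not_not.2 hf), mul_zero, zero_add, one_mul]
        exact ind_congr ⟨fun h => h.resolve_left fun h => h.1 hf, Or.inr⟩
      · rw [ind_false hf, ind_true hf, zero_mul, add_zero, mul_one]
        refine ind_congr ⟨fun h => ?_, fun h => Or.inl ⟨hf, h⟩⟩
        rcases h with h | ⟨e, _, rfl⟩
        · exact h.2
        · exact absurd ⟨e, rfl⟩ hf
    have hsum : (∑ u, ind (u ∈ S) *
            ∑ f, ind (f ∉ Set.range c.lift ∧ c.onV (A.root f) = u)) / 2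
        + (∑ u, ind (u ∈ S) * ∑ v, ind (c.onV v = u) * ((A.weight v : ℚ) - 1))
        = ∑ u, ind (u ∈ S) * ((B.weight u : ℚ) - 1) := by
      rw [Finset.sum_div, ← Finset.sum_add_distrib]
      refine Finset.sum_congr rfl fun u _ => ?_
      rw [← ha u]
      simp only [Set.mem_ofPred_eq]
      ring
    rw [hV, hF, ← hsum]
    ring

theorem isConnectedOfGenus_univ (c : Contraction A B) {k : ℕ}
    (h : A.IsConnectedOfGenus Set.univ {f | A.inv f ≠ f} k) :
    B.IsConnectedOfGenus Set.univ {f | B.inv f ≠ f} k := by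
  refine c.image ?_
  have hF : {f | (f ∉ Set.range c.lift ∧ c.onV (A.root f) ∈ Set.univ) ∨
      ∃ e ∈ {f | B.inv f ≠ f}, c.lift e = f} = {f | A.inv f ≠ f} := by
    ext f
    constructor
    · rintro (⟨hf, _⟩ | ⟨e, he, rfl⟩)
      · exact fun h => hf (c.mem_range_of_inv_eq h)
      · exact fun h => he (c.lift_injective ((c.inv_lift e).symm.trans h))
    · intro hf
      by_cases hr : f ∈ Set.range c.lift
      · obtain ⟨e, rfl⟩ := hr
        refine Or.inr ⟨e, fun h => hf ?_, rfl⟩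
        rw [c.inv_lift, h]
      · exact Or.inl ⟨hr, trivial⟩
  have hV : {v | c.onV v ∈ Set.univ} = Set.univ := by ext; simp
  rw [hF, hV]
  exact h

/-- A contraction that contracts all edges contracted by `c` factors through `c`. -/
theorem exists_factor (c : Contraction A B) (d : Contraction A C)
    (h : Set.range d.lift ⊆ Set.range c.lift) : ∃ e : Contraction B C, c.trans e = d := by
  choose l hl using fun f => h ⟨f, rfl⟩
  choose s hs using c.onV_surjective
  -- Vertices of one fibre of `c` are joined by edges contracted by `c`, and `d` contracts these
  -- edges as well. So `d.onV` descends along `c.onV`, and the section `s` serves only to write the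
  -- descended map.
  have hfib : ∀ v v', c.onV v = c.onV v' → d.onV v = d.onV v' := by
    intro v v' hv
    have hr := (c.fiber (c.onV v)).reach v rfl v' hv.symm
    clear hv
    induction hr with
    | refl => rfl
    | tail _ hf ih =>
      obtain ⟨f, ⟨hf, _⟩, rfl, rfl⟩ := hf
      rw [ih, d.onV_contracted f fun h' => hf (h h')]
  have hsv : ∀ v, d.onV (s (c.onV v)) = d.onV v := fun v => hfib _ _ (hs _)
  have hroot : ∀ e, d.onV (s (B.root e)) = d.onV (A.root (c.lift e)) := fun e => by
    rw [← hsv (A.root (c.lift e)), c.onV_root]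
  have hrange : ∀ e, c.lift e ∈ Set.range d.lift ↔ e ∈ Set.range l := by
    intro e
    constructor
    · rintro ⟨f, hf⟩
      exact ⟨f, c.lift_injective ((hl f).trans hf)⟩
    · rintro ⟨f, rfl⟩
      exact ⟨f, (hl f).symm⟩
  refine ⟨⟨fun w => d.onV (s w), l, ?_, ?_, ?_, ?_, ?_, ?_⟩, ?_⟩
  · intro f f' hf
    exact d.lift_injective (by rw [← hl, ← hl, hf])
  · intro f
    rw [hroot, hl, d.onV_root]
  · intro f
    refine c.lift_injective ?_
    rw [← c.inv_lift, hl, hl, d.inv_lift]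
  · intro e he
    rw [hroot, hroot, ← c.inv_lift, d.onV_contracted _ fun h' => he ((hrange e).1 h')]
  · intro i
    refine c.lift_injective ?_
    rw [hl, d.lift_leg, c.lift_leg]
  · intro w
    refine c.image ?_
    have hV : {v | c.onV v ∈ {w' | d.onV (s w') = w}} = {v | d.onV v = w} := by
      ext v
      change d.onV (s (c.onV v)) = w ↔ d.onV v = w
      rw [hsv]
    have hF : {f | (f ∉ Set.range c.lift ∧ c.onV (A.root f) ∈ {w' | d.onV (s w') = w}) ∨
        ∃ e ∈ {e | e ∉ Set.range l ∧ d.onV (s (B.root e)) = w}, c.lift e = f} =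
        {f | f ∉ Set.range d.lift ∧ d.onV (A.root f) = w} := by
      ext f
      constructor
      · rintro (⟨h1, h2⟩ | ⟨e, ⟨h1, h2⟩, rfl⟩)
        · exact ⟨fun h' => h1 (h h'), (hsv _).symm.trans h2⟩
        · exact ⟨fun h' => h1 ((hrange e).1 h'), (hroot e).symm.trans h2⟩
      · rintro ⟨h1, h2⟩
        by_cases hf : f ∈ Set.range c.lift
        · obtain ⟨e, rfl⟩ := hf
          exact Or.inr ⟨e, ⟨fun h' => h1 ((hrange e).2 h'), (hroot e).trans h2⟩, rfl⟩
        · exact Or.inl ⟨hf, (hsv _).trans h2⟩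
    rw [hV, hF]
    exact d.fiber w
  · exact ext_lift hsv hl

end Contraction

section ContractEdge

variable {n : ℕ} (G : MarkedGraph n) (f : G.F)

open Classical in
/-- The vertex that a vertex becomes when the edge of `f` is contracted. -/
noncomputable def mergeV (v : G.V) : G.V := if v = G.root (G.inv f) then G.root f else v

open Classical in
/-- The genus of the subgraph consisting of one edge. -/
noncomputable def edgeWeight : ℕ :=
  if G.root (G.inv f) = G.root f then G.weight (G.root f) + 1
  else G.weight (G.root f) + G.weight (G.root (G.inv f))

variable {G f} in
theorem mergeV_eq (v : G.V) : G.mergeV f v = G.root f ∨ G.mergeV f v ≠ G.root (G.inv f) := by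
  unfold mergeV
  split_ifs with h
  · exact Or.inl rfl
  · exact Or.inr h

open Classical in
/-- The graph obtained by contracting the edge of the flag `f`. -/
noncomputable def contractEdge (hf : G.inv f ≠ f) : MarkedGraph n where
  -- The first alternative matters for a loop, where the two ends coincide and the vertex has to
  -- survive.
  V := {v : G.V // v = G.root f ∨ v ≠ G.root (G.inv f)}
  F := {e : G.F // e ≠ f ∧ e ≠ G.inv f}
  root e := ⟨G.mergeV f (G.root e.1), mergeV_eq _⟩
  inv e := ⟨G.inv e.1, fun h => e.2.2 (by rw [← G.inv_inv e.1]; exact congrArg _ h),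
    fun h => e.2.1 ((G.inv_inv e.1).symm.trans ((congrArg _ h).trans (G.inv_inv f)))⟩
  inv_inv e := Subtype.ext (G.inv_inv e.1)
  weight v := if v.1 = G.root f then G.edgeWeight f else G.weight v.1
  leg i := ⟨G.leg i, fun h => hf ((G.isLeg_iff f).2 ⟨i, h⟩), fun h => hf (by
    have := (G.isLeg_iff (G.inv f)).2 ⟨i, h⟩
    rw [G.inv_inv] at this; exact this.symm)⟩
  leg_injective i j h := G.leg_injective (congrArg Subtype.val h)
  isLeg_iff e := by
    rw [Subtype.ext_iff]
    refine (G.isLeg_iff e.1).trans ⟨?_, ?_⟩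
    · rintro ⟨i, hi⟩; exact ⟨i, Subtype.ext hi⟩
    · rintro ⟨i, hi⟩; exact ⟨i, congrArg Subtype.val hi⟩

variable {G f}

theorem betti_singleton (v : G.V) : G.betti {v} ∅ + ∑ᶠ u ∈ ({v} : Set G.V), (G.weight u : ℚ)
    = G.weight v := by
  simp [betti]

theorem isConnectedOfGenus_singleton (v : G.V) : G.IsConnectedOfGenus {v} ∅ (G.weight v) := by
  refine ⟨⟨v, rfl⟩, ?_, betti_singleton v⟩
  rintro v rfl w rfl
  exact Relation.ReflTransGen.refl

theorem isConnectedOfGenus_edge (hf : G.inv f ≠ f) : G.IsConnectedOfGenus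
    {G.root f, G.root (G.inv f)} {f, G.inv f} (G.edgeWeight f) := by
  refine ⟨⟨_, Or.inl rfl⟩, ?_, ?_⟩
  · have h1 : G.Reach {f, G.inv f} (G.root f) (G.root (G.inv f)) := Reach.step (Or.inl rfl)
    have h2 : G.Reach {f, G.inv f} (G.root (G.inv f)) (G.root f) := by
      have := Reach.step (G := G) (T := {f, G.inv f}) (f := G.inv f) (Or.inr rfl)
      rwa [G.inv_inv] at this
    rintro v (rfl | rfl) w (rfl | rfl)
    · exact Relation.ReflTransGen.refl
    · exact h1
    · exact h2
    · exact Relation.ReflTransGen.refl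
  · rw [betti, Set.ncard_pair hf.symm, edgeWeight]
    split_ifs with h
    · rw [h]; simp; ring
    · rw [Set.ncard_pair (Ne.symm h), finsum_mem_pair (Ne.symm h)]
      push_cast; ring

theorem mergeV_eq_iff {v w : G.V} (hw : w = G.root f ∨ w ≠ G.root (G.inv f)) :
    G.mergeV f v = w ↔ v = w ∨ (w = G.root f ∧ v = G.root (G.inv f)) := by
  unfold mergeV
  split_ifs with h
  · subst h
    constructor
    · rintro rfl; exact Or.inr ⟨rfl, rfl⟩
    · rintro (rfl | ⟨rfl, _⟩)
      · rcases hw with h | h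
        · exact h.symm
        · exact absurd rfl h
      · rfl
  · exact ⟨Or.inl, fun h' => h'.resolve_right fun h' => h h'.2⟩

/-- The contraction of one edge. -/
noncomputable def contractEdgeMap (hf : G.inv f ≠ f) : Contraction G (G.contractEdge f hf) where
  onV v := ⟨G.mergeV f v, mergeV_eq _⟩
  lift e := e.1
  lift_injective := Subtype.val_injective
  onV_root _ := rfl
  inv_lift _ := rfl
  onV_contracted e he := by
    refine Subtype.ext ?_
    have : e = f ∨ e = G.inv f := by
      by_contra h
      push Not at h
      exact he ⟨⟨e, h⟩, rfl⟩
    have h1 : G.mergeV f (G.root (G.inv f)) = G.mergeV f (G.root f) := by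
      unfold mergeV; simp
    rcases this with rfl | rfl
    · exact h1
    · change G.mergeV f (G.root (G.inv (G.inv f))) = _
      rw [G.inv_inv]; exact h1.symm
  lift_leg _ := rfl
  fiber w := by
    have hr : ∀ e, e ∉ Set.range (fun e : (G.contractEdge f hf).F => e.1) ↔ e = f ∨ e = G.inv f := by
      intro e
      constructor
      · intro he
        by_contra h
        push Not at h
        exact he ⟨⟨e, h⟩, rfl⟩
      · rintro h ⟨e, rfl⟩
        exact h.elim e.2.1 e.2.2
    have hV : ∀ v, (⟨G.mergeV f v, mergeV_eq _⟩ : (G.contractEdge f hf).V) = w ↔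
        v = w.1 ∨ (w.1 = G.root f ∧ v = G.root (G.inv f)) := fun v =>
      Subtype.ext_iff.trans (mergeV_eq_iff w.2)
    have e1 := Set.ext hV
    have e2 : {e | e ∉ Set.range (fun e : (G.contractEdge f hf).F => e.1) ∧
        (⟨G.mergeV f (G.root e), mergeV_eq _⟩ : (G.contractEdge f hf).V) = w} =
        {e | (e = f ∨ e = G.inv f) ∧
          (G.root e = w.1 ∨ (w.1 = G.root f ∧ G.root e = G.root (G.inv f)))} :=
      Set.ext fun e => and_congr (hr e) (hV _)
    by_cases hw : w.1 = G.root f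
    · have h1 : {v | v = w.1 ∨ (w.1 = G.root f ∧ v = G.root (G.inv f))} =
          {G.root f, G.root (G.inv f)} := by
        ext v; simp [hw]
      have h2 : {e | (e = f ∨ e = G.inv f) ∧
          (G.root e = w.1 ∨ (w.1 = G.root f ∧ G.root e = G.root (G.inv f)))} = {f, G.inv f} := by
        ext e
        simp only [hw, Set.mem_ofPred_eq, Set.mem_insert_iff, Set.mem_singleton_iff]
        refine ⟨fun h => h.1, fun h => ⟨h, ?_⟩⟩
        rcases h with rfl | rfl <;> simp
      refine Eq.mpr (congrArg₂ (G.IsConnectedOfGenus · · _) (e1.trans h1) (e2.trans h2)) ?_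
      have := isConnectedOfGenus_edge hf
      convert this using 1
      simp only [contractEdge, hw, if_true]
    · have hw2 : w.1 ≠ G.root (G.inv f) := w.2.resolve_left hw
      have h1 : {v | v = w.1 ∨ (w.1 = G.root f ∧ v = G.root (G.inv f))} = {w.1} := by
        ext v; simp [hw]
      have h2 : {e | (e = f ∨ e = G.inv f) ∧
          (G.root e = w.1 ∨ (w.1 = G.root f ∧ G.root e = G.root (G.inv f)))} = ∅ := by
        ext e
        simp only [hw, false_and, or_false, Set.mem_ofPred_eq, Set.mem_empty_iff_false, iff_false]
        rintro ⟨rfl | rfl, h⟩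
        · exact hw h.symm
        · exact hw2 h.symm
      refine Eq.mpr (congrArg₂ (G.IsConnectedOfGenus · · _) (e1.trans h1) (e2.trans h2)) ?_
      have := isConnectedOfGenus_singleton (G := G) w.1
      convert this using 1
      simp only [contractEdge, hw, if_false]

end ContractEdge

/-- Every inversion-invariant set of flags that contains no leg can be contracted. -/
theorem exists_contraction {n : ℕ} (G : MarkedGraph n) (T : Set G.F)
    (hinv : ∀ f ∈ T, G.inv f ∈ T) (hleg : ∀ f ∈ T, G.inv f ≠ f) :
    ∃ (H : MarkedGraph n) (c : Contraction G H), ∀ f, f ∈ Set.range c.lift ↔ f ∉ T := by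
  induction hk : T.ncard using Nat.strong_induction_on generalizing G with
  | _ k ih =>
    by_cases hT : T.Nonempty
    · obtain ⟨f, hf⟩ := hT
      -- Contracting the edge of `f` removes at least the flag `f` from `T`; the remaining flags of
      -- `T` are its preimage under `c.lift`.
      let c := contractEdgeMap (hleg f hf)
      have hr : ∀ e : G.F, e ∈ Set.range c.lift ↔ e ≠ f ∧ e ≠ G.inv f := fun e =>
        ⟨fun ⟨x, hx⟩ => hx ▸ x.2, fun h => ⟨⟨e, h⟩, rfl⟩⟩
      obtain ⟨H, d, hd⟩ := ih (c.lift ⁻¹' T).ncard (by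
          rw [← hk, ← Set.ncard_image_of_injective _ c.lift_injective]
          refine Set.ncard_lt_ncard ⟨?_, ?_⟩ (Set.toFinite _)
          · rintro _ ⟨e, he, rfl⟩; exact he
          · intro h
            obtain ⟨e, _, he⟩ := h hf
            exact ((hr f).1 ⟨e, he⟩).1 rfl) _ (c.lift ⁻¹' T)
        (fun e he => by
          change c.lift _ ∈ T
          rw [← c.inv_lift]; exact hinv _ he)
        (fun e he h => hleg _ he (by rw [c.inv_lift, h])) rfl
      refine ⟨H, c.trans d, fun e => ?_⟩
      constructor
      · rintro ⟨x, rfl⟩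
        exact (hd _).1 ⟨x, rfl⟩
      · intro he
        obtain ⟨x, rfl⟩ := (hr e).2 ⟨fun h => he (h ▸ hf), fun h => he (h ▸ hinv f hf)⟩
        obtain ⟨y, rfl⟩ := (hd x).2 he
        exact ⟨y, rfl⟩
    · rw [Set.not_nonempty_iff_eq_empty] at hT
      subst hT
      exact ⟨G, .refl G, fun f => ⟨fun _ h => h, fun _ => ⟨f, rfl⟩⟩⟩

end MarkedGraph

/-! ### Specialization of curves along maps of monoids. -/

namespace CurveContraction

variable {g n : ℕ} {P Q R : ShpMon} {h : P →+ Q} {k : Q →+ R} {A : StableCurve g n P}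

/-- A curve specializes along every homomorphism of monoids. -/
theorem exists_pullback (h : P →+ Q) (A : StableCurve g n P) :
    ∃ B : StableCurve g n Q, Nonempty (CurveContraction h A B) := by
  -- Legs also have length zero and must be excluded from the set of contracted flags.
  obtain ⟨H, c, hc⟩ := A.toMarkedGraph.exists_contraction
    {f | h (A.len f) = 0 ∧ A.inv f ≠ f}
    (fun f hf => ⟨by rw [A.len_inv]; exact hf.1, fun e => hf.2 (by
      rw [A.inv_inv] at e; exact e.symm)⟩) (fun f hf => hf.2)
  refine ⟨⟨H, c.isConnectedOfGenus_univ A.connected, c.isStable A.stable,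
    fun f => h (A.len (c.lift f)), fun f => ?_, fun f => ?_⟩, ⟨⟨c, fun f => rfl, fun f hf => ?_⟩⟩⟩
  · rw [← c.inv_lift, A.len_inv]
  · have h1 : A.inv (c.lift f) = c.lift f ↔ H.inv f = f := by
      rw [c.inv_lift]; exact c.lift_injective.eq_iff
    rw [← h1]
    constructor
    · intro h0
      by_contra h2
      exact (hc _).1 ⟨f, rfl⟩ ⟨h0, h2⟩
    · intro h2
      rw [(A.len_eq_zero_iff _).2 h2, map_zero]
  · have := fun h' => hf ((hc f).2 h')
    exact (not_not.1 this).1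

variable {B : StableCurve g n Q} {C : StableCurve g n R}

/-- The contracted edges depend only on `h`, not on the specialization: those whose length goes to
zero. This is the source of all uniqueness of specializations. -/
theorem mem_range_iff (a : CurveContraction h A B) (f : A.F) :
    f ∈ Set.range a.graph.lift ↔ (h (A.len f) = 0 → A.inv f = f) := by
  constructor
  · rintro ⟨e, rfl⟩ h0
    rw [a.len_lift, B.len_eq_zero_iff] at h0
    rw [a.graph.inv_lift, h0]
  · intro h0
    by_contra hf
    exact hf (a.graph.mem_range_of_inv_eq (h0 (a.len_contracted f hf)))

/-- Specializations are cocartesian. -/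
theorem exists_factor (a : CurveContraction h A B) (d : CurveContraction (k.comp h) A C) :
    ∃ e : CurveContraction k B C, a.graph.trans e.graph = d.graph := by
  -- An edge whose length is killed by `h` is killed by the composite with `k`, so `d` contracts
  -- everything that `a` contracts.
  have hr : Set.range d.graph.lift ⊆ Set.range a.graph.lift := by
    intro f hf
    rw [mem_range_iff] at hf ⊢
    intro h0
    refine hf ?_
    change k (h (A.len f)) = 0
    rw [h0, map_zero]
  obtain ⟨e, he⟩ := a.graph.exists_factor d.graph hr
  have hl : ∀ f, a.graph.lift (e.lift f) = d.graph.lift f := fun f => by rw [← he]; rfl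
  refine ⟨⟨e, fun f => ?_, fun f hf => ?_⟩, he⟩
  · rw [← a.len_lift, hl]
    exact d.len_lift f
  · rw [← a.len_lift]
    refine d.len_contracted _ ?_
    rintro ⟨x, hx⟩
    exact hf ⟨x, a.graph.lift_injective ((hl x).trans hx)⟩

end CurveContraction

/-! ### Isomorphisms of graphs and their recovery from the stabilizations. -/

namespace MarkedGraph

namespace Contraction

section Iso

variable {n : ℕ} {A B : MarkedGraph n}

/-- If no flag is contracted, the fibres are connected subgraphs without edges, hence single
vertices. -/
theorem onV_injective (c : Contraction A B) (hl : Function.Surjective c.lift) :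
    Function.Injective c.onV := by
  intro v v' h
  have hr := (c.fiber (c.onV v)).reach v rfl v' h.symm
  clear h
  induction hr with
  | refl => rfl
  | tail _ hf ih =>
    obtain ⟨f, ⟨hf, _⟩, rfl, rfl⟩ := hf
    exact absurd (hl f) hf

theorem weight_onV (c : Contraction A B) (hl : Function.Surjective c.lift) (v : A.V) :
    B.weight (c.onV v) = A.weight v := by
  have h := (c.fiber (c.onV v)).genus
  have hV : {u | c.onV u = c.onV v} = {v} := by
    ext u; exact ⟨fun h => c.onV_injective hl h, fun h => congrArg _ h⟩
  have hF : {f | f ∉ Set.range c.lift ∧ c.onV (A.root f) = c.onV v} = ∅ := by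
    ext f; exact ⟨fun h => h.1 (hl f), fun h => h.elim⟩
  rw [hV, hF, betti_singleton] at h
  exact_mod_cast h.symm

/-- An isomorphism of graphs is a contraction. -/
def ofBijective (onV : A.V → B.V) (hV : Function.Bijective onV) (lift : B.F → A.F)
    (hF : Function.Bijective lift) (onV_root : ∀ f, onV (A.root (lift f)) = B.root f)
    (inv_lift : ∀ f, A.inv (lift f) = lift (B.inv f)) (lift_leg : ∀ i, lift (B.leg i) = A.leg i)
    (hw : ∀ v, A.weight v = B.weight (onV v)) : Contraction A B where
  onV := onV
  lift := lift
  lift_injective := hF.1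
  onV_root := onV_root
  inv_lift := inv_lift
  onV_contracted f hf := absurd (hF.2 f) hf
  lift_leg := lift_leg
  fiber w := by
    obtain ⟨v, rfl⟩ := hV.2 w
    have h1 : {u | onV u = onV v} = {v} := by
      ext u; exact ⟨fun h => hV.1 h, fun h => congrArg _ h⟩
    have h2 : {f | f ∉ Set.range lift ∧ onV (A.root f) = onV v} = ∅ := by
      ext f; exact ⟨fun h => h.1 (hF.2 f), fun h => h.elim⟩
    rw [h1, h2, ← hw]
    exact isConnectedOfGenus_singleton v

/-- The identity contracts no more than `c` does, so it factors through `c`; cancelling `c` shows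
that the factor is a two-sided inverse. -/
theorem exists_inverse (c : Contraction A B) (hl : Function.Surjective c.lift) :
    ∃ d : Contraction B A, c.trans d = .refl A ∧ d.trans c = .refl B ∧
      Function.Surjective d.lift := by
  obtain ⟨d, hd⟩ := c.exists_factor (.refl A) fun f _ => hl f
  have hd' : ∀ f, c.lift (d.lift f) = f := fun f => congrFun (congrArg lift hd) f
  refine ⟨d, hd, c.trans_left_cancel ?_, fun f => ⟨c.lift f, c.lift_injective (hd' _)⟩⟩
  refine ext_lift (fun v => ?_) fun f => hd' _
  exact congrArg c.onV (congrFun (congrArg onV hd) v)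

end Iso

variable {n : ℕ} {A B : MarkedGraph (n + 1)}

theorem root_lift_iff (c : Contraction A B) (hA : A.IsStable) (hB : B.Unstab) (f : B.F) :
    A.root (c.lift f) = A.lastRoot ↔ B.root f = B.lastRoot := by
  rw [← c.onV_root f]
  exact ⟨fun h => h ▸ c.onV_lastRoot, c.fiber_of_unstab hA hB⟩

/-- By stability of `A`, the fibre over a vertex that becomes unstable is one vertex without
contracted flags. The three flags at this vertex are therefore the lifts of those in `B`. -/
theorem _root_.MarkedGraph.Thin.lift (c : Contraction A B) (hA : A.IsStable)
    (hSB : B.Stabilizable) {e₁ e₂ : B.F} (s : B.Thin e₁ e₂) :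
    A.Thin (c.lift e₁) (c.lift e₂) := by
  have hr := c.root_lift_iff hA s.unstab
  obtain ⟨hu, hm⟩ := c.unstab_of_unstab hA hSB s.unstab
  have h2 := hA A.lastRoot
  have hv : 1 ≤ A.val A.lastRoot := one_le_val_lastRoot
  -- Together with instability, valence three leaves no room for a positive weight.
  have hval : A.val A.lastRoot = 3 := by
    have : {f | A.root f = A.lastRoot} = {A.lastLeg, c.lift e₁, c.lift e₂} := by
      ext f
      constructor
      · intro h
        obtain ⟨e, rfl⟩ := hm f h
        rcases s.only e ((hr e).1 h) with rfl | rfl | rfl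
        · exact Or.inl c.lift_lastLeg
        · exact Or.inr (Or.inl rfl)
        · exact Or.inr (Or.inr rfl)
      · rintro (rfl | rfl | rfl)
        · rfl
        · exact (hr _).2 s.root₁
        · exact (hr _).2 s.root₂
    exact Set.ncard_eq_three.2 ⟨_, _, _, (c.lift_ne_lastLeg s.ne₁).symm,
      (c.lift_ne_lastLeg s.ne₂).symm, fun h => s.ne₁₂ (c.lift_injective h), this⟩
  refine ⟨hu, ?_, fun h => s.ne₁₂ (c.lift_injective h), c.lift_ne_lastLeg s.ne₁,
    c.lift_ne_lastLeg s.ne₂, (hr _).2 s.root₁, (hr _).2 s.root₂, ?_, ?_, ?_⟩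
  · unfold Unstab at hu; omega
  · intro f h
    obtain ⟨e, rfl⟩ := hm f h
    rcases s.only e ((hr e).1 h) with rfl | rfl | rfl
    · exact Or.inl c.lift_lastLeg
    · exact Or.inr (Or.inl rfl)
    · exact Or.inr (Or.inr rfl)
  · rw [c.inv_lift]
    exact fun h => s.out₁ ((hr _).1 h)
  · rw [c.inv_lift]
    exact s.out₂.imp (fun h => by rw [h]) fun h h' => h ((hr _).1 h')

theorem stabilize_lift (c : Contraction A B) (hA : A.IsStable) (hSA : A.Stabilizable)
    (hSB : B.Stabilizable) (f : (B.stabilize hSB).F) :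
    ((c.stabilize hA hSA hSB).lift f).1 = A.jump (c.lift f.1) := rfl

/-- A contraction is determined by its stabilization and the set of contracted edges. -/
theorem eq_of_stabilize_eq {c c' : Contraction A B} (hA : A.IsStable) (hSA : A.Stabilizable)
    (hSB : B.Stabilizable) (hr : Set.range c.lift = Set.range c'.lift)
    (h : c.stabilize hA hSA hSB = c'.stabilize hA hSA hSB) : c = c' := by
  have hj : ∀ f, B.Kept f → A.jump (c.lift f) = A.jump (c'.lift f) := fun f hf =>
    congrArg Subtype.val (congrFun (congrArg lift h) ⟨f, hf⟩)
  refine ext_lift (fun v => ?_) fun f => ?_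
  · by_cases hv : A.Unstab → v ≠ A.lastRoot
    · exact congrArg Subtype.val (congrFun (congrArg onV h) ⟨v, hv⟩)
    · push Not at hv
      rw [hv.2, c.onV_lastRoot, c'.onV_lastRoot]
  · by_cases hfl : f = B.lastLeg
    · rw [hfl, c.lift_lastLeg, c'.lift_lastLeg]
    have hl := c.lift_ne_lastLeg hfl
    have hl' := c'.lift_ne_lastLeg hfl
    by_cases huA : A.Unstab
    · obtain ⟨f₁, f₂, t⟩ := hSA huA
      have c1 := t.cases (c.lift f)
      have c2 := t.cases (c'.lift f)
      have j1 := t.jump₁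
      have j2 := t.jump₂
      have hjk : ∀ f, A.Kept f → A.jump f = f := fun f => jump_of_kept
      by_cases huB : B.Unstab
      · obtain ⟨e₁, e₂, s⟩ := hSB huB
        have hk : ∀ f, B.Kept f → c.lift f = c'.lift f := fun f hf => by
          rw [← jump_of_kept (t.kept_iff.2 fun h => s.kept_iff.1 hf ((c.root_lift_iff hA huB f).1 h)),
            hj f hf, jump_of_kept
              (t.kept_iff.2 fun h => s.kept_iff.1 hf ((c'.root_lift_iff hA huB f).1 h))]
        -- The flag `e₁` is recovered from its inverse, which survives. The flag `e₂` may be a leg,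
        -- so it is recovered below by elimination among the three flags at the vertex.
        have he₁ : c.lift e₁ = c'.lift e₁ := by
          rw [← B.inv_inv e₁, ← c.inv_lift, ← c'.inv_lift, hk _ s.kept_inv₁]
        rcases s.cases f with h | h | h | h
        · exact hk f h
        · exact absurd h hfl
        · rw [h, he₁]
        · subst h
          have t1 := (s.lift c hA hSB)
          have t2 := (s.lift c' hA hSB)
          rcases t1.only _ t2.root₂ with h | h | h
          · exact absurd h t2.ne₂
          · exact absurd (h.trans he₁) t2.ne₁₂.symm
          · exact h.symm
      -- Away from the last leg, `jump` can identify only `f₁` with `A.inv f₂` and `f₂` with `A.inv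
      -- f₁`. As the common range is stable under the involution, such a coincidence would put both
      -- `f₁` and `f₂` into it, contrary to `hn`.
      · have hjf := hj f (kept_of_not_unstab huB hfl)
        have hn := c.not_mem_range_of_not_unstab huB t
        have m1 : c.lift f ∈ Set.range c.lift := ⟨f, rfl⟩
        have m2 : c'.lift f ∈ Set.range c.lift := hr ▸ ⟨f, rfl⟩
        have hi : ∀ f, A.inv f ∈ Set.range c.lift ↔ f ∈ Set.range c.lift :=
          fun f => c.inv_mem_range
        grind
    · have huB : ¬ B.Unstab := fun h => huA (c.unstab_of_unstab hA hSB h).1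
      have := hj f (kept_of_not_unstab huB hfl)
      rwa [jump_of_kept (kept_of_not_unstab huA hl), jump_of_kept (kept_of_not_unstab huA hl')]
        at this

section LiftIso

variable {hSA : A.Stabilizable} {hSB : B.Stabilizable}

/-- Total functions replace functions on subtypes in the two constructions below; the values outside
the surviving vertices and flags are arbitrary. -/
theorem exists_extend (ε : Contraction (A.stabilize hSA) (B.stabilize hSB)) :
    ∃ (o : A.V → B.V) (l : B.F → A.F),
      (∀ v : (A.stabilize hSA).V, o v.1 = (ε.onV v).1) ∧
      (∀ f : (B.stabilize hSB).F, l f.1 = (ε.lift f).1) := by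
  classical
  refine ⟨fun v => if hv : A.Unstab → v ≠ A.lastRoot then (ε.onV ⟨v, hv⟩).1 else B.lastRoot,
    fun f => if hf : B.Kept f then (ε.lift ⟨f, hf⟩).1 else A.lastLeg, fun v => ?_, fun f => ?_⟩
  · exact dif_pos v.2
  · exact dif_pos f.2

/-- Stabilization removes nothing but the last leg here. An isomorphism of the stabilizations
extends by sending last leg to last leg, provided that it matches the vertices to which these legs
are attached. -/
theorem exists_iso_of_not_unstab (hA : A.IsStable) (huA : ¬ A.Unstab) (huB : ¬ B.Unstab)
    (ε : Contraction (A.stabilize hSA) (B.stabilize hSB)) (hε : Function.Surjective ε.lift)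
    (hroot : ∀ v, v.1 = A.lastRoot → (ε.onV v).1 = B.lastRoot) :
    ∃ e : Contraction A B, Function.Surjective e.lift ∧ e.stabilize hA hSA hSB = ε := by
  classical
  obtain ⟨o, l, ho, hl⟩ := exists_extend ε
  have kA : ∀ f, A.Kept f ↔ f ≠ A.lastLeg := fun f => ⟨fun h => h.1, kept_of_not_unstab huA⟩
  have kB : ∀ f, B.Kept f ↔ f ≠ B.lastLeg := fun f => ⟨fun h => h.1, kept_of_not_unstab huB⟩
  have ho' : ∀ v, o v = (ε.onV ⟨v, fun h => absurd h huA⟩).1 := fun v => ho ⟨v, _⟩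
  have hl' : ∀ f (hf : f ≠ B.lastLeg), l f = (ε.lift ⟨f, (kB f).2 hf⟩).1 := fun f hf => hl ⟨f, _⟩
  have lne : ∀ f, f ≠ B.lastLeg → l f ≠ A.lastLeg := fun f hf => by
    rw [hl' f hf]; exact (ε.lift _).2.1
  have oroot : o A.lastRoot = B.lastRoot := by rw [ho']; exact hroot _ rfl
  have linj : ∀ f f', f ≠ B.lastLeg → f' ≠ B.lastLeg → l f = l f' → f = f' := by
    intro f f' hf hf' h
    rw [hl' f hf, hl' f' hf'] at h
    exact congrArg Subtype.val (ε.lift_injective (Subtype.ext h))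
  have lroot : ∀ f, f ≠ B.lastLeg → o (A.root (l f)) = B.root f := by
    intro f hf
    rw [ho']
    have := congrArg Subtype.val (ε.onV_root ⟨f, (kB f).2 hf⟩)
    refine Eq.trans ?_ this
    congr 2
    exact Subtype.ext (congrArg A.root (hl' f hf))
  have iA : ∀ f : (A.stabilize hSA).F, ((A.stabilize hSA).inv f).1 = A.inv f.1 := fun f => by
    have hk : A.Kept (A.inv f.1) := (kA _).2 (inv_ne_lastLeg f.2.1)
    rw [stabilize_inv_of_kept f (by rwa [jump_of_kept hk]), jump_of_kept hk]
  have iB : ∀ f : (B.stabilize hSB).F, ((B.stabilize hSB).inv f).1 = B.inv f.1 := fun f => by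
    have hk : B.Kept (B.inv f.1) := (kB _).2 (inv_ne_lastLeg f.2.1)
    rw [stabilize_inv_of_kept f (by rwa [jump_of_kept hk]), jump_of_kept hk]
  have linv : ∀ f, f ≠ B.lastLeg → A.inv (l f) = l (B.inv f) := by
    intro f hf
    have := congrArg Subtype.val (ε.inv_lift ⟨f, (kB f).2 hf⟩)
    rw [iA, ← hl] at this
    rw [hl' f hf]
    exact this.trans (congrArg l (iB _))
  have lsurj : ∀ f, f ≠ A.lastLeg → ∃ e, e ≠ B.lastLeg ∧ l e = f := by
    intro f hf
    obtain ⟨e, he⟩ := hε ⟨f, (kA f).2 hf⟩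
    exact ⟨e.1, e.2.1, (hl e).trans (congrArg Subtype.val he)⟩
  let e : Contraction A B := ofBijective o
    ⟨fun v v' h => by
      rw [ho', ho'] at h
      exact congrArg Subtype.val (ε.onV_injective hε (Subtype.ext h)), fun w => by
      obtain ⟨v, hv⟩ := ε.onV_surjective ⟨w, fun h => absurd h huB⟩
      exact ⟨v.1, (ho v).trans (congrArg Subtype.val hv)⟩⟩
    (fun f => if f = B.lastLeg then A.lastLeg else l f)
    ⟨fun f f' h => by
      dsimp only at h
      split_ifs at h with h1 h2 h2
      · rw [h1, h2]
      · exact absurd h.symm (lne _ h2)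
      · exact absurd h (lne _ h1)
      · exact linj _ _ h1 h2 h, fun f => by
      by_cases hf : f = A.lastLeg
      · exact ⟨B.lastLeg, (if_pos rfl).trans hf.symm⟩
      · obtain ⟨e, he, rfl⟩ := lsurj f hf
        exact ⟨e, if_neg he⟩⟩
    (fun f => by
      split_ifs with hf
      · rw [hf]; exact oroot
      · exact lroot f hf)
    (fun f => by
      by_cases hf : f = B.lastLeg
      · rw [if_pos hf, hf, inv_lastLeg, inv_lastLeg, if_pos rfl]
      · rw [if_neg hf, if_neg (inv_ne_lastLeg hf), linv f hf])
    (fun i => by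
      induction i using Fin.lastCases with
      | last => exact if_pos rfl
      | cast i =>
        have h1 : B.leg i.castSucc ≠ B.lastLeg := fun h =>
          absurd (B.leg_injective h) (Fin.castSucc_lt_last i).ne
        have h2 : A.leg i.castSucc ≠ A.lastLeg := fun h =>
          absurd (A.leg_injective h) (Fin.castSucc_lt_last i).ne
        rw [if_neg h1]
        have h3 := congrArg Subtype.val (ε.lift_leg i)
        rw [← hl] at h3
        have e1 : ((B.stabilize hSB).leg i).1 = B.leg i.castSucc := jump_of_kept ((kB _).2 h1)
        have e2 : ((A.stabilize hSA).leg i).1 = A.leg i.castSucc := jump_of_kept ((kA _).2 h2)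
        rwa [e1, e2] at h3)
    (fun v => by
      rw [ho']
      exact (ε.weight_onV hε ⟨v, fun h => absurd h huA⟩).symm)
  have hel : ∀ f, f ≠ B.lastLeg → e.lift f = l f := fun f hf => if_neg hf
  refine ⟨e, fun f => ?_, ext_lift (fun v => Subtype.ext (ho v)) fun f => Subtype.ext ?_⟩
  · by_cases hf : f = A.lastLeg
    · exact ⟨B.lastLeg, by rw [e.lift_lastLeg, hf]⟩
    · obtain ⟨x, hx, rfl⟩ := lsurj f hf
      exact ⟨x, hel x hx⟩
  · rw [stabilize_lift, hel _ f.2.1, hl, jump_of_kept (ε.lift f).2]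

/-- The stabilization forgets one vertex and its three flags. An isomorphism of the stabilizations
extends over them as soon as it matches the subdivided edges or legs with their orientation, which
is what `h₁` expresses. -/
theorem exists_iso_of_thin (hA : A.IsStable)
    {f₁ f₂ : A.F} (t : A.Thin f₁ f₂) {e₁ e₂ : B.F} (s : B.Thin e₁ e₂)
    (ε : Contraction (A.stabilize hSA) (B.stabilize hSB)) (hε : Function.Surjective ε.lift)
    (h₁ : (ε.lift ⟨B.inv e₁, s.kept_inv₁⟩).1 = A.inv f₁) :
    ∃ e : Contraction A B, Function.Surjective e.lift ∧ e.stabilize hA hSA hSB = ε ∧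
      e.lift e₁ = f₁ ∧ e.lift e₂ = f₂ := by
  classical
  obtain ⟨o, l, ho, hl⟩ := exists_extend ε
  have hk : ∀ {f}, A.Kept f ↔ A.root f ≠ A.lastRoot := t.kept_iff
  have hk' : ∀ {f}, B.Kept f ↔ B.root f ≠ B.lastRoot := s.kept_iff
  have cA := t.cases
  have cB := s.cases
  have ho' : ∀ v (hv : v ≠ A.lastRoot), o v = (ε.onV ⟨v, fun _ => hv⟩).1 := fun v hv => ho ⟨v, _⟩
  have hl' : ∀ f (hf : B.Kept f), l f = (ε.lift ⟨f, hf⟩).1 := fun f hf => hl ⟨f, _⟩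
  have lk : ∀ f, B.Kept f → A.Kept (l f) := fun f hf => by rw [hl' f hf]; exact (ε.lift _).2
  have ok : ∀ v, v ≠ A.lastRoot → o v ≠ B.lastRoot := fun v hv => by
    rw [ho' v hv]; exact (ε.onV _).2 s.unstab
  have linj : ∀ f f', B.Kept f → B.Kept f' → l f = l f' → f = f' := by
    intro f f' hf hf' h
    rw [hl' f hf, hl' f' hf'] at h
    exact congrArg Subtype.val (ε.lift_injective (Subtype.ext h))
  have oinj : ∀ v v', v ≠ A.lastRoot → v' ≠ A.lastRoot → o v = o v' → v = v' := by
    intro v v' hv hv' h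
    rw [ho' v hv, ho' v' hv'] at h
    exact congrArg Subtype.val (ε.onV_injective hε (Subtype.ext h))
  have lroot : ∀ f, B.Kept f → o (A.root (l f)) = B.root f := by
    intro f hf
    have := congrArg Subtype.val (ε.onV_root ⟨f, hf⟩)
    refine Eq.trans ?_ this
    rw [hl' f hf]
    exact ho ((A.stabilize hSA).root (ε.lift ⟨f, hf⟩))
  have iA := fun f : (A.stabilize hSA).F => stabilize_inv_of_kept f
  have iA' := fun (f : (A.stabilize hSA).F) h =>
    congrArg Subtype.val (stabilize_inv_of_not_kept f h)
  have linv : ∀ f, B.Kept f →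
      (A.Kept (A.jump (A.inv (l f))) ∧ B.Kept (B.jump (B.inv f)) ∧
        A.jump (A.inv (l f)) = l (B.jump (B.inv f))) ∨
      (A.Kept (A.jump (A.inv (l f))) ∧ ¬ B.Kept (B.jump (B.inv f)) ∧
        A.jump (A.inv (l f)) = l f) ∨
      (¬ A.Kept (A.jump (A.inv (l f))) ∧ B.Kept (B.jump (B.inv f)) ∧
        l f = l (B.jump (B.inv f))) ∨
      (¬ A.Kept (A.jump (A.inv (l f))) ∧ ¬ B.Kept (B.jump (B.inv f))) := by
    intro f hf
    have h1 : ((A.stabilize hSA).inv (ε.lift ⟨f, hf⟩)).1 = l ((B.stabilize hSB).inv ⟨f, hf⟩).1 :=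
      (congrArg Subtype.val (ε.inv_lift ⟨f, hf⟩)).trans (hl _).symm
    rw [hl' f hf]
    by_cases a : A.Kept (A.jump (A.inv (ε.lift ⟨f, hf⟩).1)) <;> by_cases b : B.Kept (B.jump (B.inv f))
    · exact Or.inl ⟨a, b, (iA _ a).symm.trans (h1.trans (congrArg l
        (stabilize_inv_of_kept (hG := hSB) ⟨f, hf⟩ b)))⟩
    · exact Or.inr (Or.inl ⟨a, b, (iA _ a).symm.trans (h1.trans ((congrArg l (congrArg Subtype.val
        (stabilize_inv_of_not_kept (hG := hSB) ⟨f, hf⟩ b))).trans (hl' f hf)))⟩)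
    · exact Or.inr (Or.inr (Or.inl ⟨a, b, (iA' _ a).symm.trans (h1.trans (congrArg l
        (stabilize_inv_of_kept (hG := hSB) ⟨f, hf⟩ b)))⟩))
    · exact Or.inr (Or.inr (Or.inr ⟨a, b⟩))
  have lsurj : ∀ f, A.Kept f → ∃ e, B.Kept e ∧ l e = f := by
    intro f hf
    obtain ⟨e, he⟩ := hε ⟨f, hf⟩
    exact ⟨e.1, e.2, (hl e).trans (congrArg Subtype.val he)⟩
  have lleg : ∀ i : Fin n, l (B.jump (B.leg i.castSucc)) = A.jump (A.leg i.castSucc) :=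
    fun i => (hl ((B.stabilize hSB).leg i)).trans (congrArg Subtype.val (ε.lift_leg i))
  have lk₁ : l (B.inv e₁) = A.inv f₁ := (hl' _ s.kept_inv₁).trans h₁
  have a1 := A.inv_inv
  have b1 := B.inv_inv
  have a2 : ∀ f, A.Kept f → A.jump f = f := fun f => jump_of_kept
  have b2 : ∀ f, B.Kept f → B.jump f = f := fun f => jump_of_kept
  have a3 := t.jump₁
  have a4 := t.jump₂
  have b3 := s.jump₁
  have b4 := s.jump₂
  have a5 := t.not_kept₁
  have a6 := t.not_kept₂
  have b5 := s.not_kept₁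
  have b6 := s.not_kept₂
  have a7 := t.kept_inv₁
  have b7 := s.kept_inv₁
  have a8 : A.inv f₂ = f₂ ∨ A.Kept (A.inv f₂) := by rw [hk]; exact t.out₂
  have b8 : B.inv e₂ = e₂ ∨ B.Kept (B.inv e₂) := by rw [hk']; exact s.out₂
  have a9 : A.inv A.lastLeg = A.lastLeg := inv_lastLeg
  have b9 : B.inv B.lastLeg = B.lastLeg := inv_lastLeg
  have a10 : ¬ A.Kept A.lastLeg := fun h => h.1 rfl
  have b10 : ¬ B.Kept B.lastLeg := fun h => h.1 rfl
  have a11 := t.ne₁₂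
  have a12 := t.ne₁
  have a13 := t.ne₂
  have b11 := s.ne₁₂
  have b12 := s.ne₁
  have b13 := s.ne₂
  -- Only one end of the subdivided edge is matched by hypothesis. Applying the involutions of the
  -- stabilizations to it matches the other end, or shows that `f₂` and `e₂` are both legs.
  have lk₂ : (A.inv f₂ = f₂ ∧ B.inv e₂ = e₂) ∨
      (A.Kept (A.inv f₂) ∧ B.Kept (B.inv e₂) ∧ l (B.inv e₂) = A.inv f₂) := by
    have := linv _ s.kept_inv₁
    rw [lk₁, a1, a3, b1, b3] at this
    rcases a8 with a8 | a8 <;> rcases b8 with b8 | b8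
    · exact Or.inl ⟨a8, b8⟩
    · grind
    · grind
    · exact Or.inr ⟨a8, b8, by grind⟩
  obtain ⟨L, hL⟩ : ∃ L : B.F → A.F, (∀ f, B.Kept f → L f = l f) ∧ L B.lastLeg = A.lastLeg ∧
      L e₁ = f₁ ∧ L e₂ = f₂ :=
    ⟨fun f => if B.Kept f then l f else if f = e₁ then f₁ else if f = e₂ then f₂ else A.lastLeg,
      fun f hf => if_pos hf, by simp [b10, b12.symm, b13.symm], by simp [b5],
      by simp [b6, b11.symm]⟩
  obtain ⟨hL1, hL2, hL3, hL4⟩ := hL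
  have hroots : ∀ f, A.Kept f ↔ A.root f ≠ A.lastRoot := fun f => hk
  obtain ⟨O, hO1, hO2⟩ : ∃ O : A.V → B.V, (∀ v, v ≠ A.lastRoot → O v = o v) ∧
      O A.lastRoot = B.lastRoot :=
    ⟨fun v => if v = A.lastRoot then B.lastRoot else o v, fun v hv => if_neg hv, if_pos rfl⟩
  have Lsurj : Function.Surjective L := fun f => by
    rcases cA f with h | h | h | h
    · obtain ⟨x, hx, rfl⟩ := lsurj f h
      exact ⟨x, hL1 x hx⟩
    · exact ⟨_, hL2.trans h.symm⟩
    · exact ⟨_, hL3.trans h.symm⟩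
    · exact ⟨_, hL4.trans h.symm⟩
  let e : Contraction A B := ofBijective O
    ⟨fun v v' h => by
      by_cases hv : v = A.lastRoot <;> by_cases hv' : v' = A.lastRoot
      · rw [hv, hv']
      · rw [hv, hO2, hO1 _ hv'] at h; exact absurd h.symm (ok _ hv')
      · rw [hv', hO2, hO1 _ hv] at h; exact absurd h (ok _ hv)
      · rw [hO1 _ hv, hO1 _ hv'] at h; exact oinj _ _ hv hv' h, fun w => by
      by_cases hw : w = B.lastRoot
      · exact ⟨_, hO2.trans hw.symm⟩
      · obtain ⟨v, hv⟩ := ε.onV_surjective ⟨w, fun _ => hw⟩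
        exact ⟨v.1, (hO1 _ (v.2 t.unstab)).trans ((ho v).trans (congrArg Subtype.val hv))⟩⟩
    L ⟨fun f f' h => by
      have c1 := cB f
      have c2 := cB f'
      have d1 := lk f
      have d2 := lk f'
      have d3 := hL1 f
      have d4 := hL1 f'
      have d5 := linj f f'
      grind, Lsurj⟩
    (fun f => by
      rcases cB f with h | h | h | h
      · rw [hL1 f h, hO1 _ (hk.1 (lk f h)), lroot f h]
      · rw [h, hL2]; exact hO2
      · rw [h, hL3, t.root₁, hO2, s.root₁]
      · rw [h, hL4, t.root₂, hO2, s.root₂])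
    (fun f => by
      -- If `A.inv (l f)` were one of the removed flags, injectivity of `l` would make `f` the
      -- inverse of `e₁` or `e₂`, contradicting that `B.inv f` survives.
      have hLi : B.Kept f → B.Kept (B.inv f) → A.inv (l f) = l (B.inv f) := by
        intro h h'
        have c1 := linv f h
        have c2 := cA (A.inv (l f))
        have c3 := lk f h
        have c4 := lk _ h'
        have c5 := linj f (B.inv f) h h'
        have c6 := fun h'' => linj (B.inv e₁) f b7 h h''
        have c7 := linj (B.inv e₂) f
        rw [b2 _ h'] at c1
        grind
      rcases cB f with h | h | h | h
      · rcases cB (B.inv f) with h' | h' | h' | h'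
        · rw [hL1 f h, hL1 _ h', hLi h h']
        · grind
        · have : f = B.inv e₁ := by grind
          grind
        · have : f = B.inv e₂ := by grind
          grind
      · grind
      · grind
      · grind)
    (fun i => by
      induction i using Fin.lastCases with
      | last => exact hL2
      | cast i =>
        have h1 : B.leg i.castSucc ≠ B.lastLeg := fun h =>
          absurd (B.leg_injective h) (Fin.castSucc_lt_last i).ne
        have h2 : A.leg i.castSucc ≠ A.lastLeg := fun h =>
          absurd (A.leg_injective h) (Fin.castSucc_lt_last i).ne
        have h3 : B.inv (B.leg i.castSucc) = B.leg i.castSucc := (B.isLeg_iff _).2 ⟨_, rfl⟩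
        have h4 : A.inv (A.leg i.castSucc) = A.leg i.castSucc := (A.isLeg_iff _).2 ⟨_, rfl⟩
        have h5 := lleg i
        have c1 := cA (A.leg i.castSucc)
        have c2 := cB (B.leg i.castSucc)
        have c3 := linj (B.inv e₁) (B.leg i.castSucc) b7
        grind)
    (fun v => by
      by_cases hv : v = A.lastRoot
      · rw [hv, hO2, t.weight_eq, s.weight_eq]
      · rw [hO1 v hv, ho' v hv]
        exact (ε.weight_onV hε ⟨v, fun _ => hv⟩).symm)
  refine ⟨e, Lsurj, ext_lift (fun v => Subtype.ext ((hO1 _ (v.2 t.unstab)).trans (ho v)))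
    fun f => Subtype.ext ?_, hL3, hL4⟩
  rw [stabilize_lift]
  change A.jump (L f.1) = _
  rw [hL1 _ f.2, a2 _ (lk _ f.2), hl]

end LiftIso

end Contraction

end MarkedGraph

/-! ### Adding a leg at a vertex or in the interior of an edge or leg. -/

namespace MarkedGraph

variable {n : ℕ} (G : MarkedGraph n)

/-- The graph with an additional leg at the vertex `v`. -/
def attachLeg (v : G.V) : MarkedGraph (n + 1) where
  V := G.V
  F := Option G.F
  root f := f.elim v G.root
  inv f := f.map G.inv
  inv_inv f := by cases f <;> simp [G.inv_inv]
  weight := G.weight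
  leg := Fin.snoc (α := fun _ => Option G.F) (fun i => some (G.leg i)) none
  leg_injective i j h := by
    induction i using Fin.lastCases <;> induction j using Fin.lastCases
    · rfl
    · simp at h
    · simp at h
    · simp only [Fin.snoc_castSucc, Option.some.injEq] at h
      rw [G.leg_injective h]
  isLeg_iff f := by
    constructor
    · intro h
      cases f with
      | none => exact ⟨Fin.last n, by simp⟩
      | some f =>
        obtain ⟨i, rfl⟩ := (G.isLeg_iff f).1 (Option.some_injective _ h)
        exact ⟨i.castSucc, by simp⟩
    · rintro ⟨i, rfl⟩
      induction i using Fin.lastCases with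
      | last => simp
      | cast i => simpa using (G.isLeg_iff _).2 ⟨i, rfl⟩

section AttachLeg

variable {G} (v : G.V)

theorem attachLeg_lastLeg : (G.attachLeg v).lastLeg = none :=
  Fin.snoc_last (n := n) (α := fun _ => Option G.F) none fun i => some (G.leg i)

theorem attachLeg_lastRoot : (G.attachLeg v).lastRoot = v := by
  rw [lastRoot, attachLeg_lastLeg]; rfl

theorem attachLeg_isConnectedOfGenus {k : ℕ} (h : G.IsConnectedOfGenus Set.univ {f | G.inv f ≠ f} k) :
    (G.attachLeg v).IsConnectedOfGenus Set.univ {f | (G.attachLeg v).inv f ≠ f} k := by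
  refine ⟨⟨v, trivial⟩, fun a _ b _ => ?_, ?_⟩
  · refine Relation.ReflTransGen.mono ?_ _ _ (h.reach a trivial b trivial)
    rintro a b ⟨f, hf, h1, h2⟩
    exact ⟨some f, fun h => hf (Option.some_injective _ h), h1, h2⟩
  · refine Eq.trans ?_ h.genus
    have hF : {f | (G.attachLeg v).inv f ≠ f} = some '' {f | G.inv f ≠ f} := ?_
    · refine congrArg (· + _) (congrArg (fun k : ℕ => (k : ℚ) / 2 - _ + 1) ?_)
      exact (congrArg Set.ncard hF).trans
        (Set.ncard_image_of_injective _ (Option.some_injective G.F))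
    ext f
    cases f with
    | none =>
      exact ⟨fun h => absurd rfl h, fun ⟨f, _, h⟩ => absurd h (Option.some_ne_none _)⟩
    | some f =>
      constructor
      · exact fun h => ⟨f, fun h' => h (congrArg some h'), rfl⟩
      · rintro ⟨f, h, ⟨⟩⟩
        exact fun h' => h (Option.some_injective _ h')

theorem le_val_attachLeg (w : G.V) : G.val w ≤ (G.attachLeg v).val w := by
  refine (Set.ncard_image_of_injective _ (Option.some_injective G.F)).symm.le.trans
    (Set.ncard_le_ncard ?_ (Set.toFinite _))
  rintro _ ⟨f, hf, rfl⟩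
  exact hf

theorem attachLeg_isStable (h : G.IsStable) : (G.attachLeg v).IsStable := fun w =>
  lt_of_lt_of_le (h w) (Nat.add_le_add_left (le_val_attachLeg v w) _)

/-- The new leg raises the valence of `v` by one, so removing it restores a stable vertex. -/
theorem attachLeg_not_unstab (h : G.IsStable) : ¬ (G.attachLeg v).Unstab := by
  unfold Unstab
  rw [attachLeg_lastRoot]
  have h1 : G.val v + 1 ≤ (G.attachLeg v).val v := by
    have h2 : (insert none (some '' {f | G.root f = v}) : Set (Option G.F)).ncard = G.val v + 1 := by
      rw [Set.ncard_insert_of_notMem (by simp) (Set.toFinite _),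
        Set.ncard_image_of_injective _ (Option.some_injective G.F)]
      rfl
    rw [← h2]
    refine Set.ncard_le_ncard ?_ (Set.toFinite _)
    rintro _ (rfl | ⟨f, hf, rfl⟩)
    · rfl
    · exact hf
  have h3 := h v
  have h4 : (G.attachLeg v).weight v = G.weight v := rfl
  omega

end AttachLeg

open Classical in
/-- The graph with an additional leg at a new vertex in the interior of the edge or leg to which
the flag `e` belongs.  The flags at the new vertex are `Sum.inr 0` (the new leg), `Sum.inr 1`
(towards the root of `e`) and `Sum.inr 2`. -/
noncomputable def subdivide (e : G.F) : MarkedGraph (n + 1) where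
  V := Option G.V
  F := G.F ⊕ Fin 3
  root := Sum.elim (fun f => some (G.root f)) fun _ => none
  inv := Sum.elim
    (fun f => if f = e then Sum.inr 1 else if f = G.inv e then Sum.inr 2 else Sum.inl (G.inv f))
    ![Sum.inr 0, Sum.inl e, if G.inv e = e then Sum.inr 2 else Sum.inl (G.inv e)]
  inv_inv f := by
    have := G.inv_inv
    rcases f with f | f
    · simp only [Sum.elim_inl]
      split_ifs <;> simp <;> grind
    · fin_cases f <;> simp
      split_ifs <;> simp
      grind
  weight v := v.elim 0 G.weight
  leg := Fin.snoc (α := fun _ => G.F ⊕ Fin 3)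
    (fun i => if G.leg i = e then Sum.inr 2 else Sum.inl (G.leg i)) (Sum.inr 0)
  leg_injective i j h := by
    have := G.leg_injective
    induction i using Fin.lastCases <;> induction j using Fin.lastCases
    · rfl
    · simp at h; grind
    · simp at h; grind
    · simp only [Fin.snoc_castSucc] at h
      split_ifs at h with h1 h2 h2
      · rw [G.leg_injective (h1.trans h2.symm)]
      · rw [G.leg_injective (Sum.inl_injective h)]
  isLeg_iff f := by
    have h0 := G.isLeg_iff
    have h1 := G.inv_inv
    constructor
    · intro h
      rcases f with f | f
      · simp only [Sum.elim_inl] at h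
        split_ifs at h with h1 h2
        obtain ⟨i, rfl⟩ := (h0 f).1 (Sum.inl_injective h)
        exact ⟨i.castSucc, by simp [h1]⟩
      · fin_cases f
        · exact ⟨Fin.last n, by simp⟩
        · simp at h
        · simp at h
          obtain ⟨i, rfl⟩ := (h0 e).1 h
          exact ⟨i.castSucc, by simp⟩
    · rintro ⟨i, rfl⟩
      induction i using Fin.lastCases with
      | last => simp
      | cast i =>
        have h2 := (h0 _).2 ⟨i, rfl⟩
        rw [Fin.snoc_castSucc]
        by_cases h3 : G.leg i = e
        · rw [if_pos h3, ← h3, h2]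
          simp
        · rw [if_neg h3]
          simp only [Sum.elim_inl]
          grind

section Subdivide

variable {G} (e : G.F)

theorem subdivide_lastLeg : (G.subdivide e).lastLeg = Sum.inr 0 := by
  classical
  exact Fin.snoc_last (n := n) (α := fun _ => G.F ⊕ Fin 3) (Sum.inr 0)
    fun i => if G.leg i = e then Sum.inr 2 else Sum.inl (G.leg i)

theorem subdivide_lastRoot : (G.subdivide e).lastRoot = none := by
  rw [lastRoot, subdivide_lastLeg]; rfl

theorem subdivide_inv_one : (G.subdivide e).inv (Sum.inr 1) = Sum.inl e := rfl

theorem subdivide_inv_two_of_eq (h : G.inv e = e) : (G.subdivide e).inv (Sum.inr 2) = Sum.inr 2 :=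
  if_pos h

theorem subdivide_inv_two_of_ne (h : G.inv e ≠ e) :
    (G.subdivide e).inv (Sum.inr 2) = Sum.inl (G.inv e) := if_neg h

theorem subdivide_inv_self : (G.subdivide e).inv (Sum.inl e) = Sum.inr 1 := if_pos rfl

theorem subdivide_inv_inv (h : G.inv e ≠ e) :
    (G.subdivide e).inv (Sum.inl (G.inv e)) = Sum.inr 2 := (if_neg h).trans (if_pos rfl)

theorem subdivide_inv_of_ne {f : G.F} (h : f ≠ e) (h' : f ≠ G.inv e) :
    (G.subdivide e).inv (Sum.inl f) = Sum.inl (G.inv f) := (if_neg h).trans (if_neg h')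

/-- The new vertex has weight zero, and the number of edges also rises by one, whether an edge or a
leg is subdivided; so the genus is unchanged. A crossing of the old edge becomes a path through the
new vertex. -/
theorem subdivide_isConnectedOfGenus {k : ℕ}
    (h : G.IsConnectedOfGenus Set.univ {f | G.inv f ≠ f} k) :
    (G.subdivide e).IsConnectedOfGenus Set.univ {f | (G.subdivide e).inv f ≠ f} k := by
  have hs : ∀ f, (G.subdivide e).inv f ≠ f → (G.subdivide e).Reach
      {f | (G.subdivide e).inv f ≠ f} ((G.subdivide e).root f)
      ((G.subdivide e).root ((G.subdivide e).inv f)) := fun f hf => Reach.step hf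
  have h1 : (G.subdivide e).Reach {f | (G.subdivide e).inv f ≠ f} none (some (G.root e)) :=
    hs (Sum.inr 1) (by rw [subdivide_inv_one]; exact Sum.inl_ne_inr)
  have h1' : (G.subdivide e).Reach {f | (G.subdivide e).inv f ≠ f} (some (G.root e)) none := by
    have := hs (Sum.inl e) (by rw [subdivide_inv_self]; exact Sum.inr_ne_inl)
    rwa [subdivide_inv_self] at this
  have hold : ∀ a b, (G.subdivide e).Reach {f | (G.subdivide e).inv f ≠ f} (some a) (some b) := by
    intro a b
    have hr := h.reach a trivial b trivial
    induction hr with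
    | refl => exact Relation.ReflTransGen.refl
    | tail _ hf ih =>
      obtain ⟨f, hf, rfl, rfl⟩ := hf
      refine ih.trans ?_
      by_cases h2 : f = e
      · subst h2
        have := hs (Sum.inr 2) (by rw [subdivide_inv_two_of_ne f hf]; exact Sum.inl_ne_inr)
        rw [subdivide_inv_two_of_ne f hf] at this
        exact h1'.trans this
      · by_cases h3 : f = G.inv e
        · subst h3
          have he : G.inv e ≠ e := h2
          have := hs (Sum.inl (G.inv e)) (by rw [subdivide_inv_inv e he]; exact Sum.inr_ne_inl)
          rw [subdivide_inv_inv e he] at this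
          rw [G.inv_inv]
          exact Relation.ReflTransGen.trans this h1
        · have := hs (Sum.inl f) (by
            rw [subdivide_inv_of_ne e h2 h3]; exact fun h => hf (Sum.inl_injective h))
          rwa [subdivide_inv_of_ne e h2 h3] at this
  refine ⟨⟨none, trivial⟩, ?_, ?_⟩
  · rintro (_ | a) _ (_ | b) _
    · exact Relation.ReflTransGen.refl
    · exact h1.trans (hold _ _)
    · exact (hold _ _).trans h1'
    · exact hold _ _
  · have hg := (genus_eq_iff _ _ _ _).1 h.genus
    rw [genus_eq_iff, ← hg]
    have hV : ∑ v, ind (v ∈ (Set.univ : Set (G.subdivide e).V)) *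
        (((G.subdivide e).weight v : ℚ) - 1)
        = ∑ v, ind (v ∈ (Set.univ : Set G.V)) * ((G.weight v : ℚ) - 1) - 1 := by
      refine (Fintype.sum_option (α := G.V) _).trans ?_
      have h1 : ind ((none : (G.subdivide e).V) ∈ Set.univ) *
          (((G.subdivide e).weight none : ℚ) - 1) = -1 := by
        have : ((G.subdivide e).weight none : ℚ) = 0 := Nat.cast_zero
        rw [this, ind_true (Set.mem_univ _)]; norm_num
      have h2 : ∀ v, ind ((some v : (G.subdivide e).V) ∈ Set.univ) *
          (((G.subdivide e).weight (some v) : ℚ) - 1) =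
          ind (v ∈ (Set.univ : Set G.V)) * ((G.weight v : ℚ) - 1) := fun v => by
        rw [ind_true (Set.mem_univ _), ind_true (Set.mem_univ _)]; rfl
      refine (congrArg₂ (· + ·) h1 (Finset.sum_congr rfl fun v _ => h2 v)).trans ?_
      ring
    have hF : ∑ f, ind (f ∈ {f | (G.subdivide e).inv f ≠ f})
        = ∑ f, ind (f ∈ {f | G.inv f ≠ f}) + 2 := by
      classical
      obtain ⟨y, hy⟩ : ∃ y : G.F ⊕ Fin 3 → ℚ, ∀ f, y f = ind ((G.subdivide e).inv f ≠ f) :=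
        ⟨_, fun f => rfl⟩
      have hsum : ∑ f, ind (f ∈ {f | (G.subdivide e).inv f ≠ f}) =
          ∑ f, y (Sum.inl f) + (y (Sum.inr 0) + y (Sum.inr 1) + y (Sum.inr 2)) := by
        rw [← Fin.sum_univ_three (fun i => y (Sum.inr i)), ← Fintype.sum_sum_type]
        exact Finset.sum_congr rfl fun f _ => (hy f).symm
      have y0 : y (Sum.inr 0) = 0 := (hy _).trans (ind_false fun h => h rfl)
      have y1 : y (Sum.inr 1) = 1 := (hy _).trans (ind_true (by
        rw [subdivide_inv_one]; exact Sum.inl_ne_inr))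
      rw [hsum, y0, y1]
      -- The two additional flags that belong to edges are `Sum.inr 1` together with `Sum.inl e`,
      -- formerly a leg, in the case of a leg, and `Sum.inr 1` together with `Sum.inr 2` in the case
      -- of an edge.
      by_cases he : G.inv e = e
      · have y2 : y (Sum.inr 2) = 0 :=
          (hy _).trans (ind_false fun h => h (subdivide_inv_two_of_eq e he))
        have : ∀ f, y (Sum.inl f) = ind (f ∈ {f | G.inv f ≠ f}) + if f = e then 1 else 0 := by
          intro f
          by_cases hf : f = e
          · rw [if_pos hf, hf, ind_false (p := e ∈ {f | G.inv f ≠ f}) (fun h => h he), hy,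
              ind_true]
            · ring
            · rw [subdivide_inv_self]; exact Sum.inr_ne_inl
          · rw [if_neg hf, add_zero, hy]
            refine ind_congr ?_
            rw [subdivide_inv_of_ne e hf (by rwa [he])]
            exact not_congr Sum.inl_injective.eq_iff
        simp_rw [this, y2]
        rw [Finset.sum_add_distrib]
        simp; ring
      · have y2 : y (Sum.inr 2) = 1 := (hy _).trans (ind_true (by
          rw [subdivide_inv_two_of_ne e he]; exact Sum.inl_ne_inr))
        have : ∀ f, y (Sum.inl f) = ind (f ∈ {f | G.inv f ≠ f}) := by
          intro f
          rw [hy]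
          refine ind_congr ?_
          change _ ↔ G.inv f ≠ f
          by_cases hf : f = e
          · rw [hf, subdivide_inv_self]
            exact ⟨fun _ => he, fun _ => Sum.inr_ne_inl⟩
          · by_cases hf' : f = G.inv e
            · rw [hf', subdivide_inv_inv e he, G.inv_inv]
              exact ⟨fun _ => Ne.symm he, fun _ => Sum.inr_ne_inl⟩
            · rw [subdivide_inv_of_ne e hf hf']
              exact not_congr Sum.inl_injective.eq_iff
        simp_rw [this, y2]
        ring
    rw [hV, hF]
    ring

theorem subdivide_val_none : (G.subdivide e).val none = 3 := by
  refine Eq.trans (congrArg Set.ncard (?_ : _ = Set.range (Sum.inr : Fin 3 → G.F ⊕ Fin 3))) ?_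
  · ext f
    constructor
    · rcases f with f | f
      · exact fun h => absurd h (Option.some_ne_none _)
      · exact fun _ => ⟨f, rfl⟩
    · rintro ⟨i, rfl⟩; rfl
  · refine (congrArg Set.ncard Set.image_univ.symm).trans
      ((Set.ncard_image_of_injective _ Sum.inr_injective).trans ?_)
    simp

theorem subdivide_isStable (h : G.IsStable) : (G.subdivide e).IsStable := by
  rintro (_ | v)
  · rw [subdivide_val_none]; omega
  · refine lt_of_lt_of_le (h v) (Nat.add_le_add_left ?_ _)
    refine (Set.ncard_image_of_injective _ (Sum.inl_injective (α := G.F) (β := Fin 3))).symm.le.trans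
      (Set.ncard_le_ncard ?_ (Set.toFinite _))
    rintro _ ⟨f, hf, rfl⟩
    exact congrArg some hf

/-- The order of the two flags matters: the one towards the root of `e` always belongs to an edge,
while the other is a leg if `e` is one. -/
theorem subdivide_thin : (G.subdivide e).Thin (Sum.inr 1) (Sum.inr 2) := by
  have hl := subdivide_lastLeg e
  have hr := subdivide_lastRoot e
  refine ⟨?_, ?_, ?_, ?_, ?_, ?_, ?_, ?_, ?_, ?_⟩
  · unfold Unstab
    rw [hr, subdivide_val_none]
    exact le_refl 2
  · rw [hr]; rfl
  · exact fun h => absurd (Sum.inr_injective h) (by decide)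
  · rw [hl]; exact fun h => absurd (Sum.inr_injective h) (by decide)
  · rw [hl]; exact fun h => absurd (Sum.inr_injective h) (by decide)
  · rw [hr]; rfl
  · rw [hr]; rfl
  · intro f hf
    rw [hr] at hf
    rw [hl]
    rcases f with f | f
    · exact absurd hf (Option.some_ne_none _)
    · fin_cases f
      · exact Or.inl rfl
      · exact Or.inr (Or.inl rfl)
      · exact Or.inr (Or.inr rfl)
  · rw [hr, subdivide_inv_one]; exact Option.some_ne_none _
  · by_cases he : G.inv e = e
    · exact Or.inl (subdivide_inv_two_of_eq e he)
    · right
      rw [hr, subdivide_inv_two_of_ne e he]; exact Option.some_ne_none _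

theorem subdivide_kept_iff (f : (G.subdivide e).F) :
    (G.subdivide e).Kept f ↔ ∃ f' : G.F, f = Sum.inl f' := by
  rw [(subdivide_thin e).kept_iff, subdivide_lastRoot]
  rcases f with f | f
  · exact ⟨fun _ => ⟨f, rfl⟩, fun _ => Option.some_ne_none _⟩
  · exact ⟨fun h => absurd rfl h, fun ⟨f', h⟩ => absurd h Sum.inr_ne_inl⟩

end Subdivide

end MarkedGraph

/-! ### Deleting the added leg recovers the graph. -/

namespace MarkedGraph

namespace Contraction

variable {n : ℕ} {A B : MarkedGraph n}

/-- An isomorphism of graphs, given by bijections in the direction of the contraction. -/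
noncomputable def ofIso (onV : A.V → B.V) (hV : Function.Bijective onV) (onF : A.F → B.F)
    (hF : Function.Bijective onF) (root : ∀ f, B.root (onF f) = onV (A.root f))
    (inv : ∀ f, B.inv (onF f) = onF (A.inv f)) (leg : ∀ i, onF (A.leg i) = B.leg i)
    (hw : ∀ v, A.weight v = B.weight (onV v)) : Contraction A B :=
  have hl : ∀ f, (Equiv.ofBijective onF hF).symm (onF f) = f :=
    (Equiv.ofBijective onF hF).symm_apply_apply
  ofBijective onV hV (Equiv.ofBijective onF hF).symm (Equiv.bijective _)
    (fun f => by obtain ⟨f, rfl⟩ := hF.2 f; rw [hl, root])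
    (fun f => by obtain ⟨f, rfl⟩ := hF.2 f; rw [hl, inv, hl])
    (fun i => by rw [← leg, hl]) hw

theorem ofIso_lift (onV : A.V → B.V) (hV : Function.Bijective onV) (onF : A.F → B.F)
    (hF : Function.Bijective onF) (root : ∀ f, B.root (onF f) = onV (A.root f))
    (inv : ∀ f, B.inv (onF f) = onF (A.inv f)) (leg : ∀ i, onF (A.leg i) = B.leg i)
    (hw : ∀ v, A.weight v = B.weight (onV v)) (f : A.F) :
    (ofIso onV hV onF hF root inv leg hw).lift (onF f) = f :=
  (Equiv.ofBijective onF hF).symm_apply_apply f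

end Contraction

variable {n : ℕ} {G : MarkedGraph n}

theorem stabilize_leg {n : ℕ} {G : MarkedGraph (n + 1)} {hG : G.Stabilizable} (i : Fin n) :
    ((G.stabilize hG).leg i).1 = G.jump (G.leg i.castSucc) := rfl

theorem attachLeg_kept (hs : G.IsStable) (v : G.V) (f : G.F) : (G.attachLeg v).Kept (some f) :=
  kept_of_not_unstab (attachLeg_not_unstab v hs) (by
    rw [attachLeg_lastLeg]; exact Option.some_ne_none _)

theorem attachLeg_leg (v : G.V) (i : Fin n) : (G.attachLeg v).leg i.castSucc = some (G.leg i) :=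
  Fin.snoc_castSucc (α := fun _ => Option G.F) none (fun i => some (G.leg i)) i

/-- Attaching a leg and deleting it again. -/
noncomputable def attachLegMap (hs : G.IsStable) (v : G.V)
    (hS : (G.attachLeg v).Stabilizable) : Contraction G ((G.attachLeg v).stabilize hS) :=
  Contraction.ofIso (fun w => ⟨w, fun h => absurd h (attachLeg_not_unstab v hs)⟩)
    ⟨fun _ _ h => congrArg Subtype.val h, fun w => ⟨w.1, rfl⟩⟩
    (fun f => ⟨some f, attachLeg_kept hs v f⟩)
    ⟨fun _ _ h => Option.some_injective _ (congrArg Subtype.val h), fun ⟨f, hf⟩ => by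
      match f, hf with
      | none, hf => exact absurd (attachLeg_lastLeg v).symm hf.1
      | some f, hf => exact ⟨f, rfl⟩⟩
    (fun _ => rfl)
    (fun f => Subtype.ext (by
      have hk : (G.attachLeg v).Kept ((G.attachLeg v).inv (some f)) := attachLeg_kept hs v (G.inv f)
      refine (stabilize_inv_of_kept _ ?_).trans (jump_of_kept hk)
      rwa [jump_of_kept hk]))
    (fun i => Subtype.ext (by
      rw [stabilize_leg, attachLeg_leg]
      exact (jump_of_kept (attachLeg_kept hs v (G.leg i))).symm))
    (fun _ => rfl)

theorem subdivide_kept (e f : G.F) : (G.subdivide e).Kept (Sum.inl f) :=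
  (subdivide_kept_iff e _).2 ⟨f, rfl⟩

theorem subdivide_leg_of_eq {e : G.F} {i : Fin n} (h : G.leg i = e) :
    (G.subdivide e).leg i.castSucc = Sum.inr 2 := by
  classical
  exact (Fin.snoc_castSucc (α := fun _ => G.F ⊕ Fin 3) (Sum.inr 0)
    (fun i => if G.leg i = e then Sum.inr 2 else Sum.inl (G.leg i)) i).trans (if_pos h)

theorem subdivide_leg_of_ne {e : G.F} {i : Fin n} (h : G.leg i ≠ e) :
    (G.subdivide e).leg i.castSucc = Sum.inl (G.leg i) := by
  classical
  exact (Fin.snoc_castSucc (α := fun _ => G.F ⊕ Fin 3) (Sum.inr 0)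
    (fun i => if G.leg i = e then Sum.inr 2 else Sum.inl (G.leg i)) i).trans (if_neg h)

/-- Subdividing an edge or leg and deleting the new leg again. -/
noncomputable def subdivideMap (e : G.F) (hS : (G.subdivide e).Stabilizable) :
    Contraction G ((G.subdivide e).stabilize hS) :=
  Contraction.ofIso (fun w => ⟨some w, fun _ => by
      rw [subdivide_lastRoot]; exact Option.some_ne_none _⟩)
    ⟨fun _ _ h => Option.some_injective _ (congrArg Subtype.val h), fun ⟨w, hw⟩ => by
      match w, hw with
      | none, hw => exact absurd (subdivide_lastRoot e).symm (hw (subdivide_thin e).unstab)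
      | some w, hw => exact ⟨w, rfl⟩⟩
    (fun f => ⟨Sum.inl f, subdivide_kept e f⟩)
    ⟨fun _ _ h => Sum.inl_injective (congrArg Subtype.val h), fun ⟨f, hf⟩ => by
      obtain ⟨f', rfl⟩ := (subdivide_kept_iff e f).1 hf
      exact ⟨f', rfl⟩⟩
    (fun _ => rfl)
    (fun f => Subtype.ext (by
      have t := subdivide_thin e
      have hjk : ∀ f : G.F, (G.subdivide e).jump (Sum.inl f) = Sum.inl f :=
        fun f => jump_of_kept (subdivide_kept e f)
      have hnk : ¬ (G.subdivide e).Kept (Sum.inr 2) := t.not_kept₂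
      change ((MarkedGraph.stabilize _ hS).inv ⟨Sum.inl f, subdivide_kept e f⟩).1 =
        Sum.inl (G.inv f)
      by_cases h1 : f = e
      · subst h1
        -- The involution leads from `f` to the new vertex, and `jump` crosses it. For an edge this
        -- ends at the old inverse of `f`. For a leg it ends at the removed flag `Sum.inr 2`, and
        -- stabilization then declares `f` to be a leg.
        have hj : (G.subdivide f).jump ((G.subdivide f).inv (Sum.inl f)) =
            (G.subdivide f).inv (Sum.inr 2) := by rw [subdivide_inv_self, t.jump₁]
        by_cases hf : G.inv f = f
        · rw [subdivide_inv_two_of_eq f hf] at hj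
          rw [hf]
          exact congrArg Subtype.val (stabilize_inv_of_not_kept (hG := hS) ⟨Sum.inl f, _⟩ (by
            rw [hj]; exact hnk))
        · rw [subdivide_inv_two_of_ne f hf] at hj
          exact (stabilize_inv_of_kept (hG := hS) ⟨Sum.inl f, _⟩ (by
            rw [hj]; exact subdivide_kept f _)).trans hj
      · by_cases h2 : f = G.inv e
        · subst h2
          have hj : (G.subdivide e).jump ((G.subdivide e).inv (Sum.inl (G.inv e))) =
              Sum.inl e := by
            rw [subdivide_inv_inv e h1, t.jump₂, subdivide_inv_one]
          rw [G.inv_inv]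
          exact (stabilize_inv_of_kept (hG := hS) ⟨Sum.inl (G.inv e), _⟩ (by
            rw [hj]; exact subdivide_kept e _)).trans hj
        · have hj : (G.subdivide e).jump ((G.subdivide e).inv (Sum.inl f)) =
              Sum.inl (G.inv f) := by
            rw [subdivide_inv_of_ne e h1 h2, hjk]
          exact (stabilize_inv_of_kept (hG := hS) ⟨Sum.inl f, _⟩ (by
            rw [hj]; exact subdivide_kept e _)).trans hj))
    (fun i => Subtype.ext (by
      have t := subdivide_thin e
      rw [stabilize_leg]
      by_cases h : G.leg i = e
      · rw [subdivide_leg_of_eq h, t.jump₂, subdivide_inv_one]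
        exact congrArg Sum.inl h
      · rw [subdivide_leg_of_ne h]
        exact (jump_of_kept (subdivide_kept e _)).symm))
    (fun _ => rfl)

theorem attachLegMap_lift (hs : G.IsStable) (v : G.V) (hS : (G.attachLeg v).Stabilizable)
    (f : G.F) : (attachLegMap hs v hS).lift ⟨some f, attachLeg_kept hs v f⟩ = f :=
  Contraction.ofIso_lift _ _ _ _ _ _ _ _ f

theorem subdivideMap_lift (e : G.F) (hS : (G.subdivide e).Stabilizable) (f : G.F) :
    (subdivideMap e hS).lift ⟨Sum.inl f, subdivide_kept e f⟩ = f :=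
  Contraction.ofIso_lift _ _ _ _ _ _ _ _ f

end MarkedGraph

/-! ### The same constructions with lengths. -/

namespace StableCurve

variable {g n : ℕ} {P : ShpMon} (A : StableCurve g n P)

/-- The curve with an additional leg at a vertex. -/
def attachLeg (v : A.V) : StableCurve g (n + 1) P where
  toMarkedGraph := A.toMarkedGraph.attachLeg v
  connected := MarkedGraph.attachLeg_isConnectedOfGenus v A.connected
  stable := MarkedGraph.attachLeg_isStable v A.stable
  len f := f.elim 0 A.len
  len_inv f := by
    match f with
    | none => rfl
    | some f => exact A.len_inv f
  len_eq_zero_iff f := by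
    match f with
    | none => exact ⟨fun _ => rfl, fun _ => rfl⟩
    | some f =>
      exact (A.len_eq_zero_iff f).trans
        ⟨fun h => congrArg some h, fun h => Option.some_injective _ h⟩

/-- `A` is obtained from `A.attachLeg v` by deleting the last leg. -/
noncomputable def attachLegMap (hgn : 2 < 2 * g + n) (v : A.V) :
    CurveContraction (AddMonoidHom.id P) A ((A.attachLeg v).stabilize hgn) where
  graph := MarkedGraph.attachLegMap A.stable v ((A.attachLeg v).stabilizable hgn)
  len_lift f := by
    obtain ⟨f, hf⟩ := f
    obtain ⟨f, rfl⟩ : ∃ f', f = some f' := by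
      match f, hf with
      | none, hf => exact absurd (MarkedGraph.attachLeg_lastLeg v).symm hf.1
      | some f, hf => exact ⟨f, rfl⟩
    refine (congrArg A.len (MarkedGraph.attachLegMap_lift A.stable v ((A.attachLeg v).stabilizable hgn) f)).trans ?_
    exact (stabLen_of_kept (A := A.attachLeg v) (f := some f)
      (MarkedGraph.attachLeg_kept A.stable v (A.inv f))).symm
  len_contracted f hf :=
    absurd ⟨_, MarkedGraph.attachLegMap_lift A.stable v ((A.attachLeg v).stabilizable hgn) f⟩ hf

open Classical in
/-- The curve with an additional leg at a new vertex on an edge or leg. -/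
noncomputable def subdivide (e : A.F) (p q : P) (hp : p ≠ 0) (hq : q = 0 ↔ A.inv e = e) :
    StableCurve g (n + 1) P where
  toMarkedGraph := A.toMarkedGraph.subdivide e
  connected := MarkedGraph.subdivide_isConnectedOfGenus e A.connected
  stable := MarkedGraph.subdivide_isStable e A.stable
  len := Sum.elim (fun f => if f = e then p else if f = A.inv e then q else A.len f) ![0, p, q]
  len_inv f := by
    have h1 := A.inv_inv
    have h2 := A.len_inv
    rcases f with f | f
    · by_cases h3 : f = e
      · subst h3
        rw [MarkedGraph.subdivide_inv_self]
        simp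
      · by_cases h4 : f = A.inv e
        · subst h4
          rw [MarkedGraph.subdivide_inv_inv e h3]
          simp [h3]
        · rw [MarkedGraph.subdivide_inv_of_ne e h3 h4]
          have h5 : A.inv f ≠ e := by grind
          have h6 : A.inv f ≠ A.inv e := by grind
          simp [h3, h4, h5, h6, h2]
    · fin_cases f
      · rfl
      · change Sum.elim _ _ ((A.toMarkedGraph.subdivide e).inv (Sum.inr 1)) = _
        rw [MarkedGraph.subdivide_inv_one]
        simp
      · change Sum.elim _ _ ((A.toMarkedGraph.subdivide e).inv (Sum.inr 2)) = _
        by_cases he : A.inv e = e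
        · rw [MarkedGraph.subdivide_inv_two_of_eq e he]; rfl
        · rw [MarkedGraph.subdivide_inv_two_of_ne e he]
          simp [he]
  len_eq_zero_iff f := by
    rcases f with f | f
    · by_cases h3 : f = e
      · subst h3
        rw [MarkedGraph.subdivide_inv_self]
        simpa using hp
      · by_cases h4 : f = A.inv e
        · subst h4
          rw [MarkedGraph.subdivide_inv_inv e h3]
          simp [h3, hq]
        · rw [MarkedGraph.subdivide_inv_of_ne e h3 h4]
          simp only [Sum.elim_inl, h3, h4, if_false]
          exact (A.len_eq_zero_iff f).trans Sum.inl_injective.eq_iff.symm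
    · fin_cases f
      · exact ⟨fun _ => rfl, fun _ => rfl⟩
      · refine ⟨fun h => absurd h hp, fun h => ?_⟩
        exact absurd ((MarkedGraph.subdivide_inv_one e).symm.trans h) Sum.inl_ne_inr
      · refine hq.trans ⟨fun h => MarkedGraph.subdivide_inv_two_of_eq e h, fun h => ?_⟩
        by_contra he
        exact absurd ((MarkedGraph.subdivide_inv_two_of_ne e he).symm.trans h) Sum.inl_ne_inr

section

variable {A} {e : A.F} {p q : P} {hp : p ≠ 0} {hq : q = 0 ↔ A.inv e = e}

theorem subdivide_len_one : (A.subdivide e p q hp hq).len (Sum.inr 1) = p := rfl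

theorem subdivide_len_two : (A.subdivide e p q hp hq).len (Sum.inr 2) = q := rfl

theorem subdivide_len_self : (A.subdivide e p q hp hq).len (Sum.inl e) = p := if_pos rfl

theorem subdivide_len_inv (he : A.inv e ≠ e) :
    (A.subdivide e p q hp hq).len (Sum.inl (A.inv e)) = q := (if_neg he).trans (if_pos rfl)

theorem subdivide_len_of_ne {f : A.F} (h : f ≠ e) (h' : f ≠ A.inv e) :
    (A.subdivide e p q hp hq).len (Sum.inl f) = A.len f := (if_neg h).trans (if_neg h')

end

/-- `A` is obtained from a subdivision by deleting the last leg. -/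
noncomputable def subdivideMap (hgn : 2 < 2 * g + n) (e : A.F) (p q : P) (hp : p ≠ 0)
    (hq : q = 0 ↔ A.inv e = e) (hpq : A.inv e ≠ e → p + q = A.len e) :
    CurveContraction (AddMonoidHom.id P) A ((A.subdivide e p q hp hq).stabilize hgn) where
  graph := MarkedGraph.subdivideMap e ((A.subdivide e p q hp hq).stabilizable hgn)
  len_lift f := by
    obtain ⟨f, hf⟩ := f
    obtain ⟨f, rfl⟩ := (MarkedGraph.subdivide_kept_iff e f).1 hf
    refine (congrArg A.len (MarkedGraph.subdivideMap_lift e ((A.subdivide e p q hp hq).stabilizable hgn) f)).trans ?_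
    have t : (A.subdivide e p q hp hq).Thin (Sum.inr 1) (Sum.inr 2) :=
      MarkedGraph.subdivide_thin e
    change _ = (A.subdivide e p q hp hq).stabLen (Sum.inl f)
    have hk : ∀ f, (A.subdivide e p q hp hq).Kept (Sum.inl f) := MarkedGraph.subdivide_kept e
    obtain ⟨y, hy⟩ : ∃ y : (A.subdivide e p q hp hq).F, y = Sum.inl f := ⟨_, rfl⟩
    refine Eq.trans ?_ (congrArg (A.subdivide e p q hp hq).stabLen hy)
    by_cases h1 : f = e
    · subst h1
      have hi : (A.subdivide f p q hp hq).inv y = Sum.inr 1 :=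
        hy ▸ MarkedGraph.subdivide_inv_self f
      have hl : (A.subdivide f p q hp hq).len y = p := hy ▸ subdivide_len_self
      have hnk : ¬ (A.subdivide f p q hp hq).Kept ((A.subdivide f p q hp hq).inv y) := by
        rw [hi]; exact t.not_kept₁
      by_cases he : A.inv f = f
      · have h2 : (A.subdivide f p q hp hq).inv (Sum.inr 2) = Sum.inr 2 :=
          MarkedGraph.subdivide_inv_two_of_eq f he
        rw [stabLen_of_not_kept hnk (by rw [hi, t.jump₁, h2]; exact t.not_kept₂)]
        exact (A.len_eq_zero_iff f).2 he
      · have h2 : (A.subdivide f p q hp hq).inv (Sum.inr 2) = Sum.inl (A.inv f) :=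
          MarkedGraph.subdivide_inv_two_of_ne f he
        -- The two new pieces are joined again, and `hpq` says that their lengths add up to the old
        -- length.
        rw [stabLen_of_kept_jump hnk (by rw [hi, t.jump₁, h2]; exact hk _), hi, t.other₁,
          hl, subdivide_len_two, hpq he]
    · by_cases h3 : f = A.inv e
      · subst h3
        have hi : (A.subdivide e p q hp hq).inv y = Sum.inr 2 :=
          hy ▸ MarkedGraph.subdivide_inv_inv e h1
        have hl : (A.subdivide e p q hp hq).len y = q := hy ▸ subdivide_len_inv h1
        have h2 : (A.subdivide e p q hp hq).inv (Sum.inr 1) = Sum.inl e :=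
          MarkedGraph.subdivide_inv_one e
        rw [stabLen_of_kept_jump (by rw [hi]; exact t.not_kept₂)
          (by rw [hi, t.jump₂, h2]; exact hk _), hi, t.other₂, hl,
          subdivide_len_one, A.len_inv, ← hpq h1, add_comm]
      · have hi : (A.subdivide e p q hp hq).inv y = Sum.inl (A.inv f) :=
          hy ▸ MarkedGraph.subdivide_inv_of_ne e h1 h3
        have hl : (A.subdivide e p q hp hq).len y = A.len f := hy ▸ subdivide_len_of_ne h1 h3
        rw [stabLen_of_kept (by rw [hi]; exact hk _), hl]
  len_contracted f hf :=
    absurd ⟨_, MarkedGraph.subdivideMap_lift e ((A.subdivide e p q hp hq).stabilizable hgn) f⟩ hf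

end StableCurve

/-! ### Products, sections and equalizers of polyhedral cones. -/

namespace PC

theorem zero_mem (σ : PC) : (0 : σ.V) ∈ σ.cone := by
  obtain ⟨s, _, h⟩ := σ.polyhedral
  rw [h]
  exact fun ℓ _ => by simp

theorem hom_ext {σ τ : PC} {f g : σ ⟶ τ} (h : ∀ v ∈ σ.cone, f.1 v = g.1 v) : f = g :=
  Subtype.ext (LinearMap.ext_on σ.span_eq_top h)

/-- The product of two cones. -/
noncomputable def prod (σ τ : PC) : PC where
  V := σ.V × τ.V
  cone := σ.cone ×ˢ τ.cone
  polyhedral := by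
    obtain ⟨s, hs, h⟩ := σ.polyhedral
    obtain ⟨t, ht, h'⟩ := τ.polyhedral
    refine ⟨(fun ℓ : Module.Dual ℝ σ.V => ℓ.comp (LinearMap.fst ℝ σ.V τ.V)) '' s ∪
      (fun ℓ : Module.Dual ℝ τ.V => ℓ.comp (LinearMap.snd ℝ σ.V τ.V)) '' t,
      (hs.image _).union (ht.image _), ?_⟩
    ext ⟨v, w⟩
    rw [h, h']
    constructor
    · rintro ⟨h1, h2⟩ ℓ (⟨ℓ, hℓ, rfl⟩ | ⟨ℓ, hℓ, rfl⟩)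
      · exact h1 ℓ hℓ
      · exact h2 ℓ hℓ
    · intro h1
      exact ⟨fun ℓ hℓ => h1 _ (Or.inl ⟨ℓ, hℓ, rfl⟩), fun ℓ hℓ => h1 _ (Or.inr ⟨ℓ, hℓ, rfl⟩)⟩
  salient := by
    rintro ⟨v, w⟩ ⟨h1, h2⟩ ⟨h3, h4⟩
    exact Prod.ext (σ.salient v h1 h3) (τ.salient w h2 h4)
  span_eq_top := by
    refine Submodule.eq_top_iff'.2 fun ⟨v, w⟩ => ?_
    have h1 : (v, (0 : τ.V)) ∈ Submodule.span ℝ (σ.cone ×ˢ τ.cone) := by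
      have hv : v ∈ Submodule.span ℝ σ.cone := σ.span_eq_top ▸ Submodule.mem_top
      have := Submodule.mem_map_of_mem (f := LinearMap.inl ℝ σ.V τ.V) hv
      rw [Submodule.map_span] at this
      refine Submodule.span_mono ?_ this
      rintro _ ⟨u, hu, rfl⟩
      exact ⟨hu, τ.zero_mem⟩
    have h2 : ((0 : σ.V), w) ∈ Submodule.span ℝ (σ.cone ×ˢ τ.cone) := by
      have hw : w ∈ Submodule.span ℝ τ.cone := τ.span_eq_top ▸ Submodule.mem_top
      have := Submodule.mem_map_of_mem (f := LinearMap.inr ℝ σ.V τ.V) hw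
      rw [Submodule.map_span] at this
      refine Submodule.span_mono ?_ this
      rintro _ ⟨u, hu, rfl⟩
      exact ⟨σ.zero_mem, hu⟩
    simpa using Submodule.add_mem _ h1 h2

noncomputable def fst (σ τ : PC) : σ.prod τ ⟶ σ := ⟨LinearMap.fst ℝ σ.V τ.V, fun _ h => h.1⟩

noncomputable def snd (σ τ : PC) : σ.prod τ ⟶ τ := ⟨LinearMap.snd ℝ σ.V τ.V, fun _ h => h.2⟩

/-- The pairing of two continuous maps to cones. -/
noncomputable def pair {σ τ : PC} {X : TopCat.{0}} (a : X ⟶ space.obj σ) (b : X ⟶ space.obj τ) :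
    X ⟶ space.obj (σ.prod τ) :=
  TopCat.ofHom ⟨fun x => ⟨((a x).1, (b x).1), (a x).2, (b x).2⟩,
    ((continuous_subtype_val.comp a.hom.continuous).prodMk
      (continuous_subtype_val.comp b.hom.continuous)).subtype_mk _⟩

theorem pair_fst {σ τ : PC} {X : TopCat.{0}} (a : X ⟶ space.obj σ) (b : X ⟶ space.obj τ) :
    pair a b ≫ space.map (fst σ τ) = a := rfl

theorem pair_snd {σ τ : PC} {X : TopCat.{0}} (a : X ⟶ space.obj σ) (b : X ⟶ space.obj τ) :
    pair a b ≫ space.map (snd σ τ) = b := rfl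

/-- The intersection of a cone with a linear subspace. -/
noncomputable def cut (σ : PC) (W : Submodule ℝ σ.V) : PC where
  -- A cone has to span its vector space, so the ambient space is the span of the intersection,
  -- which may be smaller than `W`.
  V := Submodule.span ℝ (σ.cone ∩ W)
  cone := {v | v.1 ∈ σ.cone}
  polyhedral := by
    obtain ⟨s, hs, h⟩ := σ.polyhedral
    refine ⟨(fun ℓ : Module.Dual ℝ σ.V => ℓ.comp (Submodule.span ℝ (σ.cone ∩ W)).subtype) '' s,
      hs.image _, ?_⟩
    ext v
    refine (Set.ext_iff.1 h v.1).trans ⟨?_, fun h1 ℓ hℓ => h1 _ ⟨ℓ, hℓ, rfl⟩⟩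
    rintro h1 _ ⟨ℓ, hℓ, rfl⟩
    exact h1 ℓ hℓ
  salient v h1 h2 := Subtype.ext (σ.salient v.1 h1 h2)
  span_eq_top := by
    have h1 : Submodule.span ℝ (σ.cone ∩ W) ≤ W := Submodule.span_le.2 Set.inter_subset_right
    have h2 : {v : Submodule.span ℝ (σ.cone ∩ W) | v.1 ∈ σ.cone} =
        Subtype.val ⁻¹' (σ.cone ∩ W) := by
      ext v
      exact ⟨fun h => ⟨h, h1 v.2⟩, fun h => h.1⟩
    rw [h2]
    exact Submodule.span_span_coe_preimage

noncomputable def cutIncl (σ : PC) (W : Submodule ℝ σ.V) : σ.cut W ⟶ σ :=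
  ⟨(Submodule.span ℝ (σ.cone ∩ W)).subtype, fun _ h => h⟩

theorem cutIncl_mem (σ : PC) (W : Submodule ℝ σ.V) (v : (σ.cut W).V) : (σ.cutIncl W).1 v ∈ W :=
  (Submodule.span_le.2 Set.inter_subset_right : Submodule.span ℝ (σ.cone ∩ W) ≤ W) v.2

theorem exists_lift_cut {σ : PC} {W : Submodule ℝ σ.V} {X : TopCat.{0}} (a : X ⟶ space.obj σ)
    (h : ∀ x, (a x).1 ∈ W) : ∃ b : X ⟶ space.obj (σ.cut W), b ≫ space.map (σ.cutIncl W) = a :=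
  ⟨TopCat.ofHom ⟨fun x => ⟨⟨(a x).1, Submodule.subset_span ⟨(a x).2, h x⟩⟩, (a x).2⟩,
    ((continuous_subtype_val.comp a.hom.continuous).subtype_mk _).subtype_mk _⟩, rfl⟩

/-- The kernel of the difference of two maps is a linear subspace, and the section of the cone by it
is the equalizer. -/
theorem cutIncl_comp_eq {σ τ : PC} (f g : σ ⟶ τ) :
    σ.cutIncl (LinearMap.ker (f.1 - g.1)) ≫ f = σ.cutIncl (LinearMap.ker (f.1 - g.1)) ≫ g := by
  refine hom_ext fun v _ => ?_
  have := σ.cutIncl_mem (LinearMap.ker (f.1 - g.1)) v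
  exact sub_eq_zero.1 (LinearMap.mem_ker.1 this)

/-- Two morphisms of cones can be equalized without changing a map to the first cone after which
they agree. -/
theorem exists_equalizer {σ τ : PC} (f g : σ ⟶ τ) {X : TopCat.{0}} (a : X ⟶ space.obj σ)
    (h : a ≫ space.map f = a ≫ space.map g) :
    ∃ (ρ : PC) (i : ρ ⟶ σ) (b : X ⟶ space.obj ρ), b ≫ space.map i = a ∧ i ≫ f = i ≫ g := by
  obtain ⟨b, hb⟩ := exists_lift_cut (W := LinearMap.ker (f.1 - g.1)) a fun x => by
    have h1 : (a ≫ space.map f) x = (a ≫ space.map g) x := by rw [h]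
    exact LinearMap.mem_ker.2 (sub_eq_zero.2 (congrArg Subtype.val h1))
  exact ⟨_, _, b, hb, cutIncl_comp_eq f g⟩

/-- Two maps to cones that agree in a third cone lift to a cone over both. -/
theorem exists_fiberProduct {σ τ υ : PC} (f : σ ⟶ υ) (g : τ ⟶ υ) {X : TopCat.{0}}
    (a : X ⟶ space.obj σ) (b : X ⟶ space.obj τ) (h : a ≫ space.map f = b ≫ space.map g) :
    ∃ (ρ : PC) (i : ρ ⟶ σ) (j : ρ ⟶ τ) (c : X ⟶ space.obj ρ),
      c ≫ space.map i = a ∧ c ≫ space.map j = b ∧ i ≫ f = j ≫ g := by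
  -- The fibre product is the equalizer inside the product of the cones.
  obtain ⟨ρ, i, c, hc, hi⟩ := exists_equalizer (fst σ τ ≫ f) (snd σ τ ≫ g) (pair a b) (by
    rw [space.map_comp, space.map_comp, ← Category.assoc, ← Category.assoc, pair_fst, pair_snd, h])
  refine ⟨ρ, i ≫ fst σ τ, i ≫ snd σ τ, c, ?_, ?_, ?_⟩
  · rw [space.map_comp, ← Category.assoc, hc, pair_fst]
  · rw [space.map_comp, ← Category.assoc, hc, pair_snd]
  · rw [Category.assoc, hi, Category.assoc]

end PC

/-! ### The extension of the moduli of curves to topological spaces. -/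

namespace CatOver

section Extension

variable {C : Type 1} [Category.{0} C] (p : C ⥤ PC)

/-- The object of the extension given by a triple. -/
noncomputable def extQ : Triples p ⥤ (extension p).E := (triplesIso p).Q

instance : (extQ p).IsLocalization (overIso (extQ p ⋙ (extension p).p)) :=
  inferInstanceAs ((triplesIso p).Q.IsLocalization (triplesIso p))

theorem extQ_comp_p : extQ p ⋙ (extension p).p = Comma.fst _ _ :=
  Localization.Construction.fac _ _

theorem extQ_surjective (a : (extension p).E) : ∃ d, (extQ p).obj d = a :=
  (Localization.Construction.objEquiv (triplesIso p)).surjective a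

theorem isIso_extQ_map_iff (h : (extension p).Cart) {d d' : Triples p} (f : d ⟶ d') :
    IsIso ((extQ p).map f) ↔ IsIso f.left := by
  constructor
  · intro hf
    exact inferInstanceAs (IsIso ((extension p).p.map ((extQ p).map f)))
  · exact fun hf => h.isIso ((extQ p).map f) hf

/-- A triple is restricted by composing its map to the cone, while cone and curve remain the same.
-/
theorem fibered_extension : (extension p).Fibered := by
  intro a T t
  obtain ⟨d, rfl⟩ := extQ_surjective p a
  let d' : Triples p := ⟨T, d.right, (show T ⟶ d.left from t) ≫ d.hom⟩
  let f : d' ⟶ d := ⟨t, 𝟙 _, by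
    rw [CategoryTheory.Functor.map_id]
    exact (Category.comp_id d'.hom).symm⟩
  exact ⟨(extQ p).obj d', (extQ p).map f, Iso.refl _, (Category.id_comp _).symm⟩

end Extension

section Curves

variable {g n : ℕ}

/-- Triples of a space, a curve over a cone and a map from the space to the cone. -/
abbrev CurveTriples (g n : ℕ) : Type 1 := Triples (Curves.proj PC.dual g n)

/-- For a lift, the cone of `x` is replaced by the fibre product with the cone of `y` over that of
`z`, and the curve of `x` is specialized to it. The specialization from the curve of `y` then exists
because specializations are cocartesian. For uniqueness, the two maps of cones are equalized; the
contractions of graphs agree already, as contractions are epimorphic. -/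
theorem refinable_curveTriples : Refinable (Comma.fst (𝟭 TopCat.{0})
    (Curves.proj PC.dual g n ⋙ PC.space)) where
  exists_lift {x y z} f g k hk := by
    obtain ⟨ρ, i, j, c, hi, hj, hij⟩ := PC.exists_fiberProduct g.right.base f.right.base x.hom
      (k ≫ y.hom) (by
        have h1 := f.w
        have h2 := g.w
        exact h2.symm.trans ((congrArg (· ≫ z.hom) hk.symm).trans ((Category.assoc _ _ _).trans
          ((congrArg (k ≫ ·) h1).trans (Category.assoc _ _ _).symm))))
    obtain ⟨N, ⟨u⟩⟩ := CurveContraction.exists_pullback (PC.dual.map i).unop x.right.curve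
    obtain ⟨w, hw⟩ := CurveContraction.exists_factor (k := (PC.dual.map j).unop) f.right.curve
      ((g.right.curve.trans u).congr (k := (show _ →+ _ from (PC.dual.map j).unop).comp
        (show _ →+ _ from (PC.dual.map f.right.base).unop)) (by
        have : (PC.dual.map (i ≫ g.right.base)).unop = (PC.dual.map (j ≫ f.right.base)).unop := by
          rw [hij]
        exact this))
    let x' : CurveTriples _ _ := ⟨x.left, ⟨ρ, N⟩, c⟩
    let t : x' ⟶ x := ⟨𝟙 _, ⟨i, u⟩, (Category.id_comp _).trans hi.symm⟩
    let l : x' ⟶ y := ⟨k, ⟨j, w⟩, hj.symm⟩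
    have ht : t.left = 𝟙 _ := rfl
    refine ⟨x', t, l, ?_, ?_, ?_⟩
    · change IsIso (𝟙 _)
      infer_instance
    · exact (Category.id_comp k).symm
    · refine CommaMorphism.ext (hk.trans (Category.id_comp g.left).symm) ?_
      exact Curves.Hom.ext' hij.symm hw
  ext {x y z} f l l' hl hc := by
    obtain ⟨ρ, i, b, hb, hi⟩ := PC.exists_equalizer l.right.base l'.right.base x.hom (by
      have h1 := l.w
      have h2 := l'.w
      simp only [Functor.id_map, Functor.comp_map] at h1 h2
      exact h1.symm.trans ((congrArg (· ≫ y.hom) hl).trans h2))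
    obtain ⟨N, ⟨u⟩⟩ := CurveContraction.exists_pullback (PC.dual.map i).unop x.right.curve
    let x' : CurveTriples _ _ := ⟨x.left, ⟨ρ, N⟩, b⟩
    let t : x' ⟶ x := ⟨𝟙 _, ⟨i, u⟩, (Category.id_comp _).trans hb.symm⟩
    refine ⟨x', t, ?_, ?_⟩
    · change IsIso (𝟙 _)
      infer_instance
    · refine CommaMorphism.ext (congrArg (𝟙 _ ≫ ·) hl) (Curves.Hom.ext' hi ?_)
      have h1 : f.right.curve.graph.trans l.right.curve.graph =
          f.right.curve.graph.trans l'.right.curve.graph :=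
        congrArg (fun m : x ⟶ z => m.right.curve.graph) hc
      exact congrArg (·.trans u.graph) (MarkedGraph.Contraction.trans_left_cancel _ h1)

theorem refinable_extQ : Refinable (extQ (Curves.proj PC.dual g n) ⋙
    (extension (Curves.proj PC.dual g n)).p) := by
  rw [extQ_comp_p]
  exact refinable_curveTriples

theorem cart_extension : (extension (Curves.proj PC.dual g n)).Cart :=
  refinable_extQ.cart (extQ _)

theorem presentation_extension : Presentation (extension (Curves.proj PC.dual g n)) (extQ _) :=
  refinable_extQ.presentation (extQ _)

end Curves

section Forget

variable {g n : ℕ} (hgn : 2 < 2 * g + n) (Γ : StableCurve g n ShpMon.nnreal)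

/-- The forgetful morphism on extensions. -/
noncomputable abbrev extForget : Hom (extension (Curves.proj PC.dual g (n + 1)))
    (extension (Curves.proj PC.dual g n)) :=
  extensionMap (Curves.forget PC.dual hgn) (Iso.refl _)

/-- The forgetful morphism on triples. -/
noncomputable abbrev triplesForget : CurveTriples g (n + 1) ⥤ CurveTriples g n :=
  triplesMap (Curves.forget PC.dual hgn) (Iso.refl _)

/-- The point of the extension given by a curve. -/
noncomputable abbrev extPoint : (extension (Curves.proj PC.dual g n)).Point where
  F := Γ.triples ⋙ (triplesIso _).Q
  w := eqToIso (congrArg (Γ.triples ⋙ ·)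
    (Localization.Construction.fac (Comma.fst _ _) (fun _ _ _ h => h)))

theorem extQ_comp_extForget :
    extQ _ ⋙ (extForget (g := g) hgn).F = triplesForget hgn ⋙ extQ _ :=
  Localization.Construction.fac _ _

/-- The forgetful morphism on extensions is the one on triples. -/
noncomputable def extComm : extQ _ ⋙ (extForget (g := g) hgn).F ≅ triplesForget hgn ⋙ extQ _ :=
  eqToIso (extQ_comp_extForget hgn)

theorem extComm_app (d : CurveTriples g (n + 1)) :
    (extComm (g := g) hgn).hom.app d = 𝟙 _ := by
  exact (eqToHom_app (extQ_comp_extForget hgn) d).trans (eqToHom_refl _ rfl)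

/-- For `refine_map`, the curve of `d` is specialized along the map of cones of `t`. The stabilized
specialization factors through the curve of `e`, because `t` is itself a specialization along the
same map and specializations are cocartesian. -/
theorem strictData_ext : StrictData (F := extForget hgn) (s := extPoint Γ) (extComm hgn)
    (Iso.refl (Γ.triples ⋙ extQ _)) where
  cartA := cart_extension
  cartB := cart_extension
  presA := presentation_extension
  presB := presentation_extension
  refine_map d e t ht := by
    rw [isIso_extQ_map_iff _ cart_extension] at ht
    obtain ⟨N, ⟨u⟩⟩ := CurveContraction.exists_pullback (PC.dual.map t.right.base).unop
      d.right.curve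
    obtain ⟨w, hw⟩ := CurveContraction.exists_factor (k := (PC.dual.map (𝟙 e.right.base)).unop)
      t.right.curve ((u.stabilize hgn).congr (by rw [PC.dual.map_id]; rfl))
    have hω : t.left ≫ d.hom = e.hom ≫ PC.space.map t.right.base := by
      refine Eq.trans ?_ t.w
      change _ = t.left ≫ d.hom ≫ PC.space.map (𝟙 _)
      rw [PC.space.map_id]
      exact congrArg (t.left ≫ ·) (Category.comp_id d.hom).symm
    let d' : CurveTriples g (n + 1) := ⟨e.left, ⟨e.right.base, N⟩, e.hom⟩
    let u' : d' ⟶ d := ⟨t.left, ⟨t.right.base, u⟩, hω⟩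
    let v : (triplesForget hgn).obj d' ⟶ e := ⟨𝟙 _, ⟨𝟙 _, w⟩, by
      refine (Category.id_comp e.hom).trans ?_
      change e.hom = (e.hom ≫ PC.space.map (𝟙 _)) ≫ PC.space.map (𝟙 _)
      rw [PC.space.map_id]
      exact ((Category.comp_id _).trans (Category.comp_id _)).symm⟩
    refine ⟨d', u', v, ?_, ?_⟩
    · rw [isIso_extQ_map_iff _ cart_extension]
      exact ht
    · refine CommaMorphism.ext (Category.id_comp t.left) (Curves.Hom.ext' ?_ hw)
      exact Category.id_comp t.right.base

/-- As for the plus construction, all comparison isomorphisms evaluate to identities. -/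
theorem strictOver_ext_iff (d : CurveTriples g (n + 1))
    (μ : (triplesForget hgn).obj d ⟶ Γ.triples.obj d.left) :
    StrictOver (F := extForget hgn) (s := extPoint Γ) (extComm hgn)
      (Iso.refl (Γ.triples ⋙ extQ _)) d μ ↔ μ.left = 𝟙 d.left := by
  have e1 : (extPoint Γ).w.hom.app d.left = 𝟙 d.left :=
    (eqToHom_app (congrArg (Γ.triples ⋙ ·)
      (Localization.Construction.fac (Comma.fst _ _) (fun _ _ _ h => h))) d.left).trans
      (eqToHom_refl d.left rfl)
  have e2 : (extForget (g := g) hgn).w.hom.app ((extQ _).obj d) = 𝟙 d.left :=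
    (eqToHom_app (lift_comp_lift _ _ (triplesForget hgn) (Comma.fst _ _) (Comma.fst _ _) rfl
      _ _ _) ((extQ _).obj d)).trans (eqToHom_refl d.left rfl)
  have e3 : (extension (Curves.proj PC.dual g n)).p.map (strictHom (F := extForget hgn)
      (s := extPoint Γ) (extComm hgn) (Iso.refl (Γ.triples ⋙ extQ _)) d μ) = μ.left := by
    have : strictHom (F := extForget hgn) (s := extPoint Γ) (extComm hgn)
        (Iso.refl (Γ.triples ⋙ extQ _)) d μ = (extQ _).map μ :=
      (congrArg (· ≫ _) (extComm_app hgn d)).trans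
        ((Category.id_comp _).trans (Category.comp_id _))
    rw [this]; rfl
  unfold StrictOver
  constructor
  · intro h
    exact e3.symm.trans ((Category.comp_id _).symm.trans
      ((congrArg (_ ≫ ·) e1).symm.trans (h.trans e2)))
  · intro h
    exact (congrArg (_ ≫ ·) e1).trans ((Category.comp_id _).trans (e3.trans (h.trans e2.symm)))

end Forget

end CatOver

/-! ### Marked curves: strict objects of the preimage in the extension. -/

namespace PC

/-- The map of dual monoids belonging to a map of cones. -/
abbrev pull {σ τ : PC} (f : σ ⟶ τ) : τ.dualMon →+ σ.dualMon := (dual.map f).unop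

/-- The value of an element of the dual monoid. -/
noncomputable def eval {σ : PC} (ℓ : σ.dualMon) (v : σ.cone) : ℝ := ℓ.1 v.1

variable {σ τ : PC}

theorem eval_nonneg (a : σ.dualMon) (v : σ.cone) : 0 ≤ eval a v := a.2 _ v.2

theorem eval_ext {a b : σ.dualMon} (h : ∀ v, eval a v = eval b v) : a = b :=
  Subtype.ext (LinearMap.ext_on σ.span_eq_top fun v hv => h ⟨v, hv⟩)

theorem continuous_eval (a : σ.dualMon) : Continuous (eval a) :=
  a.1.continuous_of_finiteDimensional.comp continuous_subtype_val

theorem pull_comp {ρ : PC} (f : ρ ⟶ σ) (k : σ ⟶ τ) : pull (f ≫ k) = (pull f).comp (pull k) := rfl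

end PC

variable {g n : ℕ}

/-- A curve with one more leg over a cone, with a map from `X` to the cone, such that the curve
obtained by deleting the leg is identified with `Γ` on `X`. -/
structure MarkedCurve (hgn : 2 < 2 * g + n) (Γ : StableCurve g n ShpMon.nnreal)
    (X : TopCat.{0}) where
  cone : PC
  curve : StableCurve g (n + 1) cone.dualMon
  map : X ⟶ PC.space.obj cone
  ray : cone ⟶ PC.ray
  marking : CurveContraction (PC.pull ray) Γ.overRay.curve (curve.stabilize hgn)
  one : map ≫ PC.space.map ray = PC.constOne X

namespace MarkedCurve

variable {hgn : 2 < 2 * g + n} {Γ : StableCurve g n ShpMon.nnreal} {X X' : TopCat.{0}}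

/-- The marking as a contraction of graphs. -/
noncomputable def mark (M : MarkedCurve hgn Γ X) : MarkedGraph.Contraction Γ.toMarkedGraph
    (M.curve.toMarkedGraph.stabilize (M.curve.stabilizable hgn)) := M.marking.graph

/-- Morphisms of marked curves over a continuous map. -/
structure Hom (f : X ⟶ X') (M : MarkedCurve hgn Γ X) (M' : MarkedCurve hgn Γ X') where
  base : M.cone ⟶ M'.cone
  curve : CurveContraction (PC.pull base) M'.curve M.curve
  map_base : M.map ≫ PC.space.map base = f ≫ M'.map
  base_ray : base ≫ M'.ray = M.ray
  mark_eq : M'.mark.trans (curve.graph.stabilize M'.curve.stable (M'.curve.stabilizable hgn)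
    (M.curve.stabilizable hgn)) = M.mark

/-- The underlying triple. -/
noncomputable def triple (M : MarkedCurve hgn Γ X) : CatOver.CurveTriples g (n + 1) :=
  ⟨X, ⟨M.cone, M.curve⟩, M.map⟩

/-- The identification of the curve obtained by deleting the last leg. -/
noncomputable def toPoint (M : MarkedCurve hgn Γ X) :
    (CatOver.triplesForget hgn).obj M.triple ⟶ Γ.triples.obj M.triple.left :=
  ⟨𝟙 X, ⟨M.ray, M.marking⟩, by
    refine (Category.id_comp _).trans ?_
    refine M.one.symm.trans ?_
    change _ = (M.map ≫ PC.space.map (𝟙 _)) ≫ PC.space.map M.ray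
    rw [PC.space.map_id]
    exact (congrArg (· ≫ _) (Category.comp_id M.map)).symm⟩

theorem toPoint_left (M : MarkedCurve hgn Γ X) : M.toPoint.left = 𝟙 X := rfl

/-- The marked curve given by a triple whose image is identified with `Γ`. -/
noncomputable def ofTriple (d : CatOver.CurveTriples g (n + 1))
    (μ : (CatOver.triplesForget hgn).obj d ⟶ Γ.triples.obj d.left) (hμ : μ.left = 𝟙 d.left) :
    MarkedCurve hgn Γ d.left where
  cone := d.right.base
  curve := d.right.curve
  map := d.hom
  ray := μ.right.base
  marking := μ.right.curve
  one := by
    have h := μ.w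
    refine Eq.trans ?_ (h.symm.trans ((congrArg (· ≫ PC.constOne d.left) hμ).trans
      (Category.id_comp _)))
    change _ = (d.hom ≫ PC.space.map (𝟙 _)) ≫ PC.space.map μ.right.base
    rw [PC.space.map_id]
    exact (congrArg (· ≫ _) (Category.comp_id d.hom)).symm

theorem toPoint_ofTriple (d : CatOver.CurveTriples g (n + 1))
    (μ : (CatOver.triplesForget hgn).obj d ⟶ Γ.triples.obj d.left) (hμ : μ.left = 𝟙 d.left) :
    (ofTriple d μ hμ).toPoint = μ :=
  CommaMorphism.ext hμ.symm rfl

/-- The morphism of marked curves given by a morphism of triples. -/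
noncomputable def homOfTriple {d d' : CatOver.CurveTriples g (n + 1)}
    {μ : (CatOver.triplesForget hgn).obj d ⟶ Γ.triples.obj d.left}
    {μ' : (CatOver.triplesForget hgn).obj d' ⟶ Γ.triples.obj d'.left}
    (hμ : μ.left = 𝟙 d.left) (hμ' : μ'.left = 𝟙 d'.left) (f : d ⟶ d')
    (hf : (CatOver.triplesForget hgn).map f ≫ μ' = μ ≫ Γ.triples.map f.left) :
    Hom f.left (ofTriple d μ hμ) (ofTriple d' μ' hμ') where
  base := f.right.base
  curve := f.right.curve
  map_base := f.w.symm
  base_ray := congrArg (fun m : (CatOver.triplesForget hgn).obj d ⟶ Γ.triples.obj d'.left =>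
    m.right.base) hf
  mark_eq := congrArg (fun m : (CatOver.triplesForget hgn).obj d ⟶ Γ.triples.obj d'.left =>
    m.right.curve.graph) hf

/-- The morphism of triples given by a morphism of marked curves. -/
noncomputable def Hom.triple {f : X ⟶ X'} {M : MarkedCurve hgn Γ X} {M' : MarkedCurve hgn Γ X'}
    (h : Hom f M M') : M.triple ⟶ M'.triple :=
  ⟨f, ⟨h.base, h.curve⟩, h.map_base.symm⟩

theorem Hom.triple_comp {f : X ⟶ X'} {M : MarkedCurve hgn Γ X} {M' : MarkedCurve hgn Γ X'}
    (h : Hom f M M') : (CatOver.triplesForget hgn).map h.triple ≫ M'.toPoint =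
      M.toPoint ≫ Γ.triples.map f :=
  CommaMorphism.ext ((Category.comp_id f).trans (Category.id_comp f).symm)
    (Curves.Hom.ext' h.base_ray h.mark_eq)

/-- The pullback of a marked curve along a map of cones. -/
noncomputable def comap (M : MarkedCurve hgn Γ X) (f : X' ⟶ X) {ρ : PC} (i : ρ ⟶ M.cone)
    (b : X' ⟶ PC.space.obj ρ) (hb : b ≫ PC.space.map i = f ≫ M.map)
    {N : StableCurve g (n + 1) ρ.dualMon} (u : CurveContraction (PC.pull i) M.curve N) :
    MarkedCurve hgn Γ X' where
  cone := ρ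
  curve := N
  map := b
  ray := i ≫ M.ray
  marking := (M.marking.trans (u.stabilize hgn)).congr (PC.pull_comp i M.ray).symm
  one := by
    rw [PC.space.map_comp, ← Category.assoc, hb, Category.assoc, M.one]
    rfl

/-- The morphism from the pullback along a map of cones. -/
noncomputable def comapHom (M : MarkedCurve hgn Γ X) (f : X' ⟶ X) {ρ : PC} (i : ρ ⟶ M.cone)
    (b : X' ⟶ PC.space.obj ρ) (hb : b ≫ PC.space.map i = f ≫ M.map)
    {N : StableCurve g (n + 1) ρ.dualMon} (u : CurveContraction (PC.pull i) M.curve N) :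
    Hom f (M.comap f i b hb u) M where
  base := i
  curve := u
  map_base := hb
  base_ray := rfl
  mark_eq := rfl

/-- The restriction of a marked curve along a continuous map. -/
noncomputable def restrict (M : MarkedCurve hgn Γ X) (f : X' ⟶ X) : MarkedCurve hgn Γ X' where
  __ := M
  map := f ≫ M.map
  one := by
    rw [Category.assoc, M.one]
    rfl

/-- The morphism from the restriction along a continuous map. -/
noncomputable def restrictHom (M : MarkedCurve hgn Γ X) (f : X' ⟶ X) : Hom f (M.restrict f) M where
  base := 𝟙 _
  curve := (CurveContraction.refl M.curve).congr (by
    change _ = (PC.dual.map (𝟙 _)).unop; rw [PC.dual.map_id]; rfl)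
  map_base := (congrArg ((f ≫ M.map) ≫ ·) (PC.space.map_id M.cone)).trans (Category.comp_id _)
  base_ray := Category.id_comp _
  mark_eq := congrArg (M.mark.trans ·)
    (MarkedGraph.Contraction.stabilize_refl M.curve.stable _)

/-- Composition of morphisms of marked curves. -/
noncomputable def Hom.comp {X'' : TopCat.{0}} {f : X ⟶ X'} {f' : X' ⟶ X''} {M : MarkedCurve hgn Γ X}
    {M' : MarkedCurve hgn Γ X'} {M'' : MarkedCurve hgn Γ X''} (h : Hom f M M')
    (h' : Hom f' M' M'') : Hom (f ≫ f') M M'' where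
  base := h.base ≫ h'.base
  curve := (h'.curve.trans h.curve).congr (PC.pull_comp _ _).symm
  map_base := by
    rw [PC.space.map_comp, ← Category.assoc, h.map_base, Category.assoc, h'.map_base,
      Category.assoc]
  base_ray := by rw [Category.assoc, h'.base_ray, h.base_ray]
  mark_eq := by
    rw [← h.mark_eq, ← h'.mark_eq]
    exact congrArg (M''.mark.trans ·) (MarkedGraph.Contraction.stabilize_trans _ _
      M''.curve.stable M'.curve.stable _ _ _)

/-- Morphisms of marked curves over a given map agree after restriction to a smaller cone. -/
theorem exists_comp_eq {d d' : CatOver.CurveTriples g (n + 1)}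
    {μ : (CatOver.triplesForget hgn).obj d ⟶ Γ.triples.obj d.left}
    {μ' : (CatOver.triplesForget hgn).obj d' ⟶ Γ.triples.obj d'.left} (f f' : d ⟶ d')
    (hf : (CatOver.triplesForget hgn).map f ≫ μ' = μ ≫ Γ.triples.map f.left)
    (hf' : (CatOver.triplesForget hgn).map f' ≫ μ' = μ ≫ Γ.triples.map f'.left)
    (h : f.left = f'.left) :
    ∃ (d₀ : CatOver.CurveTriples g (n + 1)) (t : d₀ ⟶ d), IsIso t.left ∧ t ≫ f = t ≫ f' := by
  -- The two maps of cones agree on the image of the base and can be equalized there. It remains to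
  -- compare the contractions of graphs.
  obtain ⟨ρ, i, b, hb, hi⟩ := PC.exists_equalizer f.right.base f'.right.base d.hom (by
      have h1 := f.w
      have h2 := f'.w
      exact h1.symm.trans ((congrArg (· ≫ d'.hom) h).trans h2))
  obtain ⟨N, ⟨u⟩⟩ := CurveContraction.exists_pullback (PC.dual.map i).unop d.right.curve
  let d₀ : CatOver.CurveTriples g (n + 1) := ⟨d.left, ⟨ρ, N⟩, b⟩
  let t : d₀ ⟶ d := ⟨𝟙 _, ⟨i, u⟩, (Category.id_comp _).trans hb.symm⟩
  refine ⟨d₀, t, ?_, ?_⟩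
  · change IsIso (𝟙 _)
    infer_instance
  · refine CommaMorphism.ext (congrArg (𝟙 _ ≫ ·) h) (Curves.Hom.ext' hi ?_)
    have h1 : μ'.right.curve.graph.trans (f.right.curve.stabilize hgn).graph =
        μ'.right.curve.graph.trans (f'.right.curve.stabilize hgn).graph := by
      have e1 := congrArg (fun m : (CatOver.triplesForget hgn).obj d ⟶
        Γ.triples.obj d'.left => m.right.curve.graph) hf
      have e2 := congrArg (fun m : (CatOver.triplesForget hgn).obj d ⟶
        Γ.triples.obj d'.left => m.right.curve.graph) hf'
      exact e1.trans e2.symm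
    have h2 := MarkedGraph.Contraction.trans_left_cancel _ h1
    let c := f.right.curve.trans u
    let c' := f'.right.curve.trans u
    -- The contracted edges are determined by the maps of monoids, which agree after the
    -- equalization. The stabilizations agree because both are compatible with the markings by `Γ`,
    -- which can be cancelled.
    refine MarkedGraph.Contraction.eq_of_stabilize_eq (c := c.graph) (c' := c'.graph)
      d'.right.curve.stable (d'.right.curve.stabilizable hgn) (N.stabilizable hgn) ?_ ?_
    · ext e
      rw [c.mem_range_iff, c'.mem_range_iff]
      have : (PC.pull i).comp (PC.pull f.right.base) = (PC.pull i).comp (PC.pull f'.right.base) :=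
        congrArg PC.pull hi
      exact ⟨fun k k' => k ((DFunLike.congr_fun this _).trans k'),
        fun k k' => k ((DFunLike.congr_fun this _).symm.trans k')⟩
    · refine ((MarkedGraph.Contraction.stabilize_trans f.right.curve.graph u.graph
        d'.right.curve.stable d.right.curve.stable _ (d.right.curve.stabilizable hgn) _).trans
        ?_).trans (MarkedGraph.Contraction.stabilize_trans f'.right.curve.graph u.graph
        d'.right.curve.stable d.right.curve.stable _ (d.right.curve.stabilizable hgn) _).symm
      exact congrArg (fun z : MarkedGraph.Contraction
        (d'.right.curve.toMarkedGraph.stabilize (d'.right.curve.stabilizable hgn))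
        (d.right.curve.toMarkedGraph.stabilize (d.right.curve.stabilizable hgn)) =>
          z.trans (u.graph.stabilize d.right.curve.stable _ (N.stabilizable hgn))) h2

end MarkedCurve

/-! ### The realization of `Γ` as a quotient, and equality of its points. -/

namespace StableCurve

variable {g n : ℕ} (Γ : StableCurve g n ShpMon.nnreal)

/-- The point of the realization given by a vertex. -/
def vertexPt (v : Γ.V) : Γ.Realization := Quot.mk _ (Sum.inl ⟨v, PUnit.unit⟩)

/-- `s` is a position on the edge or leg of the flag `f`. -/
def IsPos (f : Γ.F) (s : ℝ) : Prop := 0 ≤ s ∧ (Γ.inv f ≠ f → s ≤ Γ.realLen f)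

/-- `s` is a position on the edge or leg of the flag `f` other than the far end. -/
def IsShort (f : Γ.F) (s : ℝ) : Prop := 0 ≤ s ∧ (Γ.inv f ≠ f → s < Γ.realLen f)

variable {Γ}

theorem IsShort.isPos {f : Γ.F} {s : ℝ} (h : Γ.IsShort f s) : Γ.IsPos f s :=
  ⟨h.1, fun hf => (h.2 hf).le⟩

variable (Γ) in
open Classical in
/-- The point at distance `s` from the origin of the flag `f`. -/
noncomputable def flagPt (f : Γ.F) (s : ℝ) : Γ.Realization :=
  if h : Γ.IsPos f s then Quot.mk _ (Sum.inr ⟨f, ⟨s, h⟩⟩) else Γ.vertexPt (Γ.root f)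

theorem flagPt_of_isPos {f : Γ.F} {s : ℝ} (h : Γ.IsPos f s) :
    Γ.flagPt f s = Quot.mk _ (Sum.inr ⟨f, ⟨s, h⟩⟩) := dif_pos h

theorem realLen_nonneg (f : Γ.F) : 0 ≤ Γ.realLen f := NNReal.coe_nonneg _

theorem realLen_inv (f : Γ.F) : Γ.realLen (Γ.inv f) = Γ.realLen f :=
  congrArg NNReal.toReal (Γ.len_inv f)

theorem realLen_pos {f : Γ.F} (h : Γ.inv f ≠ f) : 0 < Γ.realLen f := by
  refine lt_of_le_of_ne (realLen_nonneg f) fun h0 => h ((Γ.len_eq_zero_iff f).1 ?_)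
  exact NNReal.eq h0.symm

theorem isShort_zero (f : Γ.F) : Γ.IsShort f 0 := ⟨le_rfl, realLen_pos⟩

theorem inv_inv_ne {f : Γ.F} (h : Γ.inv f ≠ f) : Γ.inv (Γ.inv f) ≠ Γ.inv f := by
  rw [Γ.inv_inv]; exact h.symm

theorem IsPos.flip {f : Γ.F} {s : ℝ} (h : Γ.IsPos f s) (hf : Γ.inv f ≠ f) :
    Γ.IsPos (Γ.inv f) (Γ.realLen f - s) :=
  ⟨sub_nonneg.2 (h.2 hf), fun _ => by rw [realLen_inv]; linarith [h.1]⟩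

theorem flagPt_zero (f : Γ.F) : Γ.flagPt f 0 = Γ.vertexPt (Γ.root f) := by
  rw [flagPt_of_isPos (isShort_zero f).isPos]
  exact Quot.sound (Glue.root f _)

theorem flagPt_flip {f : Γ.F} (hf : Γ.inv f ≠ f) {s : ℝ} (h : Γ.IsPos f s) :
    Γ.flagPt f s = Γ.flagPt (Γ.inv f) (Γ.realLen f - s) := by
  rw [flagPt_of_isPos h, flagPt_of_isPos (h.flip hf)]
  exact Quot.sound (Glue.flip f hf s _ _)

theorem continuous_flagPt {X : Type*} [TopologicalSpace X] {f : Γ.F} {a : X → ℝ}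
    (ha : Continuous a) (h : ∀ x, Γ.IsPos f (a x)) : Continuous fun x => Γ.flagPt f (a x) := by
  have : (fun x => Γ.flagPt f (a x)) =
      (Quot.mk Γ.Glue) ∘ fun x => Sum.inr ⟨f, ⟨a x, h x⟩⟩ :=
    funext fun x => flagPt_of_isPos (h x)
  rw [this]
  exact continuous_quot_mk.comp (continuous_inr.comp (continuous_sigmaMk.comp (ha.subtype_mk h)))

variable (Γ) in
open Classical in
/-- A complete invariant of the points of the realization. -/
noncomputable def code : Γ.Pieces → Γ.V ⊕ Set (Γ.F × ℝ)
  | Sum.inl v => Sum.inl v.1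
  | Sum.inr ⟨f, s⟩ =>
    if s.1 = 0 then Sum.inl (Γ.root f)
    else if Γ.inv f ≠ f ∧ s.1 = Γ.realLen f then Sum.inl (Γ.root (Γ.inv f))
    -- An interior point is recorded by the set of all its descriptions, one for a leg and from both
    -- ends for an edge, so that flipping the edge does not change it.
    else Sum.inr {p | p = (f, s.1) ∨ Γ.inv f ≠ f ∧ p = (Γ.inv f, Γ.realLen f - s.1)}

theorem code_eq_of_glue {p q : Γ.Pieces} (h : Γ.Glue p q) : Γ.code p = Γ.code q := by
  cases h with
  | root f h => simp [code]
  | flip f hf t h h' =>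
    have hp := realLen_pos hf
    have hne := inv_inv_ne hf
    have hl : Γ.realLen (Γ.inv f) = Γ.realLen f := realLen_inv f
    simp only [code]
    by_cases h0 : t = 0
    · have h1 : Γ.realLen f - t ≠ 0 := by rw [h0, sub_zero]; exact hp.ne'
      rw [if_pos h0, if_neg h1, if_pos ⟨hne, by rw [h0, sub_zero, hl]⟩, Γ.inv_inv]
    · rw [if_neg h0]
      by_cases h1 : t = Γ.realLen f
      · rw [if_pos ⟨hf, h1⟩, if_pos (sub_eq_zero.2 h1.symm)]
      · rw [if_neg (fun h => h1 h.2), if_neg (fun h => h1 (sub_eq_zero.1 h).symm),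
          if_neg (fun h => h0 (by linarith [h.2]))]
        congr 1
        ext p
        change (_ ∨ _) ↔ (_ ∨ _)
        rw [hl, Γ.inv_inv, sub_sub_cancel]
        exact ⟨fun h => h.elim (fun h => Or.inr ⟨hf.symm, h⟩) fun h => Or.inl h.2,
          fun h => h.elim (fun h => Or.inr ⟨hf, h⟩) fun h => Or.inl h.2⟩

theorem code_eq {p q : Γ.Pieces} (h : Quot.mk Γ.Glue p = Quot.mk Γ.Glue q) :
    Γ.code p = Γ.code q :=
  congrArg (Quot.lift Γ.code fun _ _ => code_eq_of_glue) h

theorem vertexPt_injective {v w : Γ.V} (h : Γ.vertexPt v = Γ.vertexPt w) : v = w :=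
  Sum.inl_injective (code_eq h)

theorem code_of_isShort {f : Γ.F} {s : ℝ} (h : Γ.IsShort f s) (h0 : s ≠ 0) :
    Γ.code (Sum.inr ⟨f, ⟨s, h.isPos⟩⟩) =
      Sum.inr {p | p = (f, s) ∨ Γ.inv f ≠ f ∧ p = (Γ.inv f, Γ.realLen f - s)} := by
  simp only [code]
  rw [if_neg h0, if_neg (fun k => (h.2 k.1).ne k.2)]

/-- The far end has to be excluded, since it is a vertex too. -/
theorem flagPt_eq_vertexPt {f : Γ.F} {s : ℝ} (h : Γ.IsShort f s) {v : Γ.V}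
    (e : Γ.flagPt f s = Γ.vertexPt v) : s = 0 ∧ Γ.root f = v := by
  by_cases h0 : s = 0
  · subst h0
    rw [flagPt_zero] at e
    exact ⟨rfl, vertexPt_injective e⟩
  · rw [flagPt_of_isPos h.isPos] at e
    have := code_eq e
    rw [code_of_isShort h h0] at this
    simp [code] at this

/-- The three alternatives are the same description, two flags meeting at their common root, and one
edge seen from its two ends. They organize the local comparison of marked curves below. -/
theorem flagPt_eq_flagPt {f f' : Γ.F} {s s' : ℝ} (h : Γ.IsShort f s) (h' : Γ.IsShort f' s')
    (e : Γ.flagPt f s = Γ.flagPt f' s') :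
    (f' = f ∧ s' = s) ∨ (s = 0 ∧ s' = 0) ∨
      (Γ.inv f ≠ f ∧ f' = Γ.inv f ∧ s' = Γ.realLen f - s) := by
  by_cases h0 : s = 0
  · subst h0
    rw [flagPt_zero] at e
    exact Or.inr (Or.inl ⟨rfl, (flagPt_eq_vertexPt h' e.symm).1⟩)
  · by_cases h0' : s' = 0
    · subst h0'
      rw [flagPt_zero] at e
      exact Or.inr (Or.inl ⟨(flagPt_eq_vertexPt h e).1, rfl⟩)
    · rw [flagPt_of_isPos h.isPos, flagPt_of_isPos h'.isPos] at e
      have := code_eq e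
      rw [code_of_isShort h h0, code_of_isShort h' h0'] at this
      have h1 : (f', s') ∈ {p | p = (f, s) ∨ Γ.inv f ≠ f ∧ p = (Γ.inv f, Γ.realLen f - s)} := by
        rw [Sum.inr_injective this]
        exact Or.inl rfl
      rcases h1 with h1 | ⟨h1, h2⟩
      · exact Or.inl ⟨congrArg Prod.fst h1, congrArg Prod.snd h1⟩
      · exact Or.inr (Or.inr ⟨h1, congrArg Prod.fst h2, congrArg Prod.snd h2⟩)

variable (Γ) in
/-- The vertices, edges and legs as spaces. -/
abbrev Piece : Γ.V ⊕ Γ.F → TopCat.{0}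
  | Sum.inl _ => TopCat.of PUnit
  | Sum.inr f => TopCat.of {s : ℝ // Γ.IsPos f s}

variable (Γ) in
/-- The maps of the vertices, edges and legs to the realization. -/
noncomputable def pieceMap : ∀ i, C(Γ.Piece i, Γ.Realization)
  | Sum.inl v => ContinuousMap.const _ (Γ.vertexPt v)
  | Sum.inr f => ⟨fun s => Γ.flagPt f s.1, continuous_flagPt continuous_subtype_val fun s => s.2⟩

theorem exists_pieceMap_eq (r : Γ.Realization) : ∃ i k, Γ.pieceMap i k = r := by
  obtain ⟨v | ⟨f, s⟩⟩ := r
  · exact ⟨Sum.inl v.1, PUnit.unit, rfl⟩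
  · exact ⟨Sum.inr f, s, flagPt_of_isPos s.2⟩

/-- The realization has the quotient topology of the disjoint union of its pieces. -/
theorem isOpen_of_pieceMap (U : Set Γ.Realization) (h : ∀ i, IsOpen (Γ.pieceMap i ⁻¹' U)) :
    IsOpen U := by
  refine isOpen_coinduced.2 (isOpen_sum_iff.2 ⟨isOpen_sigma_iff.2 fun v => ?_,
    isOpen_sigma_iff.2 fun f => ?_⟩)
  · exact h (Sum.inl v)
  · have := h (Sum.inr f)
    have e : ∀ s : {s : ℝ // Γ.IsPos f s}, Γ.flagPt f s.1 = Quot.mk _ (Sum.inr ⟨f, s⟩) :=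
      fun s => flagPt_of_isPos s.2
    have e2 : (Γ.pieceMap (Sum.inr f) ⁻¹' U : Set {s : ℝ // Γ.IsPos f s}) =
        {s | Quot.mk Γ.Glue (Sum.inr ⟨f, s⟩) ∈ U} := by
      ext s
      change Γ.flagPt f s.1 ∈ U ↔ _
      rw [e]; rfl
    rw [e2] at this
    exact this

end StableCurve

theorem MarkedGraph.Thin.symm {n : ℕ} {G : MarkedGraph (n + 1)} {f₁ f₂ : G.F} (t : G.Thin f₁ f₂)
    (h : G.inv f₂ ≠ f₂) : G.Thin f₂ f₁ where
  unstab := t.unstab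
  weight_eq := t.weight_eq
  ne₁₂ := t.ne₁₂.symm
  ne₁ := t.ne₂
  ne₂ := t.ne₁
  root₁ := t.root₂
  root₂ := t.root₁
  only f hf := (t.only f hf).imp_right Or.symm
  out₁ := t.out₂.resolve_left h
  out₂ := Or.inr t.out₁

/-! ### The point of `Γ` at which the last leg of a marked curve is attached. -/

namespace MarkedCurve

variable {g n : ℕ} {hgn : 2 < 2 * g + n} {Γ : StableCurve g n ShpMon.nnreal} {X X' : TopCat.{0}}

/-- The point of the cone belonging to a point of the base. -/
def coneAt (M : MarkedCurve hgn Γ X) (x : X) : M.cone.cone := M.map x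

/-- A flag that survives deleting the last leg. -/
def keptFlag (M : MarkedCurve hgn Γ X) {f : M.curve.F} (hf : M.curve.Kept f) :
    (M.curve.toMarkedGraph.stabilize (M.curve.stabilizable hgn)).F := ⟨f, hf⟩

/-- The length of a flag at a point of the base. -/
noncomputable def lenAt (M : MarkedCurve hgn Γ X) (f : M.curve.F) (x : X) : ℝ :=
  PC.eval (M.curve.len f) (M.coneAt x)

variable (M : MarkedCurve hgn Γ X)

theorem lenAt_nonneg (f : M.curve.F) (x : X) : 0 ≤ M.lenAt f x := PC.eval_nonneg _ _

theorem lenAt_inv (f : M.curve.F) (x : X) : M.lenAt (M.curve.inv f) x = M.lenAt f x :=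
  congrArg (PC.eval · (M.coneAt x)) (M.curve.len_inv f)

theorem lenAt_of_inv_eq {f : M.curve.F} (h : M.curve.inv f = f) (x : X) : M.lenAt f x = 0 :=
  congrArg (PC.eval · (M.coneAt x)) ((M.curve.len_eq_zero_iff f).2 h)

theorem continuous_lenAt (f : M.curve.F) : Continuous (M.lenAt f) :=
  (PC.continuous_eval _).comp (TopCat.Hom.hom M.map).continuous

/-- The base is mapped to the point `1` of the ray, where the linear function belonging to a length
takes that length as its value. -/
theorem eval_overRay (f : Γ.F) (x : X) :
    PC.eval (PC.pull M.ray (Γ.overRay.curve.len f)) (M.coneAt x) = Γ.realLen f := by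
  have h : (PC.space.map M.ray (M.map x)) = PC.rayOne :=
    congrArg (fun k : X ⟶ PC.space.obj PC.ray => k x) M.one
  have h1 : M.ray.1 (M.coneAt x).1 = (1 : ℝ) := congrArg Subtype.val h
  have h2 : PC.eval (PC.pull M.ray (Γ.overRay.curve.len f)) (M.coneAt x) =
      (show ℝ from M.ray.1 (M.coneAt x).1) * Γ.realLen f := rfl
  rw [h2]
  exact (congrArg (· * Γ.realLen f) h1).trans (one_mul _)

/-- At every point of the base the marking dictates all lengths of the stabilized curve. -/
theorem eval_stabLen (f : (M.curve.toMarkedGraph.stabilize (M.curve.stabilizable hgn)).F) (x : X) :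
    PC.eval (M.curve.stabLen f.1) (M.coneAt x) = Γ.realLen (M.mark.lift f) :=
  (congrArg (PC.eval · (M.coneAt x)) (M.marking.len_lift f)).symm.trans (M.eval_overRay _ x)

theorem lenAt_of_kept {f : M.curve.F} (hf : M.curve.Kept f) (h : M.curve.Kept (M.curve.inv f))
    (x : X) : M.lenAt f x = Γ.realLen (M.mark.lift (M.keptFlag hf)) := by
  rw [← M.eval_stabLen]
  exact congrArg (PC.eval · (M.coneAt x)) (StableCurve.stabLen_of_kept h).symm

/-- An edge contracted by the marking would have length zero at `x`, but the lengths of `Γ` are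
positive. A point `x` is indispensable: over the empty base the map to the ray may vanish. -/
theorem mark_lift_surjective (x : X) : Function.Surjective M.mark.lift := by
  intro f
  by_contra h
  have h1 : PC.eval (PC.pull M.ray (Γ.overRay.curve.len f)) (M.coneAt x) = 0 :=
    congrArg (PC.eval · (M.coneAt x)) (M.marking.len_contracted f h)
  rw [M.eval_overRay] at h1
  by_cases hf : Γ.inv f = f
  · exact h (M.mark.mem_range_of_inv_eq hf)
  · exact (StableCurve.realLen_pos hf).ne' h1

section Thin

variable {M} {f₁ f₂ : M.curve.F} (t : M.curve.Thin f₁ f₂)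

/-- The flag of `Γ` to which the last leg is attached. -/
noncomputable def flag : Γ.F := M.mark.lift (M.keptFlag t.kept_inv₁)

theorem inv_flag : Γ.inv (flag t) = M.mark.lift
    ((M.curve.toMarkedGraph.stabilize (M.curve.stabilizable hgn)).inv
      (M.keptFlag t.kept_inv₁)) :=
  M.mark.inv_lift _

/-- The inverses of `f₁` and `f₂` are the two ends of the edge that stabilization creates. -/
theorem flag_symm (h : M.curve.inv f₂ ≠ f₂) : flag (t.symm h) = Γ.inv (flag t) := by
  rw [inv_flag]
  refine congrArg M.mark.lift (Subtype.ext ?_)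
  have h1 : M.curve.jump (M.curve.inv (M.curve.inv f₁)) = M.curve.inv f₂ := by
    rw [M.curve.inv_inv, t.jump₁]
  refine Eq.trans ?_ (MarkedGraph.stabilize_inv_of_kept _ ?_).symm
  · exact h1.symm
  · exact h1 ▸ (t.symm h).kept_inv₁

theorem inv_flag_eq (h : M.curve.inv f₂ = f₂) : Γ.inv (flag t) = flag t := by
  rw [inv_flag]
  refine congrArg M.mark.lift (MarkedGraph.stabilize_inv_of_not_kept _ ?_)
  change ¬ M.curve.Kept (M.curve.jump (M.curve.inv (M.curve.inv f₁)))
  rw [M.curve.inv_inv, t.jump₁, h]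
  exact t.not_kept₂

theorem inv_flag_ne (h : M.curve.inv f₂ ≠ f₂) : Γ.inv (flag t) ≠ flag t := by
  rw [← flag_symm t h]
  intro e
  exact t.ne₁₂ (MarkedGraph.inv_injective
    (congrArg Subtype.val (M.mark.lift_injective e))).symm

theorem inv_ne_of_flag (h : Γ.inv (flag t) ≠ flag t) : M.curve.inv f₂ ≠ f₂ :=
  fun e => h (inv_flag_eq t e)

/-- Stabilization adds the two lengths, and the marking identifies the sum with an edge length of
`Γ`. Thus the length of `f₁` is a position on the edge, and that of `f₂` is the same position
measured from the other end. -/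
theorem lenAt_add (h : M.curve.inv f₂ ≠ f₂) (x : X) :
    M.lenAt f₁ x + M.lenAt f₂ x = Γ.realLen (flag t) := by
  have h1 : ¬ M.curve.Kept (M.curve.inv (M.curve.inv f₁)) := by
    rw [M.curve.inv_inv]; exact t.not_kept₁
  have h2 : M.curve.Kept (M.curve.jump (M.curve.inv (M.curve.inv f₁))) := by
    rw [M.curve.inv_inv, t.jump₁]
    exact (t.symm h).kept_inv₁
  rw [flag, ← M.eval_stabLen _ x]
  refine Eq.trans ?_ (congrArg (PC.eval · (M.coneAt x))
    (StableCurve.stabLen_of_kept_jump h1 h2)).symm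
  rw [M.curve.inv_inv, t.other₁]
  exact congrArg (· + M.lenAt f₂ x) (M.lenAt_inv f₁ x).symm

theorem isPos (x : X) : Γ.IsPos (flag t) (M.lenAt f₁ x) :=
  ⟨M.lenAt_nonneg _ _, fun h => by
    rw [← lenAt_add t (inv_ne_of_flag t h) x]
    linarith [M.lenAt_nonneg f₂ x]⟩

theorem flagPt_symm (h : M.curve.inv f₂ ≠ f₂) (x : X) :
    Γ.flagPt (flag (t.symm h)) (M.lenAt f₂ x) = Γ.flagPt (flag t) (M.lenAt f₁ x) := by
  rw [StableCurve.flagPt_flip (inv_flag_ne t h) (isPos t x), flag_symm t h, ← lenAt_add t h x]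
  congr 1
  ring

/-- The pair of flags at the disappearing vertex is unique up to order, and a change of order is a
flip of the edge. Hence the choice made in `classify` does not matter. -/
theorem flagPt_eq_of_thin {e₁ e₂ : M.curve.F} (s : M.curve.Thin e₁ e₂) (x : X) :
    Γ.flagPt (flag s) (M.lenAt e₁ x) = Γ.flagPt (flag t) (M.lenAt f₁ x) := by
  rcases t.only e₁ s.root₁ with h | h | h
  · exact absurd h s.ne₁
  · subst h; rfl
  · subst h
    have h2 : f₁ = e₂ := by
      rcases s.only f₁ t.root₁ with h | h | h
      · exact absurd h t.ne₁
      · exact absurd h t.ne₁₂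
      · exact h
    subst h2
    have h3 : M.curve.inv e₁ ≠ e₁ := fun h => s.out₁ (h.symm ▸ s.root₁)
    exact flagPt_symm t h3 x

/-- The root of the flag to which the last leg is attached. -/
theorem onV_root_flag : (M.mark.onV (Γ.root (flag t))).1 = M.curve.root (M.curve.inv f₁) :=
  congrArg Subtype.val (M.mark.onV_root _)

end Thin

/-- The last leg is attached to the vertex `v`. -/
def AtVertex (v : Γ.V) : Prop := ¬ M.curve.Unstab ∧ (M.mark.onV v).1 = M.curve.lastRoot

theorem exists_atVertex (h : ¬ M.curve.Unstab) : ∃ v, M.AtVertex v := by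
  obtain ⟨v, hv⟩ := M.mark.onV_surjective ⟨M.curve.lastRoot, fun hu => absurd hu h⟩
  exact ⟨v, h, congrArg Subtype.val hv⟩

open Classical in
/-- The point of `Γ` to which the last leg is attached. -/
noncomputable def classify (x : X) : Γ.Realization :=
  if h : M.curve.Unstab then
    Γ.flagPt (flag (M.curve.stabilizable hgn h).choose_spec.choose_spec)
      (M.lenAt (M.curve.stabilizable hgn h).choose x)
  else Γ.vertexPt (M.exists_atVertex h).choose

variable {M}

theorem classify_of_thin {f₁ f₂ : M.curve.F} (t : M.curve.Thin f₁ f₂) (x : X) :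
    M.classify x = Γ.flagPt (flag t) (M.lenAt f₁ x) := by
  rw [classify, dif_pos t.unstab]
  exact flagPt_eq_of_thin t _ x

theorem AtVertex.eq {v w : Γ.V} (h : M.AtVertex v) (h' : M.AtVertex w) (x : X) : v = w :=
  M.mark.onV_injective (M.mark_lift_surjective x) (Subtype.ext (h.2.trans h'.2.symm))

theorem AtVertex.classify {v : Γ.V} (h : M.AtVertex v) (x : X) : M.classify x = Γ.vertexPt v := by
  rw [MarkedCurve.classify, dif_neg h.1]
  exact congrArg Γ.vertexPt (AtVertex.eq (M.exists_atVertex h.1).choose_spec h x)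

-- One graph serves for the whole of `X`, so a single formula applies: a flag of `Γ` with a
-- continuously varying position, or a constant vertex.
variable (M) in
theorem continuous_classify : Continuous M.classify := by
  by_cases h : M.curve.Unstab
  · obtain ⟨f₁, f₂, t⟩ := M.curve.stabilizable hgn h
    have : M.classify = fun x => Γ.flagPt (flag t) (M.lenAt f₁ x) :=
      funext fun x => classify_of_thin t x
    rw [this]
    exact StableCurve.continuous_flagPt (M.continuous_lenAt f₁) (isPos t)
  · obtain ⟨v, hv⟩ := M.exists_atVertex h
    have : M.classify = fun x => Γ.vertexPt v := funext hv.classify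
    rw [this]
    exact continuous_const

namespace Hom

variable {M' : MarkedCurve hgn Γ X'} {f : X ⟶ X'} (h : Hom f M M')

include h

theorem coneAt_eq (x : X) : M'.coneAt (f x) =
    ⟨h.base.1 (M.coneAt x).1, h.base.2 _ (M.coneAt x).2⟩ :=
  congrArg (fun k : X ⟶ PC.space.obj M'.cone => k x) h.map_base.symm

theorem lenAt_eq_eval (e : M'.curve.F) (x : X) :
    M'.lenAt e (f x) = PC.eval (PC.pull h.base (M'.curve.len e)) (M.coneAt x) := by
  rw [lenAt, h.coneAt_eq]
  rfl

theorem lenAt_lift (e : M.curve.F) (x : X) :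
    M'.lenAt (h.curve.graph.lift e) (f x) = M.lenAt e x := by
  rw [h.lenAt_eq_eval, h.curve.len_lift]
  rfl

theorem lenAt_of_not_mem {e : M'.curve.F} (he : e ∉ Set.range h.curve.graph.lift) (x : X) :
    M'.lenAt e (f x) = 0 := by
  rw [h.lenAt_eq_eval, h.curve.len_contracted e he]
  rfl

theorem mark_onV (v : Γ.V) : (M.mark.onV v).1 = h.curve.graph.onV (M'.mark.onV v).1 := by
  rw [← h.mark_eq]
  rfl

theorem mark_lift (e : (M.curve.toMarkedGraph.stabilize (M.curve.stabilizable hgn)).F) : M.mark.lift e =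
    M'.mark.lift ((h.curve.graph.stabilize M'.curve.stable (M'.curve.stabilizable hgn)
      (M.curve.stabilizable hgn)).lift e) := by
  rw [← h.mark_eq]
  rfl

theorem thin {e₁ e₂ : M.curve.F} (s : M.curve.Thin e₁ e₂) :
    M'.curve.Thin (h.curve.graph.lift e₁) (h.curve.graph.lift e₂) :=
  s.lift h.curve.graph M'.curve.stable (M.curve.stabilizable hgn)

theorem flag_thin {e₁ e₂ : M.curve.F} (s : M.curve.Thin e₁ e₂) : flag (h.thin s) = flag s := by
  rw [flag, flag, h.mark_lift]
  refine congrArg M'.mark.lift (Subtype.ext ?_)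
  have h1 : M'.curve.inv (h.curve.graph.lift e₁) = h.curve.graph.lift (M.curve.inv e₁) :=
    h.curve.graph.inv_lift e₁
  change M'.curve.inv (h.curve.graph.lift e₁) = M'.curve.jump (h.curve.graph.lift (M.curve.inv e₁))
  rw [← h1, MarkedGraph.jump_of_kept (h.thin s).kept_inv₁]

/-- Contracting the edge of `f₁` moves the last leg to the far end of that edge, which is the root
of `flag t`. -/
theorem atVertex_of_thin {f₁ f₂ : M'.curve.F} (t : M'.curve.Thin f₁ f₂) (hM : ¬ M.curve.Unstab)
    (h1 : f₁ ∉ Set.range h.curve.graph.lift) : M.AtVertex (Γ.root (flag t)) := by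
  refine ⟨hM, ?_⟩
  rw [h.mark_onV, onV_root_flag, h.curve.graph.onV_contracted _ h1, t.root₁]
  exact h.curve.graph.onV_lastRoot

/-- The substantial case is that the vertex becomes unstable for `M'` but not for `M`. One of its
two flags is then contracted and has length zero, so both descriptions give the vertex of `Γ` at
that end. -/
theorem classify_eq (x : X) : M'.classify (f x) = M.classify x := by
  by_cases hM : M.curve.Unstab
  · obtain ⟨e₁, e₂, s⟩ := M.curve.stabilizable hgn hM
    rw [classify_of_thin s, classify_of_thin (h.thin s), h.flag_thin, h.lenAt_lift]
  · by_cases hM' : M'.curve.Unstab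
    · have main : ∀ {f₁ f₂} (t : M'.curve.Thin f₁ f₂), f₁ ∉ Set.range h.curve.graph.lift →
          M'.classify (f x) = M.classify x := by
        intro f₁ f₂ t h1
        rw [classify_of_thin t, h.lenAt_of_not_mem h1, StableCurve.flagPt_zero,
          (h.atVertex_of_thin t hM h1).classify]
      obtain ⟨f₁, f₂, t⟩ := M'.curve.stabilizable hgn hM'
      rcases h.curve.graph.not_mem_range_of_not_unstab hM t with h1 | h1
      · exact main t h1
      · exact main (t.symm fun e => h1 (h.curve.graph.mem_range_of_inv_eq e)) h1
    · obtain ⟨v, hv⟩ := M'.exists_atVertex hM'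
      have : M.AtVertex v := ⟨hM, by
        rw [h.mark_onV, hv.2]; exact h.curve.graph.onV_lastRoot⟩
      rw [hv.classify, this.classify]

end Hom

end MarkedCurve

/-! ### Local comparison of marked curves with the same classifying map. -/

namespace PC

/-- Elements of the dual monoid that agree on the image of a map to the cone can be identified
without changing the map. -/
theorem exists_pull_eq {σ : PC} {ι : Type*} (a b : ι → σ.dualMon) {X : TopCat.{0}}
    (c : X ⟶ space.obj σ) (h : ∀ k (x : X), eval (a k) (c x) = eval (b k) (c x)) :
    ∃ (ρ : PC) (i : ρ ⟶ σ) (d : X ⟶ space.obj ρ), d ≫ space.map i = c ∧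
      ∀ k, pull i (a k) = pull i (b k) := by
  -- Each desired equality cuts out a linear subspace; the given map factors through the
  -- intersection of all of them.
  let W : Submodule ℝ σ.V := ⨅ k, LinearMap.ker ((a k).1 - (b k).1)
  obtain ⟨d, hd⟩ := exists_lift_cut (W := W) c fun x =>
    (Submodule.mem_iInf _).2 fun k => LinearMap.mem_ker.2 (sub_eq_zero.2 (h k x))
  refine ⟨_, _, d, hd, fun k => eval_ext fun v => ?_⟩
  have h1 := (Submodule.mem_iInf _).1 (σ.cutIncl_mem W v.1) k
  exact sub_eq_zero.1 (LinearMap.mem_ker.1 h1)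

end PC

/-- The inclusion of a subspace. -/
def TopCat.incl {X : TopCat.{0}} (S : Set X) : TopCat.of S ⟶ X :=
  TopCat.ofHom ⟨Subtype.val, continuous_subtype_val⟩

namespace MarkedCurve

variable {g n : ℕ} {hgn : 2 < 2 * g + n} {Γ : StableCurve g n ShpMon.nnreal} {X Y : TopCat.{0}}

/-- Two marked curves have a common restriction along a continuous map. -/
def Joint (f : Y ⟶ X) (M M' : MarkedCurve hgn Γ X) : Prop :=
  ∃ N : MarkedCurve hgn Γ Y, Nonempty (Hom f N M) ∧ Nonempty (Hom f N M')

theorem Joint.symm {f : Y ⟶ X} {M M' : MarkedCurve hgn Γ X} (h : Joint f M M') :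
    Joint f M' M :=
  ⟨h.choose, h.choose_spec.2, h.choose_spec.1⟩

theorem Joint.comp {f : Y ⟶ X} {M M' : MarkedCurve hgn Γ X} {N N' : MarkedCurve hgn Γ Y}
    (h : Joint (𝟙 Y) N N') (a : Hom f N M) (b : Hom f N' M') : Joint f M M' := by
  obtain ⟨L, ⟨c⟩, ⟨d⟩⟩ := h
  exact ⟨L, ⟨Category.id_comp f ▸ c.comp a⟩, ⟨Category.id_comp f ▸ d.comp b⟩⟩

/-- Marked curves with isomorphic graphs and equal lengths have a common restriction. -/
theorem joint_of_iso {M M' : MarkedCurve hgn Γ X}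
    (e : MarkedGraph.Contraction M'.curve.toMarkedGraph M.curve.toMarkedGraph)
    (he : Function.Surjective e.lift)
    (hm : M'.mark.trans (e.stabilize M'.curve.stable (M'.curve.stabilizable hgn)
      (M.curve.stabilizable hgn)) = M.mark)
    (hl : ∀ f x, M'.lenAt (e.lift f) x = M.lenAt f x) : Joint (𝟙 X) M M' := by
  -- Taking the fibre product over the ray makes the structure maps to the ray agree. The further
  -- cut by `exists_pull_eq` makes corresponding lengths agree, so that one curve `N` specializes
  -- both.
  obtain ⟨ρ, i, j, c, hi, hj, hij⟩ := PC.exists_fiberProduct M.ray M'.ray M.map M'.map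
    (M.one.trans M'.one.symm)
  have hci : ∀ x, (⟨i.1 (c x).1, i.2 _ (c x).2⟩ : M.cone.cone) = M.coneAt x := fun x =>
    congrArg (fun k : X ⟶ PC.space.obj M.cone => k x) hi
  have hcj : ∀ x, (⟨j.1 (c x).1, j.2 _ (c x).2⟩ : M'.cone.cone) = M'.coneAt x := fun x =>
    congrArg (fun k : X ⟶ PC.space.obj M'.cone => k x) hj
  obtain ⟨ρ', k, d, hd, hk⟩ := PC.exists_pull_eq (fun f : M.curve.F => PC.pull i (M.curve.len f))
    (fun f => PC.pull j (M'.curve.len (e.lift f))) c (fun f x => by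
      exact (congrArg (PC.eval (M.curve.len f)) (hci x)).trans ((hl f x).symm.trans
        (congrArg (PC.eval (M'.curve.len (e.lift f))) (hcj x)).symm))
  obtain ⟨N, ⟨u⟩⟩ := CurveContraction.exists_pullback (PC.pull (k ≫ i)) M.curve
  let u' : CurveContraction (PC.pull (k ≫ j)) M'.curve N :=
    { graph := e.trans u.graph
      len_lift := fun f => (hk (u.graph.lift f)).symm.trans (u.len_lift f)
      len_contracted := fun f hf => by
        obtain ⟨f, rfl⟩ := he f
        refine (hk f).symm.trans (u.len_contracted f fun ⟨q, hq⟩ => hf ⟨q, ?_⟩)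
        exact congrArg e.lift hq }
  have hdi : d ≫ PC.space.map (k ≫ i) = 𝟙 X ≫ M.map := by
    rw [PC.space.map_comp, ← Category.assoc, hd, hi, Category.id_comp]
  have hdj : d ≫ PC.space.map (k ≫ j) = 𝟙 X ≫ M'.map := by
    rw [PC.space.map_comp, ← Category.assoc, hd, hj, Category.id_comp]
  refine ⟨M.comap (𝟙 X) (k ≫ i) d hdi u, ⟨M.comapHom _ _ _ _ _⟩, ⟨⟨k ≫ j, u', hdj, ?_, ?_⟩⟩⟩
  · exact (Category.assoc _ _ _).trans ((congrArg (k ≫ ·) hij).symm.trans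
      (Category.assoc _ _ _).symm)
  · refine Eq.trans ?_ (congrArg (fun z : MarkedGraph.Contraction Γ.toMarkedGraph
      (M.curve.toMarkedGraph.stabilize (M.curve.stabilizable hgn)) =>
      z.trans (u.graph.stabilize M.curve.stable _ (N.stabilizable hgn))) hm)
    exact congrArg (M'.mark.trans ·) (MarkedGraph.Contraction.stabilize_trans e u.graph
      M'.curve.stable M.curve.stable _ (M.curve.stabilizable hgn) _)

/-- Comparison of the curves obtained by deleting the last leg. -/
theorem exists_comparison (M M' : MarkedCurve hgn Γ X) (x : X) :
    ∃ ε : MarkedGraph.Contraction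
        (M'.curve.toMarkedGraph.stabilize (M'.curve.stabilizable hgn))
        (M.curve.toMarkedGraph.stabilize (M.curve.stabilizable hgn)),
      Function.Surjective ε.lift ∧ M'.mark.trans ε = M.mark := by
  obtain ⟨d, hd, -, hs⟩ := M'.mark.exists_inverse (M'.mark_lift_surjective x)
  exact ⟨d.trans M.mark, hs.comp (M.mark_lift_surjective x),
    congrArg (MarkedGraph.Contraction.trans · M.mark) hd⟩

/-- Both flags of such an edge survive stabilization, so its length on either side is that of the
corresponding edge of `Γ`. -/
theorem lenAt_eq_of_kept {M M' : MarkedCurve hgn Γ X}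
    {e : MarkedGraph.Contraction M'.curve.toMarkedGraph M.curve.toMarkedGraph}
    (hm : M'.mark.trans (e.stabilize M'.curve.stable (M'.curve.stabilizable hgn)
      (M.curve.stabilizable hgn)) = M.mark) {f : M.curve.F} (hf : M.curve.Kept f)
    (hf' : M.curve.Kept (M.curve.inv f)) (he : M'.curve.Kept (e.lift f))
    (he' : M'.curve.Kept (e.lift (M.curve.inv f))) (x : X) :
    M'.lenAt (e.lift f) x = M.lenAt f x := by
  rw [M.lenAt_of_kept hf hf', M'.lenAt_of_kept he (by rw [e.inv_lift]; exact he')]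
  refine congrArg Γ.realLen ?_
  have h : M'.mark.lift ((e.stabilize M'.curve.stable (M'.curve.stabilizable hgn)
      (M.curve.stabilizable hgn)).lift (M.keptFlag hf)) = M.mark.lift (M.keptFlag hf) :=
    congrFun (congrArg MarkedGraph.Contraction.lift hm) (M.keptFlag hf)
  rw [← h]
  exact congrArg M'.mark.lift (Subtype.ext (MarkedGraph.jump_of_kept he).symm)

/-- The comparison of the stabilizations matches the vertices of the last legs, both of which come
from `v`, hence extends to the graphs. Apart from the last leg, all lengths are dictated by `Γ`. -/
theorem AtVertex.joint {M M' : MarkedCurve hgn Γ X} {v : Γ.V} (h : M.AtVertex v)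
    (h' : M'.AtVertex v) (x : X) : Joint (𝟙 X) M M' := by
  obtain ⟨ε, hε, hm⟩ := exists_comparison M M' x
  have hv : ∀ w, ε.onV (M'.mark.onV w) = M.mark.onV w := fun w =>
    congrFun (congrArg MarkedGraph.Contraction.onV hm) w
  obtain ⟨e, he, hs⟩ := MarkedGraph.Contraction.exists_iso_of_not_unstab M'.curve.stable h'.1 h.1
    ε hε (fun w hw => by
      have : w = M'.mark.onV v := Subtype.ext (hw.trans h'.2.symm)
      rw [this, hv, h.2])
  have hm' : M'.mark.trans (e.stabilize M'.curve.stable (M'.curve.stabilizable hgn)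
      (M.curve.stabilizable hgn)) = M.mark := by rw [hs, hm]
  refine joint_of_iso e he hm' fun f y => ?_
  by_cases hf : f = M.curve.lastLeg
  · subst hf
    rw [M.lenAt_of_inv_eq MarkedGraph.inv_lastLeg, e.lift_lastLeg,
      M'.lenAt_of_inv_eq MarkedGraph.inv_lastLeg]
  · have hf' := MarkedGraph.inv_ne_lastLeg hf
    exact lenAt_eq_of_kept hm' (MarkedGraph.kept_of_not_unstab h.1 hf)
      (MarkedGraph.kept_of_not_unstab h.1 hf')
      (MarkedGraph.kept_of_not_unstab h'.1 (e.lift_ne_lastLeg hf))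
      (MarkedGraph.kept_of_not_unstab h'.1 (e.lift_ne_lastLeg hf')) y

/-- Equality of the flags of `Γ` matches the subdivided edges with orientation, so the comparison
extends to the graphs. The lengths of `f₁` and `f₁'` agree by hypothesis, those of `f₂` and `f₂'`
because the sums are the same, and the others are dictated by `Γ`. -/
theorem joint_of_thin {M M' : MarkedCurve hgn Γ X} {f₁ f₂ : M.curve.F}
    (t : M.curve.Thin f₁ f₂) {f₁' f₂' : M'.curve.F} (t' : M'.curve.Thin f₁' f₂')
    (hf : flag t' = flag t) (hl : ∀ x, M'.lenAt f₁' x = M.lenAt f₁ x) (x : X) :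
    Joint (𝟙 X) M M' := by
  obtain ⟨ε, hε, hm⟩ := exists_comparison M M' x
  have hv : ∀ w, M'.mark.lift (ε.lift w) = M.mark.lift w := fun w =>
    congrFun (congrArg MarkedGraph.Contraction.lift hm) w
  obtain ⟨e, he, hs, h1, h2⟩ := MarkedGraph.Contraction.exists_iso_of_thin M'.curve.stable t' t
    ε hε (congrArg Subtype.val (M'.mark.lift_injective ((hv (M.keptFlag t.kept_inv₁)).trans
      hf.symm)))
  have hm' : M'.mark.trans (e.stabilize M'.curve.stable (M'.curve.stabilizable hgn)
      (M.curve.stabilizable hgn)) = M.mark := by rw [hs, hm]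
  have key : ∀ f y, ¬ M.curve.Kept f → M'.lenAt (e.lift f) y = M.lenAt f y := by
    intro f y hk
    rcases t.cases f with h | h | h | h
    · exact absurd h hk
    · subst h
      rw [M.lenAt_of_inv_eq MarkedGraph.inv_lastLeg, e.lift_lastLeg,
        M'.lenAt_of_inv_eq MarkedGraph.inv_lastLeg]
    · subst h
      rw [h1, hl]
    · subst h
      rw [h2]
      by_cases hi : M.curve.inv f = f
      · have hi' : M'.curve.inv f₂' = f₂' := by
          by_contra hi'
          exact inv_flag_ne t' hi' (by rw [hf]; exact inv_flag_eq t hi)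
        rw [M.lenAt_of_inv_eq hi, M'.lenAt_of_inv_eq hi']
      · have hi' : M'.curve.inv f₂' ≠ f₂' := fun hi' =>
          inv_flag_ne t hi (by rw [← hf]; exact inv_flag_eq t' hi')
        have a := lenAt_add t hi y
        have a' := lenAt_add t' hi' y
        rw [hf, hl] at a'
        linarith
  have kept : ∀ f, M.curve.Kept f → M'.curve.Kept (e.lift f) := by
    intro f hk
    rw [t.kept_iff'] at hk
    rw [t'.kept_iff', ← h1, ← h2]
    exact ⟨e.lift_ne_lastLeg hk.1, fun h => hk.2.1 (e.lift_injective h),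
      fun h => hk.2.2 (e.lift_injective h)⟩
  refine joint_of_iso e he hm' fun f y => ?_
  by_cases hk : M.curve.Kept f
  · by_cases hk' : M.curve.Kept (M.curve.inv f)
    · exact lenAt_eq_of_kept hm' hk hk' (kept _ hk) (kept _ hk') y
    · rw [← M.lenAt_inv, ← M'.lenAt_inv, e.inv_lift]
      exact key _ y hk'
  · exact key f y hk

/-- If the distance of the last leg from a vertex vanishes, the last leg can be moved to the
vertex. -/
theorem exists_not_unstab (M : MarkedCurve hgn Γ X) {f₁ f₂ : M.curve.F} (t : M.curve.Thin f₁ f₂)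
    (f : Y ⟶ X) (h : ∀ y, M.lenAt f₁ (f y) = 0) :
    ∃ N : MarkedCurve hgn Γ Y, Nonempty (Hom f N M) ∧ ¬ N.curve.Unstab := by
  -- On the smaller cone the length of `f₁` is identically zero, which forces its edge to be
  -- contracted. Were the vertex still unstable, all flags at the vertex above it would survive,
  -- including `f₁`.
  obtain ⟨ρ, i, d, hd, hk⟩ := PC.exists_pull_eq (fun _ : Unit => M.curve.len f₁) (fun _ => 0)
    (f ≫ M.map) fun _ y => h y
  obtain ⟨N, ⟨u⟩⟩ := CurveContraction.exists_pullback (PC.pull i) M.curve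
  refine ⟨M.comap f i d hd u, ⟨M.comapHom f i d hd u⟩, fun hu => ?_⟩
  have hu : N.Unstab := hu
  obtain ⟨e₁, e₂, s⟩ := N.stabilizable hgn hu
  have s' := s.lift u.graph M.curve.stable (N.stabilizable hgn)
  have hr : f₁ ∉ Set.range u.graph.lift := by
    rw [u.mem_range_iff]
    intro h0
    have h1 := h0 (hk ())
    exact t.out₁ (h1.symm ▸ t.root₁)
  rcases s'.only f₁ t.root₁ with h | h | h
  · exact t.ne₁ h
  · exact hr ⟨_, h.symm⟩
  · exact hr ⟨_, h.symm⟩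

/-- Restrictions whose vertex stays stable have constant classifying maps, so agreement at the one
point `y` gives the same vertex of `Γ`. -/
theorem joint_of_not_unstab {f : Y ⟶ X} {M M' : MarkedCurve hgn Γ X} {N N' : MarkedCurve hgn Γ Y}
    (a : Hom f N M) (b : Hom f N' M') (h : ¬ N.curve.Unstab) (h' : ¬ N'.curve.Unstab) (y : Y)
    (e : M.classify (f y) = M'.classify (f y)) : Joint f M M' := by
  obtain ⟨v, hv⟩ := N.exists_atVertex h
  obtain ⟨v', hv'⟩ := N'.exists_atVertex h'
  rw [a.classify_eq, b.classify_eq, hv.classify, hv'.classify] at e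
  obtain rfl := StableCurve.vertexPt_injective e
  exact Joint.comp (hv.joint hv' y) a b

/-- If the position is the far end of an edge, the other flag has length zero, and exchanging the
two flags puts the position at the beginning. -/
theorem exists_isShort (M : MarkedCurve hgn Γ X) (h : M.curve.Unstab) (x : X) :
    ∃ (f₁ f₂ : M.curve.F) (t : M.curve.Thin f₁ f₂), Γ.IsShort (flag t) (M.lenAt f₁ x) := by
  obtain ⟨f₁, f₂, t⟩ := M.curve.stabilizable hgn h
  by_cases hs : Γ.IsShort (flag t) (M.lenAt f₁ x)
  · exact ⟨f₁, f₂, t, hs⟩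
  · have h1 : Γ.inv (flag t) ≠ flag t ∧ Γ.realLen (flag t) ≤ M.lenAt f₁ x := by
      by_contra h1
      refine hs ⟨M.lenAt_nonneg _ _, fun h2 => ?_⟩
      by_contra h3
      exact h1 ⟨h2, not_lt.1 h3⟩
    have hi := inv_ne_of_flag t h1.1
    have h0 : M.lenAt f₂ x = 0 := by
      have := lenAt_add t hi x
      linarith [M.lenAt_nonneg f₂ x]
    refine ⟨f₂, f₁, t.symm hi, ?_⟩
    rw [h0]
    exact StableCurve.isShort_zero _

theorem isOpen_isShort (M : MarkedCurve hgn Γ X) (f : Γ.F) (e : M.curve.F) :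
    IsOpen {x | Γ.IsShort f (M.lenAt e x)} := by
  by_cases h : Γ.inv f = f
  · have : {x | Γ.IsShort f (M.lenAt e x)} = Set.univ :=
      Set.eq_univ_of_forall fun x => ⟨M.lenAt_nonneg _ _, fun h' => absurd h h'⟩
    rw [this]
    exact isOpen_univ
  · have : {x | Γ.IsShort f (M.lenAt e x)} = {x | M.lenAt e x < Γ.realLen f} :=
      Set.ext fun x => ⟨fun h' => h'.2 h, fun h' => ⟨M.lenAt_nonneg _ _, fun _ => h'⟩⟩
    rw [this]
    exact isOpen_lt (M.continuous_lenAt e) continuous_const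

/-- The classifying map of `M'` is a constant vertex. Where the position for `M` stays short of the
far end, it has to vanish, and the last leg of `M` can be moved to the vertex. -/
theorem exists_joint_of_not_unstab {M M' : MarkedCurve hgn Γ X}
    (h : ∀ x, M.classify x = M'.classify x) (hM : M.curve.Unstab) (hM' : ¬ M'.curve.Unstab)
    (x : X) : ∃ S : Set X, IsOpen S ∧ x ∈ S ∧ Joint (TopCat.incl S) M M' := by
  obtain ⟨f₁, f₂, t, ht⟩ := M.exists_isShort hM x
  refine ⟨_, M.isOpen_isShort (flag t) f₁, ht, ?_⟩
  obtain ⟨v, hv⟩ := M'.exists_atVertex hM'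
  obtain ⟨N, ⟨a⟩, hN⟩ := M.exists_not_unstab t
    (TopCat.incl {x | Γ.IsShort (flag t) (M.lenAt f₁ x)}) (fun y => by
      have := h y.1
      rw [classify_of_thin t, hv.classify] at this
      exact (StableCurve.flagPt_eq_vertexPt y.2 this).1)
  exact joint_of_not_unstab a (M'.restrictHom _) hN hM' ⟨x, ht⟩ (h _)

/-- Short positions on the same flag that give the same point of `Γ` are equal, so `joint_of_thin`
applies on the open set where both are short. -/
theorem exists_joint_of_flag_eq {M M' : MarkedCurve hgn Γ X}
    (h : ∀ x, M.classify x = M'.classify x) {f₁ f₂ : M.curve.F}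
    (t : M.curve.Thin f₁ f₂) {f₁' f₂' : M'.curve.F} (t' : M'.curve.Thin f₁' f₂')
    (hf : flag t' = flag t) (x : X) (hx : Γ.IsShort (flag t) (M.lenAt f₁ x))
    (hx' : Γ.IsShort (flag t') (M'.lenAt f₁' x)) :
    ∃ S : Set X, IsOpen S ∧ x ∈ S ∧ Joint (TopCat.incl S) M M' := by
  let S : Set X := {x | Γ.IsShort (flag t) (M.lenAt f₁ x)} ∩
    {x | Γ.IsShort (flag t') (M'.lenAt f₁' x)}
  refine ⟨S, (M.isOpen_isShort _ _).inter (M'.isOpen_isShort _ _), ⟨hx, hx'⟩, ?_⟩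
  refine Joint.comp (joint_of_thin (M := M.restrict (TopCat.incl S))
    (M' := M'.restrict (TopCat.incl S)) t t' hf (fun y => ?_) ⟨x, hx, hx'⟩) (M.restrictHom _)
    (M'.restrictHom _)
  have := h y.1
  rw [classify_of_thin t, classify_of_thin t'] at this
  change M'.lenAt f₁' y.1 = M.lenAt f₁ y.1
  rcases StableCurve.flagPt_eq_flagPt y.2.1 y.2.2 this with k | k | k
  · exact k.2
  · rw [k.1, k.2]
  · exact absurd (k.2.1.symm.trans hf) k.1

/-- If the two flags of `Γ` differ, the common point at `x` is either their common root, where both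
last legs can be moved to the vertex near `x`, or an interior point of one edge seen from both ends,
where exchanging the flags on one side leads back to equal flags. -/
theorem exists_joint_of_unstab {M M' : MarkedCurve hgn Γ X}
    (h : ∀ x, M.classify x = M'.classify x) (hM : M.curve.Unstab) (hM' : M'.curve.Unstab)
    (x : X) : ∃ S : Set X, IsOpen S ∧ x ∈ S ∧ Joint (TopCat.incl S) M M' := by
  obtain ⟨f₁, f₂, t, ht⟩ := M.exists_isShort hM x
  obtain ⟨f₁', f₂', t', ht'⟩ := M'.exists_isShort hM' x
  have hx := h x
  rw [classify_of_thin t, classify_of_thin t'] at hx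
  by_cases hf : flag t' = flag t
  · exact exists_joint_of_flag_eq h t t' hf x ht ht'
  rcases StableCurve.flagPt_eq_flagPt ht ht' hx with k | k | k
  · exact absurd k.1 hf
  -- The flags may be the two ends of a loop of `Γ`. Requiring the two positions to add up to less
  -- than the edge length excludes that they describe the same interior point near `x`, so both have
  -- to vanish on `S`.
  · let T : Set X := {y | Γ.inv (flag t) ≠ flag t →
      M.lenAt f₁ y + M'.lenAt f₁' y < Γ.realLen (flag t)}
    have hT : IsOpen T := by
      by_cases hi : Γ.inv (flag t) = flag t
      · have : T = Set.univ := Set.eq_univ_of_forall fun x h' => absurd hi h'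
        rw [this]
        exact isOpen_univ
      · have : T = {y | M.lenAt f₁ y + M'.lenAt f₁' y < Γ.realLen (flag t)} :=
          Set.ext fun x => ⟨fun h' => h' hi, fun h' _ => h'⟩
        rw [this]
        exact isOpen_lt ((M.continuous_lenAt _).add (M'.continuous_lenAt _)) continuous_const
    have hxT : x ∈ T := fun hi => by
      rw [k.1, k.2, add_zero]
      exact StableCurve.realLen_pos hi
    let S : Set X := ({x | Γ.IsShort (flag t) (M.lenAt f₁ x)} ∩
      {x | Γ.IsShort (flag t') (M'.lenAt f₁' x)}) ∩ T
    have hS : ∀ y ∈ S, M.lenAt f₁ y = 0 ∧ M'.lenAt f₁' y = 0 := by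
      rintro y ⟨⟨h1, h2⟩, h3⟩
      have hy := h y
      rw [classify_of_thin t, classify_of_thin t'] at hy
      rcases StableCurve.flagPt_eq_flagPt h1 h2 hy with k | k | k
      · exact absurd k.1 hf
      · exact k
      · linarith [h3 k.1, k.2.2]
    refine ⟨S, ((M.isOpen_isShort _ _).inter (M'.isOpen_isShort _ _)).inter hT,
      ⟨⟨ht, ht'⟩, hxT⟩, ?_⟩
    obtain ⟨N, ⟨a⟩, hN⟩ := M.exists_not_unstab t (TopCat.incl S) fun y => (hS y.1 y.2).1
    obtain ⟨N', ⟨b⟩, hN'⟩ := M'.exists_not_unstab t' (TopCat.incl S) fun y => (hS y.1 y.2).2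
    exact joint_of_not_unstab a b hN hN' ⟨x, ⟨ht, ht'⟩, hxT⟩ (h _)
  -- Opposite flags of one edge: exchanging the two flags on the side of `M'` reverses the
  -- orientation.
  · have hi : M'.curve.inv f₂' ≠ f₂' := inv_ne_of_flag t' (by
      rw [k.2.1]; exact StableCurve.inv_inv_ne k.1)
    have hf' : flag (t'.symm hi) = flag t := by rw [flag_symm t' hi, k.2.1, Γ.inv_inv]
    refine exists_joint_of_flag_eq h t (t'.symm hi) hf' x ht ?_
    have hl := lenAt_add t' hi x
    rw [k.2.1, StableCurve.realLen_inv, k.2.2] at hl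
    rw [hf', show M'.lenAt f₂' x = M.lenAt f₁ x by linarith]
    exact ht

/-- Marked curves with the same classifying map have locally a common restriction. -/
theorem exists_joint {M M' : MarkedCurve hgn Γ X} (h : ∀ x, M.classify x = M'.classify x) (x : X) :
    ∃ S : Set X, IsOpen S ∧ x ∈ S ∧ Joint (TopCat.incl S) M M' := by
  by_cases hM : M.curve.Unstab <;> by_cases hM' : M'.curve.Unstab
  · exact exists_joint_of_unstab h hM hM' x
  · exact exists_joint_of_not_unstab h hM hM' x
  · obtain ⟨S, h1, h2, h3⟩ := exists_joint_of_not_unstab (fun x => (h x).symm) hM' hM x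
    exact ⟨S, h1, h2, h3.symm⟩
  · exact ⟨Set.univ, isOpen_univ, trivial, joint_of_not_unstab (M.restrictHom _)
      (M'.restrictHom _) hM hM' ⟨x, trivial⟩ (h x)⟩

end MarkedCurve

/-! ### Families over the vertices, edges and legs of `Γ`. -/

namespace PC

/-- The identity of the ray, as an element of the dual monoid. -/
noncomputable def coord : ray.dualMon := ⟨LinearMap.id, fun _ => id⟩

/-- The map to the ray given by a nonnegative continuous function. -/
noncomputable def rayMap {X : TopCat.{0}} (a : X → ℝ) (ha : Continuous a) (h : ∀ x, 0 ≤ a x) :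
    X ⟶ space.obj ray :=
  TopCat.ofHom ⟨fun x => ⟨a x, h x⟩, ha.subtype_mk _⟩

/-- A nonzero map to the ray is injective on dual monoids. -/
theorem eq_zero_of_pull {σ : PC} (t : σ ⟶ ray) (v : σ.cone) (hv : (show ℝ from t.1 v.1) ≠ 0)
    (p : ray.dualMon) (h : pull t p = 0) : p = 0 := by
  have h1 : p.1 (t.1 v.1) = 0 := congrArg (eval · v) h
  have h2 : p.1 (t.1 v.1) = (show ℝ from t.1 v.1) * p.1 (1 : ℝ) := by
    have h3 := p.1.map_smul (show ℝ from t.1 v.1) (1 : ℝ)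
    refine Eq.trans (congrArg p.1 ?_) h3
    exact (mul_one (show ℝ from t.1 v.1)).symm
  have h4 : p.1 (1 : ℝ) = 0 := (mul_eq_zero.1 (h2.symm.trans h1)).resolve_left hv
  exact Subtype.ext (LinearMap.ext_ring (f := p.1) (g := 0) h4)

/-- The map from the square of the ray to the ray given by the sum divided by `d`. -/
noncomputable def sumDiv (d : ℝ) (hd : 0 ≤ d) : ray.prod ray ⟶ ray :=
  ⟨(show ℝ × ℝ →ₗ[ℝ] ℝ from d⁻¹ • (LinearMap.fst ℝ ℝ ℝ + LinearMap.snd ℝ ℝ ℝ)), fun _ hv =>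
    mul_nonneg (inv_nonneg.2 hd) (add_nonneg hv.1 hv.2)⟩

end PC

namespace MarkedCurve

variable {g n : ℕ} {hgn : 2 < 2 * g + n} {Γ : StableCurve g n ShpMon.nnreal} {X : TopCat.{0}}

/-- The curve `Γ` with an additional leg at a vertex. -/
noncomputable def atVertex (hgn : 2 < 2 * g + n) (v : Γ.V) (X : TopCat.{0}) :
    MarkedCurve hgn Γ X where
  cone := PC.ray
  curve := Γ.overRay.curve.attachLeg v
  map := PC.constOne X
  ray := 𝟙 _
  marking := (StableCurve.attachLegMap Γ.overRay.curve hgn v).congr rfl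
  one := rfl

theorem atVertex_spec (v : Γ.V) : (atVertex hgn v X).AtVertex v :=
  ⟨MarkedGraph.attachLeg_not_unstab (G := Γ.toMarkedGraph) v Γ.stable,
    (MarkedGraph.attachLeg_lastRoot (G := Γ.toMarkedGraph) v).symm⟩

/-- The curve `Γ` with an additional leg at a point of an edge or leg. -/
noncomputable def onFlag (hgn : 2 < 2 * g + n) (f : Γ.F) {σ : PC} (t : σ ⟶ PC.ray)
    (ht : ∀ p, PC.pull t p = 0 → p = 0) (ψ : X ⟶ PC.space.obj σ)
    (one : ψ ≫ PC.space.map t = PC.constOne X) (p q : σ.dualMon) (hp : p ≠ 0)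
    (hq : q = 0 ↔ Γ.inv f = f)
    (hpq : Γ.inv f ≠ f → p + q = PC.pull t (PC.nnrealToDual (Γ.len f))) :
    MarkedCurve hgn Γ X where
  cone := σ
  curve := (Γ.overRay.curve.mapLen (PC.pull t) ht).subdivide f p q hp hq
  map := ψ
  ray := t
  marking := CurveContraction.congr (AddMonoidHom.id_comp (PC.pull t))
    (CurveContraction.trans (B := Γ.overRay.curve.mapLen (PC.pull t) ht)
      ⟨.refl _, fun _ => rfl, fun f hf => absurd ⟨f, rfl⟩ hf⟩
      (StableCurve.subdivideMap (Γ.overRay.curve.mapLen (PC.pull t) ht) hgn f p q hp hq hpq))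
  one := one

/-- The new vertex is the one that disappears, and the piece towards the root of `f` has length `p`,
so `p` measures the position. -/
theorem classify_onFlag (f : Γ.F) {σ : PC} (t : σ ⟶ PC.ray)
    (ht : ∀ p, PC.pull t p = 0 → p = 0) (ψ : X ⟶ PC.space.obj σ)
    (one : ψ ≫ PC.space.map t = PC.constOne X) (p q : σ.dualMon) (hp : p ≠ 0)
    (hq : q = 0 ↔ Γ.inv f = f)
    (hpq : Γ.inv f ≠ f → p + q = PC.pull t (PC.nnrealToDual (Γ.len f))) (x : X) :
    (onFlag hgn f t ht ψ one p q hp hq hpq).classify x = Γ.flagPt f (PC.eval p (ψ x)) := by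
  have s : (onFlag hgn f t ht ψ one p q hp hq hpq).curve.Thin (Sum.inr 1) (Sum.inr 2) :=
    MarkedGraph.subdivide_thin (G := Γ.toMarkedGraph) f
  have hf : flag s = f :=
    MarkedGraph.subdivideMap_lift (G := Γ.toMarkedGraph) f
      ((onFlag hgn f t ht ψ one p q hp hq hpq).curve.stabilizable hgn) f
  refine (classify_of_thin s x).trans (congrArg₂ Γ.flagPt hf ?_)
  rfl

/-- The universal family on a flag lives over the square of the ray. For an edge the coordinates are
the distances from its two ends, and their sum divided by the edge length is the scale of `Γ`. For a
leg, one coordinate is the scale and the other is the distance from the root. -/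
theorem exists_onFlag (hgn : 2 < 2 * g + n) (f : Γ.F) :
    ∃ M : MarkedCurve hgn Γ (Γ.Piece (Sum.inr f)), ∀ s, M.classify s = Γ.flagPt f s.1 := by
  -- Both coordinates and the scale are nonzero at this point, which shows that the lengths are
  -- nonzero and that no length of `Γ` is lost.
  have h11 : ((1 : ℝ), (1 : ℝ)) ∈ (PC.ray.prod PC.ray).cone :=
    ⟨zero_le_one (α := ℝ), zero_le_one (α := ℝ)⟩
  have hc : ∀ k : PC.ray.prod PC.ray ⟶ PC.ray, (show ℝ from k.1 ((1 : ℝ), (1 : ℝ))) = 1 →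
      PC.pull k PC.coord ≠ 0 := fun k hk h0 =>
    one_ne_zero (α := ℝ) (hk.symm.trans (congrArg (PC.eval · ⟨_, h11⟩) h0))
  by_cases hf : Γ.inv f = f
  · refine ⟨onFlag hgn f (PC.fst PC.ray PC.ray) (PC.eq_zero_of_pull _ ⟨_, h11⟩ one_ne_zero)
      (PC.pair (PC.constOne _) (PC.rayMap (fun s : {s : ℝ // Γ.IsPos f s} => s.1)
        continuous_subtype_val fun s => s.2.1)) rfl (PC.pull (PC.snd _ _) PC.coord) 0
      (hc _ rfl) ⟨fun _ => hf, fun _ => rfl⟩ (fun h => absurd hf h), fun s => ?_⟩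
    exact classify_onFlag f _ _ _ _ _ _ _ _ _ s
  · have hd := StableCurve.realLen_pos hf
    have hv : (show ℝ from (PC.sumDiv (Γ.realLen f) hd.le).1 ((1 : ℝ), (1 : ℝ))) ≠ 0 :=
      mul_ne_zero (inv_ne_zero hd.ne') (show (1 : ℝ) + 1 ≠ 0 by norm_num)
    refine ⟨onFlag hgn f (PC.sumDiv (Γ.realLen f) hd.le) (PC.eq_zero_of_pull _ ⟨_, h11⟩ hv)
      (PC.pair (PC.rayMap (fun s : {s : ℝ // Γ.IsPos f s} => s.1)
        continuous_subtype_val fun s => s.2.1) (PC.rayMap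
        (fun s : {s : ℝ // Γ.IsPos f s} => Γ.realLen f - s.1)
        (continuous_const.sub continuous_subtype_val) fun s => sub_nonneg.2 (s.2.2 hf)))
      ?_ (PC.pull (PC.fst _ _) PC.coord) (PC.pull (PC.snd _ _) PC.coord)
      (hc _ rfl) ⟨fun h => absurd h (hc _ rfl), fun h => absurd h hf⟩
      (fun _ => PC.eval_ext fun v => ?_), fun s => ?_⟩
    -- On the segment parametrized by the distance from the root, the two coordinates sum to the
    -- edge length, so the scale is `1`.
    · refine TopCat.hom_ext (ContinuousMap.ext fun s : {s : ℝ // Γ.IsPos f s} => Subtype.ext ?_)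
      change (Γ.realLen f)⁻¹ * (s.1 + (Γ.realLen f - s.1)) = 1
      rw [add_sub_cancel, inv_mul_cancel₀ hd.ne']
    · obtain ⟨v, hv⟩ := v
      change (show ℝ from v.1) + (show ℝ from v.2) =
        ((Γ.realLen f)⁻¹ * ((show ℝ from v.1) + (show ℝ from v.2))) * Γ.realLen f
      rw [mul_comm, ← mul_assoc, mul_inv_cancel₀ hd.ne', one_mul]
    · exact classify_onFlag f _ _ _ _ _ _ _ _ _ s

theorem exists_section (hgn : 2 < 2 * g + n) :
    ∀ i, ∃ M : MarkedCurve hgn Γ (Γ.Piece i), ∀ s, M.classify s = Γ.pieceMap i s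
  | Sum.inl v => ⟨atVertex hgn v _, fun s => (atVertex_spec v).classify s⟩
  | Sum.inr f => exists_onFlag hgn f

end MarkedCurve

/-! ### The classifier of the extension, and the theorem. -/

namespace CatOver

/-- Local lifting of compatible maps can be checked on strict objects. -/
theorem StrictData.locally_of_strict {A B : CatOver} {F : CatOver.Hom A B} {s : B.Point}
    {D : Type*} [Category* D] {D' : Type*} [Category* D']
    {L : D ⥤ A.E} {L' : D' ⥤ B.E} {FD : D ⥤ D'} {sD : TopCat.{0} ⥤ D'}
    {α : L ⋙ F.F ≅ FD ⋙ L'} {β : sD ⋙ L' ≅ s.F} (S : StrictData α β)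
    {R : Type*} [TopologicalSpace R]
    {Φ : ∀ Z : Preimage F s, C(A.p.obj Z.obj, R)}
    (hΦ : ∀ {Z Z' : Preimage F s} (m : Z ⟶ Z') (x), Φ Z' (A.p.map m.hom x) = Φ Z x)
    (loc : ∀ {d d' : D} {μ : FD.obj d ⟶ sD.obj (A.p.obj (L.obj d))}
      {μ' : FD.obj d' ⟶ sD.obj (A.p.obj (L.obj d'))} (h : StrictOver α β d μ)
      (h' : StrictOver α β d' μ') (k : A.p.obj (L.obj d) ⟶ A.p.obj (L.obj d')),
      (∀ x, Φ (ofStrict S.cartB d' μ' h') (k x) = Φ (ofStrict S.cartB d μ h) x) →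
      ∀ x, ∃ (W : Preimage F s) (m : W ⟶ ofStrict S.cartB d μ h)
        (m' : W ⟶ ofStrict S.cartB d' μ' h'), Topology.IsOpenEmbedding (A.p.map m.hom) ∧
        x ∈ Set.range (A.p.map m.hom) ∧ A.p.map m'.hom = A.p.map m.hom ≫ k)
    {Z Z' : Preimage F s} (h : A.p.obj Z.obj ⟶ A.p.obj Z'.obj)
    (hh : ∀ x, Φ Z' (h x) = Φ Z x) (x : A.p.obj Z.obj) :
    ∃ (W : Preimage F s) (m : W ⟶ Z) (m' : W ⟶ Z'),
      Topology.IsOpenEmbedding (A.p.map m.hom) ∧ x ∈ Set.range (A.p.map m.hom) ∧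
      A.p.map m'.hom = A.p.map m.hom ≫ h := by
  obtain ⟨d, μ, hμ, ⟨e⟩⟩ := S.exists_ofStrict Z
  obtain ⟨d', μ', hμ', ⟨e'⟩⟩ := S.exists_ofStrict Z'
  have a1 : A.p.map e.inv.hom ≫ A.p.map e.hom.hom = 𝟙 _ := by
    rw [← Preimage.p_hom_comp, e.inv_hom_id, Preimage.p_hom_id]
  have a1' : A.p.map e.hom.hom ≫ A.p.map e.inv.hom = 𝟙 _ := by
    rw [← Preimage.p_hom_comp, e.hom_inv_id, Preimage.p_hom_id]
  have a2 : A.p.map e'.inv.hom ≫ A.p.map e'.hom.hom = 𝟙 _ := by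
    rw [← Preimage.p_hom_comp, e'.inv_hom_id, Preimage.p_hom_id]
  obtain ⟨W, m, m', hm, ⟨w, hw⟩, hm'⟩ := loc hμ hμ'
    (A.p.map e.hom.hom ≫ h ≫ A.p.map e'.inv.hom) (fun x => by
      exact Eq.trans (hΦ e'.inv (h (A.p.map e.hom.hom x))) ((hh _).trans (hΦ e.hom x)))
    (A.p.map e.inv.hom x)
  have he : Topology.IsOpenEmbedding (A.p.map e.hom.hom) :=
    (TopCat.homeoOfIso ⟨A.p.map e.hom.hom, A.p.map e.inv.hom, a1', a1⟩).isOpenEmbedding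
  refine ⟨W, m ≫ e.hom, m' ≫ e'.hom, ?_, ⟨w, ?_⟩, ?_⟩
  · rw [Preimage.p_hom_comp]
    exact he.comp hm
  · rw [Preimage.p_hom_comp]
    refine (congrArg (A.p.map e.hom.hom) hw).trans ?_
    exact congrArg (fun k : A.p.obj Z.obj ⟶ A.p.obj Z.obj => k x) a1
  · rw [Preimage.p_hom_comp, Preimage.p_hom_comp, hm']
    simp only [Category.assoc]
    exact congrArg (_ ≫ ·) (congrArg (_ ≫ ·) ((congrArg (h ≫ ·) a2).trans (Category.comp_id h)))

variable {g n : ℕ} (hgn : 2 < 2 * g + n) (Γ : StableCurve g n ShpMon.nnreal)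

/-- The object of the preimage given by a marked curve. -/
noncomputable abbrev ofMarked {X : TopCat.{0}} (M : MarkedCurve hgn Γ X) :
    Preimage (extForget hgn) (extPoint Γ) :=
  ofStrict (α := extComm hgn) (β := Iso.refl (Γ.triples ⋙ extQ _)) cart_extension M.triple
    M.toPoint ((strictOver_ext_iff hgn Γ M.triple M.toPoint).2 M.toPoint_left)

/-- Strict objects are marked curves, so the classifying map, uniqueness, local existence and
sections come from `MarkedCurve`. In the extension, morphisms can be asserted only locally: several
combinatorial types may occur along one classifying map, and a common restriction is found only near
each point. -/
theorem exists_classifier_extension :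
    Nonempty (Classifier (extForget hgn) (extPoint Γ) Γ.pieceMap) := by
  have S := strictData_ext hgn Γ
  have so := fun d μ => strictOver_ext_iff hgn Γ d μ
  obtain ⟨Φ, h1, h2⟩ := S.exists_map (R := Γ.Realization)
    (fun d μ h => ⟨(MarkedCurve.ofTriple d μ ((so d μ).1 h)).classify,
      MarkedCurve.continuous_classify _⟩)
    (fun {d d' μ μ'} h h' f hf x =>
      (MarkedCurve.homOfTriple ((so d μ).1 h) ((so d' μ').1 h') f hf).classify_eq x)
  refine ⟨
    { cartA := S.cartA
      cartB := S.cartB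
      fibA := fibered_extension _
      map := Φ
      map_hom := h1
      unique := fun m m' hm => S.hom_unique (fun {d d' μ μ'} h h' f f' hf hf' hff => by
        obtain ⟨d₀, t, ht, htt⟩ := MarkedCurve.exists_comp_eq f f' hf hf' hff
        exact ⟨d₀, t, (isIso_extQ_map_iff _ cart_extension t).2 ht, htt⟩) m m' hm
      locally := fun h hh x => S.locally_of_strict h1
        (fun {d d' μ μ'} hμ hμ' k hk x => by
          let M := MarkedCurve.ofTriple d μ ((so d μ).1 hμ)
          let M' := MarkedCurve.ofTriple d' μ' ((so d' μ').1 hμ')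
          -- Restricting `M'` along `k` reduces the comparison to marked curves over the same base.
          have hc : ∀ x : d.left, M.classify x = (M'.restrict k).classify x := fun x =>
            ((h2 d' μ' hμ' (k x)).symm.trans ((hk x).trans (h2 d μ hμ x))).symm.trans
              ((M'.restrictHom k).classify_eq x)
          obtain ⟨T, hT, hx, N, ⟨a⟩, ⟨b⟩⟩ := MarkedCurve.exists_joint hc x
          let b' := b.comp (M'.restrictHom k)
          refine ⟨ofMarked hgn Γ N, ofStrictMap S.cartB _ hμ a.triple ?_,
            ofStrictMap S.cartB _ hμ' b'.triple ?_, ?_, ?_, ?_⟩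
          · exact (congrArg (_ ≫ ·) (MarkedCurve.toPoint_ofTriple d μ _).symm).trans a.triple_comp
          · exact (congrArg (_ ≫ ·) (MarkedCurve.toPoint_ofTriple d' μ' _).symm).trans
              b'.triple_comp
          · exact hT.isOpenEmbedding_subtypeVal
          · exact ⟨⟨x, hx⟩, rfl⟩
          · rfl) h hh x
      sect := fun i => by
        obtain ⟨M, hM⟩ := MarkedCurve.exists_section (Γ := Γ) hgn i
        exact ⟨ofMarked hgn Γ M, Iso.refl _, fun x => (h2 _ _ _ x).trans (hM x)⟩ }⟩

end CatOver
theorem mainTheorem9 (g n : ℕ) (hgn : 2 < 2 * g + n) (Γ : StableCurve g n ShpMon.nnreal) :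
    (CatOver.preimage (topologicalForget hgn) Γ.point).IsSubsheafOfUnderlyingSpace ∧
      Nonempty
        ((CatOver.preimage (topologicalForget hgn) Γ.point).UnderlyingSpace ≃ₜ Γ.Realization) := by
  obtain ⟨C⟩ := CatOver.exists_classifier_extension hgn Γ
  -- Every plus construction preserves the classifier over the same pieces of `Γ`; fullness is
  -- needed only at the last stage.
  obtain ⟨C₁, -⟩ := C.exists_plus
  obtain ⟨C₂, -⟩ := C₁.exists_plus
  obtain ⟨C₃, h⟩ := C₂.exists_plus
  exact ⟨C₃.isSubsheaf h,
    C₃.nonempty_homeomorph h StableCurve.exists_pieceMap_eq StableCurve.isOpen_of_pieceMap⟩
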